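/- Let $G\in C^2(\mathbb{R})$ be an even double-well potential: $G(\pm1)=0$, $G(s)>0$ for $s\neq\pm1$, $G'\le 0$ on $[0,1]$, and $G''(\pm1)>0$. For $f:\mathbb{R}\to\mathbb{R}$ put $$E(f)=\int_{\mathbb{R}}\tfrac12 f_x^2+G(f)\,dx\in[0,\infty]$$ (with $E(f)=\infty$ if $f$ is not locally absolutely continuous), and let $e_*$ be the energy of the kink, i.e. the minimum of $E(v)$ over all $v$ with $v(x)\to\pm1$ as $x\to\pm\infty$. Assume that $\int_1^\infty\sqrt{2G(s)}\,ds\ge e_*$ (this holds, for instance, if $\liminf_{|s|\to\infty}G(s)>0$). A smooth solution of the Cahn–Hilliard equation on the line with initial data $u_0$ means a function $u:[0,\infty)\times\mathbb{R}\to\mathbb{R}$ that is continuous, bounded on $[0,T]\times\mathbb{R}$ for every $T<\infty$, satisfies $u(0,\cdot)=u_0$, and solves $$u_t=-\bigl(u_{xx}-G'(u)\bigr)_{xx}\qquad\text{on }(0,\infty)\times\mathbb{R}$$ classically: for every $t>0$ the functions $u(t,\cdot)$ and $u_{xx}(t,\cdot)-G'(u(t,\cdot))$ are of class $C^2$, and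 $u_t$ exists and is continuous on $(0,\infty)\times\mathbb{R}$. Then for every $\epsilon>0$ there is a constant $C\in(0,\infty)$, depending only on $G$ and $\epsilon$, such that the following holds. Let $u$ be a smooth solution of the Cahn–Hilliard equation on the line with initial data $u_0$, let $V_-(t)=\int_{\mathbb{R}}|u(t,x)+1|\,dx$, and suppose that $$E(u_0)\le 2e_*-\epsilon\qquad\text{and}\qquad V_-(0)<\infty .$$ Then $u(t,\cdot)+1\to0$ in $H^1(\mathbb{R})$ as $t\to\infty$, and for all $t\ge0$ $$V_-(t)\le C\,\bigl(V_-(0)+1\bigr),\qquad E(u(t))\le C\min\Bigl\{E(u_0),\ \frac{V_-(0)^2+1}{t^{1/2}}\Bigr\},$$ where the second entry of the minimum is read as $+\infty$ at $t=0$. -/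

import Mathlib

open MeasureTheory Set Filter Topology
open scoped ENNReal NNReal

noncomputable section

namespace CahnHilliard

/-- Even double-well potentials of class `C²` with nondegenerate absolute minima (of value zero)
at `1` and `-1`, nonincreasing on `[0, 1]`. -/
structure IsDoubleWell (G : ℝ → ℝ) : Prop where
  contDiff : ContDiff ℝ 2 G
  even : ∀ s, G (-s) = G s
  zero_one : G 1 = 0
  zero_neg_one : G (-1) = 0
  pos : ∀ s, s ≠ 1 → s ≠ -1 → 0 < G s
  deriv_nonpos : ∀ s ∈ Icc (0 : ℝ) 1, deriv G s ≤ 0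
  deriv2_one_pos : 0 < deriv (deriv G) 1
  deriv2_neg_one_pos : 0 < deriv (deriv G) (-1)

/-- Local absolute continuity on the line, that is, membership in `W^{1,1}_loc(ℝ)` (for the
continuous representative). Such a function is differentiable almost everywhere and its weak
derivative is its pointwise derivative. -/
def LocallyAC (f : ℝ → ℝ) : Prop :=
  ∀ a b : ℝ, AbsolutelyContinuousOnInterval f a b

open Classical in
/-- The Ginzburg-Landau energy `∫ (1/2) f_x² + G(f) dx`, with values in `[0, ∞]`; it is infinite
if `f` has no locally integrable weak derivative. -/
def energy (G : ℝ → ℝ) (f : ℝ → ℝ) : ℝ≥0∞ :=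
  if LocallyAC f then ∫⁻ x, ENNReal.ofReal ((1 / 2) * (deriv f x) ^ 2 + G (f x)) else ⊤

open Classical in
/-- The squared `H¹(ℝ)` norm `∫ f² + f_x² dx`, with values in `[0, ∞]`; it is infinite
if `f` has no locally integrable weak derivative. -/
def h1NormSq (f : ℝ → ℝ) : ℝ≥0∞ :=
  if LocallyAC f then ∫⁻ x, ENNReal.ofReal ((f x) ^ 2 + (deriv f x) ^ 2) else ⊤

/-- The energy `e_*` of the kink: the minimal energy among the functions on the line that tend
to `-1` at `-∞` and to `1` at `+∞`. -/
def kinkEnergy (G : ℝ → ℝ) : ℝ≥0∞ :=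
  ⨅ v ∈ {v : ℝ → ℝ | Tendsto v atBot (𝓝 (-1)) ∧ Tendsto v atTop (𝓝 1)}, energy G v

/-- The excess mass relative to `-1`, that is, `∫ |f + 1| dx`, with values in `[0, ∞]`. -/
def excessMass (f : ℝ → ℝ) : ℝ≥0∞ :=
  ∫⁻ x, ENNReal.ofReal |f x + 1|

/-- The expression `f_xx - G'(f)`. -/
def innerTerm (G : ℝ → ℝ) (f : ℝ → ℝ) (x : ℝ) : ℝ :=
  deriv (deriv f) x - deriv G (f x)

/-- `u` (written `u t x`, for `t ≥ 0`) is a global smooth solution of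
`u_t = -(u_xx - G'(u))_xx` on the line with initial data `u₀`: it is continuous up to `t = 0`
and bounded on bounded time intervals, and for `t > 0` all the derivatives that occur in the
equation exist and are continuous, and the equation holds at every point. -/
structure IsSmoothSolution (G : ℝ → ℝ) (u₀ : ℝ → ℝ) (u : ℝ → ℝ → ℝ) : Prop where
  initial : ∀ x, u 0 x = u₀ x
  continuousOn : ContinuousOn (fun p : ℝ × ℝ => u p.1 p.2) (Ici 0 ×ˢ univ)
  bounded : ∀ T : ℝ, ∃ M : ℝ, ∀ t ∈ Icc 0 T, ∀ x, |u t x| ≤ M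
  contDiff_space : ∀ t, 0 < t → ContDiff ℝ 2 (u t)
  contDiff_innerTerm : ∀ t, 0 < t → ContDiff ℝ 2 (innerTerm G (u t))
  continuousOn_time_deriv :
    ContinuousOn (fun p : ℝ × ℝ => deriv (fun s => u s p.2) p.1) (Ioi 0 ×ˢ univ)
  equation : ∀ t, 0 < t → ∀ x,
    HasDerivAt (fun s => u s x) (-(deriv (deriv (innerTerm G (u t))) x)) t

end CahnHilliard

end

open MeasureTheory Set Filter Topology
open scoped ENNReal NNReal

noncomputable section

namespace CahnHilliard

/-! Range. Square integrability of `u + 1` propagates in time, so together with the finite energy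
every profile `u t` tends to `-1` at both ends. By the Modica-Mortola inequality a profile that
leaves `-1`, takes the value `s` and returns costs at least `2 |∫_{-1}^s √(2G)|`. The energy is
nonincreasing and stays below `2 e_* - ε`, hence the values stay in a fixed interval `[-R, 1 - c]`:
the upper end comes from `e_* ≤ ∫_{-1}^1 √(2G)`, the lower end from the assumption on `∫_1^∞ √(2G)`
and evenness. On that interval `G` is comparable to `(s + 1)²`. It need not be convex there, only
within a distance `ρ` of `-1` (`exists_tame`, `exists_wellBounds`).

Decay from a mass bound. Write `p = G'(u) - u_xx`, so `u_t = p_xx` and the energy dissipates at rate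
at least `½ ∫ p_x²`. If `∫ |u + 1| ≤ a`, then `E³ ≤ C a⁴ ∫ p_x²` (`exists_energy_interpolation`),
and integration in time gives `E ≤ C a² t^{-1/2}` (`exists_energy_decay`). The energy controls the
`H¹` norm. All that remains is to bound the mass uniformly in time by its initial value plus a
constant.

The mass bound is the heart of the matter, since a fourth-order equation has no comparison principle
and no `L¹` contraction. Three mechanisms are combined in `exists_augMass_le`.

(1) On bounded time intervals the mass grows by at most a factor. The mass potential `w`, with `w_x
= u + 1` and `w_t = p_x`, satisfies weighted `L²` estimates at the scale `l = c t^{1/4}`; these give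
local `L²` bounds of `u + 1` by local masses, and integration over the centres of the weights gives
an `L¹` bound (`Tame.excessMass_le_short`, `exists_augMass_le_short`).

(2) While `|u + 1| ≤ ρ`, the second-order part of the equation is monotone and dominates on large
scales. With `L` comparable to `√T`, the weighted estimates for `w`, for `u + 1` and for the time
differences of `w` give `|u_x(t, y)| ≤ C L^{-3/2} m(y)` for `T ≤ t ≤ 2T`, where `m(y)` is the
initial mass seen from `y` at scale `L` (`Tame.slope_sq_le`). The entropy `∫ √((u + 1)² + μ²)`, with
`μ = A m` and `A` comparable to `L^{-3/2}`, then increases at rate at most `C L^{-2} ∫ μ`: the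
fourth-order terms of the wrong sign are absorbed because `|u_x|` is a small multiple of `μ`
(`entropy_algebra`, `Tame.entropy_le`). Over `[T, 2T]` the mass thus grows by at most `C T^{-1/4}`
times its initial size, which is summable over dyadic times (`exists_augMass_le_good`).

(3) Small dissipation forces `u` near the well (`exists_small_dissipation`), and a departure from
the well persists for a fixed time (`exists_persistence`). Each departure therefore spends a fixed
amount of energy, so departures can be covered by a bounded number of windows of bounded length. The
windows are crossed by (1), the rest by (2).

Every estimate is local, with weight `(1 + z²)⁻³`: squares of primitives seen from the centre grow
like `(1 + z²)²`, which leaves an integrable factor. -/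

/-! ### Weights and cut-offs -/

/-- The rational weight `(1 + ((x - y) / L)²)⁻³` of scale `L` centred at `y`. -/
def weight (L y x : ℝ) : ℝ := ((1 + ((x - y) / L) ^ 2)⁻¹) ^ 3

lemma weight_pos (L y x : ℝ) : 0 < weight L y x := by unfold weight; positivity

lemma weight_le_one (L y x : ℝ) : weight L y x ≤ 1 := by
  unfold weight
  have h : (1 + ((x - y) / L) ^ 2)⁻¹ ≤ 1 := inv_le_one_of_one_le₀ (by nlinarith [sq_nonneg ((x - y) / L)])
  exact pow_le_one₀ (by positivity) h

@[fun_prop]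
lemma continuous_weight (L y : ℝ) : Continuous (weight L y) := by
  unfold weight
  have : ∀ x : ℝ, 1 + ((x - y) / L) ^ 2 ≠ 0 := fun x => by positivity
  fun_prop (disch := assumption)

/-- A compactly supported cut-off `φ₀` with its first four derivatives, controlled at scale `l` in
terms of itself and of a larger compactly supported cut-off `ψ`. -/
structure Cutoff (B l : ℝ) (φ : ℕ → ℝ → ℝ) (ψ : ℝ → ℝ) : Prop where
  deriv : ∀ k < 4, ∀ x, HasDerivAt (φ k) (φ (k + 1) x) x
  cont : ∀ k ≤ 4, Continuous (φ k)
  contψ : Continuous ψ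
  compact : ∃ R : ℝ, ∀ x, R < |x| → ψ x = 0 ∧ ∀ k ≤ 4, φ k x = 0
  nonneg : ∀ x, 0 ≤ φ 0 x
  le : ∀ x, φ 0 x ≤ ψ x
  one : ∀ x, l ^ 2 * φ 1 x ^ 2 ≤ B * (φ 0 x * ψ x)
  two : ∀ x, l ^ 4 * φ 2 x ^ 2 ≤ B * (φ 0 x * ψ x)
  four : ∀ x, l ^ 4 * |φ 4 x| ≤ B * ψ x

lemma Cutoff.psi_nonneg {B l : ℝ} {φ : ℕ → ℝ → ℝ} {ψ : ℝ → ℝ} (h : Cutoff B l φ ψ) (x : ℝ) :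
    0 ≤ ψ x := (h.nonneg x).trans (h.le x)

/-- Larger scales give smaller derivatives. Hence a cut-off adapted to the weight of scale `L` may
be used in estimates carried out at any smaller scale `l`. -/
lemma Cutoff.mono_scale {B l l' : ℝ} {φ : ℕ → ℝ → ℝ} {ψ : ℝ → ℝ} (h : Cutoff B l φ ψ)
    (hl' : 0 ≤ l') (hl : l' ≤ l) : Cutoff B l' φ ψ where
  deriv := h.deriv
  cont := h.cont
  contψ := h.contψ
  compact := h.compact
  nonneg := h.nonneg
  le := h.le
  one x := le_trans (by gcongr) (h.one x)
  two x := le_trans (by gcongr) (h.two x)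
  four x := le_trans (by gcongr) (h.four x)

/-- Derivatives of the unit weight `(1 + z²)⁻³`. -/
def unitWeight : ℕ → ℝ → ℝ
  | 0, z => ((1 + z ^ 2)⁻¹) ^ 3
  | 1, z => -6 * z * ((1 + z ^ 2)⁻¹) ^ 4
  | 2, z => -6 * ((1 + z ^ 2)⁻¹) ^ 4 + 48 * z ^ 2 * ((1 + z ^ 2)⁻¹) ^ 5
  | 3, z => 144 * z * ((1 + z ^ 2)⁻¹) ^ 5 - 480 * z ^ 3 * ((1 + z ^ 2)⁻¹) ^ 6
  | 4, z => 144 * ((1 + z ^ 2)⁻¹) ^ 5 - 2880 * z ^ 2 * ((1 + z ^ 2)⁻¹) ^ 6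
      + 5760 * z ^ 4 * ((1 + z ^ 2)⁻¹) ^ 7
  | _, _ => 0

lemma hasDerivAt_inv_one_add_sq (z : ℝ) :
    HasDerivAt (fun z : ℝ => (1 + z ^ 2)⁻¹) (-2 * z * ((1 + z ^ 2)⁻¹) ^ 2) z := by
  have h : HasDerivAt (fun z : ℝ => 1 + z ^ 2) (2 * z) z := by
    simpa using ((hasDerivAt_pow 2 z).const_add 1)
  refine (h.inv (by positivity)).congr_deriv ?_
  rw [inv_pow, div_eq_mul_inv, neg_mul, neg_mul, neg_mul]

lemma hasDerivAt_inv_one_add_sq_pow (n : ℕ) (z : ℝ) :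
    HasDerivAt (fun z : ℝ => ((1 + z ^ 2)⁻¹) ^ n)
      (n * ((1 + z ^ 2)⁻¹) ^ (n - 1) * (-2 * z * ((1 + z ^ 2)⁻¹) ^ 2)) z :=
  (hasDerivAt_inv_one_add_sq z).pow n

lemma hasDerivAt_unitWeight {k : ℕ} (hk : k < 4) (z : ℝ) :
    HasDerivAt (unitWeight k) (unitWeight (k + 1) z) z := by
  have hz := hasDerivAt_id' z
  have hz2 := hasDerivAt_pow 2 z
  have hz3 := hasDerivAt_pow 3 z
  interval_cases k
  · exact (hasDerivAt_inv_one_add_sq_pow 3 z).congr_deriv (by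
      simp only [unitWeight]; push_cast; generalize (1 + z ^ 2)⁻¹ = s; norm_num; ring)
  · exact ((hz.const_mul (-6)).mul (hasDerivAt_inv_one_add_sq_pow 4 z)).congr_deriv
      (by
      simp only [unitWeight]; push_cast; generalize (1 + z ^ 2)⁻¹ = s; norm_num; ring)
  · exact (((hasDerivAt_inv_one_add_sq_pow 4 z).const_mul (-6)).add
      ((hz2.const_mul 48).mul (hasDerivAt_inv_one_add_sq_pow 5 z))).congr_deriv
      (by
      simp only [unitWeight]; push_cast; generalize (1 + z ^ 2)⁻¹ = s; norm_num; ring)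
  · exact (((hz.const_mul 144).mul (hasDerivAt_inv_one_add_sq_pow 5 z)).sub
      ((hz3.const_mul 480).mul (hasDerivAt_inv_one_add_sq_pow 6 z))).congr_deriv
      (by
      simp only [unitWeight]; push_cast; generalize (1 + z ^ 2)⁻¹ = s; norm_num; ring)

lemma continuous_unitWeight {k : ℕ} (hk : k ≤ 4) : Continuous (unitWeight k) := by
  have : ∀ x : ℝ, 1 + x ^ 2 ≠ 0 := fun x => by positivity
  interval_cases k <;> · unfold unitWeight; fun_prop (disch := assumption)

/-- With `s = (1 + z²)⁻¹`, every derivative is `s³` times a polynomial in `s`, `z s` and `z² s`, all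
bounded by one. -/
lemma abs_unitWeight_le {k : ℕ} (hk : k ≤ 4) (z : ℝ) :
    |unitWeight k z| ≤ 10000 * unitWeight 0 z := by
  set s := (1 + z ^ 2)⁻¹ with hs
  have hs0 : 0 < s := by positivity
  have hs1 : s * (1 + z ^ 2) = 1 := inv_mul_cancel₀ (by positivity)
  have hs1' : s ≤ 1 := by nlinarith [sq_nonneg z]
  have h2 : z ^ 2 * s ≤ 1 := by nlinarith
  have h20 : 0 ≤ z ^ 2 * s := by positivity
  have h1 : |z * s| ≤ 1 := by
    rw [← sq_le_one_iff_abs_le_one]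
    nlinarith
  have h3 := pow_pos hs0 3
  have key : ∀ X : ℝ, |X| ≤ 10000 → |X * s ^ 3| ≤ 10000 * s ^ 3 := fun X hX => by
    rw [abs_mul, abs_of_pos h3]; gcongr
  have e0 : unitWeight 0 z = s ^ 3 := rfl
  have hss : |s| ≤ 1 := by rw [abs_of_pos hs0]; exact hs1'
  have h2s : |z ^ 2 * s| ≤ 1 := by rw [abs_of_nonneg h20]; exact h2
  have T : ∀ a b : ℝ, |a| ≤ 1 → |b| ≤ 1 → |a * b| ≤ 1 := fun a b ha hb => by
    rw [abs_mul]; exact mul_le_one₀ ha (abs_nonneg _) hb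
  interval_cases k
  · rw [e0, abs_of_pos h3]; nlinarith
  · have : unitWeight 1 z = (-6 * (z * s)) * s ^ 3 := by simp only [unitWeight, ← hs]; ring
    rw [e0, this]; apply key
    rw [abs_le] at *; constructor <;> linarith
  · have : unitWeight 2 z = (-6 * s + 48 * ((z ^ 2 * s) * s)) * s ^ 3 := by
      simp only [unitWeight, ← hs]; ring
    rw [e0, this]; apply key
    have := T _ _ h2s hss
    rw [abs_le] at *; constructor <;> linarith
  · have : unitWeight 3 z = (144 * ((z * s) * s) - 480 * ((z ^ 2 * s) * (z * s) * s)) * s ^ 3 := by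
      simp only [unitWeight, ← hs]; ring
    rw [e0, this]; apply key
    have a1 := T _ _ h1 hss
    have a2 := T _ _ (T _ _ h2s h1) hss
    rw [abs_le] at *; constructor <;> linarith
  · have : unitWeight 4 z = (144 * (s * s) - 2880 * ((z ^ 2 * s) * (s * s))
        + 5760 * ((z ^ 2 * s) * (z ^ 2 * s) * (s * s))) * s ^ 3 := by
      simp only [unitWeight, ← hs]; ring
    rw [e0, this]; apply key
    have a1 := T _ _ hss hss
    have a2 := T _ _ h2s a1
    have a3 := T _ _ (T _ _ h2s h2s) a1
    rw [abs_le] at *; constructor <;> linarith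

/-- A smooth bump and its derivatives. -/
lemma exists_bump : ∃ (M : ℝ) (χ : ℕ → ℝ → ℝ), 1 ≤ M ∧
    (∀ k < 4, ∀ x, HasDerivAt (χ k) (χ (k + 1) x) x) ∧ (∀ k ≤ 4, Continuous (χ k)) ∧
    (∀ k ≤ 4, ∀ x, |χ k x| ≤ M) ∧ (∀ x, 0 ≤ χ 0 x) ∧ (∀ x, χ 0 x ≤ 1) ∧
    (∀ x, |x| ≤ 1 → χ 0 x = 1) ∧ (∀ x, 2 ≤ |x| → ∀ k ≤ 4, χ k x = 0) ∧
    (∀ x, χ 1 x ^ 2 ≤ M * χ 0 x) ∧ (∀ x, χ 2 x ^ 2 ≤ M * χ 0 x) := by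
  let b : ContDiffBump (0 : ℝ) := ⟨1, 2, one_pos, one_lt_two⟩
  let β : ℝ → ℝ := fun x => b x
  have hβ : ContDiff ℝ (4 : ℕ) β := b.contDiff
  -- The fourth power is what makes the squares of the first two derivatives controlled by the
  -- function: they contain `β⁶` and `β⁴` respectively. A generic bump has no such bound for the
  -- second derivative.
  have hβ4 : ContDiff ℝ (4 : ℕ) (fun x => β x ^ 4) := hβ.pow 4
  have hcs : HasCompactSupport β := b.hasCompactSupport
  have hcs4 : HasCompactSupport (fun x => β x ^ 4) := by
    have : (fun x => β x ^ 4) = fun x => β x * β x ^ 3 := by ext; ring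
    rw [this]; exact hcs.mul_right
  let χ : ℕ → ℝ → ℝ := fun k => iteratedDeriv k (fun x => β x ^ 4)
  have hd : ∀ k < 4, ∀ x, HasDerivAt (χ k) (χ (k + 1) x) x := fun k hk x => by
    simp only [χ, iteratedDeriv_succ]
    exact ((hβ4.differentiable_iteratedDeriv k (by exact_mod_cast hk)) x).hasDerivAt
  have hc : ∀ k ≤ 4, Continuous (χ k) := fun k hk =>
    hβ4.continuous_iteratedDeriv k (by exact_mod_cast hk)
  have hχ0 : ∀ x, χ 0 x = β x ^ 4 := fun x => by simp [χ]
  have hβ0 : ∀ x, 0 ≤ β x := fun x => b.nonneg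
  have hβ1 : ∀ x, β x ≤ 1 := fun x => b.le_one
  have hts : ∀ k, tsupport (χ k) ⊆ tsupport (fun x => β x ^ 4) := by
    intro k
    induction k with
    | zero => exact (by simp [χ] : tsupport (χ 0) = tsupport (fun x => β x ^ 4)).subset
    | succ k ih =>
      refine subset_trans ?_ ih
      have : χ (k + 1) = deriv (χ k) := iteratedDeriv_succ
      rw [this]
      exact closure_minimal support_deriv_subset isClosed_closure
  have hcsk : ∀ k, HasCompactSupport (χ k) := fun k =>
    hcs4.of_isClosed_subset (isClosed_tsupport _) (hts k)
  have hz : ∀ k ≤ 4, ∀ x, 2 < |x| → χ k x = 0 := by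
    intro k hk x hx
    have h1 : x ∉ tsupport (fun x => β x ^ 4) := by
      intro h
      have : tsupport (fun x => β x ^ 4) ⊆ Metric.closedBall 0 2 := by
        refine closure_minimal (fun z hz => ?_) Metric.isClosed_closedBall
        have : z ∈ Function.support b := by
          intro h0
          exact hz (by simp only [β, h0]; norm_num)
        rw [b.support_eq] at this
        exact Metric.ball_subset_closedBall this
      have := this h
      rw [Metric.mem_closedBall, Real.dist_eq, sub_zero] at this
      linarith
    have h2 : x ∉ tsupport (χ k) := fun h => h1 (hts k h)
    exact image_eq_zero_of_notMem_tsupport h2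
  have hz' : ∀ x, 2 ≤ |x| → ∀ k ≤ 4, χ k x = 0 := by
    intro x hx k hk
    have hcl : IsClosed {x : ℝ | χ k x = 0} := isClosed_eq (hc k hk) continuous_const
    have hmem : x ∈ closure {x : ℝ | 2 < |x|} := by
      rcases le_or_gt 0 x with h0 | h0
      · rw [abs_of_nonneg h0] at hx
        refine closure_mono (s := Ioi 2) (fun z hz => ?_) (by rw [closure_Ioi]; exact hx)
        exact lt_of_lt_of_le hz (le_abs_self z)
      · rw [abs_of_neg h0] at hx
        refine closure_mono (s := Iio (-2)) (fun z hz => ?_) (by rw [closure_Iio]; simp; linarith)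
        have : z < -2 := hz
        show 2 < |z|
        rw [abs_of_neg (by linarith)]; linarith
    exact closure_minimal (fun z hz2 => hz k hk z hz2) hcl hmem
  have hbd : ∀ f : ℝ → ℝ, Continuous f → HasCompactSupport f → ∃ C, 0 ≤ C ∧ ∀ x, |f x| ≤ C := by
    intro f hf hs
    obtain ⟨C, hC⟩ := hs.exists_bound_of_continuous hf
    exact ⟨C, (norm_nonneg _).trans (hC 0), hC⟩
  have hβd : ∀ x, HasDerivAt β (deriv β x) x := fun x =>
    (hβ.differentiable (by norm_num) x).hasDerivAt
  have hβ1c : ContDiff ℝ (3 : ℕ) (deriv β) := hβ.deriv' (n := 3)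
  have hβdd : ∀ x, HasDerivAt (deriv β) (deriv (deriv β) x) x := fun x =>
    (hβ1c.differentiable (by norm_num) x).hasDerivAt
  have hβ2c : ContDiff ℝ (2 : ℕ) (deriv (deriv β)) := hβ1c.deriv' (n := 2)
  have hχ1 : ∀ x, χ 1 x = 4 * β x ^ 3 * deriv β x := by
    intro x
    have h := ((hβd x).pow 4).congr_deriv (g' := 4 * β x ^ 3 * deriv β x) (by simp)
    have h0 := hd 0 (by norm_num) x
    have : χ 0 = fun x => β x ^ 4 := funext hχ0
    rw [this] at h0
    exact h0.unique h
  have hχ2 : ∀ x, χ 2 x = 12 * β x ^ 2 * deriv β x ^ 2 + 4 * β x ^ 3 * deriv (deriv β) x := by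
    intro x
    have h := ((((hβd x).pow 3).const_mul 4).mul (hβdd x)).congr_deriv
      (g' := 12 * β x ^ 2 * deriv β x ^ 2 + 4 * β x ^ 3 * deriv (deriv β) x) (by simp; ring)
    have h0 := hd 1 (by norm_num) x
    have : χ 1 = fun x => 4 * β x ^ 3 * deriv β x := funext hχ1
    rw [this] at h0
    exact h0.unique h
  obtain ⟨C0, hC0, h0⟩ := hbd _ (hc 0 (by norm_num)) (hcsk 0)
  obtain ⟨C1, hC1, h1⟩ := hbd _ (hc 1 (by norm_num)) (hcsk 1)
  obtain ⟨C2, hC2, h2⟩ := hbd _ (hc 2 (by norm_num)) (hcsk 2)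
  obtain ⟨C3, hC3, h3⟩ := hbd _ (hc 3 (by norm_num)) (hcsk 3)
  obtain ⟨C4, hC4, h4⟩ := hbd _ (hc 4 (by norm_num)) (hcsk 4)
  obtain ⟨D1, hD1, g1⟩ := hbd _ hβ1c.continuous (hcs.deriv)
  obtain ⟨D2, hD2, g2⟩ := hbd _ hβ2c.continuous (hcs.deriv.deriv)
  refine ⟨1 + C0 + C1 + C2 + C3 + C4 + 16 * D1 ^ 2 + (12 * D1 ^ 2 + 4 * D2) ^ 2, χ, ?_, hd, hc, ?_,
    fun x => by rw [hχ0]; have := hβ0 x; positivity,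
    fun x => by rw [hχ0]; exact pow_le_one₀ (hβ0 x) (hβ1 x), ?_, hz', ?_, ?_⟩
  · have : 0 ≤ 16 * D1 ^ 2 + (12 * D1 ^ 2 + 4 * D2) ^ 2 := by positivity
    linarith
  · intro k hk x
    have : 0 ≤ 16 * D1 ^ 2 + (12 * D1 ^ 2 + 4 * D2) ^ 2 := by positivity
    interval_cases k
    · linarith [h0 x]
    · linarith [h1 x]
    · linarith [h2 x]
    · linarith [h3 x]
    · linarith [h4 x]
  · intro x hx
    rw [hχ0]
    have : β x = 1 := b.one_of_mem_closedBall (by simpa using hx)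
    rw [this]; norm_num
  · intro x
    rw [hχ1, hχ0]
    have a1 : deriv β x ^ 2 ≤ D1 ^ 2 := sq_le_sq' (by linarith [(abs_le.1 (g1 x)).1]) (abs_le.1 (g1 x)).2
    have hb4 : 0 ≤ β x ^ 4 := by have := hβ0 x; positivity
    have hb2 : β x ^ 2 ≤ 1 := pow_le_one₀ (hβ0 x) (hβ1 x)
    calc (4 * β x ^ 3 * deriv β x) ^ 2 = 16 * (β x ^ 2 * β x ^ 4) * deriv β x ^ 2 := by ring
      _ ≤ 16 * (1 * β x ^ 4) * D1 ^ 2 := by gcongr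
      _ = (16 * D1 ^ 2) * β x ^ 4 := by ring
      _ ≤ _ := by
        apply mul_le_mul_of_nonneg_right _ hb4
        have : 0 ≤ (12 * D1 ^ 2 + 4 * D2) ^ 2 := by positivity
        linarith
  · intro x
    rw [hχ2, hχ0]
    have hb := hβ0 x
    have a1 : deriv β x ^ 2 ≤ D1 ^ 2 := sq_le_sq' (by linarith [(abs_le.1 (g1 x)).1]) (abs_le.1 (g1 x)).2
    have hb4 : 0 ≤ β x ^ 4 := by positivity
    have a3 : |12 * deriv β x ^ 2 + 4 * β x * deriv (deriv β) x| ≤ 12 * D1 ^ 2 + 4 * D2 := by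
      have : |β x * deriv (deriv β) x| ≤ 1 * D2 := by
        rw [abs_mul, abs_of_nonneg hb]
        exact mul_le_mul (hβ1 x) (g2 x) (abs_nonneg _) zero_le_one
      rw [abs_le] at this ⊢
      constructor <;> nlinarith [sq_nonneg (deriv β x)]
    calc (12 * β x ^ 2 * deriv β x ^ 2 + 4 * β x ^ 3 * deriv (deriv β) x) ^ 2
        = β x ^ 4 * |12 * deriv β x ^ 2 + 4 * β x * deriv (deriv β) x| ^ 2 := by
          rw [sq_abs]; ring
      _ ≤ β x ^ 4 * (12 * D1 ^ 2 + 4 * D2) ^ 2 := by gcongr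
      _ = (12 * D1 ^ 2 + 4 * D2) ^ 2 * β x ^ 4 := by ring
      _ ≤ _ := by
        apply mul_le_mul_of_nonneg_right _ hb4
        have : 0 ≤ 16 * D1 ^ 2 := by positivity
        linarith

lemma weight_eq_unitWeight (L y x : ℝ) : weight L y x = unitWeight 0 ((x - y) / L) := rfl

/-- The weights are increasing limits of compactly supported cut-offs, with uniform control. -/
lemma exists_cutoffs : ∃ B : ℝ, 1 ≤ B ∧ ∀ L y : ℝ, 0 < L →
    ∃ (φ : ℕ → ℕ → ℝ → ℝ) (ψ : ℕ → ℝ → ℝ), (∀ n, Cutoff B L (φ n) (ψ n)) ∧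
      (∀ n x, ψ n x ≤ weight L y x) ∧
      (∀ x, Tendsto (fun n => φ n 0 x) atTop (𝓝 (weight L y x))) := by
  obtain ⟨M, χ, hM, hd, hc, hb, h0, h1, hone, hzero, hb1, hb2⟩ := exists_bump
  refine ⟨10 ^ 10 * M, by nlinarith, fun L y hL => ?_⟩
  let N : ℕ → ℝ := fun n => n + 1
  have hN : ∀ n, 1 ≤ N n := fun n => by simp [N]
  let X : ℕ → ℕ → ℝ → ℝ := fun n k z => (N n)⁻¹ ^ k * χ k (z / N n)
  have hNi : ∀ n k, 0 ≤ (N n)⁻¹ ^ k ∧ (N n)⁻¹ ^ k ≤ 1 := fun n k => by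
    have := hN n
    exact ⟨by positivity, pow_le_one₀ (by positivity) (inv_le_one_of_one_le₀ this)⟩
  have hXd : ∀ n, ∀ k < 4, ∀ z, HasDerivAt (X n k) (X n (k + 1) z) z := fun n k hk z => by
    have := ((hd k hk (z / N n)).comp z ((hasDerivAt_id' z).div_const (N n))).const_mul ((N n)⁻¹ ^ k)
    refine this.congr_deriv ?_
    simp only [X]; rw [pow_succ]; ring
  have hXc : ∀ n, ∀ k ≤ 4, Continuous (X n k) := fun n k hk => by
    have := hc k hk
    simp only [X]; fun_prop
  have hXM : ∀ n, ∀ k ≤ 4, ∀ z, |X n k z| ≤ M := fun n k hk z => by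
    simp only [X]; rw [abs_mul, abs_of_nonneg (hNi n k).1]
    calc _ ≤ 1 * M := mul_le_mul (hNi n k).2 (hb k hk _) (abs_nonneg _) zero_le_one
      _ = M := one_mul M
  have hX0 : ∀ n z, X n 0 z = χ 0 (z / N n) := fun n z => by simp [X]
  have hXsq : ∀ n, ∀ k ≤ 4, ∀ z, χ k (z / N n) ^ 2 ≤ M * χ 0 (z / N n) →
      X n k z ^ 2 ≤ M * X n 0 z := fun n k hk z h => by
    rw [hX0]; simp only [X]; rw [mul_pow]
    calc _ ≤ 1 ^ 2 * χ k (z / N n) ^ 2 := by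
          have := hNi n k
          gcongr
          exact this.2
      _ ≤ _ := by rw [one_pow, one_mul]; exact h
  let Φ : ℕ → ℕ → ℝ → ℝ := fun n k z => match k with
    | 0 => unitWeight 0 z * X n 0 z
    | 1 => unitWeight 1 z * X n 0 z + unitWeight 0 z * X n 1 z
    | 2 => unitWeight 2 z * X n 0 z + 2 * (unitWeight 1 z * X n 1 z) + unitWeight 0 z * X n 2 z
    | 3 => unitWeight 3 z * X n 0 z + 3 * (unitWeight 2 z * X n 1 z)
        + 3 * (unitWeight 1 z * X n 2 z) + unitWeight 0 z * X n 3 z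
    | 4 => unitWeight 4 z * X n 0 z + 4 * (unitWeight 3 z * X n 1 z)
        + 6 * (unitWeight 2 z * X n 2 z) + 4 * (unitWeight 1 z * X n 3 z) + unitWeight 0 z * X n 4 z
    | _ => 0
  -- The larger cut-off uses a bump of twice the radius, so that it equals the weight on the support
  -- of `Φ n`; off that support the bounds are trivial.
  let Ψ : ℕ → ℝ → ℝ := fun n z => unitWeight 0 z * χ 0 (z / (2 * N n))
  have hΦd : ∀ n, ∀ k < 4, ∀ z, HasDerivAt (Φ n k) (Φ n (k + 1) z) z := fun n k hk z => by
    have P : ∀ i < 4, ∀ j < 4, HasDerivAt (fun z => unitWeight i z * X n j z)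
        (unitWeight (i + 1) z * X n j z + unitWeight i z * X n (j + 1) z) z := fun i hi j hj =>
      (hasDerivAt_unitWeight hi z).mul (hXd n j hj z)
    interval_cases k
    · exact (P 0 (by norm_num) 0 (by norm_num)).congr_deriv (by simp only [Φ])
    · exact ((P 1 (by norm_num) 0 (by norm_num)).add (P 0 (by norm_num) 1 (by norm_num))).congr_deriv
        (by simp only [Φ]; ring)
    · exact (((P 2 (by norm_num) 0 (by norm_num)).add
        ((P 1 (by norm_num) 1 (by norm_num)).const_mul 2)).add
        (P 0 (by norm_num) 2 (by norm_num))).congr_deriv (by simp only [Φ]; ring)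
    · exact ((((P 3 (by norm_num) 0 (by norm_num)).add
        ((P 2 (by norm_num) 1 (by norm_num)).const_mul 3)).add
        ((P 1 (by norm_num) 2 (by norm_num)).const_mul 3)).add
        (P 0 (by norm_num) 3 (by norm_num))).congr_deriv (by simp only [Φ]; ring)
  have hΦc : ∀ n, ∀ k ≤ 4, Continuous (Φ n k) := fun n k hk => by
    have a0 := hXc n 0 (by norm_num)
    have a1 := hXc n 1 (by norm_num)
    have a2 := hXc n 2 (by norm_num)
    have a3 := hXc n 3 (by norm_num)
    have a4 := hXc n 4 (by norm_num)
    have b0 := continuous_unitWeight (k := 0) (by norm_num)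
    have b1 := continuous_unitWeight (k := 1) (by norm_num)
    have b2 := continuous_unitWeight (k := 2) (by norm_num)
    have b3 := continuous_unitWeight (k := 3) (by norm_num)
    have b4 := continuous_unitWeight (k := 4) (by norm_num)
    interval_cases k <;> · simp only [Φ]; fun_prop
  have hΨ : ∀ n z, |z| < 2 * N n → Ψ n z = unitWeight 0 z := fun n z hz => by
    have hn := hN n
    simp only [Ψ]
    rw [hone, mul_one]
    rw [abs_div, abs_of_pos (by linarith : 0 < 2 * N n), div_le_one (by linarith)]
    exact hz.le
  have hXz : ∀ n z, 2 * N n ≤ |z| → ∀ k ≤ 4, X n k z = 0 := fun n z hz k hk => by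
    have hn := hN n
    simp only [X]
    rw [hzero _ _ k hk, mul_zero]
    rw [abs_div, abs_of_pos (by linarith : 0 < N n), le_div_iff₀ (by linarith)]
    exact hz
  have hr : ∀ z, 0 < unitWeight 0 z := fun z => by simp only [unitWeight]; positivity
  have hΨ0 : ∀ n z, 0 ≤ Ψ n z := fun n z => mul_nonneg (hr z).le (h0 _)
  have hΦ0 : ∀ n z, 0 ≤ Φ n 0 z := fun n z => by
    simp only [Φ]; rw [hX0]; exact mul_nonneg (hr z).le (h0 _)
  have hΦz : ∀ n z, 2 * N n ≤ |z| → ∀ k ≤ 4, Φ n k z = 0 := fun n z hz k hk => by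
    have e := hXz n z hz
    have e0 := e 0 (by norm_num)
    have e1 := e 1 (by norm_num)
    have e2 := e 2 (by norm_num)
    have e3 := e 3 (by norm_num)
    have e4 := e 4 (by norm_num)
    interval_cases k <;> simp only [Φ, e0, e1, e2, e3, e4] <;> ring
  -- Common bound for the first and second derivative of the product: each term is a derivative of
  -- the weight times a derivative of the bump whose square is at most `M` times the bump.
  have hsq : ∀ n z, ∀ a b c d e f : ℝ, |a| ≤ 10000 * unitWeight 0 z → |b| ≤ 20000 * unitWeight 0 z →
      |c| ≤ 10000 * unitWeight 0 z → |d| ≤ 1 → d ^ 2 ≤ M * X n 0 z → e ^ 2 ≤ M * X n 0 z →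
      f ^ 2 ≤ M * X n 0 z → (a * d + b * e + c * f) ^ 2 ≤ 10 ^ 10 * M * (Φ n 0 z * unitWeight 0 z) := by
    intro n z a b c d e f ha hb' hc' hd1 hdd hee hff
    have hrz := hr z
    have ea : a ^ 2 ≤ (10000 * unitWeight 0 z) ^ 2 := sq_le_sq' (by linarith [(abs_le.1 ha).1]) (abs_le.1 ha).2
    have eb : b ^ 2 ≤ (20000 * unitWeight 0 z) ^ 2 := sq_le_sq' (by linarith [(abs_le.1 hb').1]) (abs_le.1 hb').2
    have ec : c ^ 2 ≤ (10000 * unitWeight 0 z) ^ 2 := sq_le_sq' (by linarith [(abs_le.1 hc').1]) (abs_le.1 hc').2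
    have hMX : 0 ≤ M * X n 0 z := (sq_nonneg d).trans hdd
    have T1 : a ^ 2 * d ^ 2 ≤ (10000 * unitWeight 0 z) ^ 2 * (M * X n 0 z) := by gcongr
    have T2 : b ^ 2 * e ^ 2 ≤ (20000 * unitWeight 0 z) ^ 2 * (M * X n 0 z) := by gcongr
    have T3 : c ^ 2 * f ^ 2 ≤ (10000 * unitWeight 0 z) ^ 2 * (M * X n 0 z) := by gcongr
    have T4 : 0 ≤ unitWeight 0 z ^ 2 * (M * X n 0 z) := by positivity
    have : (a * d + b * e + c * f) ^ 2 ≤ 3 * (a ^ 2 * d ^ 2 + b ^ 2 * e ^ 2 + c ^ 2 * f ^ 2) := by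
      nlinarith [sq_nonneg (a * d - b * e), sq_nonneg (a * d - c * f), sq_nonneg (b * e - c * f)]
    have e0 : Φ n 0 z = unitWeight 0 z * X n 0 z := rfl
    rw [e0]
    nlinarith
  have hX0sq : ∀ n z, X n 0 z ^ 2 ≤ M * X n 0 z := fun n z => by
    rw [hX0]
    nlinarith [h0 (z / N n), h1 (z / N n)]
  have hX0a : ∀ n z, |X n 0 z| ≤ 1 := fun n z => by
    rw [hX0, abs_of_nonneg (h0 _)]; exact h1 _
  have r0 : ∀ z, |unitWeight 0 z| ≤ 10000 * unitWeight 0 z := abs_unitWeight_le (by norm_num)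
  have r1 : ∀ z, |unitWeight 1 z| ≤ 10000 * unitWeight 0 z := abs_unitWeight_le (by norm_num)
  have r2 : ∀ z, |unitWeight 2 z| ≤ 10000 * unitWeight 0 z := abs_unitWeight_le (by norm_num)
  have r3 : ∀ z, |unitWeight 3 z| ≤ 10000 * unitWeight 0 z := abs_unitWeight_le (by norm_num)
  have r4 : ∀ z, |unitWeight 4 z| ≤ 10000 * unitWeight 0 z := abs_unitWeight_le (by norm_num)
  have hΦ1 : ∀ n z, Φ n 1 z ^ 2 ≤ 10 ^ 10 * M * (Φ n 0 z * Ψ n z) := fun n z => by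
    rcases le_or_gt (2 * N n) |z| with hz | hz
    · rw [hΦz n z hz 1 (by norm_num), hΦz n z hz 0 (by norm_num)]; simp
    · rw [hΨ n z hz]
      have := hsq n z (unitWeight 1 z) 0 (unitWeight 0 z) (X n 0 z) 0 (X n 1 z) (r1 z)
        (by have := hr z; simp; positivity) (r0 z) (hX0a n z) (hX0sq n z)
        (by simpa using (sq_nonneg _).trans (hX0sq n z)) (hXsq n 1 (by norm_num) z (hb1 _))
      simpa [Φ] using this
  have hΦ2 : ∀ n z, Φ n 2 z ^ 2 ≤ 10 ^ 10 * M * (Φ n 0 z * Ψ n z) := fun n z => by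
    rcases le_or_gt (2 * N n) |z| with hz | hz
    · rw [hΦz n z hz 2 (by norm_num), hΦz n z hz 0 (by norm_num)]; simp
    · rw [hΨ n z hz]
      have := hsq n z (unitWeight 2 z) (2 * unitWeight 1 z) (unitWeight 0 z) (X n 0 z) (X n 1 z)
        (X n 2 z) (r2 z) (by rw [abs_mul, abs_two]; linarith [r1 z]) (r0 z) (hX0a n z) (hX0sq n z)
        (hXsq n 1 (by norm_num) z (hb1 _)) (hXsq n 2 (by norm_num) z (hb2 _))
      have e2 : Φ n 2 z = unitWeight 2 z * X n 0 z + 2 * unitWeight 1 z * X n 1 z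
        + unitWeight 0 z * X n 2 z := by simp only [Φ]; ring
      rw [e2]; exact this
  have hΦ4 : ∀ n z, |Φ n 4 z| ≤ 10 ^ 10 * M * Ψ n z := fun n z => by
    rcases le_or_gt (2 * N n) |z| with hz | hz
    · rw [hΦz n z hz 4 (by norm_num), abs_zero]
      exact mul_nonneg (by positivity) (hΨ0 n z)
    · rw [hΨ n z hz]
      have hrz := hr z
      have Q : ∀ a b : ℝ, |a| ≤ 10000 * unitWeight 0 z → |b| ≤ M → |a * b| ≤ 10000 * unitWeight 0 z * M :=
        fun a b ha hb => by rw [abs_mul]; exact mul_le_mul ha hb (abs_nonneg _) (by positivity)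
      have q0 := Q _ _ (r4 z) (hXM n 0 (by norm_num) z)
      have q1 := Q _ _ (r3 z) (hXM n 1 (by norm_num) z)
      have q2 := Q _ _ (r2 z) (hXM n 2 (by norm_num) z)
      have q3 := Q _ _ (r1 z) (hXM n 3 (by norm_num) z)
      have q4 := Q _ _ (r0 z) (hXM n 4 (by norm_num) z)
      have hp : 0 ≤ unitWeight 0 z * M := by positivity
      simp only [Φ]
      rw [abs_le] at *
      constructor <;> nlinarith
  let s : ℝ → ℝ := fun x => (x - y) / L
  have hs : ∀ x, HasDerivAt s L⁻¹ x := fun x => by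
    have := ((hasDerivAt_id' x).sub_const y).div_const L
    simpa [s] using this
  have hsc : Continuous s := by simp only [s]; fun_prop
  refine ⟨fun n k x => L⁻¹ ^ k * Φ n k (s x), fun n x => Ψ n (s x), fun n => ?_, ?_, ?_⟩
  · refine ⟨?_, ?_, ?_, ?_, ?_, ?_, ?_, ?_, ?_⟩
    · intro k hk x
      refine (((hΦd n k hk (s x)).comp x (hs x)).const_mul (L⁻¹ ^ k)).congr_deriv ?_
      show L⁻¹ ^ k * (Φ n (k + 1) (s x) * L⁻¹) = L⁻¹ ^ (k + 1) * Φ n (k + 1) (s x)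
      rw [pow_succ]; ring
    · intro k hk
      exact continuous_const.mul ((hΦc n k hk).comp hsc)
    · have b0 := continuous_unitWeight (k := 0) (by norm_num)
      have c0 := hc 0 (by norm_num)
      have : Continuous (Ψ n) := by simp only [Ψ]; fun_prop
      exact this.comp hsc
    · refine ⟨|y| + L * (4 * N n), fun x hx => ?_⟩
      have hn := hN n
      have hsx : 4 * N n ≤ |s x| := by
        simp only [s]
        rw [abs_div, abs_of_pos hL, le_div_iff₀ hL]
        have := abs_sub_abs_le_abs_sub x y
        nlinarith
      refine ⟨?_, fun k hk => ?_⟩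
      · simp only [Ψ]
        rw [hzero _ _ 0 (by norm_num), mul_zero]
        rw [abs_div, abs_of_pos (by linarith : 0 < 2 * N n), le_div_iff₀ (by linarith)]
        linarith
      · show L⁻¹ ^ k * Φ n k (s x) = 0
        rw [hΦz n (s x) (by linarith) k hk, mul_zero]
    · intro x; simpa using hΦ0 n (s x)
    · intro x
      simp only [pow_zero, one_mul]
      rcases le_or_gt (2 * N n) |s x| with hz | hz
      · rw [hΦz n _ hz 0 (by norm_num)]; exact hΨ0 n _
      · rw [hΨ n _ hz]; simp only [Φ]; rw [hX0]
        nlinarith [hr (s x), h1 (s x / N n)]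
    · intro x
      have := hΦ1 n (s x)
      have e : L ^ 2 * (L⁻¹ ^ 1 * Φ n 1 (s x)) ^ 2 = Φ n 1 (s x) ^ 2 := by field_simp
      simp only [pow_zero, one_mul]
      rw [e]; exact this
    · intro x
      have := hΦ2 n (s x)
      have e : L ^ 4 * (L⁻¹ ^ 2 * Φ n 2 (s x)) ^ 2 = Φ n 2 (s x) ^ 2 := by field_simp
      simp only [pow_zero, one_mul]
      rw [e]; exact this
    · intro x
      have := hΦ4 n (s x)
      have e : L ^ 4 * |L⁻¹ ^ 4 * Φ n 4 (s x)| = |Φ n 4 (s x)| := by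
        rw [abs_mul, abs_of_pos (by positivity : 0 < L⁻¹ ^ 4)]; field_simp
      rw [e]; exact this
  · intro n x
    rw [weight_eq_unitWeight]
    show unitWeight 0 (s x) * χ 0 _ ≤ unitWeight 0 (s x)
    nlinarith [hr (s x), h1 (s x / (2 * N n)), h0 (s x / (2 * N n))]
  · intro x
    rw [weight_eq_unitWeight]
    refine tendsto_const_nhds.congr' ?_
    obtain ⟨m, hm⟩ := exists_nat_ge |s x|
    filter_upwards [eventually_ge_atTop m] with n hn
    have hnn : (m : ℝ) ≤ n := by exact_mod_cast hn
    have h1N : 0 < N n := by linarith [hN n]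
    simp only [pow_zero, one_mul, Φ]
    rw [hX0, hone, mul_one]
    rw [abs_div, abs_of_pos h1N, div_le_one h1N]
    simp only [N]; linarith

/-- The universal constant controlling the derivatives of the cut-offs. -/
def cutoffConst : ℝ := exists_cutoffs.choose

lemma one_le_cutoffConst : 1 ≤ cutoffConst := exists_cutoffs.choose_spec.1

lemma exists_cutoff_seq (L y : ℝ) (hL : 0 < L) :
    ∃ (φ : ℕ → ℕ → ℝ → ℝ) (ψ : ℕ → ℝ → ℝ), (∀ n, Cutoff cutoffConst L (φ n) (ψ n)) ∧
      (∀ n x, ψ n x ≤ weight L y x) ∧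
      (∀ x, Tendsto (fun n => φ n 0 x) atTop (𝓝 (weight L y x))) :=
  exists_cutoffs.choose_spec.2 L y hL

/-! ### Integration tools -/

lemma integrable_of_continuous_of_zero {f : ℝ → ℝ} (hf : Continuous f) {R : ℝ}
    (h : ∀ x, R < |x| → f x = 0) : Integrable f := by
  refine hf.integrable_of_hasCompactSupport ?_
  refine HasCompactSupport.intro (isCompact_Icc (a := -R) (b := R)) fun x hx => h x ?_
  by_contra hc
  exact hx (abs_le.1 (not_lt.1 hc))

/-- If `X ≤ Y + F'` with `F` compactly supported, then `∫ X ≤ ∫ Y`. -/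
lemma integral_le_of_flux {X Y F F' : ℝ → ℝ} {R : ℝ} (hX : Continuous X) (hY : Continuous Y)
    (hF' : Continuous F') (hd : ∀ x, HasDerivAt F (F' x) x)
    (hX0 : ∀ x, R < |x| → X x = 0) (hY0 : ∀ x, R < |x| → Y x = 0)
    (hF0 : ∀ x, R < |x| → F x = 0) (hF0' : ∀ x, R < |x| → F' x = 0)
    (h : ∀ x, X x ≤ Y x + F' x) : ∫ x, X x ≤ ∫ x, Y x := by
  have iX := integrable_of_continuous_of_zero hX hX0
  have iY := integrable_of_continuous_of_zero hY hY0
  have hF : Continuous F := continuous_iff_continuousAt.2 fun x => (hd x).continuousAt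
  have iF := integrable_of_continuous_of_zero hF hF0
  have iF' := integrable_of_continuous_of_zero hF' hF0'
  have h0 := integral_eq_zero_of_hasDerivAt_of_integrable hd iF' iF
  calc ∫ x, X x ≤ ∫ x, (Y x + F' x) := integral_mono iX (iY.add iF') h
    _ = ∫ x, Y x := by rw [integral_add iY iF', h0, add_zero]

lemma continuous_slice {F : ℝ → ℝ → ℝ} {S : Set ℝ}
    (hF : ContinuousOn (fun z : ℝ × ℝ => F z.1 z.2) (S ×ˢ univ)) {τ : ℝ} (hτ : τ ∈ S) :
    Continuous (F τ) := by
  rw [← continuousOn_univ]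
  exact hF.comp (f := fun x => (τ, x)) (by fun_prop) (fun x _ => ⟨hτ, mem_univ _⟩)

lemma continuousOn_time_slice {F : ℝ → ℝ → ℝ} {S : Set ℝ}
    (hF : ContinuousOn (fun z : ℝ × ℝ => F z.1 z.2) (S ×ˢ univ)) (x : ℝ) :
    ContinuousOn (fun τ => F τ x) S :=
  hF.comp (f := fun τ => (τ, x)) (by fun_prop) (fun τ hτ => ⟨hτ, mem_univ _⟩)

lemma continuousOn_lift_space {φ : ℝ → ℝ} (hφ : Continuous φ) {S : Set (ℝ × ℝ)} :
    ContinuousOn (fun z : ℝ × ℝ => φ z.2) S := (hφ.comp continuous_snd).continuousOn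

lemma continuousOn_integral {F : ℝ → ℝ → ℝ} {S : Set ℝ} {R : ℝ}
    (hF : ContinuousOn (fun z : ℝ × ℝ => F z.1 z.2) (S ×ˢ univ))
    (h0 : ∀ τ ∈ S, ∀ x, R < |x| → F τ x = 0) :
    ContinuousOn (fun τ => ∫ x, F τ x) S := by
  refine continuousOn_integral_of_compact_support (isCompact_Icc (a := -R) (b := R)) hF ?_
  intro τ x hτ hx
  refine h0 τ hτ x ?_
  by_contra hc
  exact hx (abs_le.1 (not_lt.1 hc))

/-- Differentiation under the integral sign for compactly supported integrands. -/
lemma hasDerivAt_integral_of_continuousOn {F F' : ℝ → ℝ → ℝ} {a R : ℝ}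
    (hF : ContinuousOn (fun z : ℝ × ℝ => F z.1 z.2) (Ioi a ×ˢ univ))
    (hF' : ContinuousOn (fun z : ℝ × ℝ => F' z.1 z.2) (Ioi a ×ˢ univ))
    (hd : ∀ τ > a, ∀ x, HasDerivAt (fun τ => F τ x) (F' τ x) τ)
    (h0 : ∀ τ > a, ∀ x, R < |x| → F τ x = 0) (h0' : ∀ τ > a, ∀ x, R < |x| → F' τ x = 0)
    {τ : ℝ} (hτ : a < τ) :
    HasDerivAt (fun τ => ∫ x, F τ x) (∫ x, F' τ x) τ := by
  obtain ⟨b, hab, hbτ⟩ := exists_between hτ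
  have hK : IsCompact (Icc b (τ + 1) ×ˢ Icc (-R) R) := isCompact_Icc.prod isCompact_Icc
  have hsub : Icc b (τ + 1) ×ˢ Icc (-R) R ⊆ Ioi a ×ˢ univ := fun z hz =>
    ⟨lt_of_lt_of_le hab hz.1.1, mem_univ _⟩
  obtain ⟨M, hM⟩ := hK.exists_bound_of_continuousOn (hF'.mono hsub)
  have hs : Ioo b (τ + 1) ∈ 𝓝 τ := Ioo_mem_nhds hbτ (by linarith)
  refine (hasDerivAt_integral_of_dominated_loc_of_deriv_le (F := F) (F' := F')
    (bound := (Icc (-R) R).indicator fun _ => M) hs ?_ ?_ ?_ ?_ ?_ ?_).2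
  · filter_upwards [Ioi_mem_nhds hτ] with σ hσ
    exact (continuous_slice hF hσ).aestronglyMeasurable
  · exact integrable_of_continuous_of_zero (continuous_slice hF hτ) (h0 τ hτ)
  · exact (continuous_slice hF' hτ).aestronglyMeasurable
  · refine ae_of_all _ fun x σ hσ => ?_
    by_cases hx : x ∈ Icc (-R) R
    · rw [indicator_of_mem hx]
      exact hM (σ, x) ⟨⟨hσ.1.le, hσ.2.le⟩, hx⟩
    · rw [indicator_of_notMem hx, h0' σ (hab.trans hσ.1) x, norm_zero]
      by_contra hc
      exact hx (abs_le.1 (not_lt.1 hc))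
  · exact (integrable_indicator_iff measurableSet_Icc).2
      (integrableOn_const (by simp))
  · exact ae_of_all _ fun x σ hσ => hd σ (hab.trans hσ.1) x

/-- Superadditivity of `liminf`. It allows Fatou's lemma to be applied separately to the two terms
on the left of a weighted inequality. -/
lemma add_liminf_le_of_add_le {a b : ℕ → ℝ≥0∞} {U : ℝ≥0∞} (h : ∀ n, a n + b n ≤ U) :
    liminf a atTop + liminf b atTop ≤ U := by
  rw [liminf_eq_iSup_iInf_of_nat, liminf_eq_iSup_iInf_of_nat]
  rw [ENNReal.iSup_add_iSup_of_monotone]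
  · refine iSup_le fun n => le_trans ?_ (h n)
    exact add_le_add (iInf₂_le n le_rfl) (iInf₂_le n le_rfl)
  · intro m n hmn
    exact le_iInf₂ fun i hi => iInf₂_le i (hmn.trans hi)
  · intro m n hmn
    exact le_iInf₂ fun i hi => iInf₂_le i (hmn.trans hi)

/-- Integral against the rational weight. -/
def wint (L y : ℝ) (f : ℝ → ℝ) : ℝ≥0∞ := ∫⁻ x, ENNReal.ofReal (weight L y x * f x)

lemma wint_mono {L y : ℝ} {f g : ℝ → ℝ} (h : ∀ x, f x ≤ g x) : wint L y f ≤ wint L y g :=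
  lintegral_mono fun x => ENNReal.ofReal_le_ofReal
    (mul_le_mul_of_nonneg_left (h x) (weight_pos L y x).le)

lemma wint_const_mul {L y c : ℝ} (hc : 0 ≤ c) (f : ℝ → ℝ) :
    wint L y (fun x => c * f x) = ENNReal.ofReal c * wint L y f := by
  unfold wint
  rw [← lintegral_const_mul' _ _ ENNReal.ofReal_ne_top]
  refine lintegral_congr fun x => ?_
  rw [← ENNReal.ofReal_mul hc]; congr 1; ring

lemma wint_add {L y : ℝ} {f g : ℝ → ℝ} (hf : Continuous f) (hf0 : ∀ x, 0 ≤ f x)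
    (hg0 : ∀ x, 0 ≤ g x) : wint L y (fun x => f x + g x) = wint L y f + wint L y g := by
  unfold wint
  rw [← lintegral_add_left (by have := hf; fun_prop)]
  refine lintegral_congr fun x => ?_
  rw [← ENNReal.ofReal_add (mul_nonneg (weight_pos L y x).le (hf0 x))
    (mul_nonneg (weight_pos L y x).le (hg0 x)), mul_add]

lemma wint_le_lintegral {L y : ℝ} {f : ℝ → ℝ} (hf : ∀ x, 0 ≤ f x) :
    wint L y f ≤ ∫⁻ x, ENNReal.ofReal (f x) :=
  lintegral_mono fun x => ENNReal.ofReal_le_ofReal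
    (by nlinarith [hf x, weight_le_one L y x])

/-- Passage from compactly supported cut-offs to the weight in a differential inequality. -/
lemma weighted_inequality {B A R : ℝ → ℝ → ℝ} {L y a s t : ℝ} (hL : 0 < L) (has : a < s)
    (hst : s ≤ t)
    (hB : ContinuousOn (fun z : ℝ × ℝ => B z.1 z.2) (Ioi a ×ˢ univ))
    (hA : ContinuousOn (fun z : ℝ × ℝ => A z.1 z.2) (Ioi a ×ˢ univ))
    (hR : ContinuousOn (fun z : ℝ × ℝ => R z.1 z.2) (Ioi a ×ˢ univ))
    (hB0 : ∀ τ ∈ Icc s t, ∀ x, 0 ≤ B τ x) (hA0 : ∀ τ ∈ Icc s t, ∀ x, 0 ≤ A τ x)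
    (hR0 : ∀ τ ∈ Icc s t, ∀ x, 0 ≤ R τ x)
    (h : ∀ φ ψ, Cutoff cutoffConst L φ ψ → ∀ τ ∈ Icc s t, ∃ f',
      HasDerivAt (fun τ => ∫ x, φ 0 x * B τ x) f' τ ∧
      f' ≤ -(∫ x, φ 0 x * A τ x) + ∫ x, ψ x * R τ x) :
    wint L y (B t) + ∫⁻ τ in Ioc s t, wint L y (A τ) ≤
      wint L y (B s) + ∫⁻ τ in Ioc s t, wint L y (R τ) := by
  obtain ⟨φ, ψ, hC, hψ, hlim⟩ := exists_cutoff_seq L y hL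
  have hsa : Icc s t ⊆ Ioi a := fun τ hτ => lt_of_lt_of_le has hτ.1
  have hIoc : Ioc s t ⊆ Ioi a := Ioc_subset_Icc_self.trans hsa
  have htm : t ∈ Icc s t := ⟨hst, le_rfl⟩
  have hsm : s ∈ Icc s t := ⟨le_rfl, hst⟩
  have cont : ∀ n, ∀ Z : ℝ → ℝ → ℝ, ContinuousOn (fun z : ℝ × ℝ => Z z.1 z.2) (Ioi a ×ˢ univ) →
      ContinuousOn (fun τ => ∫ x, φ n 0 x * Z τ x) (Ioi a) ∧
      ContinuousOn (fun τ => ∫ x, ψ n x * Z τ x) (Ioi a) := by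
    intro n Z hZ
    obtain ⟨r, hr⟩ := (hC n).compact
    constructor
    · refine continuousOn_integral (F := fun τ x => φ n 0 x * Z τ x) (R := r)
        ((continuousOn_lift_space ((hC n).cont 0 (by norm_num))).mul hZ) fun τ _ x hx => ?_
      rw [(hr x hx).2 0 (by norm_num), zero_mul]
    · refine continuousOn_integral (F := fun τ x => ψ n x * Z τ x) (R := r)
        ((continuousOn_lift_space ((hC n).contψ)).mul hZ) fun τ _ x hx => ?_
      rw [(hr x hx).1, zero_mul]
  have intg : ∀ n, ∀ Z : ℝ → ℝ → ℝ, ContinuousOn (fun z : ℝ × ℝ => Z z.1 z.2) (Ioi a ×ˢ univ) →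
      ∀ τ ∈ Icc s t, Integrable (fun x => φ n 0 x * Z τ x) ∧ Integrable (fun x => ψ n x * Z τ x) := by
    intro n Z hZ τ hτ
    obtain ⟨r, hr⟩ := (hC n).compact
    have hZτ := continuous_slice hZ (hsa hτ)
    exact ⟨integrable_of_continuous_of_zero (R := r) (((hC n).cont 0 (by norm_num)).mul hZτ)
      (fun x hx => by rw [(hr x hx).2 0 (by norm_num), zero_mul]),
      integrable_of_continuous_of_zero (R := r) (((hC n).contψ).mul hZτ)
      (fun x hx => by rw [(hr x hx).1, zero_mul])⟩
  -- The differential inequality is integrated in time for a fixed cut-off. On the right the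
  -- cut-offs are bounded by the weight at once; only the left side needs a limit in `n`, and
  -- Fatou's lemma suffices for it.
  have key : ∀ n, ENNReal.ofReal (∫ x, φ n 0 x * B t x)
      + ∫⁻ τ in Ioc s t, ENNReal.ofReal (∫ x, φ n 0 x * A τ x) ≤
      wint L y (B s) + ∫⁻ τ in Ioc s t, wint L y (R τ) := by
    intro n
    have hφ0 := (hC n).nonneg
    have hψ0 := (hC n).psi_nonneg
    choose! f' hf' hle using fun τ (hτ : τ ∈ Icc s t) => h (φ n) (ψ n) (hC n) τ hτ
    have cA := (cont n A hA).1.mono hsa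
    have cR := (cont n R hR).2.mono hsa
    have iA : IntervalIntegrable (fun τ => ∫ x, φ n 0 x * A τ x) volume s t :=
      ContinuousOn.intervalIntegrable (by rwa [uIcc_of_le hst])
    have iR : IntervalIntegrable (fun τ => ∫ x, ψ n x * R τ x) volume s t :=
      ContinuousOn.intervalIntegrable (by rwa [uIcc_of_le hst])
    have main := intervalIntegral.sub_le_integral_of_hasDeriv_right_of_le hst
      ((cont n B hB).1.mono hsa)
      (fun τ hτ => (hf' τ (Ioo_subset_Icc_self hτ)).hasDerivWithinAt)
      ((cA.neg.add cR).integrableOn_Icc)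
      (fun τ hτ => hle τ (Ioo_subset_Icc_self hτ))
    have e := intervalIntegral.integral_add iA.neg iR
    simp only [Pi.neg_apply, intervalIntegral.integral_neg] at e
    have main' : (∫ x, φ n 0 x * B t x) + (∫ τ in s..t, ∫ x, φ n 0 x * A τ x) ≤
        (∫ x, φ n 0 x * B s x) + ∫ τ in s..t, ∫ x, ψ n x * R τ x := by
      have := main
      simp only [Pi.add_apply, Pi.neg_apply] at this
      linarith [this.trans_eq e]
    have nA : ∀ τ ∈ Icc s t, 0 ≤ ∫ x, φ n 0 x * A τ x := fun τ hτ =>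
      integral_nonneg fun x => mul_nonneg (hφ0 x) (hA0 τ hτ x)
    have nR : ∀ τ ∈ Icc s t, 0 ≤ ∫ x, ψ n x * R τ x := fun τ hτ =>
      integral_nonneg fun x => mul_nonneg (hψ0 x) (hR0 τ hτ x)
    have oA : ENNReal.ofReal (∫ τ in s..t, ∫ x, φ n 0 x * A τ x) =
        ∫⁻ τ in Ioc s t, ENNReal.ofReal (∫ x, φ n 0 x * A τ x) := by
      rw [intervalIntegral.integral_of_le hst]
      exact ofReal_integral_eq_lintegral_ofReal (cA.integrableOn_Icc.mono_set Ioc_subset_Icc_self)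
        ((ae_restrict_iff' measurableSet_Ioc).2 (ae_of_all _ fun τ hτ => nA τ (Ioc_subset_Icc_self hτ)))
    have oR : ENNReal.ofReal (∫ τ in s..t, ∫ x, ψ n x * R τ x) =
        ∫⁻ τ in Ioc s t, ENNReal.ofReal (∫ x, ψ n x * R τ x) := by
      rw [intervalIntegral.integral_of_le hst]
      exact ofReal_integral_eq_lintegral_ofReal (cR.integrableOn_Icc.mono_set Ioc_subset_Icc_self)
        ((ae_restrict_iff' measurableSet_Ioc).2 (ae_of_all _ fun τ hτ => nR τ (Ioc_subset_Icc_self hτ)))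
    have nIA : 0 ≤ ∫ τ in s..t, ∫ x, φ n 0 x * A τ x :=
      intervalIntegral.integral_nonneg hst nA
    have nIR : 0 ≤ ∫ τ in s..t, ∫ x, ψ n x * R τ x :=
      intervalIntegral.integral_nonneg hst nR
    have nB : ∀ τ ∈ Icc s t, 0 ≤ ∫ x, φ n 0 x * B τ x := fun τ hτ =>
      integral_nonneg fun x => mul_nonneg (hφ0 x) (hB0 τ hτ x)
    rw [← oA, ← ENNReal.ofReal_add (nB t htm) nIA]
    refine (ENNReal.ofReal_le_ofReal main').trans ?_
    rw [ENNReal.ofReal_add (nB s hsm) nIR, oR]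
    refine add_le_add ?_ (lintegral_mono_ae ?_)
    · rw [ofReal_integral_eq_lintegral_ofReal (intg n B hB s hsm).1
        (ae_of_all _ fun x => mul_nonneg (hφ0 x) (hB0 s hsm x))]
      exact lintegral_mono fun x => ENNReal.ofReal_le_ofReal
        (mul_le_mul_of_nonneg_right (((hC n).le x).trans (hψ n x)) (hB0 s hsm x))
    · refine (ae_restrict_iff' measurableSet_Ioc).2 (ae_of_all _ fun τ hτ => ?_)
      have hτ' := Ioc_subset_Icc_self hτ
      rw [ofReal_integral_eq_lintegral_ofReal (intg n R hR τ hτ').2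
        (ae_of_all _ fun x => mul_nonneg (hψ0 x) (hR0 τ hτ' x))]
      exact lintegral_mono fun x => ENNReal.ofReal_le_ofReal
        (mul_le_mul_of_nonneg_right (hψ n x) (hR0 τ hτ' x))
  have fatou : ∀ Z : ℝ → ℝ → ℝ, ContinuousOn (fun z : ℝ × ℝ => Z z.1 z.2) (Ioi a ×ˢ univ) →
      ∀ τ ∈ Icc s t, (∀ x, 0 ≤ Z τ x) →
      wint L y (Z τ) ≤ liminf (fun n => ENNReal.ofReal (∫ x, φ n 0 x * Z τ x)) atTop := by
    intro Z hZ τ hτ hZ0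
    have hZτ := continuous_slice hZ (hsa hτ)
    have e : ∀ n, ENNReal.ofReal (∫ x, φ n 0 x * Z τ x) =
        ∫⁻ x, ENNReal.ofReal (φ n 0 x * Z τ x) := fun n =>
      ofReal_integral_eq_lintegral_ofReal (intg n Z hZ τ hτ).1
        (ae_of_all _ fun x => mul_nonneg ((hC n).nonneg x) (hZ0 x))
    simp_rw [e]
    refine le_trans (le_of_eq ?_) (lintegral_liminf_le fun n => ?_)
    · refine lintegral_congr fun x => ?_
      exact ((ENNReal.continuous_ofReal.tendsto _).comp ((hlim x).mul_const (Z τ x))).liminf_eq.symm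
    · have := (hC n).cont 0 (by norm_num)
      fun_prop
  refine le_trans (add_le_add (fatou B hB t htm (hB0 t htm)) ?_) (add_liminf_le_of_add_le key)
  refine le_trans (lintegral_mono_ae (g := fun τ =>
    liminf (fun n => ENNReal.ofReal (∫ x, φ n 0 x * A τ x)) atTop)
    ((ae_restrict_iff' measurableSet_Ioc).2 (ae_of_all _ fun τ hτ =>
      fatou A hA τ (Ioc_subset_Icc_self hτ) (hA0 τ (Ioc_subset_Icc_self hτ))))) ?_
  refine lintegral_liminf_le' fun n => ?_
  exact (((cont n A hA).1.mono hIoc).aemeasurable measurableSet_Ioc).ennreal_ofReal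

/-! ### Weighted estimates for fourth-order equations -/

/-- Young's inequality adapted to cut-offs: `a` is a derivative of the cut-off `f`, with `a²` at
most a multiple of `f w`. The top-order factor then keeps the cut-off `f` and can be absorbed, while
the lower-order one takes the larger cut-off `w`. -/
lemma two_abs_mul_le {a b f w x y ε : ℝ} (hε : 0 < ε) (hf : 0 ≤ f) (hw : 0 ≤ w) (hb : 0 ≤ b)
    (h : a ^ 2 ≤ b * (f * w)) : 2 * |a * x * y| ≤ ε * (f * x ^ 2) + b / ε * (w * y ^ 2) := by
  have hR : 0 ≤ ε * (f * x ^ 2) + b / ε * (w * y ^ 2) := by positivity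
  have h1 : (2 * |a * x * y|) ^ 2 ≤ (ε * (f * x ^ 2) + b / ε * (w * y ^ 2)) ^ 2 := by
    have e : (2 * |a * x * y|) ^ 2 = 4 * (a ^ 2 * (x ^ 2 * y ^ 2)) := by
      rw [mul_pow, sq_abs]; ring
    have h2 : a ^ 2 * (x ^ 2 * y ^ 2) ≤ b * (f * w) * (x ^ 2 * y ^ 2) := by gcongr
    have e2 : b * (f * w) * (x ^ 2 * y ^ 2) = (ε * (f * x ^ 2)) * (b / ε * (w * y ^ 2)) := by
      field_simp
    rw [e]
    nlinarith [sq_nonneg (ε * (f * x ^ 2) - b / ε * (w * y ^ 2))]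
  exact abs_le_of_sq_le_sq' h1 hR |>.2

lemma aux_const_one {K M : ℝ} (hK : 0 ≤ K) (hM : 1 ≤ M) :
    3 / 2 * K + 1 / 4 * M ≤ M * (2 * K + 1) := by nlinarith

lemma aux_const_two {K : ℝ} (hK : 0 ≤ K) :
    2 * K + 2 * K ^ 2 + 9 + 3 * (2 * K + 1) ^ 2 ≤ 40 * (K + 1) ^ 2 := by nlinarith

lemma sq_le_pow_four {m : ℝ} (hm : 1 ≤ m ^ 2) : m ^ 2 ≤ m ^ 4 := by nlinarith

variable {B l : ℝ} {φ : ℕ → ℝ → ℝ} {ψ : ℝ → ℝ}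

lemma Cutoff.bounds (hC : Cutoff B l φ ψ) (hB : 1 ≤ B) (hl : 0 < l) (x : ℝ) :
    0 ≤ φ 0 x ∧ φ 0 x ≤ ψ x ∧ φ 1 x ^ 2 ≤ B * l⁻¹ ^ 2 * (φ 0 x * ψ x) ∧
      φ 2 x ^ 2 ≤ B * l⁻¹ ^ 4 * (φ 0 x * ψ x) ∧ |φ 2 x| ≤ B * l⁻¹ ^ 2 * ψ x ∧
      |φ 4 x| ≤ B * l⁻¹ ^ 4 * ψ x := by
  have h0 := hC.nonneg x
  have h1 := hC.le x
  have hψ := hC.psi_nonneg x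
  have h2 : φ 2 x ^ 2 ≤ B * l⁻¹ ^ 4 * (φ 0 x * ψ x) := by
    have := hC.two x
    have e : B * l⁻¹ ^ 4 * (φ 0 x * ψ x) = B * (φ 0 x * ψ x) / l ^ 4 := by field_simp
    rw [e, le_div_iff₀ (by positivity)]; linarith
  refine ⟨h0, h1, ?_, h2, ?_, ?_⟩
  · have := hC.one x
    have e : B * l⁻¹ ^ 2 * (φ 0 x * ψ x) = B * (φ 0 x * ψ x) / l ^ 2 := by field_simp
    rw [e, le_div_iff₀ (by positivity)]; linarith
  · refine abs_le_of_sq_le_sq (h2.trans ?_) (by positivity)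
    have a1 : φ 0 x * ψ x ≤ ψ x * ψ x := by gcongr
    have a2 : B * l⁻¹ ^ 4 * (φ 0 x * ψ x) ≤ B * l⁻¹ ^ 4 * (ψ x * ψ x) := by gcongr
    have a3 : B * (l⁻¹ ^ 4 * (ψ x * ψ x)) ≤ B ^ 2 * (l⁻¹ ^ 4 * (ψ x * ψ x)) := by
      have : 0 ≤ l⁻¹ ^ 4 * (ψ x * ψ x) := by positivity
      nlinarith
    nlinarith
  · have := hC.four x
    have e : B * l⁻¹ ^ 4 * ψ x = B * ψ x / l ^ 4 := by field_simp
    rw [e, le_div_iff₀ (by positivity)]; linarith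

/-- The part of `(φ q)_xx q_xx` that remains after the fluxes are split off. -/
def bilaplaceTerm (φ : ℕ → ℝ → ℝ) (q q2 : ℝ → ℝ) (x : ℝ) : ℝ :=
  -(φ 0 x * q2 x ^ 2) - 2 * (φ 2 x * q x * q2 x) + 1 / 2 * (φ 4 x * q x ^ 2)

section static
variable {q q1 q2 : ℝ → ℝ} (hC : Cutoff B l φ ψ)
include hC

/-- Two exact derivatives used in integrations by parts. The first three terms trade `φ_x q_x q_xx`
for terms without `q_x`. The part with the free coefficient `θ` encodes `∫ φ q_x² = -∫ φ q q_xx + ½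
∫ φ_xx q²`; a large `θ` supplies coercivity in `q_x` at the cost of lower-order terms. -/
lemma Cutoff.hasDerivAt_flux (hq : ∀ x, HasDerivAt q (q1 x) x) (hq1 : ∀ x, HasDerivAt q1 (q2 x) x)
    (θ : ℝ) (x : ℝ) :
    HasDerivAt (fun x => -(φ 1 x * q1 x ^ 2) + φ 2 x * q x * q1 x - 1 / 2 * (φ 3 x * q x ^ 2)
        + θ * (φ 0 x * q x * q1 x - 1 / 2 * (φ 1 x * q x ^ 2)))
      (-2 * (φ 1 x * q1 x * q2 x) + φ 2 x * q x * q2 x - 1 / 2 * (φ 4 x * q x ^ 2)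
        + θ * (φ 0 x * q1 x ^ 2 + φ 0 x * q x * q2 x - 1 / 2 * (φ 2 x * q x ^ 2))) x := by
  have d0 := hC.deriv 0 (by norm_num) x
  have d1 := hC.deriv 1 (by norm_num) x
  have d2 := hC.deriv 2 (by norm_num) x
  have d3 := hC.deriv 3 (by norm_num) x
  refine (((((d1.mul ((hq1 x).pow 2)).neg).add ((d2.mul (hq x)).mul (hq1 x))).sub
    ((d3.mul ((hq x).pow 2)).const_mul (1 / 2))).add ((((d0.mul (hq x)).mul (hq1 x)).sub
    ((d1.mul ((hq x).pow 2)).const_mul (1 / 2))).const_mul θ)).congr_deriv ?_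
  simp
  ring

/-- Integrated form of a pointwise bound, for equations `q_t = P_x` with `P = g - q_xxx`. -/
lemma Cutoff.integral_le_divergence {P Px g A R : ℝ → ℝ} (θ : ℝ)
    (hq : ∀ x, HasDerivAt q (q1 x) x) (hq1 : ∀ x, HasDerivAt q1 (q2 x) x)
    (hq2 : ∀ x, HasDerivAt q2 (g x - P x) x) (hP : ∀ x, HasDerivAt P (Px x) x)
    (hg : Continuous g) (hPx : Continuous Px) (hA : Continuous A) (hR : Continuous R)
    (h : ∀ x, bilaplaceTerm φ q q2 x - (φ 1 x * q x + φ 0 x * q1 x) * g x ≤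
      -(φ 0 x * A x) + ψ x * R x
        + θ * (φ 0 x * q1 x ^ 2 + φ 0 x * q x * q2 x - 1 / 2 * (φ 2 x * q x ^ 2))) :
    ∫ x, φ 0 x * (q x * Px x) ≤ -(∫ x, φ 0 x * A x) + ∫ x, ψ x * R x := by
  obtain ⟨r, hr⟩ := hC.compact
  have c0 := hC.cont 0 (by norm_num)
  have c1 := hC.cont 1 (by norm_num)
  have c2 := hC.cont 2 (by norm_num)
  have c4 := hC.cont 4 (by norm_num)
  have cψ := hC.contψ
  have cq : Continuous q := continuous_iff_continuousAt.2 fun x => (hq x).continuousAt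
  have cq1 : Continuous q1 := continuous_iff_continuousAt.2 fun x => (hq1 x).continuousAt
  have cq2 : Continuous q2 := continuous_iff_continuousAt.2 fun x => (hq2 x).continuousAt
  have cP : Continuous P := continuous_iff_continuousAt.2 fun x => (hP x).continuousAt
  have z0 : ∀ x, r < |x| → φ 0 x = 0 := fun x hx => (hr x hx).2 0 (by norm_num)
  have z1 : ∀ x, r < |x| → φ 1 x = 0 := fun x hx => (hr x hx).2 1 (by norm_num)
  have z2 : ∀ x, r < |x| → φ 2 x = 0 := fun x hx => (hr x hx).2 2 (by norm_num)
  have z3 : ∀ x, r < |x| → φ 3 x = 0 := fun x hx => (hr x hx).2 3 (by norm_num)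
  have z4 : ∀ x, r < |x| → φ 4 x = 0 := fun x hx => (hr x hx).2 4 (by norm_num)
  have zψ : ∀ x, r < |x| → ψ x = 0 := fun x hx => (hr x hx).1
  have iA : Integrable fun x => φ 0 x * A x :=
    integrable_of_continuous_of_zero (c0.mul hA) fun x hx => by rw [z0 x hx, zero_mul]
  have iR : Integrable fun x => ψ x * R x :=
    integrable_of_continuous_of_zero (cψ.mul hR) fun x hx => by rw [zψ x hx, zero_mul]
  have eI := integral_add iA.neg iR
  simp only [Pi.neg_apply, integral_neg] at eI
  rw [← eI]
  have d0 := fun x => hC.deriv 0 (by norm_num) x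
  have d1 := fun x => hC.deriv 1 (by norm_num) x
  -- The first group of the flux moves two derivatives from `q_xxx = g - P` to `φ q`: the terms with
  -- `P` cancel, leaving `g (φ q)_x` and `q_xx (φ q)_xx`.
  refine integral_le_of_flux (R := r)
    (F := fun x => (φ 0 x * q x * P x + (φ 1 x * q x + φ 0 x * q1 x) * q2 x) +
      (-(φ 1 x * q1 x ^ 2) + φ 2 x * q x * q1 x - 1 / 2 * (φ 3 x * q x ^ 2)
        + θ * (φ 0 x * q x * q1 x - 1 / 2 * (φ 1 x * q x ^ 2))))
    (F' := fun x => (φ 0 x * q x * Px x + (φ 1 x * q x + φ 0 x * q1 x) * g x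
      + (φ 2 x * q x + 2 * (φ 1 x * q1 x) + φ 0 x * q2 x) * q2 x) +
      (-2 * (φ 1 x * q1 x * q2 x) + φ 2 x * q x * q2 x - 1 / 2 * (φ 4 x * q x ^ 2)
        + θ * (φ 0 x * q1 x ^ 2 + φ 0 x * q x * q2 x - 1 / 2 * (φ 2 x * q x ^ 2))))
    (by fun_prop) (by fun_prop) (by fun_prop) (fun x => ?_) ?_ ?_ ?_ ?_ (fun x => ?_)
  · refine HasDerivAt.add ?_ (hC.hasDerivAt_flux hq hq1 θ x)
    refine ((((d0 x).mul (hq x)).mul (hP x)).add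
      ((((d1 x).mul (hq x)).add ((d0 x).mul (hq1 x))).mul (hq2 x))).congr_deriv ?_
    simp only [zero_add, one_add_one_eq_two, Pi.mul_apply, Pi.add_apply]
    ring
  · intro x hx; simp only [z0 x hx]; ring
  · intro x hx; simp only [z0 x hx, zψ x hx]; ring
  · intro x hx; simp only [z0 x hx, z1 x hx, z2 x hx, z3 x hx]; ring
  · intro x hx; simp only [z0 x hx, z1 x hx, z2 x hx, z4 x hx]; ring
  · have := h x
    simp only [bilaplaceTerm] at this
    linarith

/-- Integrated form of a pointwise bound, for equations `q_t = (k - q_xx)_xx`. -/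
lemma Cutoff.integral_le_laplace {P Px k A R : ℝ → ℝ} (θ : ℝ)
    (hq : ∀ x, HasDerivAt q (q1 x) x) (hq1 : ∀ x, HasDerivAt q1 (q2 x) x)
    (hkq : ∀ x, HasDerivAt (fun x => k x - q2 x) (P x) x) (hP : ∀ x, HasDerivAt P (Px x) x)
    (hk : Continuous k) (hPx : Continuous Px) (hA : Continuous A) (hR : Continuous R)
    (h : ∀ x, bilaplaceTerm φ q q2 x
        + (φ 2 x * q x + 2 * (φ 1 x * q1 x) + φ 0 x * q2 x) * k x ≤
      -(φ 0 x * A x) + ψ x * R x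
        + θ * (φ 0 x * q1 x ^ 2 + φ 0 x * q x * q2 x - 1 / 2 * (φ 2 x * q x ^ 2))) :
    ∫ x, φ 0 x * (q x * Px x) ≤ -(∫ x, φ 0 x * A x) + ∫ x, ψ x * R x := by
  obtain ⟨r, hr⟩ := hC.compact
  have c0 := hC.cont 0 (by norm_num)
  have c1 := hC.cont 1 (by norm_num)
  have c2 := hC.cont 2 (by norm_num)
  have c4 := hC.cont 4 (by norm_num)
  have cψ := hC.contψ
  have cq : Continuous q := continuous_iff_continuousAt.2 fun x => (hq x).continuousAt
  have cq1 : Continuous q1 := continuous_iff_continuousAt.2 fun x => (hq1 x).continuousAt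
  have ckq : Continuous fun x => k x - q2 x :=
    continuous_iff_continuousAt.2 fun x => (hkq x).continuousAt
  have cq2 : Continuous q2 := by
    have : q2 = fun x => k x - (k x - q2 x) := by ext; ring
    rw [this]; fun_prop
  have cP : Continuous P := continuous_iff_continuousAt.2 fun x => (hP x).continuousAt
  have z0 : ∀ x, r < |x| → φ 0 x = 0 := fun x hx => (hr x hx).2 0 (by norm_num)
  have z1 : ∀ x, r < |x| → φ 1 x = 0 := fun x hx => (hr x hx).2 1 (by norm_num)
  have z2 : ∀ x, r < |x| → φ 2 x = 0 := fun x hx => (hr x hx).2 2 (by norm_num)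
  have z3 : ∀ x, r < |x| → φ 3 x = 0 := fun x hx => (hr x hx).2 3 (by norm_num)
  have z4 : ∀ x, r < |x| → φ 4 x = 0 := fun x hx => (hr x hx).2 4 (by norm_num)
  have zψ : ∀ x, r < |x| → ψ x = 0 := fun x hx => (hr x hx).1
  have iA : Integrable fun x => φ 0 x * A x :=
    integrable_of_continuous_of_zero (c0.mul hA) fun x hx => by rw [z0 x hx, zero_mul]
  have iR : Integrable fun x => ψ x * R x :=
    integrable_of_continuous_of_zero (cψ.mul hR) fun x hx => by rw [zψ x hx, zero_mul]
  have eI := integral_add iA.neg iR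
  simp only [Pi.neg_apply, integral_neg] at eI
  rw [← eI]
  have d0 := fun x => hC.deriv 0 (by norm_num) x
  have d1 := fun x => hC.deriv 1 (by norm_num) x
  refine integral_le_of_flux (R := r)
    (F := fun x => (φ 0 x * q x * P x - (φ 1 x * q x + φ 0 x * q1 x) * (k x - q2 x)) +
      (-(φ 1 x * q1 x ^ 2) + φ 2 x * q x * q1 x - 1 / 2 * (φ 3 x * q x ^ 2)
        + θ * (φ 0 x * q x * q1 x - 1 / 2 * (φ 1 x * q x ^ 2))))
    (F' := fun x => (φ 0 x * q x * Px x
      - (φ 2 x * q x + 2 * (φ 1 x * q1 x) + φ 0 x * q2 x) * (k x - q2 x)) +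
      (-2 * (φ 1 x * q1 x * q2 x) + φ 2 x * q x * q2 x - 1 / 2 * (φ 4 x * q x ^ 2)
        + θ * (φ 0 x * q1 x ^ 2 + φ 0 x * q x * q2 x - 1 / 2 * (φ 2 x * q x ^ 2))))
    (by fun_prop) (by fun_prop) (by fun_prop) (fun x => ?_) ?_ ?_ ?_ ?_ (fun x => ?_)
  · refine HasDerivAt.add ?_ (hC.hasDerivAt_flux hq hq1 θ x)
    refine ((((d0 x).mul (hq x)).mul (hP x)).sub
      ((((d1 x).mul (hq x)).add ((d0 x).mul (hq1 x))).mul (hkq x))).congr_deriv ?_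
    simp only [zero_add, one_add_one_eq_two, Pi.mul_apply, Pi.add_apply]
    ring
  · intro x hx; simp only [z0 x hx]; ring
  · intro x hx; simp only [z0 x hx, zψ x hx]; ring
  · intro x hx; simp only [z0 x hx, z1 x hx, z2 x hx, z3 x hx]; ring
  · intro x hx; simp only [z0 x hx, z1 x hx, z2 x hx, z4 x hx]; ring
  · have := h x
    simp only [bilaplaceTerm] at this
    linarith

/-- Bound of the biharmonic part, at a scale `l ≤ 1`. -/
lemma Cutoff.bilaplaceTerm_le (hB : 1 ≤ B) (hl : 0 < l) (x : ℝ) :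
    bilaplaceTerm φ q q2 x ≤ -(7 / 8 * (φ 0 x * q2 x ^ 2)) + 9 * B * l⁻¹ ^ 4 * (ψ x * q x ^ 2) := by
  obtain ⟨h0, hle, h1, h2, h2', h4⟩ := hC.bounds hB hl x
  have hψ := hC.psi_nonneg x
  have y2 := two_abs_mul_le (x := q2 x) (y := q x) (ε := 1 / 8) (by norm_num) h0 hψ (by positivity) h2
  have e2 : φ 2 x * q2 x * q x = φ 2 x * q x * q2 x := by ring
  rw [e2] at y2
  have y4 : φ 4 x * q x ^ 2 ≤ B * l⁻¹ ^ 4 * ψ x * q x ^ 2 :=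
    mul_le_mul_of_nonneg_right ((le_abs_self _).trans h4) (sq_nonneg _)
  have := neg_abs_le (φ 2 x * q x * q2 x)
  have hp : 0 ≤ B * l⁻¹ ^ 4 * (ψ x * q x ^ 2) := by positivity
  simp only [bilaplaceTerm]
  have e3 : B * l⁻¹ ^ 4 / (1 / 8) * (ψ x * q x ^ 2) = 8 * (B * l⁻¹ ^ 4 * (ψ x * q x ^ 2)) := by ring
  rw [e3] at y2
  linarith

/-- Interpolation of the first derivative, at a scale `l ≤ 1`. -/
lemma Cutoff.interpolation (hB : 1 ≤ B) (hl : 0 < l) {K : ℝ} (hK : 0 ≤ K) (x : ℝ) :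
    -((l⁻¹ ^ 2 * (K + 1)) * (φ 0 x * q x * q2 x - 1 / 2 * (φ 2 x * q x ^ 2))) ≤
      1 / 8 * (φ 0 x * q2 x ^ 2) + 3 * B * (K + 1) ^ 2 * l⁻¹ ^ 4 * (ψ x * q x ^ 2) := by
  obtain ⟨h0, hle, h1, h2, h2', h4⟩ := hC.bounds hB hl x
  have hψ := hC.psi_nonneg x
  set m := l⁻¹
  have hm : 0 < m := inv_pos.2 hl
  have a1 : -((m ^ 2 * (K + 1)) * (φ 0 x * q x * q2 x)) ≤
      1 / 8 * (φ 0 x * q2 x ^ 2) + 2 * (K + 1) ^ 2 * m ^ 4 * (φ 0 x * q x ^ 2) := by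
    nlinarith [mul_nonneg h0 (sq_nonneg (q2 x + 4 * (m ^ 2 * (K + 1)) * q x))]
  have a2 : φ 0 x * q x ^ 2 ≤ ψ x * q x ^ 2 := by gcongr
  have a3 : (m ^ 2 * (K + 1)) * (1 / 2 * (φ 2 x * q x ^ 2)) ≤
      (m ^ 2 * (K + 1)) * (1 / 2 * (B * m ^ 2 * ψ x * q x ^ 2)) := by
    have := (le_abs_self _).trans h2'
    gcongr
  have a4 : 2 * (K + 1) ^ 2 * m ^ 4 * (φ 0 x * q x ^ 2) ≤
      2 * (K + 1) ^ 2 * m ^ 4 * (ψ x * q x ^ 2) := by gcongr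
  have hX : 0 ≤ m ^ 4 * (ψ x * q x ^ 2) := by positivity
  have a5 : (K + 1) * (B * (m ^ 4 * (ψ x * q x ^ 2))) ≤ (K + 1) ^ 2 * (B * (m ^ 4 * (ψ x * q x ^ 2))) := by
    have h5 : 0 ≤ B * (m ^ 4 * (ψ x * q x ^ 2)) := by positivity
    exact mul_le_mul_of_nonneg_right (by nlinarith) h5
  have a6 : (K + 1) ^ 2 * (m ^ 4 * (ψ x * q x ^ 2)) ≤ (K + 1) ^ 2 * (B * (m ^ 4 * (ψ x * q x ^ 2))) := by
    have : m ^ 4 * (ψ x * q x ^ 2) ≤ B * (m ^ 4 * (ψ x * q x ^ 2)) := by nlinarith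
    gcongr
  have a7 : 0 ≤ (K + 1) ^ 2 * (B * (m ^ 4 * (ψ x * q x ^ 2))) := by positivity
  linarith

end static

/-- Pointwise bound behind the weighted estimate for `q_t = (g - q_xxx)_x`, `|g| ≤ K |q_x|`. -/
lemma Cutoff.pointwise_divergence {q q1 q2 g : ℝ → ℝ} (hC : Cutoff B l φ ψ) (hB : 1 ≤ B)
    (hl : 0 < l) (hl1 : l ≤ 1) {K : ℝ} (hK : 0 ≤ K) {x : ℝ} (hg : |g x| ≤ K * |q1 x|) :
    bilaplaceTerm φ q q2 x - (φ 1 x * q x + φ 0 x * q1 x) * g x ≤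
      -(φ 0 x * (1 / 4 * (l⁻¹ ^ 2 * q1 x ^ 2 + q2 x ^ 2)))
        + ψ x * (40 * B * (K + 1) ^ 2 * l⁻¹ ^ 4 * q x ^ 2)
        + (l⁻¹ ^ 2 * (2 * K + 1)) * (φ 0 x * q1 x ^ 2 + φ 0 x * q x * q2 x
          - 1 / 2 * (φ 2 x * q x ^ 2)) := by
  obtain ⟨h0, hle, h1, h2, h2', h4⟩ := hC.bounds hB hl x
  have hψ := hC.psi_nonneg x
  have hb := hC.bilaplaceTerm_le (q := q) (q2 := q2) hB hl x
  -- The coefficient `l⁻² (2K + 1)` is large enough to beat the terms of size `K φ q_x²`, which may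
  -- have the wrong sign, and to leave `¼ l⁻² φ q_x²`.
  have hi := hC.interpolation (q := q) (q2 := q2) hB hl (K := 2 * K) (by positivity) x
  have hm1 : 1 ≤ l⁻¹ := (one_le_inv₀ hl).2 hl1
  set m := l⁻¹
  have hm2 : 1 ≤ m ^ 2 := one_le_pow₀ hm1
  have hgq : q1 x * g x ≥ -(K * q1 x ^ 2) := by
    have : |q1 x * g x| ≤ K * q1 x ^ 2 := by
      rw [abs_mul, ← sq_abs (q1 x)]; nlinarith [abs_nonneg (q1 x)]
    linarith [neg_abs_le (q1 x * g x)]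
  have g1 : -(φ 0 x * q1 x * g x) ≤ K * (φ 0 x * q1 x ^ 2) := by nlinarith
  have y1 := two_abs_mul_le (x := q1 x) (y := q x) (ε := 1) (by norm_num) h0 hψ (by positivity) h1
  have g2 : -(φ 1 x * q x * g x) ≤ K * |φ 1 x * q1 x * q x| := by
    refine (neg_le_abs _).trans ?_
    rw [abs_mul, abs_mul, abs_mul, abs_mul]
    calc |φ 1 x| * |q x| * |g x| ≤ |φ 1 x| * |q x| * (K * |q1 x|) := by gcongr
      _ = _ := by ring
  have g3 : K * |φ 1 x * q1 x * q x| ≤ K / 2 * (φ 0 x * q1 x ^ 2) + K / 2 * (B * m ^ 2) * (ψ x * q x ^ 2) := by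
    rw [div_one] at y1; nlinarith
  have p1 : 0 ≤ φ 0 x * q1 x ^ 2 := by positivity
  have p2 : 0 ≤ φ 0 x * q2 x ^ 2 := by positivity
  have p3 : 0 ≤ ψ x * q x ^ 2 := by positivity
  have e1 : (3 / 2 * K) * (φ 0 x * q1 x ^ 2) + 1 / 4 * (m ^ 2 * (φ 0 x * q1 x ^ 2)) ≤
      m ^ 2 * (2 * K + 1) * (φ 0 x * q1 x ^ 2) := by
    have := aux_const_one hK hm2
    have := mul_le_mul_of_nonneg_right this p1
    linarith
  have e2 : K / 2 * (B * m ^ 2) + 9 * B * m ^ 4 + 3 * B * (2 * K + 1) ^ 2 * m ^ 4 ≤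
      40 * B * (K + 1) ^ 2 * m ^ 4 := by
    have hm4 : m ^ 2 ≤ m ^ 4 := sq_le_pow_four hm2
    have hBm : 0 ≤ B * m ^ 4 := by positivity
    have a1 : K / 2 * (B * m ^ 2) ≤ K / 2 * (B * m ^ 4) := by gcongr
    have a2 : K / 2 + 9 + 3 * (2 * K + 1) ^ 2 ≤ 40 * (K + 1) ^ 2 := by
      linarith [aux_const_two hK, sq_nonneg K]
    have := mul_le_mul_of_nonneg_right a2 hBm
    linarith
  have e3 := mul_le_mul_of_nonneg_right e2 p3
  linarith

/-- Pointwise bound behind the weighted estimate for `q_t = (k - q_xx)_xx`, `|k| ≤ K |q|`. -/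
lemma Cutoff.pointwise_laplace {q q1 q2 k : ℝ → ℝ} (hC : Cutoff B l φ ψ) (hB : 1 ≤ B)
    (hl : 0 < l) (hl1 : l ≤ 1) {K : ℝ} (hK : 0 ≤ K) {x : ℝ} (hk : |k x| ≤ K * |q x|) :
    bilaplaceTerm φ q q2 x + (φ 2 x * q x + 2 * (φ 1 x * q1 x) + φ 0 x * q2 x) * k x ≤
      -(φ 0 x * (1 / 4 * (l⁻¹ ^ 2 * q1 x ^ 2 + q2 x ^ 2)))
        + ψ x * (40 * B * (K + 1) ^ 2 * l⁻¹ ^ 4 * q x ^ 2)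
        + (l⁻¹ ^ 2 * (2 * K + 1)) * (φ 0 x * q1 x ^ 2 + φ 0 x * q x * q2 x
          - 1 / 2 * (φ 2 x * q x ^ 2)) := by
  obtain ⟨h0, hle, h1, h2, h2', h4⟩ := hC.bounds hB hl x
  have hψ := hC.psi_nonneg x
  have hb := hC.bilaplaceTerm_le (q := q) (q2 := q2) hB hl x
  have hi := hC.interpolation (q := q) (q2 := q2) hB hl (K := 2 * K) (by positivity) x
  have hm1 : 1 ≤ l⁻¹ := (one_le_inv₀ hl).2 hl1
  set m := l⁻¹
  have hm2 : 1 ≤ m ^ 2 := one_le_pow₀ hm1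
  have y1 := two_abs_mul_le (x := q1 x) (y := q x) (ε := 1) (by norm_num) h0 hψ (by positivity) h1
  have g2 : 2 * (φ 1 x * q1 x) * k x ≤ K * (2 * |φ 1 x * q1 x * q x|) := by
    refine (le_abs_self _).trans ?_
    simp only [abs_mul, abs_two]
    calc 2 * (|φ 1 x| * |q1 x|) * |k x| ≤ 2 * (|φ 1 x| * |q1 x|) * (K * |q x|) := by gcongr
      _ = _ := by ring
  have g3 : K * (2 * |φ 1 x * q1 x * q x|) ≤ K * (φ 0 x * q1 x ^ 2) + K * (B * m ^ 2) * (ψ x * q x ^ 2) := by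
    rw [div_one] at y1; nlinarith
  have g4 : φ 2 x * q x * k x ≤ K * (B * m ^ 2) * (ψ x * q x ^ 2) := by
    refine (le_abs_self _).trans ?_
    simp only [abs_mul]
    calc |φ 2 x| * |q x| * |k x| ≤ (B * m ^ 2 * ψ x) * |q x| * (K * |q x|) := by gcongr
      _ = K * (B * m ^ 2) * (ψ x * |q x| ^ 2) := by ring
      _ = _ := by rw [sq_abs]
  have g5 : φ 0 x * q2 x * k x ≤ 1 / 8 * (φ 0 x * q2 x ^ 2) + 2 * K ^ 2 * (ψ x * q x ^ 2) := by
    have a : q2 x * k x ≤ 1 / 8 * q2 x ^ 2 + 2 * k x ^ 2 := by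
      nlinarith [sq_nonneg (q2 x - 4 * k x)]
    have b : k x ^ 2 ≤ K ^ 2 * q x ^ 2 := by
      rw [← sq_abs (k x), ← sq_abs (q x), ← mul_pow]
      gcongr
    have c : φ 0 x * (q2 x * k x) ≤ φ 0 x * (1 / 8 * q2 x ^ 2 + 2 * (K ^ 2 * q x ^ 2)) := by
      gcongr; linarith
    have d : φ 0 x * (2 * (K ^ 2 * q x ^ 2)) ≤ ψ x * (2 * (K ^ 2 * q x ^ 2)) := by gcongr
    nlinarith
  have p1 : 0 ≤ φ 0 x * q1 x ^ 2 := by positivity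
  have p2 : 0 ≤ φ 0 x * q2 x ^ 2 := by positivity
  have p3 : 0 ≤ ψ x * q x ^ 2 := by positivity
  have e1 : K * (φ 0 x * q1 x ^ 2) + 1 / 4 * (m ^ 2 * (φ 0 x * q1 x ^ 2)) ≤
      m ^ 2 * (2 * K + 1) * (φ 0 x * q1 x ^ 2) := by
    have : K + 1 / 4 * m ^ 2 ≤ m ^ 2 * (2 * K + 1) := by linarith [aux_const_one hK hm2]
    have := mul_le_mul_of_nonneg_right this p1
    linarith
  have e2 : 2 * (K * (B * m ^ 2)) + 2 * K ^ 2 + 9 * B * m ^ 4 + 3 * B * (2 * K + 1) ^ 2 * m ^ 4 ≤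
      40 * B * (K + 1) ^ 2 * m ^ 4 := by
    have hm4 : m ^ 2 ≤ m ^ 4 := sq_le_pow_four hm2
    have hBm : 1 ≤ B * m ^ 4 := one_le_mul_of_one_le_of_one_le hB (hm2.trans hm4)
    have a1 : K * (B * m ^ 2) ≤ K * (B * m ^ 4) := by gcongr
    have a2 : K ^ 2 ≤ K ^ 2 * (B * m ^ 4) := le_mul_of_one_le_right (sq_nonneg K) hBm
    have a3 := aux_const_two hK
    have := mul_le_mul_of_nonneg_right a3 (by linarith : 0 ≤ B * m ^ 4)
    linarith
  have e3 := mul_le_mul_of_nonneg_right e2 p3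
  linarith

/-- Pointwise bound behind the weighted estimate for `q_t = (g - q_xxx)_x` with a monotone
second-order part, on scales `l ≥ 1`. -/
lemma Cutoff.pointwise_monotone {q q1 q2 g : ℝ → ℝ} (hC : Cutoff B l φ ψ) (hB : 1 ≤ B)
    (hl : 1 ≤ l) {K κ : ℝ} (hκ : 0 < κ) (hK : 0 ≤ K) {x : ℝ} (hg : |g x| ≤ K * |q1 x|)
    (hm : κ * q1 x ^ 2 ≤ q1 x * g x) :
    bilaplaceTerm φ q q2 x - (φ 1 x * q x + φ 0 x * q1 x) * g x ≤
      -(φ 0 x * (κ / 2 * q1 x ^ 2 + 1 / 2 * q2 x ^ 2))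
        + ψ x * (B * (9 + K ^ 2 / κ) * l⁻¹ ^ 2 * q x ^ 2)
        + 0 * (φ 0 x * q1 x ^ 2 + φ 0 x * q x * q2 x - 1 / 2 * (φ 2 x * q x ^ 2)) := by
  have hl0 : 0 < l := by linarith
  obtain ⟨h0, hle, h1, h2, h2', h4⟩ := hC.bounds hB hl0 x
  have hψ := hC.psi_nonneg x
  have hb := hC.bilaplaceTerm_le (q := q) (q2 := q2) hB hl0 x
  have hm0 : 0 < l⁻¹ := inv_pos.2 hl0
  have hm1 : l⁻¹ ≤ 1 := inv_le_one_of_one_le₀ hl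
  set m := l⁻¹
  have g1 : -(φ 0 x * q1 x * g x) ≤ -(κ * (φ 0 x * q1 x ^ 2)) := by nlinarith
  -- Young's inequality is used below with parameter `κ / K`, so `K = 0` is treated apart; there `g
  -- x = 0`.
  rcases hK.eq_or_lt with hK0 | hKp
  · have hgz : g x = 0 := by
      rw [← hK0, zero_mul] at hg; exact abs_eq_zero.1 (le_antisymm hg (abs_nonneg _))
    have p1 : 0 ≤ φ 0 x * q1 x ^ 2 := by positivity
    have p2 : 0 ≤ φ 0 x * q2 x ^ 2 := by positivity
    have p3 : 0 ≤ B * (ψ x * q x ^ 2) := by positivity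
    have hmm : m ^ 4 ≤ m ^ 2 := by
      have : m ^ 2 ≤ 1 := pow_le_one₀ hm0.le hm1
      nlinarith [sq_nonneg m]
    have := mul_le_mul_of_nonneg_right hmm p3
    rw [← hK0, hgz]
    rw [hgz] at g1
    have p4 : 0 ≤ κ * (φ 0 x * q1 x ^ 2) := by positivity
    have p5 : κ * (φ 0 x * q1 x ^ 2) = 0 := by linarith
    have e0 : (0:ℝ) ^ 2 / κ = 0 := by simp
    rw [e0]
    linarith
  have y1 := two_abs_mul_le (x := q1 x) (y := q x) (ε := κ / K) (by positivity) h0 hψ (by positivity) h1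
  have g2 : -(φ 1 x * q x * g x) ≤ K * |φ 1 x * q1 x * q x| := by
    refine (neg_le_abs _).trans ?_
    rw [abs_mul, abs_mul, abs_mul, abs_mul]
    calc |φ 1 x| * |q x| * |g x| ≤ |φ 1 x| * |q x| * (K * |q1 x|) := by gcongr
      _ = _ := by ring
  have g3 : K * |φ 1 x * q1 x * q x| ≤ κ / 2 * (φ 0 x * q1 x ^ 2) + (K ^ 2 / κ) / 2 * (B * m ^ 2) * (ψ x * q x ^ 2) := by
    have := mul_le_mul_of_nonneg_left y1 (by positivity : 0 ≤ K / 2)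
    have e1 : K / 2 * (2 * |φ 1 x * q1 x * q x|) = K * |φ 1 x * q1 x * q x| := by ring
    have e2 : K / 2 * (κ / K * (φ 0 x * q1 x ^ 2) + B * m ^ 2 / (κ / K) * (ψ x * q x ^ 2)) =
      κ / 2 * (φ 0 x * q1 x ^ 2) + (K ^ 2 / κ) / 2 * (B * m ^ 2) * (ψ x * q x ^ 2) := by
      field_simp
    rw [e1, e2] at this
    exact this
  have p1 : 0 ≤ φ 0 x * q1 x ^ 2 := by positivity
  have p2 : 0 ≤ φ 0 x * q2 x ^ 2 := by positivity
  have p3 : 0 ≤ B * (ψ x * q x ^ 2) := by positivity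
  have hmm : m ^ 4 ≤ m ^ 2 := by
    have : m ^ 2 ≤ 1 := pow_le_one₀ hm0.le hm1
    nlinarith [sq_nonneg m]
  have e4 := mul_le_mul_of_nonneg_right hmm p3
  have p5 : 0 ≤ (K ^ 2 / κ) * (m ^ 2 * (B * (ψ x * q x ^ 2))) := by positivity
  linarith

/-! ### Weighted differential inequalities for time-dependent functions -/

/-- A time-dependent function with its first two space derivatives and its time derivative, all
jointly continuous for times `> a`. -/
structure TimeFamily (a : ℝ) (q q1 q2 qt : ℝ → ℝ → ℝ) : Prop where
  cont0 : ContinuousOn (fun z : ℝ × ℝ => q z.1 z.2) (Ioi a ×ˢ univ)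
  cont1 : ContinuousOn (fun z : ℝ × ℝ => q1 z.1 z.2) (Ioi a ×ˢ univ)
  cont2 : ContinuousOn (fun z : ℝ × ℝ => q2 z.1 z.2) (Ioi a ×ˢ univ)
  contt : ContinuousOn (fun z : ℝ × ℝ => qt z.1 z.2) (Ioi a ×ˢ univ)
  deriv0 : ∀ τ > a, ∀ x, HasDerivAt (q τ) (q1 τ x) x
  deriv1 : ∀ τ > a, ∀ x, HasDerivAt (q1 τ) (q2 τ x) x
  derivt : ∀ τ > a, ∀ x, HasDerivAt (fun τ => q τ x) (qt τ x) τ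

namespace TimeFamily

variable {a s t L y l K : ℝ} {q q1 q2 qt : ℝ → ℝ → ℝ}

lemma hasDerivAt_integral_sq (H : TimeFamily a q q1 q2 qt) {B : ℝ} {φ : ℕ → ℝ → ℝ} {ψ : ℝ → ℝ}
    (hC : Cutoff B L φ ψ) {τ : ℝ} (hτ : a < τ) :
    HasDerivAt (fun τ => ∫ x, φ 0 x * q τ x ^ 2) (2 * ∫ x, φ 0 x * (q τ x * qt τ x)) τ := by
  obtain ⟨r, hr⟩ := hC.compact
  have cφ := continuousOn_lift_space (hC.cont 0 (by norm_num)) (S := Ioi a ×ˢ univ)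
  have c0 := H.cont0
  have ct := H.contt
  rw [← integral_const_mul]
  refine hasDerivAt_integral_of_continuousOn (a := a) (R := r)
    (F := fun τ x => φ 0 x * q τ x ^ 2) (F' := fun τ x => 2 * (φ 0 x * (q τ x * qt τ x)))
    (cφ.mul (c0.pow 2)) (continuousOn_const.mul (cφ.mul (c0.mul ct))) (fun τ hτ x => ?_)
    (fun τ _ x hx => ?_) (fun τ _ x hx => ?_) hτ
  · refine (((H.derivt τ hτ x).pow 2).const_mul (φ 0 x)).congr_deriv ?_
    simp; ring
  · rw [(hr x hx).2 0 (by norm_num), zero_mul]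
  · rw [(hr x hx).2 0 (by norm_num), zero_mul, mul_zero]

/-- From a bound for each cut-off to a weighted differential inequality in integrated form. -/
lemma weighted (H : TimeFamily a q q1 q2 qt) (hL : 0 < L) (has : a < s) (hst : s ≤ t)
    {A R : ℝ → ℝ → ℝ}
    (hA : ContinuousOn (fun z : ℝ × ℝ => A z.1 z.2) (Ioi a ×ˢ univ))
    (hR : ContinuousOn (fun z : ℝ × ℝ => R z.1 z.2) (Ioi a ×ˢ univ))
    (hA0 : ∀ τ x, 0 ≤ A τ x) (hR0 : ∀ τ x, 0 ≤ R τ x)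
    (h : ∀ φ ψ, Cutoff cutoffConst L φ ψ → ∀ τ ∈ Icc s t,
      ∫ x, φ 0 x * (q τ x * qt τ x) ≤ -(∫ x, φ 0 x * A τ x) + ∫ x, ψ x * R τ x) :
    wint L y (fun x => q t x ^ 2) + ∫⁻ τ in Ioc s t, wint L y (fun x => 2 * A τ x) ≤
      wint L y (fun x => q s x ^ 2) + ∫⁻ τ in Ioc s t, wint L y (fun x => 2 * R τ x) := by
  have c0 := H.cont0
  refine weighted_inequality (B := fun τ x => q τ x ^ 2) (A := fun τ x => 2 * A τ x)
    (R := fun τ x => 2 * R τ x) hL has hst (by fun_prop) (by fun_prop) (by fun_prop)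
    (fun τ _ x => sq_nonneg _) (fun τ _ x => by have := hA0 τ x; positivity)
    (fun τ _ x => by have := hR0 τ x; positivity) fun φ ψ hC τ hτ => ?_
  refine ⟨_, H.hasDerivAt_integral_sq hC (lt_of_lt_of_le has hτ.1), ?_⟩
  have := h φ ψ hC τ hτ
  have e1 : ∫ x, φ 0 x * (2 * A τ x) = 2 * ∫ x, φ 0 x * A τ x := by
    rw [← integral_const_mul]; congr 1; ext x; ring
  have e2 : ∫ x, ψ x * (2 * R τ x) = 2 * ∫ x, ψ x * R τ x := by
    rw [← integral_const_mul]; congr 1; ext x; ring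
  rw [e1, e2]
  linarith

/-- Weighted estimate for `q_t = P_x`, `P = g - q_xxx`, `|g| ≤ K |q_x|`. -/
lemma weighted_divergence (H : TimeFamily a q q1 q2 qt) (hl : 0 < l) (hl1 : l ≤ 1) (hlL : l ≤ L)
    (has : a < s) (hst : s ≤ t) (hK : 0 ≤ K) {P g : ℝ → ℝ → ℝ}
    (hq2 : ∀ τ ∈ Icc s t, ∀ x, HasDerivAt (q2 τ) (g τ x - P τ x) x)
    (hP : ∀ τ ∈ Icc s t, ∀ x, HasDerivAt (P τ) (qt τ x) x)
    (hg : ∀ τ ∈ Icc s t, Continuous (g τ))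
    (hgb : ∀ τ ∈ Icc s t, ∀ x, |g τ x| ≤ K * |q1 τ x|) :
    wint L y (fun x => q t x ^ 2) +
      ∫⁻ τ in Ioc s t, wint L y (fun x => 2 * (1 / 4 * (l⁻¹ ^ 2 * q1 τ x ^ 2 + q2 τ x ^ 2))) ≤
      wint L y (fun x => q s x ^ 2) + ∫⁻ τ in Ioc s t, wint L y
        (fun x => 2 * (40 * cutoffConst * (K + 1) ^ 2 * l⁻¹ ^ 4 * q τ x ^ 2)) := by
  have c0 := H.cont0
  have c1 := H.cont1
  have c2 := H.cont2
  have hB := one_le_cutoffConst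
  refine H.weighted (hl.trans_le hlL) has hst (by fun_prop) (by fun_prop)
    (fun τ x => by positivity) (fun τ x => by positivity) fun φ ψ hC τ hτ => ?_
  have hτa : a < τ := lt_of_lt_of_le has hτ.1
  -- The weight lives at scale `L`, the estimate at the smaller scale `l`.
  have hC' := hC.mono_scale hl.le hlL
  have s0 : Continuous (q τ) := continuous_slice c0 hτa
  have s1 : Continuous (q1 τ) := continuous_slice c1 hτa
  have s2 : Continuous (q2 τ) := continuous_slice c2 hτa
  exact hC'.integral_le_divergence (g := g τ) (l⁻¹ ^ 2 * (2 * K + 1))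
    (H.deriv0 τ hτa) (H.deriv1 τ hτa) (hq2 τ hτ) (hP τ hτ) (hg τ hτ)
    (continuous_slice H.contt hτa) (by fun_prop) (by fun_prop)
    fun x => hC'.pointwise_divergence hB hl hl1 hK (hgb τ hτ x)

/-- Weighted estimate for `q_t = (k - q_xx)_xx`, `|k| ≤ K |q|`. -/
lemma weighted_laplace (H : TimeFamily a q q1 q2 qt) (hl : 0 < l) (hl1 : l ≤ 1) (hlL : l ≤ L)
    (has : a < s) (hst : s ≤ t) (hK : 0 ≤ K) {P k : ℝ → ℝ → ℝ}
    (hkq : ∀ τ ∈ Icc s t, ∀ x, HasDerivAt (fun x => k τ x - q2 τ x) (P τ x) x)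
    (hP : ∀ τ ∈ Icc s t, ∀ x, HasDerivAt (P τ) (qt τ x) x)
    (hk : ∀ τ ∈ Icc s t, Continuous (k τ))
    (hkb : ∀ τ ∈ Icc s t, ∀ x, |k τ x| ≤ K * |q τ x|) :
    wint L y (fun x => q t x ^ 2) +
      ∫⁻ τ in Ioc s t, wint L y (fun x => 2 * (1 / 4 * (l⁻¹ ^ 2 * q1 τ x ^ 2 + q2 τ x ^ 2))) ≤
      wint L y (fun x => q s x ^ 2) + ∫⁻ τ in Ioc s t, wint L y
        (fun x => 2 * (40 * cutoffConst * (K + 1) ^ 2 * l⁻¹ ^ 4 * q τ x ^ 2)) := by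
  have c0 := H.cont0
  have c1 := H.cont1
  have c2 := H.cont2
  have hB := one_le_cutoffConst
  refine H.weighted (hl.trans_le hlL) has hst (by fun_prop) (by fun_prop)
    (fun τ x => by positivity) (fun τ x => by positivity) fun φ ψ hC τ hτ => ?_
  have hτa : a < τ := lt_of_lt_of_le has hτ.1
  have hC' := hC.mono_scale hl.le hlL
  have s0 : Continuous (q τ) := continuous_slice c0 hτa
  have s1 : Continuous (q1 τ) := continuous_slice c1 hτa
  have s2 : Continuous (q2 τ) := continuous_slice c2 hτa
  exact hC'.integral_le_laplace (k := k τ) (l⁻¹ ^ 2 * (2 * K + 1))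
    (H.deriv0 τ hτa) (H.deriv1 τ hτa) (hkq τ hτ) (hP τ hτ) (hk τ hτ)
    (continuous_slice H.contt hτa) (by fun_prop) (by fun_prop)
    fun x => hC'.pointwise_laplace hB hl hl1 hK (hkb τ hτ x)

/-- Weighted estimate for `q_t = P_x`, `P = g - q_xxx`, with `g` monotone in `q_x`, on large
scales. -/
lemma weighted_monotone (H : TimeFamily a q q1 q2 qt) (hL : 1 ≤ L)
    (has : a < s) (hst : s ≤ t) (hK : 0 ≤ K) {κ : ℝ} (hκ : 0 < κ) {P g : ℝ → ℝ → ℝ}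
    (hq2 : ∀ τ ∈ Icc s t, ∀ x, HasDerivAt (q2 τ) (g τ x - P τ x) x)
    (hP : ∀ τ ∈ Icc s t, ∀ x, HasDerivAt (P τ) (qt τ x) x)
    (hg : ∀ τ ∈ Icc s t, Continuous (g τ))
    (hgb : ∀ τ ∈ Icc s t, ∀ x, |g τ x| ≤ K * |q1 τ x|)
    (hgm : ∀ τ ∈ Icc s t, ∀ x, κ * q1 τ x ^ 2 ≤ q1 τ x * g τ x) :
    wint L y (fun x => q t x ^ 2) +
      ∫⁻ τ in Ioc s t, wint L y (fun x => 2 * (κ / 2 * q1 τ x ^ 2 + 1 / 2 * q2 τ x ^ 2)) ≤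
      wint L y (fun x => q s x ^ 2) + ∫⁻ τ in Ioc s t, wint L y
        (fun x => 2 * (cutoffConst * (9 + K ^ 2 / κ) * L⁻¹ ^ 2 * q τ x ^ 2)) := by
  have c0 := H.cont0
  have c1 := H.cont1
  have c2 := H.cont2
  have hB := one_le_cutoffConst
  refine H.weighted (by linarith) has hst (by fun_prop) (by fun_prop)
    (fun τ x => by positivity) (fun τ x => by positivity) fun φ ψ hC τ hτ => ?_
  have hτa : a < τ := lt_of_lt_of_le has hτ.1
  have s0 : Continuous (q τ) := continuous_slice c0 hτa
  have s1 : Continuous (q1 τ) := continuous_slice c1 hτa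
  have s2 : Continuous (q2 τ) := continuous_slice c2 hτa
  -- No interpolation is needed (`θ = 0`): the monotone term supplies the coercivity in `q_x`. Hence
  -- the error carries only `L⁻²`, the scaling of the heat equation.
  exact hC.integral_le_divergence (g := g τ) 0
    (H.deriv0 τ hτa) (H.deriv1 τ hτa) (hq2 τ hτ) (hP τ hτ) (hg τ hτ)
    (continuous_slice H.contt hτa) (by fun_prop) (by fun_prop)
    fun x => hC.pointwise_monotone hB hL hκ hK (hgb τ hτ x) (hgm τ hτ x)

end TimeFamily

/-! ### Short-time absorption -/

/-- Absorption of the lower-order term on short time intervals. -/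
lemma absorb {N J : ℝ → ℝ≥0∞} {s t : ℝ} {c M : ℝ≥0∞} (hM : M ≠ ⊤)
    (hN : ∀ τ ∈ Icc s t, N τ ≤ M)
    (h : ∀ τ ∈ Icc s t, N τ + J τ ≤ N s + c * ∫⁻ σ in Ioc s τ, N σ)
    (hc : c * ENNReal.ofReal (t - s) ≤ 1 / 2) {τ : ℝ} (hτ : τ ∈ Icc s t) :
    N τ + J τ ≤ N s + c * ENNReal.ofReal (τ - s) * (2 * N s) ∧ N τ + J τ ≤ 2 * N s := by
  -- The supremum replaces a Gronwall argument: the smallness of `c (t - s)` gives `S ≤ N s + S /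
  -- 2`, and the a priori bound `M` makes `S` finite, so that half of it can be cancelled.
  set S := ⨆ σ ∈ Icc s t, N σ with hS
  have hSM : S ≤ M := iSup₂_le hN
  have hle : ∀ σ ∈ Icc s t, N σ ≤ S := fun σ hσ => le_iSup₂ (f := fun σ _ => N σ) σ hσ
  have hint : ∀ σ ∈ Icc s t, ∫⁻ ρ in Ioc s σ, N ρ ≤ S * ENNReal.ofReal (σ - s) := by
    intro σ hσ
    calc ∫⁻ ρ in Ioc s σ, N ρ ≤ ∫⁻ _ in Ioc s σ, S := by
          refine lintegral_mono_ae ((ae_restrict_iff' measurableSet_Ioc).2 (ae_of_all _ fun ρ hρ => ?_))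
          exact hle ρ ⟨hρ.1.le, hρ.2.trans hσ.2⟩
      _ = _ := by rw [setLIntegral_const, Real.volume_Ioc]
  have h1 : ∀ σ ∈ Icc s t, N σ + J σ ≤ N s + c * ENNReal.ofReal (σ - s) * S := by
    intro σ hσ
    refine (h σ hσ).trans (add_le_add le_rfl ?_)
    calc c * ∫⁻ ρ in Ioc s σ, N ρ ≤ c * (S * ENNReal.ofReal (σ - s)) := by gcongr; exact hint σ hσ
      _ = _ := by ring
  have h2 : ∀ σ ∈ Icc s t, c * ENNReal.ofReal (σ - s) ≤ 1 / 2 := fun σ hσ =>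
    le_trans (by gcongr; exact hσ.2) hc
  have h3 : S ≤ N s + 1 / 2 * S := by
    refine iSup₂_le fun σ hσ => le_trans (le_trans le_self_add (h1 σ hσ)) ?_
    gcongr; exact h2 σ hσ
  have hST : S ≠ ⊤ := ne_top_of_le_ne_top hM hSM
  have h4 : S ≤ 2 * N s := by
    have e : S = 1 / 2 * S + 1 / 2 * S := by
      rw [← add_mul, ENNReal.add_halves, one_mul]
    have h5 : 1 / 2 * S ≤ N s := by
      have hf : 1 / 2 * S ≠ ⊤ := ENNReal.mul_ne_top (by simp) hST
      refine (ENNReal.add_le_add_iff_right hf).1 ?_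
      rw [← e]; exact h3
    calc S = 2 * (1 / 2 * S) := by
          rw [← mul_assoc, one_div, ENNReal.mul_inv_cancel (by simp) (by simp), one_mul]
      _ ≤ 2 * N s := by gcongr
  have h6 : N τ + J τ ≤ N s + c * ENNReal.ofReal (τ - s) * (2 * N s) := by
    refine (h1 τ hτ).trans ?_
    gcongr
  refine ⟨h6, h6.trans ?_⟩
  calc N s + c * ENNReal.ofReal (τ - s) * (2 * N s) ≤ N s + 1 / 2 * (2 * N s) := by
        gcongr; exact h2 τ hτ
    _ = 2 * N s := by
        rw [← mul_assoc, one_div, ENNReal.inv_mul_cancel (by simp) (by simp), one_mul, two_mul]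

/-! ### Joint regularity of smooth solutions -/

lemma continuousOn_primitive {F : ℝ → ℝ → ℝ} {S : Set ℝ}
    (hF : ContinuousOn (fun z : ℝ × ℝ => F z.1 z.2) (S ×ˢ univ)) (a : ℝ) :
    ContinuousOn (fun z : ℝ × ℝ => ∫ y in a..z.2, F z.1 y) (S ×ˢ univ) := by
  rw [continuousOn_iff_continuous_domRestrict]
  refine intervalIntegral.continuous_parametric_intervalIntegral_of_continuous
    (f := fun (z : ↥(S ×ˢ (univ : Set ℝ))) y => F z.1.1 y) (s := fun z => z.1.2) ?_ ?_
  · have : Function.uncurry (fun (z : ↥(S ×ˢ (univ : Set ℝ))) y => F z.1.1 y) =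
        (fun z : ℝ × ℝ => F z.1 z.2) ∘ fun w : ↥(S ×ˢ (univ : Set ℝ)) × ℝ => (w.1.1.1, w.2) := rfl
    rw [this]
    exact hF.comp_continuous (by fun_prop) fun w => ⟨w.1.2.1, mem_univ _⟩
  · fun_prop

lemma eq_of_hasDerivAt {f g f' : ℝ → ℝ} (hf : ∀ x, HasDerivAt f (f' x) x)
    (hg : ∀ x, HasDerivAt g (f' x) x) (h0 : f 0 = g 0) (x : ℝ) : f x = g x := by
  have h : ∀ x, HasDerivAt (fun x => f x - g x) 0 x := fun x =>
    ((hf x).sub (hg x)).congr_deriv (sub_self _)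
  have := is_const_of_deriv_eq_zero (fun x => (h x).differentiableAt) (fun x => (h x).deriv) x 0
  simp only [h0, sub_self] at this
  linarith

lemma hasDerivAt_primitive {f : ℝ → ℝ} (hf : Continuous f) (a x : ℝ) :
    HasDerivAt (fun x => ∫ y in a..x, f y) (f x) x :=
  intervalIntegral.integral_hasDerivAt_right (hf.intervalIntegrable _ _)
    hf.aestronglyMeasurable.stronglyMeasurableAtFilter hf.continuousAt

/-- The space derivative `u_x`. -/
def slope (u : ℝ → ℝ → ℝ) (t x : ℝ) : ℝ := deriv (u t) x

/-- The second space derivative `u_xx`. -/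
def curv (u : ℝ → ℝ → ℝ) (t x : ℝ) : ℝ := deriv (deriv (u t)) x

/-- The chemical potential `p = G'(u) - u_xx`. -/
def pot (G : ℝ → ℝ) (u : ℝ → ℝ → ℝ) (t x : ℝ) : ℝ := deriv G (u t x) - curv u t x

/-- The space derivative `p_x` of the chemical potential. -/
def potX (G : ℝ → ℝ) (u : ℝ → ℝ → ℝ) (t x : ℝ) : ℝ := deriv (pot G u t) x

/-- The second space derivative `p_xx` of the chemical potential. -/
def potXX (G : ℝ → ℝ) (u : ℝ → ℝ → ℝ) (t x : ℝ) : ℝ := deriv (deriv (pot G u t)) x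

/-- The regularity of a smooth solution for positive times: all derivatives that occur are jointly
continuous. -/
structure RegularFlow (G : ℝ → ℝ) (u : ℝ → ℝ → ℝ) : Prop where
  contG : ContDiff ℝ 2 G
  cont : ContinuousOn (fun z : ℝ × ℝ => u z.1 z.2) (Ioi 0 ×ˢ univ)
  cont_slope : ContinuousOn (fun z : ℝ × ℝ => slope u z.1 z.2) (Ioi 0 ×ˢ univ)
  cont_curv : ContinuousOn (fun z : ℝ × ℝ => curv u z.1 z.2) (Ioi 0 ×ˢ univ)
  cont_pot : ContinuousOn (fun z : ℝ × ℝ => pot G u z.1 z.2) (Ioi 0 ×ˢ univ)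
  cont_potX : ContinuousOn (fun z : ℝ × ℝ => potX G u z.1 z.2) (Ioi 0 ×ˢ univ)
  cont_potXX : ContinuousOn (fun z : ℝ × ℝ => potXX G u z.1 z.2) (Ioi 0 ×ˢ univ)
  deriv_u : ∀ t > 0, ∀ x, HasDerivAt (u t) (slope u t x) x
  deriv_slope : ∀ t > 0, ∀ x, HasDerivAt (slope u t) (curv u t x) x
  deriv_curv : ∀ t > 0, ∀ x,
    HasDerivAt (curv u t) (deriv (deriv G) (u t x) * slope u t x - potX G u t x) x
  deriv_pot : ∀ t > 0, ∀ x, HasDerivAt (pot G u t) (potX G u t x) x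
  deriv_potX : ∀ t > 0, ∀ x, HasDerivAt (potX G u t) (potXX G u t x) x
  deriv_time : ∀ t > 0, ∀ x, HasDerivAt (fun t => u t x) (potXX G u t x) t

lemma continuous_deriv_of_contDiff_two {G : ℝ → ℝ} (hG : ContDiff ℝ 2 G) : Continuous (deriv G) :=
  hG.continuous_deriv (by norm_num)

lemma contDiff_one_deriv {f : ℝ → ℝ} (hf : ContDiff ℝ 2 f) : ContDiff ℝ 1 (deriv f) := by
  have : ContDiff ℝ (1 + 1) f := by simpa [one_add_one_eq_two] using hf
  exact (contDiff_succ_iff_deriv.1 this).2.2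

lemma hasDerivAt_of_contDiff_two {f : ℝ → ℝ} (hf : ContDiff ℝ 2 f) (x : ℝ) :
    HasDerivAt f (deriv f x) x := ((hf.differentiable (by norm_num)) x).hasDerivAt

lemma hasDerivAt_deriv_of_contDiff_two {f : ℝ → ℝ} (hf : ContDiff ℝ 2 f) (x : ℝ) :
    HasDerivAt (deriv f) (deriv (deriv f) x) x :=
  (((contDiff_one_deriv hf).differentiable (by norm_num)) x).hasDerivAt

lemma continuous_deriv_deriv_of_contDiff_two {f : ℝ → ℝ} (hf : ContDiff ℝ 2 f) :
    Continuous (deriv (deriv f)) := (contDiff_one_deriv hf).continuous_deriv (by norm_num)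

/-- Joint continuity is assumed only for `u` and for `u_t = p_xx`. Integrating `p_xx` repeatedly in
space expresses `u` as a cubic polynomial in `x` plus a jointly continuous function. The
coefficients of the cubic are the values of `u`, `u_x`, `p`, `p_x` at `x = 0`; they are recovered
from the values of `u` at `0, 1, -1, 2`, hence are continuous in time. All intermediate derivatives
are then jointly continuous. -/
lemma IsSmoothSolution.regularFlow {G u₀ : ℝ → ℝ} {u : ℝ → ℝ → ℝ} (h : IsSmoothSolution G u₀ u)
    (hG : ContDiff ℝ 2 G) : RegularFlow G u := by
  have cG' := continuous_deriv_of_contDiff_two hG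
  have hpot : ∀ t, pot G u t = fun x => -innerTerm G (u t) x := fun t => by
    ext x; simp [pot, innerTerm, curv]
  have cp2 : ∀ t > 0, ContDiff ℝ 2 (pot G u t) := fun t ht => by
    rw [hpot]; exact (h.contDiff_innerTerm t ht).neg
  have hXX : ∀ t, ∀ x, potXX G u t x = -(deriv (deriv (innerTerm G (u t))) x) := fun t x => by
    have e : deriv (pot G u t) = fun x => -deriv (innerTerm G (u t)) x := by
      ext x; rw [hpot]; exact deriv.fun_neg
    rw [potXX, e]; exact deriv.fun_neg
  have dt : ∀ t > 0, ∀ x, HasDerivAt (fun t => u t x) (potXX G u t x) t := fun t ht x => by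
    rw [hXX]; exact h.equation t ht x
  have dp : ∀ t > 0, ∀ x, HasDerivAt (pot G u t) (potX G u t x) x := fun t ht x =>
    hasDerivAt_of_contDiff_two (cp2 t ht) x
  have dpX : ∀ t > 0, ∀ x, HasDerivAt (potX G u t) (potXX G u t x) x := fun t ht x =>
    hasDerivAt_deriv_of_contDiff_two (cp2 t ht) x
  have du : ∀ t > 0, ∀ x, HasDerivAt (u t) (slope u t x) x := fun t ht x =>
    hasDerivAt_of_contDiff_two (h.contDiff_space t ht) x
  have dux : ∀ t > 0, ∀ x, HasDerivAt (slope u t) (curv u t x) x := fun t ht x =>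
    hasDerivAt_deriv_of_contDiff_two (h.contDiff_space t ht) x
  have cont : ContinuousOn (fun z : ℝ × ℝ => u z.1 z.2) (Ioi 0 ×ˢ univ) :=
    h.continuousOn.mono (prod_mono Ioi_subset_Ici_self subset_rfl)
  have cXX : ContinuousOn (fun z : ℝ × ℝ => potXX G u z.1 z.2) (Ioi 0 ×ˢ univ) :=
    h.continuousOn_time_deriv.congr fun z hz => ((dt z.1 hz.1 z.2).deriv).symm
  have cGu : ContinuousOn (fun z : ℝ × ℝ => deriv G (u z.1 z.2)) (Ioi 0 ×ˢ univ) :=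
    cG'.comp_continuousOn cont
  -- iterated primitives
  set J : ℝ → ℝ → ℝ := fun t x => ∫ y in (0 : ℝ)..x, potXX G u t y with hJ
  have cJ : ContinuousOn (fun z : ℝ × ℝ => J z.1 z.2) (Ioi 0 ×ˢ univ) := continuousOn_primitive cXX 0
  set W : ℝ → ℝ → ℝ := fun t x => ∫ y in (0 : ℝ)..x, J t y with hW
  have cW : ContinuousOn (fun z : ℝ × ℝ => W z.1 z.2) (Ioi 0 ×ˢ univ) := continuousOn_primitive cJ 0
  set Y : ℝ → ℝ → ℝ := fun t x => ∫ y in (0 : ℝ)..x, (deriv G (u t y) - W t y) with hY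
  have cY : ContinuousOn (fun z : ℝ × ℝ => Y z.1 z.2) (Ioi 0 ×ˢ univ) :=
    continuousOn_primitive (F := fun t y => deriv G (u t y) - W t y) (cGu.sub cW) 0
  set Z : ℝ → ℝ → ℝ := fun t x => ∫ y in (0 : ℝ)..x, Y t y with hZ
  have cZ : ContinuousOn (fun z : ℝ × ℝ => Z z.1 z.2) (Ioi 0 ×ˢ univ) := continuousOn_primitive cY 0
  have dJ : ∀ t > 0, ∀ x, HasDerivAt (J t) (potXX G u t x) x := fun t ht x =>
    hasDerivAt_primitive (continuous_slice cXX ht) 0 x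
  have dW : ∀ t > 0, ∀ x, HasDerivAt (W t) (J t x) x := fun t ht x =>
    hasDerivAt_primitive (continuous_slice cJ ht) 0 x
  have dY : ∀ t > 0, ∀ x, HasDerivAt (Y t) (deriv G (u t x) - W t x) x := fun t ht x =>
    hasDerivAt_primitive (f := fun y => deriv G (u t y) - W t y)
      ((continuous_slice (F := fun t y => deriv G (u t y)) cGu ht).sub (continuous_slice cW ht)) 0 x
  have dZ : ∀ t > 0, ∀ x, HasDerivAt (Z t) (Y t x) x := fun t ht x =>
    hasDerivAt_primitive (continuous_slice cY ht) 0 x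
  have epX : ∀ t > 0, ∀ x, potX G u t x = potX G u t 0 + J t x := fun t ht x => by
    refine eq_of_hasDerivAt (g := fun x => potX G u t 0 + J t x) (dpX t ht)
      (fun x => (dJ t ht x).const_add _) ?_ x
    simp [hJ]
  have ep : ∀ t > 0, ∀ x, pot G u t x = pot G u t 0 + potX G u t 0 * x + W t x := fun t ht x => by
    refine eq_of_hasDerivAt (g := fun x => pot G u t 0 + potX G u t 0 * x + W t x) (dp t ht)
      (fun x => ?_) (by simp [hW]) x
    refine ((((hasDerivAt_id' x).const_mul (potX G u t 0)).const_add (pot G u t 0)).add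
      (dW t ht x)).congr_deriv ?_
    rw [epX t ht x]; ring
  have eux : ∀ t > 0, ∀ x, slope u t x = slope u t 0 - pot G u t 0 * x
      - potX G u t 0 / 2 * x ^ 2 + Y t x := fun t ht x => by
    refine eq_of_hasDerivAt (g := fun x => slope u t 0 - pot G u t 0 * x
      - potX G u t 0 / 2 * x ^ 2 + Y t x) (dux t ht) (fun x => ?_) (by simp [hY]) x
    refine (((((hasDerivAt_id' x).const_mul (pot G u t 0)).const_sub (slope u t 0)).sub
      ((hasDerivAt_pow 2 x).const_mul (potX G u t 0 / 2))).add (dY t ht x)).congr_deriv ?_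
    have e1 := ep t ht x
    have e2 : pot G u t x = deriv G (u t x) - curv u t x := rfl
    simp; linarith
  have eu : ∀ t > 0, ∀ x, u t x = u t 0 + slope u t 0 * x - pot G u t 0 / 2 * x ^ 2
      - potX G u t 0 / 6 * x ^ 3 + Z t x := fun t ht x => by
    refine eq_of_hasDerivAt (g := fun x => u t 0 + slope u t 0 * x - pot G u t 0 / 2 * x ^ 2
      - potX G u t 0 / 6 * x ^ 3 + Z t x) (du t ht) (fun x => ?_) (by simp [hZ]) x
    refine ((((((hasDerivAt_id' x).const_mul (slope u t 0)).const_add (u t 0)).sub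
      ((hasDerivAt_pow 2 x).const_mul (pot G u t 0 / 2))).sub
      ((hasDerivAt_pow 3 x).const_mul (potX G u t 0 / 6))).add (dZ t ht x)).congr_deriv ?_
    have e1 := eux t ht x
    simp; linarith
  have cu' := fun x => continuousOn_time_slice cont x
  have cZ' := fun x => continuousOn_time_slice cZ x
  have c1 := cu' 1
  have c2 := cu' (-1)
  have c3 := cu' 2
  have c0 := cu' 0
  have z1 := cZ' 1
  have z2 := cZ' (-1)
  have z3 := cZ' 2
  -- The second difference of `u - Z` at `-1, 0, 1` isolates the quadratic coefficient. Below, the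
  -- third difference at `-1, 0, 1, 2` isolates the cubic one, and the value at `1` then yields the
  -- linear one.
  have cp0 : ContinuousOn (fun t => pot G u t 0) (Ioi 0) := by
    refine ContinuousOn.congr (f := fun t => 2 * u t 0 - (u t 1 - Z t 1) - (u t (-1) - Z t (-1)))
      (by fun_prop) fun t ht => ?_
    have e1 := eu t ht 1
    have e2 := eu t ht (-1)
    simp only; linarith
  have cpX0 : ContinuousOn (fun t => potX G u t 0) (Ioi 0) := by
    refine ContinuousOn.congr (f := fun t => -(u t 2 - Z t 2) + 3 * (u t 1 - Z t 1)
      + (u t (-1) - Z t (-1)) - 3 * u t 0) (by fun_prop) fun t ht => ?_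
    have e1 := eu t ht 1
    have e2 := eu t ht (-1)
    have e3 := eu t ht 2
    simp only; linarith
  have cs0 : ContinuousOn (fun t => slope u t 0) (Ioi 0) := by
    refine ContinuousOn.congr (f := fun t => (u t 1 - Z t 1) - u t 0 + pot G u t 0 / 2
      + potX G u t 0 / 6) (by fun_prop) fun t ht => ?_
    have e1 := eu t ht 1
    simp only; linarith
  have lift : ∀ {f : ℝ → ℝ}, ContinuousOn f (Ioi 0) →
      ContinuousOn (fun z : ℝ × ℝ => f z.1) (Ioi 0 ×ˢ univ) := fun hf =>
    hf.comp continuousOn_fst fun z hz => hz.1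
  have lp0 := lift cp0
  have lpX0 := lift cpX0
  have ls0 := lift cs0
  have cpot : ContinuousOn (fun z : ℝ × ℝ => pot G u z.1 z.2) (Ioi 0 ×ˢ univ) :=
    ContinuousOn.congr (f := fun z : ℝ × ℝ => pot G u z.1 0 + potX G u z.1 0 * z.2 + W z.1 z.2)
      (by fun_prop) fun z hz => ep z.1 hz.1 z.2
  have ccurv : ContinuousOn (fun z : ℝ × ℝ => curv u z.1 z.2) (Ioi 0 ×ˢ univ) :=
    ContinuousOn.congr (f := fun z : ℝ × ℝ => deriv G (u z.1 z.2) - pot G u z.1 z.2)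
      (by fun_prop) fun z hz => by simp [pot]
  refine ⟨hG, cont, ?_, ccurv, cpot, ?_, cXX, du, dux, fun t ht x => ?_, dp, dpX, dt⟩
  · exact ContinuousOn.congr (f := fun z : ℝ × ℝ => slope u z.1 0 - pot G u z.1 0 * z.2
      - potX G u z.1 0 / 2 * z.2 ^ 2 + Y z.1 z.2) (by fun_prop) fun z hz => eux z.1 hz.1 z.2
  · exact ContinuousOn.congr (f := fun z : ℝ × ℝ => potX G u z.1 0 + J z.1 z.2)
      (by fun_prop) fun z hz => epX z.1 hz.1 z.2
  · have e : curv u t = fun x => deriv G (u t x) - pot G u t x := by ext x; simp [pot]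
    rw [e]
    exact ((hasDerivAt_deriv_of_contDiff_two hG (u t x)).comp x (du t ht x)).sub (dp t ht x)

lemma IsSmoothSolution.shift {G u₀ : ℝ → ℝ} {u : ℝ → ℝ → ℝ} (h : IsSmoothSolution G u₀ u)
    {σ : ℝ} (hσ : 0 ≤ σ) : IsSmoothSolution G (u σ) (fun t => u (σ + t)) where
  initial x := by rw [add_zero]
  continuousOn := h.continuousOn.comp (f := fun z : ℝ × ℝ => (σ + z.1, z.2)) (by fun_prop)
    fun z hz => ⟨add_nonneg hσ hz.1, mem_univ _⟩
  bounded T := by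
    obtain ⟨M, hM⟩ := h.bounded (σ + T)
    exact ⟨M, fun t ht x => hM (σ + t) ⟨add_nonneg hσ ht.1, by linarith [ht.2]⟩ x⟩
  contDiff_space t ht := h.contDiff_space _ (by linarith)
  contDiff_innerTerm t ht := h.contDiff_innerTerm _ (by linarith)
  continuousOn_time_deriv := by
    have := h.continuousOn_time_deriv.comp (f := fun z : ℝ × ℝ => (σ + z.1, z.2)) (by fun_prop)
      (t := Ioi 0 ×ˢ univ) (s := Ioi 0 ×ˢ univ) fun z hz => ⟨by
        have := hz.1
        simp only [mem_Ioi] at *; linarith, mem_univ _⟩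
    refine this.congr fun z hz => ?_
    exact deriv_comp_const_add (fun s => u s z.2) σ z.1
  equation t ht x := by
    have := (h.equation (σ + t) (by linarith) x).comp_const_add σ t
    exact this

/-! ### Limits of weighted integrals -/

/-- The kernel `(1 + ((x - y) / L)²)⁻¹`. -/
def tail (L y x : ℝ) : ℝ := (1 + ((x - y) / L) ^ 2)⁻¹

lemma tail_pos (L y x : ℝ) : 0 < tail L y x := by unfold tail; positivity

lemma tail_le_one (L y x : ℝ) : tail L y x ≤ 1 :=
  inv_le_one_of_one_le₀ (by nlinarith [sq_nonneg ((x - y) / L)])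

lemma tail_symm (L y x : ℝ) : tail L y x = tail L x y := by
  unfold tail; rw [← neg_sub y x, neg_div, neg_sq]

lemma weight_eq_tail_pow (L y x : ℝ) : weight L y x = tail L y x ^ 3 := rfl

@[fun_prop]
lemma continuous_tail (L y : ℝ) : Continuous (tail L y) := by
  unfold tail
  have : ∀ x : ℝ, 1 + ((x - y) / L) ^ 2 ≠ 0 := fun x => by positivity
  fun_prop (disch := assumption)

lemma integrable_tail {L : ℝ} (hL : 0 < L) (y : ℝ) : Integrable (tail L y) := by
  have := (integrable_inv_one_add_sq.comp_div hL.ne').comp_sub_right y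
  exact this

lemma integral_tail {L : ℝ} (hL : 0 < L) (y : ℝ) : ∫ x, tail L y x = Real.pi * L := by
  unfold tail
  rw [integral_sub_right_eq_self (fun x => (1 + (x / L) ^ 2)⁻¹) y,
    Measure.integral_comp_div (fun x => (1 + x ^ 2)⁻¹) L, integral_univ_inv_one_add_sq,
    abs_of_pos hL, smul_eq_mul, mul_comm]

lemma lintegral_tail {L : ℝ} (hL : 0 < L) (y : ℝ) :
    ∫⁻ x, ENNReal.ofReal (tail L y x) = ENNReal.ofReal (Real.pi * L) := by
  rw [← ofReal_integral_eq_lintegral_ofReal (integrable_tail hL y)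
    (ae_of_all _ fun x => (tail_pos L y x).le), integral_tail hL]

/-- This is the reason for the exponent three: growth like `(1 + z²)²` is admissible, because the
weight leaves the integrable factor `(1 + z²)⁻¹`. Squares of primitives of `u + 1` grow at most at
this rate. -/
lemma wint_le_of_le {L y C : ℝ} (hL : 0 < L) (hC : 0 ≤ C) {f : ℝ → ℝ}
    (h : ∀ x, f x ≤ C * (1 + ((x - y) / L) ^ 2) ^ 2) :
    wint L y f ≤ ENNReal.ofReal (C * (Real.pi * L)) := by
  rw [ENNReal.ofReal_mul hC, ← lintegral_tail hL y, ← lintegral_const_mul' _ _ ENNReal.ofReal_ne_top]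
  refine lintegral_mono fun x => ?_
  rw [← ENNReal.ofReal_mul hC]
  refine ENNReal.ofReal_le_ofReal ?_
  have e : weight L y x * (C * (1 + ((x - y) / L) ^ 2) ^ 2) = C * tail L y x := by
    unfold weight tail
    have : 1 + ((x - y) / L) ^ 2 ≠ 0 := by positivity
    field_simp
  rw [← e]
  exact mul_le_mul_of_nonneg_left (h x) (weight_pos _ _ _).le

lemma wint_le_of_le_const {L y C : ℝ} (hL : 0 < L) (hC : 0 ≤ C) {f : ℝ → ℝ} (h : ∀ x, f x ≤ C) :
    wint L y f ≤ ENNReal.ofReal (C * (Real.pi * L)) := by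
  refine wint_le_of_le hL hC fun x => (h x).trans ?_
  have : 1 ≤ (1 + ((x - y) / L) ^ 2) ^ 2 := one_le_pow₀ (by nlinarith [sq_nonneg ((x - y) / L)])
  nlinarith

/-- Dominated convergence for weighted integrals as time tends to `0`. -/
lemma tendsto_wint_zero {f : ℝ → ℝ → ℝ} {L y C : ℝ} (hL : 0 < L) (hC : 0 ≤ C)
    (hf : ∀ᶠ s in 𝓝[>] (0 : ℝ), Continuous (f s))
    (hlim : ∀ x, Tendsto (fun s => f s x) (𝓝[>] 0) (𝓝 (f 0 x)))
    (h : ∀ᶠ s in 𝓝[>] (0 : ℝ), ∀ x, f s x ≤ C * (1 + ((x - y) / L) ^ 2) ^ 2) :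
    Tendsto (fun s => wint L y (f s)) (𝓝[>] 0) (𝓝 (wint L y (f 0))) := by
  refine tendsto_lintegral_filter_of_dominated_convergence
    (fun x => ENNReal.ofReal (weight L y x * (C * (1 + ((x - y) / L) ^ 2) ^ 2))) ?_ ?_ ?_ ?_
  · filter_upwards [hf] with s hs
    fun_prop
  · filter_upwards [h] with s hs
    exact ae_of_all _ fun x => ENNReal.ofReal_le_ofReal
      (mul_le_mul_of_nonneg_left (hs x) (weight_pos _ _ _).le)
  · exact ((wint_le_of_le hL hC fun x => le_rfl).trans_lt ENNReal.ofReal_lt_top).ne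
  · exact ae_of_all _ fun x =>
      (ENNReal.continuous_ofReal.tendsto _).comp ((hlim x).const_mul (weight L y x))

lemma weight_mono_scale {L L' : ℝ} (hL : 0 < L) (h : L ≤ L') (y x : ℝ) :
    weight L y x ≤ weight L' y x := by
  unfold weight
  have h1 : ((x - y) / L') ^ 2 ≤ ((x - y) / L) ^ 2 := by
    rw [div_pow, div_pow]
    gcongr
  gcongr

lemma wint_mono_scale {L L' y : ℝ} (hL : 0 < L) (h : L ≤ L') {f : ℝ → ℝ} (hf : ∀ x, 0 ≤ f x) :
    wint L y f ≤ wint L' y f :=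
  lintegral_mono fun x => ENNReal.ofReal_le_ofReal
    (mul_le_mul_of_nonneg_right (weight_mono_scale hL h y x) (hf x))

lemma tendsto_wint_atTop (y : ℝ) {f : ℝ → ℝ} (hf : Continuous f) (hf0 : ∀ x, 0 ≤ f x) :
    Tendsto (fun n : ℕ => wint (n + 1) y f) atTop (𝓝 (∫⁻ x, ENNReal.ofReal (f x))) := by
  refine lintegral_tendsto_of_tendsto_of_monotone (fun n => by fun_prop) ?_ ?_
  · refine ae_of_all _ fun x m n hmn => ENNReal.ofReal_le_ofReal
      (mul_le_mul_of_nonneg_right (weight_mono_scale (by positivity) (by gcongr) y x) (hf0 x))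
  · refine ae_of_all _ fun x => (ENNReal.continuous_ofReal.tendsto _).comp ?_
    have h1 : Tendsto (fun n : ℕ => (x - y) / ((n : ℝ) + 1)) atTop (𝓝 0) := by
      have := tendsto_one_div_add_atTop_nhds_zero_nat (𝕜 := ℝ)
      simpa [div_eq_mul_inv] using this.const_mul (x - y)
    have h2 : Tendsto (fun n : ℕ => weight ((n : ℝ) + 1) y x) atTop (𝓝 1) := by
      have := (((h1.pow 2).const_add 1).inv₀ (by norm_num)).pow 3
      simpa [weight] using this
    simpa using h2.mul_const (f x)

lemma aemeasurable_lintegral_of_continuousOn {F : ℝ → ℝ → ℝ} {a s t : ℝ}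
    (hF : ContinuousOn (fun z : ℝ × ℝ => F z.1 z.2) (Ioi a ×ˢ univ)) (has : a ≤ s) :
    AEMeasurable (fun τ => ∫⁻ x, ENNReal.ofReal (F τ x)) (volume.restrict (Ioc s t)) := by
  have hm : MeasurableSet (Ioi a ×ˢ (univ : Set ℝ)) := measurableSet_Ioi.prod .univ
  -- Nothing is assumed at times `≤ a`, so the function is cut off there to obtain global
  -- measurability.
  have h1 : Measurable ((Ioi a ×ˢ (univ : Set ℝ)).indicator fun z : ℝ × ℝ => F z.1 z.2) := by
    classical
    rw [← piecewise_eq_indicator]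
    exact hF.measurable_piecewise continuousOn_const hm
  have h2 := h1.ennreal_ofReal.lintegral_prod_right' (ν := (volume : Measure ℝ))
  refine ⟨_, h2, (ae_restrict_iff' measurableSet_Ioc).2 (ae_of_all _ fun τ hτ => ?_)⟩
  refine lintegral_congr fun x => ?_
  rw [indicator_of_mem (show (τ, x) ∈ Ioi a ×ˢ (univ : Set ℝ) from
    ⟨lt_of_le_of_lt has hτ.1, mem_univ _⟩)]

lemma aemeasurable_wint {F : ℝ → ℝ → ℝ} {a s t L y : ℝ}
    (hF : ContinuousOn (fun z : ℝ × ℝ => F z.1 z.2) (Ioi a ×ˢ univ)) (has : a ≤ s) :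
    AEMeasurable (fun τ => wint L y (F τ)) (volume.restrict (Ioc s t)) :=
  aemeasurable_lintegral_of_continuousOn (F := fun τ x => weight L y x * F τ x)
    ((continuousOn_lift_space (continuous_weight L y)).mul hF) has

lemma setLIntegral_mono_Ioc {f g : ℝ → ℝ≥0∞} {s t : ℝ} (h : ∀ τ, s < τ → τ ≤ t → f τ ≤ g τ) :
    ∫⁻ τ in Ioc s t, f τ ≤ ∫⁻ τ in Ioc s t, g τ :=
  lintegral_mono_ae ((ae_restrict_iff' measurableSet_Ioc).2
    (ae_of_all _ fun τ hτ => h τ hτ.1 hτ.2))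

lemma setLIntegral_Ioc_le {f : ℝ → ℝ≥0∞} {s t : ℝ} {c : ℝ≥0∞}
    (h : ∀ τ, s < τ → τ ≤ t → f τ ≤ c) :
    ∫⁻ τ in Ioc s t, f τ ≤ c * ENNReal.ofReal (t - s) := by
  refine (setLIntegral_mono_Ioc h).trans ?_
  rw [setLIntegral_const, Real.volume_Ioc]

lemma le_setLIntegral_Ioc {f : ℝ → ℝ≥0∞} {s t : ℝ} {c : ℝ≥0∞}
    (h : ∀ τ, s < τ → τ ≤ t → c ≤ f τ) :
    c * ENNReal.ofReal (t - s) ≤ ∫⁻ τ in Ioc s t, f τ := by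
  refine le_trans ?_ (setLIntegral_mono_Ioc h)
  rw [setLIntegral_const, Real.volume_Ioc]

/-- Removal of the weight from a weighted inequality. -/
lemma lintegral_add_le_of_wint {B : ℝ → ℝ} {A : ℝ → ℝ → ℝ} {s t a : ℝ} (has : a ≤ s)
    (hB : Continuous B) (hB0 : ∀ x, 0 ≤ B x)
    (hA : ContinuousOn (fun z : ℝ × ℝ => A z.1 z.2) (Ioi a ×ˢ univ)) (hA0 : ∀ τ > a, ∀ x, 0 ≤ A τ x)
    {X : ℕ → ℝ≥0∞} {X₀ : ℝ≥0∞} (hX : Tendsto X atTop (𝓝 X₀))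
    (h : ∀ n : ℕ, wint (n + 1) 0 B + ∫⁻ τ in Ioc s t, wint (n + 1) 0 (A τ) ≤ X n) :
    (∫⁻ x, ENNReal.ofReal (B x)) + ∫⁻ τ in Ioc s t, ∫⁻ x, ENNReal.ofReal (A τ x) ≤ X₀ := by
  refine le_of_tendsto_of_tendsto' ((tendsto_wint_atTop 0 hB hB0).add ?_) hX h
  refine lintegral_tendsto_of_tendsto_of_monotone
    (fun n => aemeasurable_wint hA has) ?_ ?_
  · refine (ae_restrict_iff' measurableSet_Ioc).2 (ae_of_all _ fun τ hτ m n hmn => ?_)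
    exact wint_mono_scale (by positivity) (by gcongr) (hA0 τ (lt_of_le_of_lt has hτ.1))
  · refine (ae_restrict_iff' measurableSet_Ioc).2 (ae_of_all _ fun τ hτ => ?_)
    have := lt_of_le_of_lt has hτ.1
    exact tendsto_wint_atTop 0 (continuous_slice hA this) (hA0 τ this)

/-! ### Operations on time families -/

namespace TimeFamily
variable {a : ℝ} {q q1 q2 qt r r1 r2 rt : ℝ → ℝ → ℝ}

lemma sub (H : TimeFamily a q q1 q2 qt) (H' : TimeFamily a r r1 r2 rt) :
    TimeFamily a (fun t x => q t x - r t x) (fun t x => q1 t x - r1 t x)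
      (fun t x => q2 t x - r2 t x) (fun t x => qt t x - rt t x) where
  cont0 := H.cont0.sub H'.cont0
  cont1 := H.cont1.sub H'.cont1
  cont2 := H.cont2.sub H'.cont2
  contt := H.contt.sub H'.contt
  deriv0 t ht x := (H.deriv0 t ht x).sub (H'.deriv0 t ht x)
  deriv1 t ht x := (H.deriv1 t ht x).sub (H'.deriv1 t ht x)
  derivt t ht x := (H.derivt t ht x).sub (H'.derivt t ht x)

lemma const_mul (H : TimeFamily a q q1 q2 qt) (c : ℝ) :
    TimeFamily a (fun t x => c * q t x) (fun t x => c * q1 t x)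
      (fun t x => c * q2 t x) (fun t x => c * qt t x) where
  cont0 := continuousOn_const.mul H.cont0
  cont1 := continuousOn_const.mul H.cont1
  cont2 := continuousOn_const.mul H.cont2
  contt := continuousOn_const.mul H.contt
  deriv0 t ht x := (H.deriv0 t ht x).const_mul c
  deriv1 t ht x := (H.deriv1 t ht x).const_mul c
  derivt t ht x := (H.derivt t ht x).const_mul c

lemma translate (H : TimeFamily a q q1 q2 qt) (h : ℝ) :
    TimeFamily a (fun t x => q t (x + h)) (fun t x => q1 t (x + h))
      (fun t x => q2 t (x + h)) (fun t x => qt t (x + h)) where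
  cont0 := H.cont0.comp (f := fun z : ℝ × ℝ => (z.1, z.2 + h)) (by fun_prop) fun z hz => ⟨hz.1, mem_univ _⟩
  cont1 := H.cont1.comp (f := fun z : ℝ × ℝ => (z.1, z.2 + h)) (by fun_prop) fun z hz => ⟨hz.1, mem_univ _⟩
  cont2 := H.cont2.comp (f := fun z : ℝ × ℝ => (z.1, z.2 + h)) (by fun_prop) fun z hz => ⟨hz.1, mem_univ _⟩
  contt := H.contt.comp (f := fun z : ℝ × ℝ => (z.1, z.2 + h)) (by fun_prop) fun z hz => ⟨hz.1, mem_univ _⟩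
  deriv0 t ht x := (H.deriv0 t ht (x + h)).comp_add_const x h
  deriv1 t ht x := (H.deriv1 t ht (x + h)).comp_add_const x h
  derivt t ht x := H.derivt t ht (x + h)

lemma delay (H : TimeFamily a q q1 q2 qt) (h : ℝ) :
    TimeFamily (a + h) (fun t x => q (t - h) x) (fun t x => q1 (t - h) x)
      (fun t x => q2 (t - h) x) (fun t x => qt (t - h) x) := by
  have m : ∀ z ∈ Ioi (a + h) ×ˢ (univ : Set ℝ), (z.1 - h, z.2) ∈ Ioi a ×ˢ (univ : Set ℝ) :=
    fun z hz => ⟨by have := hz.1; simp only [mem_Ioi] at *; linarith, mem_univ _⟩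
  have m' : ∀ t > a + h, t - h > a := fun t ht => by linarith
  exact {
    cont0 := H.cont0.comp (f := fun z : ℝ × ℝ => (z.1 - h, z.2)) (by fun_prop) m
    cont1 := H.cont1.comp (f := fun z : ℝ × ℝ => (z.1 - h, z.2)) (by fun_prop) m
    cont2 := H.cont2.comp (f := fun z : ℝ × ℝ => (z.1 - h, z.2)) (by fun_prop) m
    contt := H.contt.comp (f := fun z : ℝ × ℝ => (z.1 - h, z.2)) (by fun_prop) m
    deriv0 := fun t ht x => H.deriv0 _ (m' t ht) x
    deriv1 := fun t ht x => H.deriv1 _ (m' t ht) x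
    derivt := fun t ht x => (H.derivt _ (m' t ht) x).comp_sub_const t h }

lemma mono (H : TimeFamily a q q1 q2 qt) {b : ℝ} (hab : a ≤ b) : TimeFamily b q q1 q2 qt := by
  have m : Ioi b ×ˢ (univ : Set ℝ) ⊆ Ioi a ×ˢ univ := prod_mono (Ioi_subset_Ioi hab) subset_rfl
  have m' : ∀ t > b, t > a := fun t ht => lt_of_le_of_lt hab ht
  exact ⟨H.cont0.mono m, H.cont1.mono m, H.cont2.mono m, H.contt.mono m,
    fun t ht => H.deriv0 t (m' t ht), fun t ht => H.deriv1 t (m' t ht),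
    fun t ht => H.derivt t (m' t ht)⟩

end TimeFamily

lemma RegularFlow.timeFamily {G : ℝ → ℝ} {u : ℝ → ℝ → ℝ} (H : RegularFlow G u) :
    TimeFamily 0 (fun t x => u t x + 1) (slope u) (curv u) (potXX G u) where
  cont0 := H.cont.add continuousOn_const
  cont1 := H.cont_slope
  cont2 := H.cont_curv
  contt := H.cont_potXX
  deriv0 t ht x := (H.deriv_u t ht x).add_const 1
  deriv1 := H.deriv_slope
  derivt t ht x := (H.deriv_time t ht x).add_const 1

lemma exists_lipschitz_deriv {G : ℝ → ℝ} (hG : ContDiff ℝ 2 G) (M : ℝ) : ∃ K : ℝ, 1 ≤ K ∧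
    (∀ s ∈ Icc (-M) M, |deriv (deriv G) s| ≤ K) ∧
    ∀ r ∈ Icc (-M) M, ∀ s ∈ Icc (-M) M, |deriv G r - deriv G s| ≤ K * |r - s| := by
  obtain ⟨K, hK⟩ := (isCompact_Icc (a := -M) (b := M)).exists_bound_of_continuousOn
    (continuous_deriv_deriv_of_contDiff_two hG).continuousOn
  have hK' : ∀ s ∈ Icc (-M) M, |deriv (deriv G) s| ≤ max K 1 := fun s hs =>
    (hK s hs).trans (le_max_left _ _)
  refine ⟨max K 1, le_max_right _ _, hK', fun r hr s hs => ?_⟩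
  exact (convex_Icc (-M) M).norm_image_sub_le_of_norm_hasDerivWithin_le
    (fun x _ => (hasDerivAt_deriv_of_contDiff_two hG x).hasDerivWithinAt) hK' hs hr

lemma IsDoubleWell.nonneg {G : ℝ → ℝ} (hG : IsDoubleWell G) (s : ℝ) : 0 ≤ G s := by
  by_cases h1 : s = 1
  · rw [h1, hG.zero_one]
  by_cases h2 : s = -1
  · rw [h2, hG.zero_neg_one]
  exact (hG.pos s h1 h2).le

lemma IsDoubleWell.deriv_neg_one {G : ℝ → ℝ} (hG : IsDoubleWell G) : deriv G (-1) = 0 := by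
  have : IsLocalMin G (-1) := Filter.Eventually.of_forall fun s => by
    rw [hG.zero_neg_one]; exact hG.nonneg s
  exact this.deriv_eq_zero

/-! ### The weighted energy inequality -/

/-- The energy density. -/
def energyDensity (G : ℝ → ℝ) (u : ℝ → ℝ → ℝ) (t x : ℝ) : ℝ := 1 / 2 * slope u t x ^ 2 + G (u t x)

/-- Time derivative of a localized Dirichlet energy, without any regularity of `u_xt`. -/
lemma TimeFamily.hasDerivAt_integral_slope_sq {a B L : ℝ} {q q1 q2 qt : ℝ → ℝ → ℝ}
    (H : TimeFamily a q q1 q2 qt) {φ : ℕ → ℝ → ℝ} {ψ : ℝ → ℝ} (hC : Cutoff B L φ ψ) {τ : ℝ}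
    (hτ : a < τ) :
    HasDerivAt (fun τ => ∫ x, φ 0 x * (1 / 2 * q1 τ x ^ 2))
      (∫ x, -(qt τ x * (φ 1 x * q1 τ x + φ 0 x * q2 τ x))) τ := by
  obtain ⟨r, hr⟩ := hC.compact
  have c0 := hC.cont 0 (by norm_num)
  have c1 := hC.cont 1 (by norm_num)
  have z0 : ∀ x, r < |x| → φ 0 x = 0 := fun x hx => (hr x hx).2 0 (by norm_num)
  have z1 : ∀ x, r < |x| → φ 1 x = 0 := fun x hx => (hr x hx).2 1 (by norm_num)
  -- The factorization `q₁(σ)² - q₁(τ)² = (q₁(σ) - q₁(τ)) (q₁(σ) + q₁(τ))` permits an integration by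
  -- parts that moves the derivative off the difference. The difference quotient in time then falls
  -- on `q` alone, whose time derivative exists.
  set S : ℝ → ℝ → ℝ := fun σ x =>
    φ 1 x * (q1 σ x + q1 τ x) + φ 0 x * (q2 σ x + q2 τ x) with hS
  have s0 : ∀ {σ}, a < σ → Continuous (q σ) := fun h => continuous_slice H.cont0 h
  have s1 : ∀ {σ}, a < σ → Continuous (q1 σ) := fun h => continuous_slice H.cont1 h
  have s2 : ∀ {σ}, a < σ → Continuous (q2 σ) := fun h => continuous_slice H.cont2 h
  have k1 := s1 hτ
  have k2 := s2 hτ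
  have l0 := continuousOn_lift_space (S := Ioi a ×ˢ univ) c0
  have l1 := continuousOn_lift_space (S := Ioi a ×ˢ univ) c1
  have lk1 := continuousOn_lift_space (S := Ioi a ×ˢ univ) k1
  have lk2 := continuousOn_lift_space (S := Ioi a ×ˢ univ) k2
  have cS : ContinuousOn (fun z : ℝ × ℝ => S z.1 z.2) (Ioi a ×ˢ univ) :=
    (l1.mul (H.cont1.add lk1)).add (l0.mul (H.cont2.add lk2))
  have zS : ∀ σ x, r < |x| → S σ x = 0 := fun σ x hx => by simp [hS, z0 x hx, z1 x hx]
  -- integration by parts for the increments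
  have hdiff : ∀ σ > a, (∫ x, φ 0 x * (1 / 2 * q1 σ x ^ 2)) - (∫ x, φ 0 x * (1 / 2 * q1 τ x ^ 2)) =
      ∫ x, -(1 / 2) * ((q σ x - q τ x) * S σ x) := by
    intro σ hσ
    have m0 := s0 hσ
    have m1 := s1 hσ
    have m2 := s2 hσ
    have n0 := s0 hτ
    have hd : ∀ x, HasDerivAt (fun x => 1 / 2 * ((q σ x - q τ x) * (φ 0 x * (q1 σ x + q1 τ x))))
        (φ 0 x * (1 / 2 * q1 σ x ^ 2) - φ 0 x * (1 / 2 * q1 τ x ^ 2)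
          - -(1 / 2) * ((q σ x - q τ x) * S σ x)) x := fun x => by
      refine ((((H.deriv0 σ hσ x).sub (H.deriv0 τ hτ x)).mul ((hC.deriv 0 (by norm_num) x).mul
        ((H.deriv1 σ hσ x).add (H.deriv1 τ hτ x)))).const_mul (1 / 2)).congr_deriv ?_
      simp only [hS, Pi.sub_apply, Pi.add_apply, Pi.mul_apply]; ring
    have i1 : Integrable fun x => φ 0 x * (1 / 2 * q1 σ x ^ 2) :=
      integrable_of_continuous_of_zero (R := r) (by fun_prop) fun x hx => by rw [z0 x hx, zero_mul]
    have i2 : Integrable fun x => φ 0 x * (1 / 2 * q1 τ x ^ 2) :=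
      integrable_of_continuous_of_zero (R := r) (by fun_prop) fun x hx => by rw [z0 x hx, zero_mul]
    have i3 : Integrable fun x => -(1 / 2) * ((q σ x - q τ x) * S σ x) :=
      integrable_of_continuous_of_zero (R := r) (by
        have := continuous_slice cS hσ
        fun_prop) fun x hx => by rw [zS σ x hx, mul_zero, mul_zero]
    have i4 : Integrable fun x => 1 / 2 * ((q σ x - q τ x) * (φ 0 x * (q1 σ x + q1 τ x))) :=
      integrable_of_continuous_of_zero (R := r) (by fun_prop) fun x hx => by
        rw [z0 x hx, zero_mul, mul_zero, mul_zero]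
    have h0 := integral_eq_zero_of_hasDerivAt_of_integrable hd ((i1.sub i2).sub i3) i4
    have e1 := integral_sub (i1.sub i2) i3
    have e2 := integral_sub i1 i2
    simp only [Pi.sub_apply] at e1
    linarith
  obtain ⟨b, hab, hbτ⟩ := exists_between hτ
  have hK : IsCompact (Icc b (τ + 1) ×ˢ Icc (-r) r) := isCompact_Icc.prod isCompact_Icc
  have hsub : Icc b (τ + 1) ×ˢ Icc (-r) r ⊆ Ioi a ×ˢ univ := fun z hz =>
    ⟨lt_of_lt_of_le hab hz.1.1, mem_univ _⟩
  obtain ⟨M1, hM1⟩ := hK.exists_bound_of_continuousOn (H.contt.mono hsub)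
  obtain ⟨M2, hM2⟩ := hK.exists_bound_of_continuousOn (cS.mono hsub)
  rw [hasDerivAt_iff_tendsto_slope]
  have hs : Ioo b (τ + 1) ∈ 𝓝[≠] τ := nhdsWithin_le_nhds (Ioo_mem_nhds hbτ (by linarith))
  have e : ∀ σ ∈ Ioo b (τ + 1), _root_.slope (fun τ => ∫ x, φ 0 x * (1 / 2 * q1 τ x ^ 2)) τ σ =
      ∫ x, -(1 / 2) * ((_root_.slope (fun σ => q σ x) τ σ) * S σ x) := fun σ hσ => by
    rw [slope_def_field, hdiff σ (hab.trans hσ.1), div_eq_mul_inv, mul_comm, ← integral_const_mul]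
    refine integral_congr_ae (ae_of_all _ fun x => ?_)
    simp only [slope_def_field]; ring
  refine Tendsto.congr' (f₁ := fun σ => ∫ x, -(1 / 2) * ((_root_.slope (fun σ => q σ x) τ σ) * S σ x))
    (by filter_upwards [hs] with σ hσ using (e σ hσ).symm) ?_
  refine tendsto_integral_filter_of_dominated_convergence
    ((Icc (-r) r).indicator fun _ => 1 / 2 * (M1 * M2)) ?_ ?_ ?_ ?_
  · filter_upwards [hs] with σ hσ
    have m0 := s0 (hab.trans hσ.1)
    have n0 := s0 hτ
    have := continuous_slice cS (hab.trans hσ.1)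
    simp only [slope_def_field]
    exact (by fun_prop : Continuous _).aestronglyMeasurable
  · filter_upwards [hs] with σ hσ
    refine ae_of_all _ fun x => ?_
    by_cases hx : x ∈ Icc (-r) r
    · rw [indicator_of_mem hx]
      have b1 : ‖_root_.slope (fun σ => q σ x) τ σ‖ ≤ M1 := by
        have hM0 : 0 ≤ M1 := (norm_nonneg _).trans (hM1 (τ, x) ⟨⟨hbτ.le, by simp⟩, hx⟩)
        have := (convex_Icc b (τ + 1)).norm_image_sub_le_of_norm_hasDerivWithin_le
          (f := fun σ => q σ x) (f' := fun σ => qt σ x) (C := M1)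
          (fun σ hσ => (H.derivt σ (lt_of_lt_of_le hab hσ.1) x).hasDerivWithinAt)
          (fun σ hσ => hM1 (σ, x) ⟨hσ, hx⟩) (x := τ) (y := σ) ⟨hbτ.le, by simp⟩
          ⟨hσ.1.le, hσ.2.le⟩
        rw [slope_def_field, norm_div]
        exact div_le_of_le_mul₀ (norm_nonneg _) hM0 this
      have b2 : ‖S σ x‖ ≤ M2 := hM2 (σ, x) ⟨⟨hσ.1.le, hσ.2.le⟩, hx⟩
      rw [norm_mul, norm_mul]
      have : ‖(-(1 / 2) : ℝ)‖ = 1 / 2 := by norm_num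
      rw [this]
      have hM0 : 0 ≤ M1 := (norm_nonneg _).trans b1
      gcongr
    · rw [indicator_of_notMem hx, zS σ x, mul_zero, mul_zero, norm_zero]
      by_contra hc
      exact hx (abs_le.1 (not_lt.1 hc))
  · exact (integrable_indicator_iff measurableSet_Icc).2 (integrableOn_const (by simp))
  · refine ae_of_all _ fun x => ?_
    have t1 := (H.derivt τ hτ x).tendsto_slope
    have t2 : Tendsto (fun σ => S σ x) (𝓝[≠] τ) (𝓝 (S τ x)) :=
      (((continuousOn_time_slice cS x).continuousAt (Ioi_mem_nhds hτ)).tendsto).mono_left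
        nhdsWithin_le_nhds
    have := ((t1.mul t2).const_mul (-(1 / 2)))
    convert this using 2
    simp only [hS]; ring

/-- Pointwise estimate of the boundary terms in the energy inequality. -/
lemma Cutoff.pointwise_energy {B L : ℝ} {φ : ℕ → ℝ → ℝ} {ψ : ℝ → ℝ} (hC : Cutoff B L φ ψ)
    (hB : 1 ≤ B) (hL : 0 < L) (x P Y Z : ℝ) :
    -(P * (φ 0 x * P + φ 1 x * Y - φ 2 x * Z)) ≤
      -(φ 0 x * (1 / 2 * P ^ 2)) + ψ x * (B * (L⁻¹ ^ 2 * Y ^ 2 + L⁻¹ ^ 4 * Z ^ 2)) := by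
  obtain ⟨h0, h1, h2, h3, -, -⟩ := hC.bounds hB hL x
  have hψ := hC.psi_nonneg x
  have a1 := two_abs_mul_le (x := P) (y := Y) (ε := 1 / 2) (by norm_num) h0 hψ
    (show 0 ≤ B * L⁻¹ ^ 2 by positivity) h2
  have a2 := two_abs_mul_le (x := P) (y := Z) (ε := 1 / 2) (by norm_num) h0 hψ
    (show 0 ≤ B * L⁻¹ ^ 4 by positivity) h3
  have b1 := neg_abs_le (φ 1 x * P * Y)
  have b2 := le_abs_self (φ 2 x * P * Z)
  have e1 : B * L⁻¹ ^ 2 / (1 / 2) * (ψ x * Y ^ 2) = 2 * (B * L⁻¹ ^ 2 * (ψ x * Y ^ 2)) := by ring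
  have e2 : B * L⁻¹ ^ 4 / (1 / 2) * (ψ x * Z ^ 2) = 2 * (B * L⁻¹ ^ 4 * (ψ x * Z ^ 2)) := by ring
  rw [e1] at a1
  rw [e2] at a2
  linarith

variable {G : ℝ → ℝ} {u : ℝ → ℝ → ℝ}

lemma RegularFlow.continuousOn_energyDensity (H : RegularFlow G u) :
    ContinuousOn (fun z : ℝ × ℝ => energyDensity G u z.1 z.2) (Ioi 0 ×ˢ univ) :=
  (continuousOn_const.mul (H.cont_slope.pow 2)).add (H.contG.continuous.comp_continuousOn H.cont)

/-- Since `G'(u) = p + u_xx`, the localized energy has time derivative `∫ p_xx (φ p - φ_x u_x)`. One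
integration by parts gives `-∫ φ p_x²` and terms with `φ_x`, `φ_xx`. These are absorbed by half of
the dissipation and leave errors of order `L⁻²` and `L⁻⁴`. -/
lemma RegularFlow.weighted_energy (H : RegularFlow G u) (hG : ∀ s, 0 ≤ G s) {L y s t : ℝ}
    (hL : 0 < L) (hs : 0 < s) (hst : s ≤ t) :
    wint L y (energyDensity G u t) + ∫⁻ τ in Ioc s t, wint L y (fun x => 1 / 2 * potX G u τ x ^ 2) ≤
      wint L y (energyDensity G u s) + ∫⁻ τ in Ioc s t, wint L y (fun x => cutoffConst *
        (L⁻¹ ^ 2 * (pot G u τ x - curv u τ x) ^ 2 + L⁻¹ ^ 4 * slope u τ x ^ 2)) := by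
  have cu := H.cont
  have cux := H.cont_slope
  have cuxx := H.cont_curv
  have cp := H.cont_pot
  have cpX := H.cont_potX
  have cpXX := H.cont_potXX
  have hB := one_le_cutoffConst
  refine weighted_inequality (A := fun τ x => 1 / 2 * potX G u τ x ^ 2) (R := fun τ x => cutoffConst *
        (L⁻¹ ^ 2 * (pot G u τ x - curv u τ x) ^ 2 + L⁻¹ ^ 4 * slope u τ x ^ 2)) hL hs hst
    H.continuousOn_energyDensity (by fun_prop) (by fun_prop)
    (fun τ _ x => add_nonneg (by positivity) (hG _)) (fun τ _ x => by positivity)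
    (fun τ _ x => by positivity) fun φ ψ hC τ hτ => ?_
  have hτ0 : 0 < τ := lt_of_lt_of_le hs hτ.1
  obtain ⟨r, hr⟩ := hC.compact
  have c0 := hC.cont 0 (by norm_num)
  have c1 := hC.cont 1 (by norm_num)
  have c2 := hC.cont 2 (by norm_num)
  have cψ := hC.contψ
  have z0 : ∀ x, r < |x| → φ 0 x = 0 := fun x hx => (hr x hx).2 0 (by norm_num)
  have z1 : ∀ x, r < |x| → φ 1 x = 0 := fun x hx => (hr x hx).2 1 (by norm_num)
  have z2 : ∀ x, r < |x| → φ 2 x = 0 := fun x hx => (hr x hx).2 2 (by norm_num)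
  have zψ : ∀ x, r < |x| → ψ x = 0 := fun x hx => (hr x hx).1
  have l0 := continuousOn_lift_space (S := Ioi 0 ×ˢ univ) c0
  have cGu : ContinuousOn (fun z : ℝ × ℝ => G (u z.1 z.2)) (Ioi 0 ×ˢ univ) :=
    H.contG.continuous.comp_continuousOn cu
  have cG'u : ContinuousOn (fun z : ℝ × ℝ => deriv G (u z.1 z.2)) (Ioi 0 ×ˢ univ) :=
    (continuous_deriv_of_contDiff_two H.contG).comp_continuousOn cu
  have d1 := H.timeFamily.hasDerivAt_integral_slope_sq hC hτ0
  have d2 := hasDerivAt_integral_of_continuousOn (a := 0) (R := r)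
    (F := fun τ x => φ 0 x * G (u τ x)) (F' := fun τ x => φ 0 x * (deriv G (u τ x) * potXX G u τ x))
    (l0.mul cGu) (l0.mul (cG'u.mul cpXX))
    (fun σ hσ x => ((hasDerivAt_of_contDiff_two H.contG (u σ x)).comp σ
      (H.deriv_time σ hσ x)).const_mul (φ 0 x))
    (fun σ _ x hx => by rw [z0 x hx, zero_mul]) (fun σ _ x hx => by rw [z0 x hx, zero_mul]) hτ0
  have s0 := continuous_slice cu hτ0
  have s1 := continuous_slice cux hτ0
  have s2 := continuous_slice cuxx hτ0
  have sp := continuous_slice cp hτ0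
  have spX := continuous_slice cpX hτ0
  have spXX := continuous_slice cpXX hτ0
  have sG := continuous_slice (F := fun τ x => G (u τ x)) cGu hτ0
  have sG' := continuous_slice (F := fun τ x => deriv G (u τ x)) cG'u hτ0
  have iz : ∀ f : ℝ → ℝ, Continuous f → (∀ x, r < |x| → f x = 0) → Integrable f := fun f hf h =>
    integrable_of_continuous_of_zero hf h
  refine ⟨_, HasDerivAt.congr_of_eventuallyEq (d1.add d2) ?_, ?_⟩
  · filter_upwards [Ioi_mem_nhds hτ0] with σ hσ
    have m0 := continuous_slice cu hσ
    have m1 := continuous_slice cux hσ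
    have mG : Continuous fun x => G (u σ x) := continuous_slice (F := fun τ x => G (u τ x)) cGu hσ
    rw [Pi.add_apply, ← integral_add]
    · refine integral_congr_ae (ae_of_all _ fun x => ?_)
      simp only [energyDensity]; ring
    · exact iz _ (by fun_prop) fun x hx => by rw [z0 x hx, zero_mul]
    · exact iz _ (c0.mul mG) fun x hx => by rw [z0 x hx, zero_mul]
  · have j1 : Integrable fun x => -(potXX G u τ x * (φ 1 x * slope u τ x + φ 0 x * curv u τ x)) :=
      iz _ (by fun_prop) fun x hx => by simp [z0 x hx, z1 x hx]
    have j2 : Integrable fun x => φ 0 x * (deriv G (u τ x) * potXX G u τ x) :=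
      iz _ (c0.mul (sG'.mul spXX)) fun x hx => by rw [z0 x hx, zero_mul]
    have j3 : Integrable fun x => -(φ 0 x * (1 / 2 * potX G u τ x ^ 2)) :=
      iz _ (by fun_prop) fun x hx => by rw [z0 x hx, zero_mul, neg_zero]
    have j4 : Integrable fun x => ψ x * (cutoffConst *
        (L⁻¹ ^ 2 * (pot G u τ x - curv u τ x) ^ 2 + L⁻¹ ^ 4 * slope u τ x ^ 2)) :=
      iz _ (by fun_prop) fun x hx => by rw [zψ x hx, zero_mul]
    rw [← integral_add j1 j2, ← integral_neg, ← integral_add j3 j4]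
    refine integral_le_of_flux (R := r)
      (F := fun x => potX G u τ x * (φ 0 x * pot G u τ x - φ 1 x * slope u τ x))
      (F' := fun x => potXX G u τ x * (φ 0 x * pot G u τ x - φ 1 x * slope u τ x)
        + potX G u τ x * ((φ 1 x * pot G u τ x + φ 0 x * potX G u τ x) -
          (φ 2 x * slope u τ x + φ 1 x * curv u τ x)))
      (by fun_prop) (by fun_prop) (by fun_prop) (fun x => ?_) (fun x hx => ?_) (fun x hx => ?_)
      (fun x hx => ?_) (fun x hx => ?_) fun x => ?_
    · exact (H.deriv_potX τ hτ0 x).mul (((hC.deriv 0 (by norm_num) x).mul (H.deriv_pot τ hτ0 x)).sub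
        ((hC.deriv 1 (by norm_num) x).mul (H.deriv_slope τ hτ0 x)))
    · simp [z0 x hx, z1 x hx]
    · simp [z0 x hx, zψ x hx]
    · simp [z0 x hx, z1 x hx]
    · simp [z0 x hx, z1 x hx, z2 x hx]
    · have := hC.pointwise_energy hB hL x (potX G u τ x) (pot G u τ x - curv u τ x) (slope u τ x)
      have e : deriv G (u τ x) = pot G u τ x + curv u τ x := by simp [pot]
      rw [e]
      linarith

/-! ### Integral Cauchy-Schwarz inequalities and difference quotients -/

lemma sq_intervalIntegral_le {f : ℝ → ℝ} {a b : ℝ} (hab : a ≤ b)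
    (hf : IntervalIntegrable f volume a b) (hf2 : IntervalIntegrable (fun x => f x ^ 2) volume a b) :
    (∫ x in a..b, f x) ^ 2 ≤ (b - a) * ∫ x in a..b, f x ^ 2 := by
  rcases hab.eq_or_lt with rfl | hab'
  · simp
  set m := (∫ x in a..b, f x) / (b - a) with hm
  have hba : 0 < b - a := sub_pos.2 hab'
  have h0 : 0 ≤ ∫ x in a..b, (f x ^ 2 - 2 * m * f x + m ^ 2) :=
    intervalIntegral.integral_nonneg hab fun x _ => by nlinarith [sq_nonneg (f x - m)]
  rw [intervalIntegral.integral_add (hf2.sub (hf.const_mul _)) intervalIntegrable_const,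
    intervalIntegral.integral_sub hf2 (hf.const_mul _), intervalIntegral.integral_const_mul,
    intervalIntegral.integral_const, smul_eq_mul] at h0
  have e : ∫ x in a..b, f x = m * (b - a) := by rw [hm]; field_simp
  rw [e] at h0 ⊢
  nlinarith

lemma ofReal_sq_intervalIntegral_le {f : ℝ → ℝ} {a b : ℝ} (hab : a ≤ b)
    (hf : IntervalIntegrable f volume a b) :
    ENNReal.ofReal ((∫ x in a..b, f x) ^ 2) ≤
      ENNReal.ofReal (b - a) * ∫⁻ x in Ioc a b, ENNReal.ofReal (f x ^ 2) := by
  rcases hab.eq_or_lt with rfl | hab'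
  · simp
  -- Square integrability is not assumed; without it the right side is infinite, as the interval has
  -- positive length.
  by_cases htop : ∫⁻ x in Ioc a b, ENNReal.ofReal (f x ^ 2) = ⊤
  · rw [htop, ENNReal.mul_top (by simpa using hab')]
    exact le_top
  have hm : AEStronglyMeasurable (fun x => f x ^ 2) (volume.restrict (Ioc a b)) :=
    hf.1.aestronglyMeasurable.pow 2
  have hi : IntegrableOn (fun x => f x ^ 2) (Ioc a b) := by
    refine ⟨hm, ?_⟩
    rw [hasFiniteIntegral_iff_ofReal (ae_of_all _ fun x => sq_nonneg _)]
    exact lt_top_iff_ne_top.2 htop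
  have hf2 : IntervalIntegrable (fun x => f x ^ 2) volume a b :=
    (intervalIntegrable_iff_integrableOn_Ioc_of_le hab).2 hi
  rw [← ofReal_integral_eq_lintegral_ofReal hi (ae_of_all _ fun x => sq_nonneg _),
    ← ENNReal.ofReal_mul (by linarith), ← intervalIntegral.integral_of_le hab]
  exact ENNReal.ofReal_le_ofReal (sq_intervalIntegral_le hab hf hf2)

/-- The difference quotient is an average of `f'`; Cauchy-Schwarz, Tonelli and translation
invariance give the bound with constant one. The sharp constant is needed to reach the initial
energy without loss. -/
lemma LocallyAC.difference_quotient {f : ℝ → ℝ} (hf : LocallyAC f) {h : ℝ} (hh : 0 < h) :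
    ∫⁻ x, ENNReal.ofReal ((h⁻¹ * (f (x + h) - f x)) ^ 2) ≤ ∫⁻ x, ENNReal.ofReal (deriv f x ^ 2) := by
  have hm : Measurable fun x => ENNReal.ofReal (deriv f x ^ 2) :=
    ((measurable_deriv f).pow_const 2).ennreal_ofReal
  have h1 : ∀ x, ENNReal.ofReal ((h⁻¹ * (f (x + h) - f x)) ^ 2) ≤
      ENNReal.ofReal h⁻¹ * ∫⁻ r in Ioc 0 h, ENNReal.ofReal (deriv f (x + r) ^ 2) := by
    intro x
    have e := (hf x (x + h)).integral_deriv_eq_sub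
    have i := (hf x (x + h)).intervalIntegrable_deriv
    have := ofReal_sq_intervalIntegral_le (f := deriv f) (by linarith : x ≤ x + h) i
    rw [e, add_sub_cancel_left] at this
    have e2 : ∫⁻ y in Ioc x (x + h), ENNReal.ofReal (deriv f y ^ 2) =
        ∫⁻ r in Ioc 0 h, ENNReal.ofReal (deriv f (x + r) ^ 2) := by
      rw [← lintegral_indicator measurableSet_Ioc, ← lintegral_indicator measurableSet_Ioc,
        ← lintegral_add_left_eq_self _ x]
      refine lintegral_congr fun r => ?_
      by_cases hr : r ∈ Ioc 0 h
      · rw [indicator_of_mem hr, indicator_of_mem]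
        exact ⟨by linarith [hr.1], by linarith [hr.2]⟩
      · rw [indicator_of_notMem hr, indicator_of_notMem]
        exact fun hc => hr ⟨by linarith [hc.1], by linarith [hc.2]⟩
    rw [← e2, mul_pow, ENNReal.ofReal_mul (by positivity)]
    calc ENNReal.ofReal (h⁻¹ ^ 2) * ENNReal.ofReal ((f (x + h) - f x) ^ 2)
        ≤ ENNReal.ofReal (h⁻¹ ^ 2) * (ENNReal.ofReal h *
          ∫⁻ y in Ioc x (x + h), ENNReal.ofReal (deriv f y ^ 2)) := by gcongr
      _ = _ := by
        rw [← mul_assoc, ← ENNReal.ofReal_mul (by positivity)]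
        congr 2; field_simp
  calc _ ≤ ∫⁻ x, ENNReal.ofReal h⁻¹ * ∫⁻ r in Ioc 0 h, ENNReal.ofReal (deriv f (x + r) ^ 2) :=
        lintegral_mono h1
    _ = ENNReal.ofReal h⁻¹ * ∫⁻ x, ∫⁻ r in Ioc 0 h, ENNReal.ofReal (deriv f (x + r) ^ 2) :=
        lintegral_const_mul' _ _ ENNReal.ofReal_ne_top
    _ = ENNReal.ofReal h⁻¹ * ∫⁻ r in Ioc 0 h, ∫⁻ x, ENNReal.ofReal (deriv f (x + r) ^ 2) := by
        rw [lintegral_lintegral_swap]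
        exact (hm.comp (measurable_fst.add measurable_snd)).aemeasurable
    _ = ENNReal.ofReal h⁻¹ * (ENNReal.ofReal h * ∫⁻ x, ENNReal.ofReal (deriv f x ^ 2)) := by
        congr 1
        simp_rw [fun r => lintegral_add_right_eq_self (μ := volume)
          (fun x => ENNReal.ofReal (deriv f x ^ 2)) r]
        rw [setLIntegral_const, Real.volume_Ioc, sub_zero, mul_comm]
    _ = _ := by
        rw [← mul_assoc, ← ENNReal.ofReal_mul (by positivity), inv_mul_cancel₀ hh.ne',
          ENNReal.ofReal_one, one_mul]

lemma locallyAC_of_contDiff {f : ℝ → ℝ} (hf : ContDiff ℝ 2 f) : LocallyAC f := fun a b =>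
  (hf.of_le (by norm_num : (1 : WithTop ℕ∞) ≤ 2)).contDiffOn.absolutelyContinuousOnInterval

/-! ### The energy inequality -/

/-- The squared `L²` norm. -/
def normSq (f : ℝ → ℝ) : ℝ≥0∞ := ∫⁻ x, ENNReal.ofReal (f x ^ 2)

/-- The constant of the short-time estimates when `G'` has Lipschitz constant `K`. -/
def shortConst (K : ℝ) : ℝ := 80 * cutoffConst * (K + 1) ^ 2

lemma shortConst_pos {K : ℝ} (hK : 0 ≤ K) : 0 < shortConst K := by
  have := one_le_cutoffConst
  unfold shortConst; positivity

variable {G : ℝ → ℝ} {u₀ : ℝ → ℝ} {u : ℝ → ℝ → ℝ}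

/-- The function `q = u + 1` solves `q_t = (k - q_xx)_xx` with `k = G'(u)`, and `|k| ≤ K |q|`
because `G'` vanishes at the well. -/
lemma RegularFlow.weighted_mass (H : RegularFlow G u) {l L y s t K : ℝ} (hl : 0 < l) (hl1 : l ≤ 1)
    (hlL : l ≤ L) (hs : 0 < s) (hst : s ≤ t) (hK : 0 ≤ K)
    (hG : ∀ τ ∈ Icc s t, ∀ x, |deriv G (u τ x)| ≤ K * |u τ x + 1|) :
    wint L y (fun x => (u t x + 1) ^ 2) +
      ∫⁻ τ in Ioc s t, wint L y (fun x => 1 / 2 * (l⁻¹ ^ 2 * slope u τ x ^ 2 + curv u τ x ^ 2)) ≤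
      wint L y (fun x => (u s x + 1) ^ 2) +
        ENNReal.ofReal (shortConst K * l⁻¹ ^ 4) *
          ∫⁻ τ in Ioc s t, wint L y (fun x => (u τ x + 1) ^ 2) := by
  have hB := one_le_cutoffConst
  have cG' := continuous_deriv_of_contDiff_two H.contG
  have := H.timeFamily.weighted_laplace (y := y) (P := potX G u) (k := fun τ x => deriv G (u τ x))
    hl hl1 hlL hs hst hK
    (fun τ hτ x => H.deriv_pot τ (lt_of_lt_of_le hs hτ.1) x)
    (fun τ hτ x => H.deriv_potX τ (lt_of_lt_of_le hs hτ.1) x)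
    (fun τ hτ => cG'.comp (continuous_slice H.cont (lt_of_lt_of_le hs hτ.1))) hG
  rw [← lintegral_const_mul' _ _ ENNReal.ofReal_ne_top]
  convert this using 2
  · refine lintegral_congr fun τ => ?_
    congr 1; ext x; ring
  · refine lintegral_congr fun τ => ?_
    rw [← wint_const_mul (by unfold shortConst; positivity)]
    congr 1; ext x; unfold shortConst; ring

/-- Difference quotients in space solve an equation of the same type, with `k` the difference
quotient of `G'(u)`; the Lipschitz bound of `G'` gives `|k| ≤ K |q|`. -/
lemma RegularFlow.weighted_difference (H : RegularFlow G u) {L y s t K h : ℝ} (hL : 1 ≤ L)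
    (hs : 0 < s) (hst : s ≤ t) (hK : 0 ≤ K)
    (hG : ∀ τ ∈ Icc s t, ∀ x z, |deriv G (u τ x) - deriv G (u τ z)| ≤ K * |u τ x - u τ z|) :
    wint L y (fun x => (h⁻¹ * (u t (x + h) - u t x)) ^ 2) ≤
      wint L y (fun x => (h⁻¹ * (u s (x + h) - u s x)) ^ 2) + ENNReal.ofReal (shortConst K) *
          ∫⁻ τ in Ioc s t, wint L y (fun x => (h⁻¹ * (u τ (x + h) - u τ x)) ^ 2) := by
  have hB := one_le_cutoffConst
  have cG' := continuous_deriv_of_contDiff_two H.contG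
  have F := ((H.timeFamily.translate h).sub H.timeFamily).const_mul h⁻¹
  have := F.weighted_laplace (y := y) (l := 1) (L := L)
    (P := fun τ x => h⁻¹ * (potX G u τ (x + h) - potX G u τ x))
    (k := fun τ x => h⁻¹ * (deriv G (u τ (x + h)) - deriv G (u τ x)))
    one_pos le_rfl hL hs hst hK
    (fun τ hτ x => by
      have p := lt_of_lt_of_le hs hτ.1
      refine (((H.deriv_pot τ p (x + h)).comp_add_const x h).sub
        (H.deriv_pot τ p x)).const_mul h⁻¹ |>.congr_of_eventuallyEq
          (Eventually.of_forall fun z => ?_)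
      simp only [pot, Pi.sub_apply]; ring)
    (fun τ hτ x => by
      have p := lt_of_lt_of_le hs hτ.1
      exact ((((H.deriv_potX τ p (x + h)).comp_add_const x h).sub
        (H.deriv_potX τ p x)).const_mul h⁻¹))
    (fun τ hτ => by
      have := cG'.comp (continuous_slice H.cont (lt_of_lt_of_le hs hτ.1))
      exact continuous_const.mul ((this.comp (continuous_add_const h)).sub this))
    (fun τ hτ x => by
      have := hG τ hτ (x + h) x
      rw [abs_mul, abs_mul, add_sub_add_right_eq_sub]
      calc _ ≤ |h⁻¹| * (K * |u τ (x + h) - u τ x|) := by gcongr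
        _ = _ := by ring)
  simp only [add_sub_add_right_eq_sub] at this
  refine le_trans le_self_add (this.trans (add_le_add le_rfl (le_of_eq ?_)))
  rw [← lintegral_const_mul' _ _ ENNReal.ofReal_ne_top]
  refine lintegral_congr fun τ => ?_
  rw [← wint_const_mul (by unfold shortConst; positivity)]
  congr 1; ext x; unfold shortConst; ring

lemma ofReal_mul_ofReal_le_half {c d : ℝ} (hc : 0 ≤ c) (h : c * d ≤ 1 / 2) :
    ENNReal.ofReal c * ENNReal.ofReal d ≤ 1 / 2 := by
  rw [← ENNReal.ofReal_mul hc]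
  calc _ ≤ ENNReal.ofReal (1 / 2) := ENNReal.ofReal_le_ofReal h
    _ = 1 / 2 := by rw [ENNReal.ofReal_div_of_pos (by norm_num)]; simp

/-- Bounds on a finite time interval. -/
lemma IsSmoothSolution.exists_bounds (h : IsSmoothSolution G u₀ u) (hG : IsDoubleWell G) (T : ℝ) :
    ∃ M K : ℝ, 1 ≤ M ∧ 1 ≤ K ∧ (∀ t ∈ Icc 0 T, ∀ x, |u t x| ≤ M) ∧
      (∀ t ∈ Icc 0 T, ∀ x z, |deriv G (u t x) - deriv G (u t z)| ≤ K * |u t x - u t z|) ∧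
      ∀ t ∈ Icc 0 T, ∀ x, |deriv G (u t x)| ≤ K * |u t x + 1| := by
  obtain ⟨M, hM⟩ := h.bounded T
  obtain ⟨K, hK1, -, hK⟩ := exists_lipschitz_deriv hG.contDiff (max M 1)
  have hm : ∀ t ∈ Icc 0 T, ∀ x, u t x ∈ Icc (-(max M 1)) (max M 1) := fun t ht x =>
    abs_le.1 ((hM t ht x).trans (le_max_left _ _))
  refine ⟨max M 1, K, le_max_right _ _, hK1, fun t ht x => abs_le.2 (hm t ht x),
    fun t ht x z => hK _ (hm t ht x) _ (hm t ht z), fun t ht x => ?_⟩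
  have := hK _ (hm t ht x) (-1) ⟨by simp, by linarith [le_max_right M 1]⟩
  rwa [hG.deriv_neg_one, sub_zero, sub_neg_eq_add] at this

lemma IsSmoothSolution.continuous_at_time (h : IsSmoothSolution G u₀ u) {t : ℝ} (ht : 0 ≤ t) :
    Continuous (u t) := continuous_slice h.continuousOn ht

lemma IsSmoothSolution.tendsto_zero (h : IsSmoothSolution G u₀ u) (x : ℝ) :
    Tendsto (fun s => u s x) (𝓝[>] 0) (𝓝 (u 0 x)) :=
  ((continuousOn_time_slice h.continuousOn x) 0 self_mem_Ici).mono_left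
    (nhdsWithin_mono _ Ioi_subset_Ici_self)

/-- Bound for the Dirichlet integral for short times. -/
lemma IsSmoothSolution.wint_slope_le (h : IsSmoothSolution G u₀ u) (hG : IsDoubleWell G)
    (hu₀ : LocallyAC u₀) (T : ℝ) : ∃ C T₀ : ℝ, 0 < C ∧ 0 < T₀ ∧ ∀ t > 0, t ≤ T → t ≤ T₀ → ∀ L ≥ 1,
      wint L 0 (fun x => slope u t x ^ 2) ≤
        (1 + ENNReal.ofReal (C * t)) * normSq (deriv u₀) := by
  obtain ⟨M, K, hM1, hK1, hM, hK, -⟩ := h.exists_bounds hG T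
  have H := h.regularFlow hG.contDiff
  have hS := shortConst_pos (by linarith : 0 ≤ K)
  refine ⟨2 * shortConst K, (2 * shortConst K)⁻¹, by positivity, by positivity,
    fun t ht htT ht0 L hL => ?_⟩
  have hL0 : 0 < L := by linarith
  -- Difference quotients are used instead of `u_x`, since only `u` is known to be continuous up to
  -- time `0`.
  have key : ∀ h' : ℝ, 0 < h' → wint L 0 (fun x => (h'⁻¹ * (u t (x + h') - u t x)) ^ 2) ≤
      (1 + ENNReal.ofReal (2 * shortConst K * t)) * normSq (deriv u₀) := by
    intro h' hh'
    set N : ℝ → ℝ≥0∞ := fun τ => wint L 0 (fun x => (h'⁻¹ * (u τ (x + h') - u τ x)) ^ 2) with hN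
    have hb : ∀ τ ∈ Icc 0 T, ∀ x, (h'⁻¹ * (u τ (x + h') - u τ x)) ^ 2 ≤ (h'⁻¹ * (2 * M)) ^ 2 := by
      intro τ hτ x
      refine sq_le_sq' ?_ ?_ <;>
      · have a1 := abs_le.1 (hM τ hτ (x + h'))
        have a2 := abs_le.1 (hM τ hτ x)
        have : 0 < h'⁻¹ := by positivity
        nlinarith
    -- The first alternative of `absorb` is needed here: the factor must tend to `1` as `t → 0`, or
    -- the energy would be compared with the initial one only up to a constant.
    have step : ∀ s > 0, s ≤ t → N t ≤ (1 + ENNReal.ofReal (2 * shortConst K * t)) * N s := by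
      intro s hs hst
      have := (absorb (N := N) (J := 0) (s := s) (t := t) (c := ENNReal.ofReal (shortConst K))
        (M := ENNReal.ofReal ((h'⁻¹ * (2 * M)) ^ 2 * (Real.pi * L))) ENNReal.ofReal_ne_top
        (fun τ hτ => wint_le_of_le_const hL0 (sq_nonneg _)
          (hb τ ⟨hs.le.trans hτ.1, hτ.2.trans htT⟩))
        (fun τ hτ => by
          simp only [Pi.zero_apply, add_zero]
          exact H.weighted_difference hL hs hτ.1 (by linarith)
            fun σ hσ => hK σ ⟨hs.le.trans hσ.1, hσ.2.trans (hτ.2.trans htT)⟩)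
        (by
          refine ofReal_mul_ofReal_le_half hS.le ?_
          calc shortConst K * (t - s) ≤ shortConst K * (2 * shortConst K)⁻¹ := by
                gcongr; linarith
            _ = 1 / 2 := by field_simp) ⟨hst, le_rfl⟩).1
      simp only [Pi.zero_apply, add_zero] at this
      refine this.trans ?_
      rw [add_mul, one_mul]
      refine add_le_add le_rfl ?_
      calc ENNReal.ofReal (shortConst K) * ENNReal.ofReal (t - s) * (2 * N s)
          = ENNReal.ofReal (2 * (shortConst K * (t - s))) * N s := by
            rw [ENNReal.ofReal_mul (by norm_num), ENNReal.ofReal_mul hS.le, ENNReal.ofReal_ofNat]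
            ring
        _ ≤ _ := by
            refine mul_le_mul' (ENNReal.ofReal_le_ofReal ?_) le_rfl
            nlinarith
    have lim : Tendsto N (𝓝[>] 0) (𝓝 (N 0)) := by
      refine tendsto_wint_zero (f := fun τ x => (h'⁻¹ * (u τ (x + h') - u τ x)) ^ 2)
        (C := (h'⁻¹ * (2 * M)) ^ 2) hL0 (sq_nonneg _) ?_ ?_ ?_
      · filter_upwards [self_mem_nhdsWithin] with s hs
        have := h.continuous_at_time (le_of_lt hs)
        fun_prop
      · intro x
        exact (((h.tendsto_zero (x + h')).sub (h.tendsto_zero x)).const_mul _).pow 2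
      · filter_upwards [Ioc_mem_nhdsGT ht] with s hs x
        refine (hb s ⟨hs.1.le, hs.2.trans htT⟩ x).trans ?_
        have : 1 ≤ (1 + ((x - 0) / L) ^ 2) ^ 2 :=
          one_le_pow₀ (by nlinarith [sq_nonneg ((x - 0) / L)])
        nlinarith [sq_nonneg (h'⁻¹ * (2 * M))]
    have h0 : N t ≤ (1 + ENNReal.ofReal (2 * shortConst K * t)) * N 0 := by
      refine ge_of_tendsto (ENNReal.Tendsto.const_mul lim (Or.inr (by simp))) ?_
      filter_upwards [Ioc_mem_nhdsGT ht] with s hs using step s hs.1 hs.2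
    refine h0.trans ?_
    gcongr
    calc N 0 ≤ ∫⁻ x, ENNReal.ofReal ((h'⁻¹ * (u 0 (x + h') - u 0 x)) ^ 2) :=
          wint_le_lintegral fun x => sq_nonneg _
      _ ≤ _ := by
        simp_rw [h.initial]
        exact hu₀.difference_quotient hh'
  have hlim : ∀ x, Tendsto (fun n : ℕ => ENNReal.ofReal (weight L 0 x *
      ((((n : ℝ) + 1)⁻¹)⁻¹ * (u t (x + ((n : ℝ) + 1)⁻¹) - u t x)) ^ 2)) atTop
      (𝓝 (ENNReal.ofReal (weight L 0 x * slope u t x ^ 2))) := by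
    intro x
    refine (ENNReal.continuous_ofReal.tendsto _).comp (((?_ : Tendsto _ _ _).pow 2).const_mul _)
    have t1 : Tendsto (fun n : ℕ => ((n : ℝ) + 1)⁻¹) atTop (𝓝[≠] 0) := by
      refine tendsto_nhdsWithin_iff.2 ⟨?_, Eventually.of_forall fun n => by
        have : (0 : ℝ) < (n : ℝ) + 1 := by positivity
        simpa using this.ne'⟩
      simpa using tendsto_one_div_add_atTop_nhds_zero_nat (𝕜 := ℝ)
    exact (hasDerivAt_iff_tendsto_slope_zero.1 (H.deriv_u t ht x)).comp t1
  have cut := h.continuous_at_time ht.le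
  calc wint L 0 (fun x => slope u t x ^ 2)
      = ∫⁻ x, liminf (fun n : ℕ => ENNReal.ofReal (weight L 0 x *
      ((((n : ℝ) + 1)⁻¹)⁻¹ * (u t (x + ((n : ℝ) + 1)⁻¹) - u t x)) ^ 2)) atTop :=
        lintegral_congr fun x => (hlim x).liminf_eq.symm
    _ ≤ liminf (fun n : ℕ => wint L 0 (fun x =>
      ((((n : ℝ) + 1)⁻¹)⁻¹ * (u t (x + ((n : ℝ) + 1)⁻¹) - u t x)) ^ 2)) atTop :=
        lintegral_liminf_le fun n => by fun_prop
    _ ≤ liminf (fun _ : ℕ => (1 + ENNReal.ofReal (2 * shortConst K * t)) * normSq (deriv u₀))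
          atTop := liminf_le_liminf (Eventually.of_forall fun n => key _ (by positivity))
    _ = _ := by simp

variable {G : ℝ → ℝ} {u₀ : ℝ → ℝ} {u : ℝ → ℝ → ℝ}

/-- The dissipation rate `∫ p_x²`. -/
def dissipation (G : ℝ → ℝ) (u : ℝ → ℝ → ℝ) (t : ℝ) : ℝ≥0∞ := normSq (potX G u t)

lemma abs_add_one_sq_le {a M : ℝ} (h : |a| ≤ M) : (a + 1) ^ 2 ≤ (M + 1) ^ 2 := by
  have := abs_le.1 h
  exact sq_le_sq' (by linarith) (by linarith)

/-- The weighted energy inequality with an error that vanishes on large scales. -/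
lemma IsSmoothSolution.weighted_energy_le (h : IsSmoothSolution G u₀ u) (hG : IsDoubleWell G)
    (T : ℝ) : ∃ C : ℝ, 0 ≤ C ∧ ∀ s > 0, ∀ t ≥ s, t ≤ T → ∀ L ≥ 1,
      wint L 0 (energyDensity G u t) +
          ∫⁻ τ in Ioc s t, wint L 0 (fun x => 1 / 2 * potX G u τ x ^ 2) ≤
        wint L 0 (energyDensity G u s) + ENNReal.ofReal (C * L⁻¹) := by
  obtain ⟨M, K, hM1, hK1, hM, -, hK⟩ := h.exists_bounds hG T
  have H := h.regularFlow hG.contDiff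
  have hS := shortConst_pos (by linarith : 0 ≤ K)
  have hB := one_le_cutoffConst
  set Q := (M + 1) ^ 2 * Real.pi with hQ
  have hQ0 : 0 ≤ Q := by positivity
  refine ⟨|T| * (cutoffConst * (2 * K ^ 2) * Q) + 16 * cutoffConst * (Q + shortConst K * Q * |T|),
    by positivity, fun s hs t hst htT L hL => ?_⟩
  have hL0 : 0 < L := by linarith
  have hmem : ∀ τ, s ≤ τ → τ ≤ t → τ ∈ Icc 0 T := fun τ h1 h2 => ⟨by linarith, by linarith⟩
  have hTt : t - s ≤ |T| := by linarith [le_abs_self T]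
  refine (H.weighted_energy hG.nonneg hL0 hs hst).trans (add_le_add le_rfl ?_)
  have hc : ∀ τ, s ≤ τ → τ ≤ t → wint L 0 (fun x => (u τ x + 1) ^ 2) ≤ ENNReal.ofReal (Q * L) := by
    intro τ h1 h2
    refine (wint_le_of_le_const hL0 (sq_nonneg (M + 1)) fun x =>
      abs_add_one_sq_le (hM τ (hmem τ h1 h2) x)).trans (le_of_eq ?_)
    rw [hQ]; ring_nf
  -- Boundedness of `u` gives weighted integrals of `(u + 1)²` of order `L`, and this inequality
  -- extends the bound to the space-time integrals of `u_x²` and `u_xx²`. The errors in the energy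
  -- inequality carry `L⁻²`, so they are of order `L⁻¹`.
  have hA := H.weighted_mass (l := 1) (L := L) (y := 0) one_pos le_rfl hL hs hst
    (by linarith : 0 ≤ K) fun τ hτ x => hK τ (hmem τ hτ.1 hτ.2) x
  have hA' : ∫⁻ τ in Ioc s t, wint L 0
      (fun x => 1 / 2 * ((1 : ℝ)⁻¹ ^ 2 * slope u τ x ^ 2 + curv u τ x ^ 2)) ≤
      ENNReal.ofReal ((Q + shortConst K * Q * |T|) * L) := by
    refine le_trans (le_trans le_add_self hA) ?_
    calc _ ≤ ENNReal.ofReal (Q * L) + ENNReal.ofReal (shortConst K * 1⁻¹ ^ 4) *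
            (ENNReal.ofReal (Q * L) * ENNReal.ofReal (t - s)) := by
          gcongr
          · exact hc s le_rfl hst
          · exact setLIntegral_Ioc_le fun τ h1 h2 => hc τ h1.le h2
      _ = ENNReal.ofReal (Q * L + shortConst K * (Q * L * (t - s))) := by
          rw [← ENNReal.ofReal_mul (by positivity), ← ENNReal.ofReal_mul (by positivity),
            ← ENNReal.ofReal_add (by positivity) (by
              have : 0 ≤ t - s := by linarith
              positivity)]
          norm_num
      _ ≤ _ := by
          refine ENNReal.ofReal_le_ofReal ?_
          have : shortConst K * (Q * L) * (t - s) ≤ shortConst K * (Q * L) * |T| := by gcongr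
          linarith
  have hR : ∀ τ, s < τ → τ ≤ t → wint L 0 (fun x => cutoffConst *
        (L⁻¹ ^ 2 * (pot G u τ x - curv u τ x) ^ 2 + L⁻¹ ^ 4 * slope u τ x ^ 2)) ≤
      ENNReal.ofReal (cutoffConst * L⁻¹ ^ 2 * (2 * K ^ 2)) * ENNReal.ofReal (Q * L) +
      ENNReal.ofReal (16 * cutoffConst * L⁻¹ ^ 2) *
        wint L 0 (fun x => 1 / 2 * ((1 : ℝ)⁻¹ ^ 2 * slope u τ x ^ 2 + curv u τ x ^ 2)) := by
    intro τ h1 h2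
    have cu := continuous_slice H.cont (lt_trans hs h1)
    refine le_trans (wint_mono (g := fun x =>
      cutoffConst * L⁻¹ ^ 2 * (2 * K ^ 2) * (u τ x + 1) ^ 2 + 16 * cutoffConst * L⁻¹ ^ 2 *
        (1 / 2 * ((1 : ℝ)⁻¹ ^ 2 * slope u τ x ^ 2 + curv u τ x ^ 2))) fun x => ?_) ?_
    · have e : pot G u τ x - curv u τ x = deriv G (u τ x) - 2 * curv u τ x := by
        simp only [pot]; ring
      have b1 : (deriv G (u τ x)) ^ 2 ≤ K ^ 2 * (u τ x + 1) ^ 2 := by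
        rw [← sq_abs (deriv G (u τ x)), ← sq_abs (u τ x + 1), ← mul_pow]
        exact pow_le_pow_left₀ (abs_nonneg _) (hK τ (hmem τ h1.le h2) x) 2
      have b2 : L⁻¹ ^ 4 ≤ L⁻¹ ^ 2 :=
        pow_le_pow_of_le_one (by positivity) (inv_le_one_of_one_le₀ hL) (by norm_num)
      have b3 : (deriv G (u τ x) - 2 * curv u τ x) ^ 2 ≤
          2 * (K ^ 2 * (u τ x + 1) ^ 2) + 8 * curv u τ x ^ 2 := by
        nlinarith [sq_nonneg (deriv G (u τ x) + 2 * curv u τ x)]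
      rw [e]
      calc _ ≤ cutoffConst * (L⁻¹ ^ 2 * (2 * (K ^ 2 * (u τ x + 1) ^ 2) + 8 * curv u τ x ^ 2)
            + L⁻¹ ^ 2 * slope u τ x ^ 2) := by gcongr
        _ ≤ _ := by
          have : 0 ≤ cutoffConst * (L⁻¹ ^ 2 * slope u τ x ^ 2) := by positivity
          simp only [inv_one, one_pow, one_mul]
          linarith
    · rw [wint_add (by fun_prop) (fun x => by positivity) (fun x => by positivity),
        wint_const_mul (by positivity), wint_const_mul (by positivity)]
      gcongr
      exact hc τ h1.le h2
  refine (setLIntegral_mono_Ioc hR).trans ?_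
  rw [lintegral_add_left measurable_const, setLIntegral_const, Real.volume_Ioc,
    lintegral_const_mul' _ _ ENNReal.ofReal_ne_top]
  calc _ ≤ ENNReal.ofReal (cutoffConst * L⁻¹ ^ 2 * (2 * K ^ 2)) * ENNReal.ofReal (Q * L) *
        ENNReal.ofReal |T| + ENNReal.ofReal (16 * cutoffConst * L⁻¹ ^ 2) *
          ENNReal.ofReal ((Q + shortConst K * Q * |T|) * L) := by
        gcongr
    _ = _ := by
      rw [← ENNReal.ofReal_mul (by positivity), ← ENNReal.ofReal_mul (by positivity),
        ← ENNReal.ofReal_mul (by positivity), ← ENNReal.ofReal_add (by positivity) (by positivity)]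
      congr 1
      field_simp

lemma tendsto_ofReal_inv_succ (C : ℝ) :
    Tendsto (fun n : ℕ => ENNReal.ofReal (C * ((n : ℝ) + 1)⁻¹)) atTop (𝓝 0) := by
  have := (tendsto_one_div_add_atTop_nhds_zero_nat (𝕜 := ℝ)).const_mul C
  simpa using ENNReal.tendsto_ofReal this

lemma RegularFlow.continuousOn_potX_sq (H : RegularFlow G u) :
    ContinuousOn (fun z : ℝ × ℝ => 1 / 2 * potX G u z.1 z.2 ^ 2) (Ioi 0 ×ˢ univ) :=
  continuousOn_const.mul (H.cont_potX.pow 2)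

lemma lintegral_half_sq (f : ℝ → ℝ) :
    ∫⁻ x, ENNReal.ofReal (1 / 2 * f x ^ 2) = 1 / 2 * normSq f := by
  rw [normSq, ← lintegral_const_mul' _ _ (by simp)]
  refine lintegral_congr fun x => ?_
  rw [ENNReal.ofReal_mul (by norm_num), ENNReal.ofReal_div_of_pos (by norm_num)]; simp

lemma energyDensity_nonneg (hG : IsDoubleWell G) (t x : ℝ) : 0 ≤ energyDensity G u t x :=
  add_nonneg (by positivity) (hG.nonneg _)

lemma IsSmoothSolution.energy_eq (h : IsSmoothSolution G u₀ u) {t : ℝ} (ht : 0 < t) :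
    energy G (u t) = ∫⁻ x, ENNReal.ofReal (energyDensity G u t x) := by
  rw [energy, if_pos (locallyAC_of_contDiff (h.contDiff_space t ht))]; rfl

/-- The weights increase to `1` as `L → ∞`, so monotone convergence removes them while the error
vanishes. No integrability of the energy is assumed beforehand. -/
lemma energy_add_half_dissipation_le_of_wint (h : IsSmoothSolution G u₀ u) (hG : IsDoubleWell G)
    {s t : ℝ} (hs : 0 < s) (hst : s ≤ t) {X : ℝ≥0∞} {C : ℝ}
    (hX : ∀ L ≥ 1, wint L 0 (energyDensity G u t) +
      ∫⁻ τ in Ioc s t, wint L 0 (fun x => 1 / 2 * potX G u τ x ^ 2) ≤ X + ENNReal.ofReal (C * L⁻¹)) :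
    energy G (u t) + 1 / 2 * ∫⁻ τ in Ioc s t, dissipation G u τ ≤ X := by
  have H := h.regularFlow hG.contDiff
  have ht : 0 < t := hs.trans_le hst
  rw [h.energy_eq ht]
  have := lintegral_add_le_of_wint (a := 0) (s := s) (t := t) (X₀ := X)
    (X := fun n => X + ENNReal.ofReal (C * ((n : ℝ) + 1)⁻¹)) hs.le
    (continuous_slice H.continuousOn_energyDensity ht) (fun x => energyDensity_nonneg hG t x)
    H.continuousOn_potX_sq (fun τ _ x => by positivity)
    (by simpa using (tendsto_ofReal_inv_succ C).const_add X) fun n => hX _ (by simp)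
  simp_rw [lintegral_half_sq] at this
  rwa [lintegral_const_mul' _ _ (by simp)] at this

/-- The energy inequality between positive times. -/
lemma IsSmoothSolution.energy_inequality (h : IsSmoothSolution G u₀ u) (hG : IsDoubleWell G)
    {s t : ℝ} (hs : 0 < s) (hst : s ≤ t) :
    energy G (u t) + 1 / 2 * ∫⁻ τ in Ioc s t, dissipation G u τ ≤ energy G (u s) := by
  obtain ⟨C, hC, hE⟩ := h.weighted_energy_le hG t
  refine energy_add_half_dissipation_le_of_wint h hG hs hst fun L hL =>
    (hE s hs t hst le_rfl L hL).trans (add_le_add ?_ le_rfl)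
  rw [h.energy_eq hs]
  exact wint_le_lintegral fun x => energyDensity_nonneg hG s x

/-- The energy inequality from time `0`. -/
lemma IsSmoothSolution.energy_inequality_zero (h : IsSmoothSolution G u₀ u) (hG : IsDoubleWell G)
    (hu₀ : LocallyAC u₀) {s t : ℝ} (hs : 0 < s) (hst : s ≤ t) :
    energy G (u t) + 1 / 2 * ∫⁻ τ in Ioc s t, dissipation G u τ ≤ energy G u₀ := by
  obtain ⟨C, hC, hE⟩ := h.weighted_energy_le hG t
  obtain ⟨C', T₀, hC', hT₀, hD⟩ := h.wint_slope_le hG hu₀ t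
  have H := h.regularFlow hG.contDiff
  have ht : 0 < t := hs.trans_le hst
  have cG := hG.contDiff.continuous
  obtain ⟨M, hM⟩ := h.bounded t
  obtain ⟨MG, hMG⟩ := (isCompact_Icc (a := -M) (b := M)).exists_bound_of_continuousOn cG.continuousOn
  have hMG0 : ∀ τ ∈ Icc 0 t, ∀ x, G (u τ x) ≤ MG := fun τ hτ x =>
    (le_abs_self _).trans (hMG _ (abs_le.1 (hM τ hτ x)))
  have hMG1 : 0 ≤ MG := (hG.nonneg _).trans (hMG0 t ⟨ht.le, le_rfl⟩ 0)
  refine energy_add_half_dissipation_le_of_wint h hG hs hst (C := C) fun L hL => ?_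
  have hL0 : 0 < L := by linarith
  -- The passage `σ → 0` is done at a fixed scale `L`: dominated convergence handles the potential
  -- part, and the short-time bound of the Dirichlet integral handles the rest. The limit `L → ∞`
  -- comes afterwards.
  set Y : ℝ → ℝ≥0∞ := fun σ => (1 / 2 * ((1 + ENNReal.ofReal (C' * σ)) * normSq (deriv u₀)) +
    wint L 0 (fun x => G (u σ x))) + ENNReal.ofReal (C * L⁻¹) with hY
  have bound : ∀ σ > 0, σ ≤ s → σ ≤ T₀ → wint L 0 (energyDensity G u t) +
      ∫⁻ τ in Ioc s t, wint L 0 (fun x => 1 / 2 * potX G u τ x ^ 2) ≤ Y σ := by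
    intro σ hσ hσs hσ0
    refine le_trans (add_le_add le_rfl (lintegral_mono_set (Ioc_subset_Ioc_left hσs)))
      ((hE σ hσ t (hσs.trans hst) le_rfl L hL).trans (add_le_add ?_ le_rfl))
    have cux := continuous_slice H.cont_slope hσ
    have e : wint L 0 (energyDensity G u σ) =
        wint L 0 (fun x => 1 / 2 * slope u σ x ^ 2) + wint L 0 (fun x => G (u σ x)) :=
      wint_add (by fun_prop) (fun x => by positivity) (fun x => hG.nonneg _)
    rw [e, wint_const_mul (by norm_num), ENNReal.ofReal_div_of_pos (by norm_num)]
    simp only [ENNReal.ofReal_one, ENNReal.ofReal_ofNat]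
    gcongr
    exact hD σ hσ (hσs.trans hst) hσ0 L hL
  have lim : Tendsto Y (𝓝[>] 0) (𝓝 ((1 / 2 * ((1 + 0) * normSq (deriv u₀)) +
      wint L 0 (fun x => G (u 0 x))) + ENNReal.ofReal (C * L⁻¹))) := by
    refine Tendsto.add_const _ (Tendsto.add (ENNReal.Tendsto.const_mul ?_ (Or.inr (by simp))) ?_)
    · refine ENNReal.Tendsto.mul_const (Tendsto.const_add _ ?_) (Or.inl (by simp))
      have : Tendsto (fun σ : ℝ => C' * σ) (𝓝[>] 0) (𝓝 0) := by
        have := ((continuous_const_mul C').tendsto 0).mono_left (nhdsWithin_le_nhds (s := Ioi 0))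
        simpa using this
      simpa using ENNReal.tendsto_ofReal this
    · refine tendsto_wint_zero (f := fun σ x => G (u σ x)) (C := MG) hL0 hMG1 ?_ ?_ ?_
      · filter_upwards [self_mem_nhdsWithin] with σ hσ
        exact cG.comp (h.continuous_at_time (le_of_lt hσ))
      · intro x
        exact (cG.tendsto _).comp (h.tendsto_zero x)
      · filter_upwards [Ioc_mem_nhdsGT ht] with σ hσ x
        refine (hMG0 σ ⟨hσ.1.le, hσ.2⟩ x).trans ?_
        have : 1 ≤ (1 + ((x - 0) / L) ^ 2) ^ 2 :=
          one_le_pow₀ (by nlinarith [sq_nonneg ((x - 0) / L)])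
        nlinarith
  have fin : wint L 0 (energyDensity G u t) +
      ∫⁻ τ in Ioc s t, wint L 0 (fun x => 1 / 2 * potX G u τ x ^ 2) ≤
      (1 / 2 * ((1 + 0) * normSq (deriv u₀)) +
      wint L 0 (fun x => G (u 0 x))) + ENNReal.ofReal (C * L⁻¹) := by
    refine ge_of_tendsto lim ?_
    filter_upwards [Ioc_mem_nhdsGT hs, Ioc_mem_nhdsGT hT₀] with σ h1 h2 using bound σ h1.1 h1.2 h2.2
  refine fin.trans (add_le_add ?_ le_rfl)
  rw [add_zero, one_mul, energy, if_pos hu₀, ← lintegral_half_sq]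
  have hm : Measurable fun x => ENNReal.ofReal (1 / 2 * deriv u₀ x ^ 2) :=
    (((measurable_deriv u₀).pow_const 2).const_mul _).ennreal_ofReal
  calc _ ≤ (∫⁻ x, ENNReal.ofReal (1 / 2 * deriv u₀ x ^ 2)) + ∫⁻ x, ENNReal.ofReal (G (u 0 x)) := by
        gcongr; exact wint_le_lintegral fun x => hG.nonneg _
    _ = _ := by
        rw [← lintegral_add_left hm]
        refine lintegral_congr fun x => ?_
        rw [← ENNReal.ofReal_add (by positivity) (hG.nonneg _), h.initial]

/-! ### Propagation of square integrability -/

lemma normSq_lt_top_of_excessMass (h : IsSmoothSolution G u₀ u) (hV : excessMass u₀ < ⊤) :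
    normSq (fun x => u 0 x + 1) < ⊤ := by
  obtain ⟨M, hM⟩ := h.bounded 0
  have : normSq (fun x => u 0 x + 1) ≤ ENNReal.ofReal (M + 1) * excessMass u₀ := by
    rw [normSq, excessMass, ← lintegral_const_mul' _ _ ENNReal.ofReal_ne_top]
    refine lintegral_mono fun x => ?_
    have hMx := hM 0 ⟨le_rfl, le_rfl⟩ x
    have : 0 ≤ M := (abs_nonneg _).trans hMx
    rw [← ENNReal.ofReal_mul (by linarith), ← h.initial, ← sq_abs, sq]
    refine ENNReal.ofReal_le_ofReal (mul_le_mul_of_nonneg_right ?_ (abs_nonneg _))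
    exact (abs_add_le _ _).trans (by simpa using hMx)
  exact this.trans_lt (ENNReal.mul_lt_top ENNReal.ofReal_lt_top hV)

/-- The squared norm at most doubles over each time step `δ`, and finitely many steps reach `T`; the
dissipative term then bounds `u_x` and `u_xx` in space-time. The bound `B` depends on the solution
and is used only qualitatively: for limits at infinity, integrability, and vanishing of cut-off
errors. -/
lemma IsSmoothSolution.normSq_bounded (h : IsSmoothSolution G u₀ u) (hG : IsDoubleWell G)
    (hV : excessMass u₀ < ⊤) (T : ℝ) :
    ∃ B : ℝ≥0∞, B < ⊤ ∧ (∀ t ∈ Icc 0 T, normSq (fun x => u t x + 1) ≤ B) ∧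
      ∀ s > 0, ∀ t ≥ s, t ≤ T → ∫⁻ τ in Ioc s t,
        ∫⁻ x, ENNReal.ofReal (1 / 2 * (slope u τ x ^ 2 + curv u τ x ^ 2)) ≤ B := by
  obtain ⟨M, K, hM1, hK1, hM, -, hK⟩ := h.exists_bounds hG T
  have H := h.regularFlow hG.contDiff
  have hS := shortConst_pos (by linarith : 0 ≤ K)
  set δ := (2 * shortConst K)⁻¹ with hδ
  have hδ0 : 0 < δ := by positivity
  have hmem : ∀ {s t τ}, 0 < s → t ≤ T → τ ∈ Icc s t → τ ∈ Icc 0 T := fun h1 h2 h3 =>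
    ⟨by linarith [h3.1], by linarith [h3.2]⟩
  have base : ∀ s > 0, ∀ t ≥ s, t ≤ T → ∀ L ≥ 1,
      wint L 0 (fun x => (u t x + 1) ^ 2) + ∫⁻ τ in Ioc s t, wint L 0
        (fun x => 1 / 2 * (slope u τ x ^ 2 + curv u τ x ^ 2)) ≤
      wint L 0 (fun x => (u s x + 1) ^ 2) + ENNReal.ofReal (shortConst K) *
        ∫⁻ τ in Ioc s t, wint L 0 (fun x => (u τ x + 1) ^ 2) := by
    intro s hs t hst htT L hL
    have := H.weighted_mass (l := 1) (L := L) (y := 0) one_pos le_rfl hL hs hst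
      (by linarith : 0 ≤ K) fun τ hτ x => hK τ (hmem hs htT hτ) x
    simpa using this
  have step0 : ∀ s > 0, ∀ t ≥ s, t ≤ T → t - s ≤ δ → ∀ L ≥ 1,
      wint L 0 (fun x => (u t x + 1) ^ 2) ≤ 2 * wint L 0 (fun x => (u s x + 1) ^ 2) := by
    intro s hs t hst htT hδt L hL
    have hL0 : 0 < L := by linarith
    have := (absorb (N := fun τ => wint L 0 (fun x => (u τ x + 1) ^ 2)) (J := 0) (s := s) (t := t)
      (c := ENNReal.ofReal (shortConst K)) (M := ENNReal.ofReal ((M + 1) ^ 2 * (Real.pi * L)))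
      ENNReal.ofReal_ne_top
      (fun τ hτ => wint_le_of_le_const hL0 (sq_nonneg _) fun x =>
        abs_add_one_sq_le (hM τ (hmem hs htT hτ) x))
      (fun τ hτ => by
        simp only [Pi.zero_apply, add_zero]
        exact le_trans le_self_add (base s hs τ hτ.1 (hτ.2.trans htT) L hL))
      (ofReal_mul_ofReal_le_half hS.le (by
        calc shortConst K * (t - s) ≤ shortConst K * δ := by gcongr
          _ = 1 / 2 := by rw [hδ]; field_simp)) ⟨hst, le_rfl⟩).2
    simpa using this
  have step : ∀ s ≥ 0, ∀ t ≥ s, t ≤ T → t - s ≤ δ →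
      normSq (fun x => u t x + 1) ≤ 2 * normSq (fun x => u s x + 1) := by
    intro s hs t hst htT hδt
    have ct := h.continuous_at_time (hs.trans hst)
    rcases hst.eq_or_lt with rfl | hst'
    · rw [two_mul]; exact le_self_add
    refine le_of_tendsto' (tendsto_wint_atTop 0 (f := fun x => (u t x + 1) ^ 2) (by fun_prop)
      fun x => sq_nonneg _) fun n => ?_
    have hn : (1 : ℝ) ≤ (n : ℝ) + 1 := by simp
    refine le_trans ?_ (mul_le_mul' le_rfl (wint_le_lintegral (L := (n : ℝ) + 1) (y := 0)
      fun x => sq_nonneg _))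
    rcases hs.eq_or_lt with rfl | hs'
    · have lim : Tendsto (fun σ => 2 * wint ((n : ℝ) + 1) 0 (fun x => (u σ x + 1) ^ 2)) (𝓝[>] 0)
          (𝓝 (2 * wint ((n : ℝ) + 1) 0 (fun x => (u 0 x + 1) ^ 2))) := by
        refine ENNReal.Tendsto.const_mul ?_ (Or.inr (by simp))
        refine tendsto_wint_zero (f := fun σ x => (u σ x + 1) ^ 2) (C := (M + 1) ^ 2) (by positivity)
          (sq_nonneg _) ?_ (fun x => ((h.tendsto_zero x).add_const 1).pow 2) ?_
        · filter_upwards [self_mem_nhdsWithin] with σ hσ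
          have := h.continuous_at_time (le_of_lt hσ)
          fun_prop
        · filter_upwards [Ioc_mem_nhdsGT hst'] with σ hσ x
          refine (abs_add_one_sq_le (hM σ ⟨hσ.1.le, hσ.2.trans htT⟩ x)).trans ?_
          have : 1 ≤ (1 + ((x - 0) / ((n : ℝ) + 1)) ^ 2) ^ 2 :=
            one_le_pow₀ (by nlinarith [sq_nonneg ((x - 0) / ((n : ℝ) + 1))])
          nlinarith [sq_nonneg (M + 1)]
      refine ge_of_tendsto lim ?_
      filter_upwards [Ioc_mem_nhdsGT hst'] with σ hσ
      exact step0 σ hσ.1 t hσ.2 htT (by linarith [hσ.1]) _ hn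
    · exact step0 s hs' t hst htT hδt _ hn
  have ind : ∀ n : ℕ, ∀ t ∈ Icc 0 T, t ≤ n * δ →
      normSq (fun x => u t x + 1) ≤ 2 ^ n * normSq (fun x => u 0 x + 1) := by
    intro n
    induction n with
    | zero =>
      intro t ht htn
      have : t = 0 := le_antisymm (by simpa using htn) ht.1
      simp [this]
    | succ n ih =>
      intro t ht htn
      push_cast at htn
      have h1 : 0 ≤ max 0 (t - δ) := le_max_left _ _
      have h2 : max 0 (t - δ) ≤ t := max_le ht.1 (by linarith)
      refine (step _ h1 t h2 ht.2 (by linarith [le_max_right 0 (t - δ)])).trans ?_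
      rw [pow_succ', mul_assoc]
      gcongr
      exact ih _ ⟨h1, h2.trans ht.2⟩ (max_le (by positivity) (by linarith))
  obtain ⟨n, hn⟩ := exists_nat_ge (T / δ)
  have hTn : T ≤ n * δ := by rwa [div_le_iff₀ hδ0] at hn
  set B₀ := 2 ^ n * normSq (fun x => u 0 x + 1) with hB₀
  have hB₀t : B₀ < ⊤ := ENNReal.mul_lt_top (by simp) (normSq_lt_top_of_excessMass h hV)
  have hB : ∀ t ∈ Icc 0 T, normSq (fun x => u t x + 1) ≤ B₀ := fun t ht => ind n t ht (ht.2.trans hTn)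
  set B₁ := B₀ + ENNReal.ofReal (shortConst K) * (B₀ * ENNReal.ofReal |T|) with hB₁
  refine ⟨B₁, ?_, fun t ht => (hB t ht).trans le_self_add, fun s hs t hst htT => ?_⟩
  · exact ENNReal.add_lt_top.2 ⟨hB₀t, ENNReal.mul_lt_top ENNReal.ofReal_lt_top
      (ENNReal.mul_lt_top hB₀t ENNReal.ofReal_lt_top)⟩
  · have cux := H.cont_slope
    have cuxx := H.cont_curv
    have ct := continuous_slice H.cont (hs.trans_le hst)
    refine le_trans le_add_self (lintegral_add_le_of_wint (a := 0) (B := fun x => (u t x + 1) ^ 2)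
      (A := fun τ x => 1 / 2 * (slope u τ x ^ 2 + curv u τ x ^ 2)) (X := fun _ => B₁) hs.le
      (by fun_prop) (fun x => sq_nonneg _) (by fun_prop) (fun τ _ x => by positivity)
      tendsto_const_nhds fun k => ?_)
    refine (base s hs t hst htT _ (by simp)).trans ?_
    have hw : ∀ τ ∈ Icc 0 T, wint ((k : ℝ) + 1) 0 (fun x => (u τ x + 1) ^ 2) ≤ B₀ := fun τ hτ =>
      (wint_le_lintegral fun x => sq_nonneg _).trans (hB τ hτ)
    refine add_le_add (hw s (hmem hs htT ⟨le_rfl, hst⟩)) (mul_le_mul' le_rfl ?_)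
    refine (setLIntegral_Ioc_le fun τ h1 h2 => hw τ (hmem hs htT ⟨h1.le, h2⟩)).trans ?_
    gcongr
    linarith [le_abs_self T]

/-! ### The range of low-energy profiles -/

variable {G : ℝ → ℝ}

/-- The primitive `∫_{-1}^s √(2G)`. -/
def primH (G : ℝ → ℝ) (s : ℝ) : ℝ := ∫ r in (-1 : ℝ)..s, Real.sqrt (2 * G r)

lemma continuous_sqrtG (hG : IsDoubleWell G) : Continuous fun s => Real.sqrt (2 * G s) := by
  have := hG.contDiff.continuous
  fun_prop

lemma hasDerivAt_primH (hG : IsDoubleWell G) (s : ℝ) :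
    HasDerivAt (primH G) (Real.sqrt (2 * G s)) s := hasDerivAt_primitive (continuous_sqrtG hG) _ _

lemma primH_sub (hG : IsDoubleWell G) (a b : ℝ) :
    primH G b - primH G a = ∫ r in a..b, Real.sqrt (2 * G r) :=
  intervalIntegral.integral_interval_sub_left ((continuous_sqrtG hG).intervalIntegrable _ _)
    ((continuous_sqrtG hG).intervalIntegrable _ _)

lemma monotone_primH (hG : IsDoubleWell G) : Monotone (primH G) := fun a b hab => by
  have := primH_sub hG a b
  have h0 : 0 ≤ ∫ r in a..b, Real.sqrt (2 * G r) :=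
    intervalIntegral.integral_nonneg hab fun _ _ => Real.sqrt_nonneg _
  linarith

lemma continuous_primH (hG : IsDoubleWell G) : Continuous (primH G) :=
  continuous_iff_continuousAt.2 fun s => (hasDerivAt_primH hG s).continuousAt

/-- The optimal profile solves `v' = √(2G(v))` but reaches the wells only asymptotically. Adding `δ`
to the speed makes it reach them in finite time: the competitor is the inverse function of `∫ 1 /
w`, clamped to `[-1, 1]`. Its energy density is at most `w²`, and `∫ w(Y) Y' = ∫_{-1}^1 w`. -/
lemma kinkEnergy_le_add (hG : IsDoubleWell G) {δ : ℝ} (hδ : 0 < δ) :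
    kinkEnergy G ≤ ENNReal.ofReal (primH G 1 + 2 * δ) := by
  set cl : ℝ → ℝ := fun s => max (-1) (min s 1) with hcl
  have cl_cont : Continuous cl := by fun_prop
  have cl_mem : ∀ s, cl s ∈ Icc (-1 : ℝ) 1 := fun s => ⟨le_max_left _ _, by simp [hcl]⟩
  have cl_id : ∀ s ∈ Icc (-1 : ℝ) 1, cl s = s := fun s hs => by
    simp only [hcl, min_eq_left hs.2, max_eq_right hs.1]
  have cl_ge : ∀ s, 1 ≤ s → cl s = 1 := fun s hs => by
    simp only [hcl, min_eq_right hs]; norm_num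
  have cl_le : ∀ s, s ≤ -1 → cl s = -1 := fun s hs => by
    simp only [hcl]; rw [min_eq_left (by linarith), max_eq_left hs]
  set w : ℝ → ℝ := fun s => Real.sqrt (2 * G (cl s)) + δ with hw
  have w_cont : Continuous w := ((continuous_sqrtG hG).comp cl_cont).add continuous_const
  have w_pos : ∀ s, 0 < w s := fun s => add_pos_of_nonneg_of_pos (Real.sqrt_nonneg _) hδ
  obtain ⟨M, hM⟩ : ∃ M, ∀ s, w s ≤ M := by
    obtain ⟨M, hM⟩ := (isCompact_Icc (a := (-1 : ℝ)) (b := 1)).exists_bound_of_continuousOn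
      (continuous_sqrtG hG).continuousOn
    exact ⟨M + δ, fun s => add_le_add ((le_abs_self _).trans (hM _ (cl_mem s))) le_rfl⟩
  have M_pos : 0 < M := (w_pos 0).trans_le (hM 0)
  have wi_cont : Continuous fun s => (w s)⁻¹ := w_cont.inv₀ fun s => (w_pos s).ne'
  set X : ℝ → ℝ := fun v => ∫ s in (0 : ℝ)..v, (w s)⁻¹ with hX
  have dX : ∀ v, HasDerivAt X (w v)⁻¹ v := fun v => hasDerivAt_primitive wi_cont 0 v
  have cX : Continuous X := continuous_iff_continuousAt.2 fun s => (dX s).continuousAt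
  have mX : StrictMono X := strictMono_of_hasDerivAt_pos dX fun v => inv_pos.2 (w_pos v)
  have mXM : Monotone fun v => X v - M⁻¹ * v := by
    refine monotone_of_hasDerivAt_nonneg (f' := fun v => (w v)⁻¹ - M⁻¹) (fun v => ?_) fun v => ?_
    · exact ((dX v).sub ((hasDerivAt_id' v).const_mul M⁻¹)).congr_deriv (by simp)
    · have := inv_anti₀ (w_pos v) (hM v)
      simpa using this
  have X0 : X 0 = 0 := by simp [hX]
  have tX : Tendsto X atTop atTop := by
    refine tendsto_atTop_mono' atTop ?_ (tendsto_id.const_mul_atTop (inv_pos.2 M_pos))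
    filter_upwards [eventually_ge_atTop 0] with v hv
    have := mXM hv
    simp only [X0, mul_zero, sub_zero, id] at *
    linarith
  have bX : Tendsto X atBot atBot := by
    refine tendsto_atBot_mono' atBot ?_ (tendsto_id.const_mul_atBot (inv_pos.2 M_pos))
    filter_upwards [eventually_le_atBot 0] with v hv
    have := mXM hv
    simp only [X0, mul_zero, sub_zero, id] at *
    linarith
  set e := mX.orderIsoOfSurjective X (cX.surjective tX bX) with he
  set Y : ℝ → ℝ := fun x => e.symm x with hY
  have XY : ∀ x, X (Y x) = x := fun x => e.apply_symm_apply x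
  have YX : ∀ x, Y (X x) = x := fun x => e.symm_apply_apply x
  have cY : Continuous Y := e.symm.continuous
  have mY : StrictMono Y := e.symm.strictMono
  have dY : ∀ x, HasDerivAt Y (w (Y x)) x := fun x => by
    have := HasDerivAt.of_local_left_inverse cY.continuousAt (dX (Y x)) (inv_ne_zero (w_pos _).ne')
      (Eventually.of_forall XY)
    simpa using this
  have lY : LipschitzWith M.toNNReal Y := lipschitzWith_of_nnnorm_deriv_le
    (fun x => (dY x).differentiableAt) fun x => by
      rw [(dY x).deriv, ← NNReal.coe_le_coe, coe_nnnorm, Real.norm_of_nonneg (w_pos _).le,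
        Real.coe_toNNReal _ M_pos.le]
      exact hM _
  set v : ℝ → ℝ := fun x => cl (Y x) with hv
  have lv : LipschitzWith M.toNNReal v := (lY.min_const 1).const_max (-1)
  have v_ge : ∀ x, X 1 ≤ x → v x = 1 := fun x hx => cl_ge _ (by rw [← YX 1]; exact mY.monotone hx)
  have v_le : ∀ x, x ≤ X (-1) → v x = -1 := fun x hx => cl_le _ (by
    rw [← YX (-1)]; exact mY.monotone hx)
  have acv : LocallyAC v := fun a b => (lv.lipschitzOnWith).absolutelyContinuousOnInterval
  have hX1 : X (-1) < X 1 := mX (by norm_num)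
  have t1 : Tendsto v atBot (𝓝 (-1)) := tendsto_const_nhds.congr' (by
    filter_upwards [eventually_le_atBot (X (-1))] with x hx using (v_le x hx).symm)
  have t2 : Tendsto v atTop (𝓝 1) := tendsto_const_nhds.congr' (by
    filter_upwards [eventually_ge_atTop (X 1)] with x hx using (v_ge x hx).symm)
  refine le_trans (iInf₂_le (f := fun v _ => energy G v) v ⟨t1, t2⟩) ?_
  rw [energy, if_pos acv]
  have hint : (∫ x in X (-1)..X 1, w (Y x) * w (Y x)) = primH G 1 + 2 * δ := by
    have h1 := intervalIntegral.integral_comp_mul_deriv (a := X (-1)) (b := X 1) (f := Y)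
      (f' := fun x => w (Y x)) (g := w) (fun x _ => dY x) (w_cont.comp cY).continuousOn w_cont
    simp only [Function.comp, YX] at h1
    rw [h1, primH]
    have : ∫ s in (-1 : ℝ)..1, w s = ∫ s in (-1 : ℝ)..1, (Real.sqrt (2 * G s) + δ) :=
      intervalIntegral.integral_congr fun s hs => by
        rw [uIcc_of_le (by norm_num)] at hs
        simp only [hw, cl_id s hs]
    rw [this, intervalIntegral.integral_add ((continuous_sqrtG hG).intervalIntegrable _ _)
      intervalIntegrable_const, intervalIntegral.integral_const]
    norm_num
  rw [← hint, intervalIntegral.integral_of_le hX1.le,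
    ofReal_integral_eq_lintegral_ofReal (f := fun x => w (Y x) * w (Y x))
      (((w_cont.comp cY).mul (w_cont.comp cY)).integrableOn_Ioc)
      (ae_of_all _ fun x => mul_self_nonneg _), ← lintegral_indicator measurableSet_Ioc]
  -- The clamped profile may fail to be differentiable at the two points where it reaches the wells.
  have hnull : ∀ᵐ x : ℝ, x ≠ X (-1) ∧ x ≠ X 1 := by
    have := (Set.toFinite ({X (-1), X 1} : Set ℝ)).measure_zero (volume : Measure ℝ)
    filter_upwards [measure_eq_zero_iff_ae_notMem.1 this] with x hx
    simpa [not_or] using hx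
  refine lintegral_mono_ae ?_
  filter_upwards [hnull] with x hx
  rcases lt_or_gt_of_ne hx.1 with h1 | h1
  · have ev : v =ᶠ[𝓝 x] fun _ => -1 := by
      filter_upwards [Iio_mem_nhds h1] with z hz using v_le z (le_of_lt hz)
    rw [ev.deriv_eq, ev.eq_of_nhds, hG.zero_neg_one]
    simp
  · rcases lt_or_gt_of_ne hx.2 with h2 | h2
    · rw [indicator_of_mem (show x ∈ Ioc (X (-1)) (X 1) from ⟨h1, h2.le⟩)]
      have hYm : ∀ z ∈ Ioo (X (-1)) (X 1), Y z ∈ Icc (-1 : ℝ) 1 := fun z hz =>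
        ⟨by rw [← YX (-1)]; exact mY.monotone hz.1.le, by rw [← YX 1]; exact mY.monotone hz.2.le⟩
      have ev : v =ᶠ[𝓝 x] Y := by
        filter_upwards [Ioo_mem_nhds h1 h2] with z hz using cl_id _ (hYm z hz)
      rw [ev.deriv_eq, ev.eq_of_nhds, (dY x).deriv]
      refine ENNReal.ofReal_le_ofReal ?_
      have h3 : Real.sqrt (2 * G (Y x)) ≤ w (Y x) := by
        simp only [hw, cl_id _ (hYm x ⟨h1, h2⟩)]; linarith
      have h4 := Real.sq_sqrt (show 0 ≤ 2 * G (Y x) by have := hG.nonneg (Y x); linarith)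
      have h5 := Real.sqrt_nonneg (2 * G (Y x))
      nlinarith
    · have ev : v =ᶠ[𝓝 x] fun _ => 1 := by
        filter_upwards [Ioi_mem_nhds h2] with z hz using v_ge z (le_of_lt hz)
      rw [ev.deriv_eq, ev.eq_of_nhds, hG.zero_one]
      simp

/-- The kink energy is at most `∫_{-1}^1 √(2G)`. -/
lemma kinkEnergy_le (hG : IsDoubleWell G) : kinkEnergy G ≤ ENNReal.ofReal (primH G 1) := by
  have : Tendsto (fun δ : ℝ => ENNReal.ofReal (primH G 1 + 2 * δ)) (𝓝[>] 0)
      (𝓝 (ENNReal.ofReal (primH G 1))) := by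
    refine ENNReal.tendsto_ofReal ?_
    have : Continuous fun δ : ℝ => primH G 1 + 2 * δ := by fun_prop
    simpa using (this.tendsto 0).mono_left (nhdsWithin_le_nhds (s := Ioi 0))
  refine ge_of_tendsto this ?_
  filter_upwards [self_mem_nhdsWithin] with δ hδ using kinkEnergy_le_add hG hδ

/-- The Modica-Mortola bound for profiles that tend to `-1` at both ends. -/
lemma two_abs_primH_le (hG : IsDoubleWell G) {f f' : ℝ → ℝ} (hf : ∀ x, HasDerivAt f (f' x) x)
    (hf' : Continuous f') (hbot : Tendsto f atBot (𝓝 (-1))) (htop : Tendsto f atTop (𝓝 (-1)))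
    (x : ℝ) :
    ENNReal.ofReal (2 * |primH G (f x)|) ≤ ∫⁻ x, ENNReal.ofReal (1 / 2 * f' x ^ 2 + G (f x)) := by
  have cf : Continuous f := continuous_iff_continuousAt.2 fun x => (hf x).continuousAt
  have cG := hG.contDiff.continuous
  have ce : Continuous fun x => 1 / 2 * f' x ^ 2 + G (f x) := by fun_prop
  have he0 : ∀ x, 0 ≤ 1 / 2 * f' x ^ 2 + G (f x) := fun x =>
    add_nonneg (by positivity) (hG.nonneg _)
  have cS := continuous_sqrtG hG
  have inc : ∀ a b, a ≤ b → |primH G (f b) - primH G (f a)| ≤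
      ∫ x in a..b, (1 / 2 * f' x ^ 2 + G (f x)) := by
    intro a b hab
    have e : primH G (f b) - primH G (f a) = ∫ x in a..b, Real.sqrt (2 * G (f x)) * f' x := by
      have cn : Continuous fun x => Real.sqrt (2 * G (f x)) * f' x := by fun_prop
      exact (intervalIntegral.integral_eq_sub_of_hasDerivAt (f := fun x => primH G (f x))
        (fun x _ => (hasDerivAt_primH hG (f x)).comp x (hf x)) (cn.intervalIntegrable _ _)).symm
    have cn : Continuous fun x => ‖Real.sqrt (2 * G (f x)) * f' x‖ := by fun_prop
    rw [e]
    refine (intervalIntegral.norm_integral_le_integral_norm hab).trans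
      (intervalIntegral.integral_mono_on hab (cn.intervalIntegrable _ _)
        (ce.intervalIntegrable _ _) fun z _ => ?_)
    rw [Real.norm_eq_abs, abs_mul, abs_of_nonneg (Real.sqrt_nonneg _)]
    have h4 := Real.sq_sqrt (show 0 ≤ 2 * G (f z) by have := hG.nonneg (f z); linarith)
    nlinarith [sq_nonneg (Real.sqrt (2 * G (f z)) - |f' z|), sq_abs (f' z)]
  -- Two excursions are added: from far left, where `primH G ∘ f` is nearly `0`, up to `x`, and back
  -- to far right. This produces the factor `2`.
  have both : ∀ a b, a ≤ x → x ≤ b →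
      ENNReal.ofReal (|primH G (f x) - primH G (f a)| + |primH G (f b) - primH G (f x)|) ≤
        ∫⁻ x, ENNReal.ofReal (1 / 2 * f' x ^ 2 + G (f x)) := by
    intro a b ha hb
    have h1 := add_le_add (inc a x ha) (inc x b hb)
    rw [intervalIntegral.integral_add_adjacent_intervals (ce.intervalIntegrable _ _)
      (ce.intervalIntegrable _ _), intervalIntegral.integral_of_le (ha.trans hb)] at h1
    refine (ENNReal.ofReal_le_ofReal h1).trans ?_
    rw [ofReal_integral_eq_lintegral_ofReal ce.integrableOn_Ioc (ae_of_all _ he0)]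
    exact setLIntegral_le_lintegral _ _
  have p1 : primH G (-1) = 0 := by simp [primH]
  have cH := continuous_primH hG
  have l1 : Tendsto (fun n : ℕ => ENNReal.ofReal (|primH G (f x) - primH G (f (-(n : ℝ)))| +
      |primH G (f n) - primH G (f x)|)) atTop (𝓝 (ENNReal.ofReal (2 * |primH G (f x)|))) := by
    refine ENNReal.tendsto_ofReal ?_
    have t1 := (cH.tendsto (-1)).comp (hbot.comp
      (tendsto_neg_atTop_atBot.comp (tendsto_natCast_atTop_atTop (R := ℝ))))
    have t2 := (cH.tendsto (-1)).comp (htop.comp (tendsto_natCast_atTop_atTop (R := ℝ)))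
    rw [p1] at t1 t2
    have := (t1.const_sub (primH G (f x))).abs.add (t2.sub_const (primH G (f x))).abs
    simp only [sub_zero, zero_sub, abs_neg, ← two_mul] at this
    exact this
  refine le_of_tendsto l1 ?_
  obtain ⟨n, hn⟩ := exists_nat_ge |x|
  filter_upwards [eventually_ge_atTop n] with m hm
  have hm' : |x| ≤ m := hn.trans (by exact_mod_cast hm)
  exact both _ _ (by linarith [neg_abs_le x]) (by linarith [le_abs_self x])

/-- Low-energy profiles stay in a compact interval that does not contain `1`. -/
lemma exists_range (hG : IsDoubleWell G)
    (hGinf : kinkEnergy G ≤ ∫⁻ s in Ioi (1 : ℝ), ENNReal.ofReal (Real.sqrt (2 * G s)))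
    {ε : ℝ} (hε : 0 < ε) : ∃ R c : ℝ, 1 < R ∧ 0 < c ∧ c < 2 ∧
      ∀ s : ℝ, ENNReal.ofReal (2 * |primH G s|) + ENNReal.ofReal ε ≤ 2 * kinkEnergy G →
        -R ≤ s ∧ s ≤ 1 - c := by
  have hk := kinkEnergy_le hG
  have hkt : kinkEnergy G ≠ ⊤ := ne_top_of_le_ne_top ENNReal.ofReal_ne_top hk
  set k := (kinkEnergy G).toReal with hkdef
  have hk_eq : kinkEnergy G = ENNReal.ofReal k := (ENNReal.ofReal_toReal hkt).symm
  have hk0 : 0 ≤ k := ENNReal.toReal_nonneg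
  have hm1 : primH G (-1) = 0 := by simp [primH]
  have hP1 : 0 ≤ primH G 1 := by
    have := monotone_primH hG (show (-1 : ℝ) ≤ 1 by norm_num)
    linarith
  have hk1 : k ≤ primH G 1 := by
    rw [hk_eq] at hk
    exact (ENNReal.ofReal_le_ofReal_iff hP1).1 hk
  -- By continuity the value `1 - c` already costs nearly `primH G 1 ≥ e_*`, so larger values are
  -- excluded by the gap `ε`.
  obtain ⟨c, hc0, hc2, hc⟩ : ∃ c : ℝ, 0 < c ∧ c < 2 ∧ primH G 1 - ε / 2 < primH G (1 - c) := by
    have ht : Tendsto (fun c : ℝ => primH G (1 - c)) (𝓝[>] 0) (𝓝 (primH G 1)) := by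
      have : Continuous fun c : ℝ => primH G (1 - c) := (continuous_primH hG).comp (by fun_prop)
      simpa using (this.tendsto 0).mono_left (nhdsWithin_le_nhds (s := Ioi 0))
    have h1 := ht.eventually (lt_mem_nhds (show primH G 1 - ε / 2 < primH G 1 by linarith))
    obtain ⟨c, h2, h3⟩ := (h1.and (Ioo_mem_nhdsGT (show (0 : ℝ) < 2 by norm_num))).exists
    exact ⟨c, h3.1, h3.2, h2⟩
  -- The assumption on `∫_1^∞ √(2G)` enters only here: a finite interval captures all but `ε / 2` of
  -- `e_*`. Evenness transfers this to values below `-1`.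
  obtain ⟨R, hR1, hR⟩ : ∃ R : ℝ, 1 < R ∧ k - ε / 2 < ∫ s in (1 : ℝ)..R, Real.sqrt (2 * G s) := by
    by_cases hneg : k - ε / 2 < 0
    · exact ⟨2, by norm_num, hneg.trans_le (intervalIntegral.integral_nonneg (by norm_num)
        fun _ _ => Real.sqrt_nonneg _)⟩
    have hU : Ioi (1 : ℝ) = ⋃ n : ℕ, Ioc (1 : ℝ) n := by
      ext x
      simp only [mem_Ioi, mem_iUnion, mem_Ioc]
      exact ⟨fun h => (exists_nat_ge x).imp fun n hn => ⟨h, hn⟩, fun ⟨n, h, _⟩ => h⟩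
    have hlt : ENNReal.ofReal (k - ε / 2) <
        ∫⁻ s in Ioi (1 : ℝ), ENNReal.ofReal (Real.sqrt (2 * G s)) := by
      refine lt_of_lt_of_le ?_ hGinf
      rw [hk_eq]
      exact (ENNReal.ofReal_lt_ofReal_iff_of_nonneg (by linarith)).2 (by linarith)
    rw [hU, setLIntegral_iUnion_of_directed _ (directed_of_isDirected_le fun m n hmn =>
      Ioc_subset_Ioc_right (by exact_mod_cast hmn))] at hlt
    obtain ⟨n, hn⟩ := lt_iSup_iff.1 hlt
    have hn1 : (1 : ℝ) < n := by
      by_contra hcon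
      rw [Ioc_eq_empty hcon] at hn
      simp at hn
    refine ⟨n, hn1, ?_⟩
    rw [← ofReal_integral_eq_lintegral_ofReal (continuous_sqrtG hG).integrableOn_Ioc
      (ae_of_all _ fun _ => Real.sqrt_nonneg _), ← intervalIntegral.integral_of_le hn1.le] at hn
    exact (ENNReal.ofReal_lt_ofReal_iff_of_nonneg (by linarith)).1 hn
  have hRn : primH G (-R) = -∫ s in (1 : ℝ)..R, Real.sqrt (2 * G s) := by
    have h1 : (∫ s in (1 : ℝ)..R, Real.sqrt (2 * G s)) = ∫ s in (1 : ℝ)..R, Real.sqrt (2 * G (-s)) := by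
      simp_rw [hG.even]
    rw [h1, intervalIntegral.integral_comp_neg fun s => Real.sqrt (2 * G s), primH,
      intervalIntegral.integral_symm]
  refine ⟨R, c, hR1, hc0, hc2, fun s hs => ?_⟩
  have hs' : 2 * |primH G s| + ε ≤ 2 * k := by
    rw [hk_eq, ← ENNReal.ofReal_add (by positivity) hε.le, show (2 : ℝ≥0∞) = ENNReal.ofReal 2 by simp,
      ← ENNReal.ofReal_mul (by norm_num)] at hs
    exact (ENNReal.ofReal_le_ofReal_iff (by positivity)).1 hs
  constructor
  · by_contra hcon
    have := monotone_primH hG (not_le.1 hcon).le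
    have := neg_abs_le (primH G s)
    linarith
  · by_contra hcon
    have := monotone_primH hG (not_le.1 hcon).le
    have := le_abs_self (primH G s)
    linarith

/-- Square integrable functions with square integrable derivative vanish at infinity. -/
lemma tendsto_zero_of_normSq {f f' : ℝ → ℝ} (hf : ∀ x, HasDerivAt f (f' x) x) (hf' : Continuous f')
    (h0 : normSq f < ⊤) (h1 : normSq f' < ⊤) :
    Tendsto f atBot (𝓝 0) ∧ Tendsto f atTop (𝓝 0) := by
  have cf : Continuous f := continuous_iff_continuousAt.2 fun x => (hf x).continuousAt
  have i0 : Integrable fun x => f x ^ 2 := by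
    refine ⟨(cf.pow 2).aestronglyMeasurable, ?_⟩
    rwa [hasFiniteIntegral_iff_ofReal (ae_of_all _ fun x => sq_nonneg _)]
  have i1 : Integrable fun x => f' x ^ 2 := by
    refine ⟨(hf'.pow 2).aestronglyMeasurable, ?_⟩
    rwa [hasFiniteIntegral_iff_ofReal (ae_of_all _ fun x => sq_nonneg _)]
  have i2 : Integrable fun x => 2 * f x * f' x := by
    refine (i0.add i1).mono' (by fun_prop) (ae_of_all _ fun x => ?_)
    rw [Real.norm_eq_abs, abs_le]
    simp only [Pi.add_apply]
    constructor <;> nlinarith [sq_nonneg (f x - f' x), sq_nonneg (f x + f' x)]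
  have hd : ∀ x, HasDerivAt (fun x => f x ^ 2) (2 * f x * f' x) x := fun x =>
    ((hf x).pow 2).congr_deriv (by simp)
  have key : ∀ l : Filter ℝ, Tendsto (fun x => f x ^ 2) l (𝓝 0) → Tendsto f l (𝓝 0) := fun l hl => by
    have := (Real.continuous_sqrt.tendsto 0).comp hl
    simp only [Real.sqrt_zero, Function.comp_def, Real.sqrt_sq_eq_abs] at this
    exact tendsto_zero_iff_abs_tendsto_zero f |>.2 this
  exact ⟨key _ (tendsto_zero_of_hasDerivAt_of_integrableOn_Iic (a := 0) (fun x _ => hd x)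
      i2.integrableOn i0.integrableOn),
    key _ (tendsto_zero_of_hasDerivAt_of_integrableOn_Ioi (a := 0) (fun x _ => hd x)
      i2.integrableOn i0.integrableOn)⟩

/-! ### Uniform control of low-energy solutions -/

/-- Bounds for a potential on a range of values `I` containing the well `-1`. -/
structure WellBounds (G : ℝ → ℝ) (I : Set ℝ) (K κ ρ : ℝ) : Prop where
  contDiff : ContDiff ℝ 2 G
  nonneg : ∀ s, 0 ≤ G s
  one_le : 1 ≤ K
  κ_pos : 0 < κ
  κ_le : κ ≤ 1
  ρ_pos : 0 < ρ
  abs_le : ∀ s ∈ I, |s + 1| ≤ K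
  deriv_le : ∀ s ∈ I, |deriv G s| ≤ K * |s + 1|
  deriv2_le : ∀ s ∈ I, |deriv (deriv G) s| ≤ K
  lipschitz : ∀ r ∈ I, ∀ s ∈ I, |deriv G r - deriv G s| ≤ K * |r - s|
  le_potential : ∀ s ∈ I, κ * (s + 1) ^ 2 ≤ G s
  potential_le : ∀ s ∈ I, G s ≤ K * (s + 1) ^ 2
  convex : ∀ s, |s + 1| ≤ ρ → κ ≤ deriv (deriv G) s
  monotone : ∀ r s, |r + 1| ≤ ρ → |s + 1| ≤ ρ → κ * (r - s) ^ 2 ≤ (r - s) * (deriv G r - deriv G s)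
  deriv_mul : ∀ s, |s + 1| ≤ ρ → κ * (s + 1) ^ 2 ≤ (s + 1) * deriv G s

variable {G : ℝ → ℝ}

lemma monotone_of_convex {f f' : ℝ → ℝ} (hf : ∀ s, HasDerivAt f (f' s) s) {κ : ℝ} {I : Set ℝ}
    (hI : Convex ℝ I) (h : ∀ s ∈ I, κ ≤ f' s) {r s : ℝ} (hr : r ∈ I) (hs : s ∈ I) :
    κ * (r - s) ^ 2 ≤ (r - s) * (f r - f s) := by
  wlog hrs : s ≤ r generalizing r s
  · have := this hs hr (le_of_not_ge hrs)
    linarith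
  have hsub : Icc s r ⊆ I := by rw [← segment_eq_Icc hrs]; exact hI.segment_subset hs hr
  have := (convex_Icc s r).mul_sub_le_image_sub_of_le_deriv (f := f) (C := κ)
    (fun x _ => (hf x).continuousAt.continuousWithinAt)
    (fun x _ => (hf x).differentiableAt.differentiableWithinAt)
    (fun x hx => by rw [(hf x).deriv]; exact h x (hsub (interior_subset hx)))
    s ⟨le_rfl, hrs⟩ r ⟨hrs, le_rfl⟩ hrs
  nlinarith

/-- Near `-1` the bounds follow from continuity and positivity of `G''`. Away from `-1`, the lower
bound of `G` follows by compactness, as the range stays at distance `c` from the other well. -/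
lemma exists_wellBounds (hG : IsDoubleWell G) {R c : ℝ} (hR : 1 < R) (hc : 0 < c) (hc2 : c < 2) :
    ∃ K κ ρ : ℝ, WellBounds G (Icc (-R) (1 - c)) K κ ρ := by
  have c2 := continuous_deriv_deriv_of_contDiff_two hG.contDiff
  have dG := hasDerivAt_of_contDiff_two hG.contDiff
  have dG' := hasDerivAt_deriv_of_contDiff_two hG.contDiff
  have cG := hG.contDiff.continuous
  have hpos := hG.deriv2_neg_one_pos
  set κ₀ := deriv (deriv G) (-1) / 2 with hκ₀
  have hκ₀0 : 0 < κ₀ := by positivity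
  obtain ⟨ρ, hρ, hρc⟩ : ∃ ρ > 0, ∀ s, |s + 1| ≤ ρ → κ₀ ≤ deriv (deriv G) s := by
    have h1 := c2.continuousAt.eventually (lt_mem_nhds (show κ₀ < deriv (deriv G) (-1) by linarith))
    obtain ⟨δ, hδ, h2⟩ := Metric.eventually_nhds_iff.1 h1
    refine ⟨δ / 2, by positivity, fun s hs => (h2 ?_).le⟩
    rw [Real.dist_eq, sub_neg_eq_add]; linarith
  obtain ⟨K, hK1, hK2, hK⟩ := exists_lipschitz_deriv hG.contDiff (R + 1)
  have hI : ∀ s ∈ Icc (-R) (1 - c), s ∈ Icc (-(R + 1)) (R + 1) := fun s hs =>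
    ⟨by linarith [hs.1], by linarith [hs.2]⟩
  have hconv : Convex ℝ {s : ℝ | |s + 1| ≤ ρ} := by
    have : {s : ℝ | |s + 1| ≤ ρ} = Icc (-1 - ρ) (-1 + ρ) := by
      ext s; simp only [mem_ofPred_eq, mem_Icc, abs_le]
      constructor <;> rintro ⟨h1, h2⟩ <;> constructor <;> linarith
    rw [this]; exact convex_Icc _ _
  have hmono : ∀ r s, |r + 1| ≤ ρ → |s + 1| ≤ ρ →
      κ₀ * (r - s) ^ 2 ≤ (r - s) * (deriv G r - deriv G s) := fun r s hr hs =>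
    monotone_of_convex dG' hconv hρc hr hs
  have h1ρ : |(-1 : ℝ) + 1| ≤ ρ := by simpa using hρ.le
  have hdm : ∀ s, |s + 1| ≤ ρ → κ₀ * (s + 1) ^ 2 ≤ (s + 1) * deriv G s := fun s hs => by
    have := hmono s (-1) hs h1ρ
    rwa [hG.deriv_neg_one, sub_neg_eq_add, sub_zero] at this
  -- mean value bounds for `G`
  have mv : ∀ s, s ≠ -1 → ∃ θ, |θ + 1| ≤ |s + 1| ∧ 0 ≤ (θ + 1) * (s + 1) ∧
      G s - κ₀ / 2 * (s + 1) ^ 2 = (deriv G θ - κ₀ * (θ + 1)) * (s + 1) := by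
    intro s hs
    have dg : ∀ s, HasDerivAt (fun s => G s - κ₀ / 2 * (s + 1) ^ 2) (deriv G s - κ₀ * (s + 1)) s :=
      fun s => ((dG s).sub ((((hasDerivAt_id' s).add_const 1).pow 2).const_mul (κ₀ / 2))).congr_deriv
        (by simp; ring)
    have cg : Continuous fun s => G s - κ₀ / 2 * (s + 1) ^ 2 := by fun_prop
    rcases lt_or_gt_of_ne hs with h | h
    · obtain ⟨θ, hθ, e⟩ := exists_hasDerivAt_eq_slope _ _ h cg.continuousOn fun x _ => dg x
      refine ⟨θ, ?_, by nlinarith [hθ.1, hθ.2], ?_⟩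
      · rw [abs_of_nonpos (by linarith [hθ.2]), abs_of_nonpos (by linarith)]; linarith [hθ.1]
      · rw [e, hG.zero_neg_one]
        have : (-1 - s) ≠ 0 := by linarith
        field_simp; ring
    · obtain ⟨θ, hθ, e⟩ := exists_hasDerivAt_eq_slope _ _ h cg.continuousOn fun x _ => dg x
      refine ⟨θ, ?_, by nlinarith [hθ.1, hθ.2], ?_⟩
      · rw [abs_of_nonneg (by linarith [hθ.1]), abs_of_nonneg (by linarith)]; linarith [hθ.2]
      · rw [e, hG.zero_neg_one]
        have : (s - -1) ≠ 0 := by linarith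
        field_simp; ring
  have lower : ∀ s, |s + 1| ≤ ρ → κ₀ / 2 * (s + 1) ^ 2 ≤ G s := by
    intro s hs
    by_cases h1 : s = -1
    · rw [h1, hG.zero_neg_one]; simp
    obtain ⟨θ, h2, h3, h4⟩ := mv s h1
    have h5 := hdm θ (h2.trans hs)
    have h6 : 0 ≤ (deriv G θ - κ₀ * (θ + 1)) * (s + 1) := by
      by_cases h7 : θ + 1 = 0
      · rw [show θ = -1 by linarith, hG.deriv_neg_one]; simp
      · have h8 : 0 ≤ ((deriv G θ - κ₀ * (θ + 1)) * (θ + 1)) * ((θ + 1) * (s + 1)) :=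
          mul_nonneg (by nlinarith) h3
        have h9 : 0 < (θ + 1) ^ 2 := by positivity
        by_contra hcon
        push Not at hcon
        nlinarith [mul_neg_of_pos_of_neg h9 hcon]
    linarith
  have hdl : ∀ s ∈ Icc (-(R + 1)) (R + 1), |deriv G s| ≤ K * |s + 1| := fun s hs => by
    have := hK s hs (-1) ⟨by linarith, by linarith⟩
    rwa [hG.deriv_neg_one, sub_zero, sub_neg_eq_add] at this
  have hab : ∀ s ∈ Icc (-R) (1 - c), |s + 1| ≤ R + 1 := fun s hs =>
    _root_.abs_le.2 ⟨by linarith [hs.1], by linarith [hs.2]⟩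
  have upper : ∀ s ∈ Icc (-R) (1 - c), G s ≤ K * (s + 1) ^ 2 := by
    intro s hs
    -- The mean value inequality is applied on the part of the range no farther from `-1` than `s`,
    -- where `|G'| ≤ K |s + 1|`; this yields a quadratic bound.
    have hconv' : Convex ℝ (Icc (-R) (1 - c) ∩ {r | |r + 1| ≤ |s + 1|}) := by
      refine (convex_Icc _ _).inter ?_
      have : {r : ℝ | |r + 1| ≤ |s + 1|} = Icc (-1 - |s + 1|) (-1 + |s + 1|) := by
        ext s; simp only [mem_ofPred_eq, mem_Icc, _root_.abs_le]
        constructor <;> rintro ⟨h1, h2⟩ <;> constructor <;> linarith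
      rw [this]; exact convex_Icc _ _
    have := hconv'.norm_image_sub_le_of_norm_hasDerivWithin_le
      (f := G) (f' := deriv G) (C := K * |s + 1|) (x := -1) (y := s)
      (fun x _ => (dG x).hasDerivWithinAt)
      (fun x hx => (hdl x (hI x hx.1)).trans (mul_le_mul_of_nonneg_left hx.2 (by linarith)))
      ⟨⟨by linarith, by linarith⟩, by simp⟩ ⟨hs, by simp⟩
    rw [hG.zero_neg_one, sub_zero, sub_neg_eq_add, Real.norm_eq_abs, Real.norm_eq_abs,
      abs_of_nonneg (hG.nonneg s), mul_assoc, ← sq, sq_abs] at this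
    exact this
  obtain ⟨m, hm0, hm⟩ : ∃ m > 0, ∀ s ∈ Icc (-R) (1 - c), ρ ≤ |s + 1| → m ≤ G s := by
    by_cases hne : (Icc (-R) (1 - c) ∩ {s | ρ ≤ |s + 1|}).Nonempty
    · have hcl : IsClosed {s : ℝ | ρ ≤ |s + 1|} := isClosed_le (by fun_prop) (by fun_prop)
      obtain ⟨s, hs, hmin⟩ := (isCompact_Icc.inter_right hcl).exists_isMinOn hne cG.continuousOn
      refine ⟨G s, hG.pos s (by linarith [hs.1.2]) (fun h => ?_), fun r hr hr' => hmin ⟨hr, hr'⟩⟩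
      have h5 : ρ ≤ |s + 1| := hs.2
      rw [h] at h5; norm_num at h5; linarith
    · exact ⟨1, one_pos, fun s hs hs' => absurd ⟨s, hs, hs'⟩ hne⟩
  have hR1 : 0 < (R + 1) ^ 2 := by positivity
  set κ := min (min (κ₀ / 2) (m / (R + 1) ^ 2)) 1 with hκ
  have k1 : κ ≤ κ₀ / 2 := (min_le_left _ _).trans (min_le_left _ _)
  have k2 : κ ≤ m / (R + 1) ^ 2 := (min_le_left _ _).trans (min_le_right _ _)
  have k0 : 0 < κ := by positivity
  have hKR : K ≤ K + R := by linarith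
  refine ⟨K + R, κ, ρ, hG.contDiff, hG.nonneg, by linarith, k0, min_le_right _ _, hρ,
    fun s hs => (hab s hs).trans (by linarith),
    fun s hs => (hdl s (hI s hs)).trans (by gcongr), fun s hs => (hK2 s (hI s hs)).trans hKR,
    fun r hr s hs => (hK r (hI r hr) s (hI s hs)).trans (by gcongr), fun s hs => ?_,
    fun s hs => (upper s hs).trans (by gcongr),
    fun s hs => le_trans (by linarith) (hρc s hs),
    fun r s hr hs => le_trans (mul_le_mul_of_nonneg_right (by linarith) (sq_nonneg _))
      (hmono r s hr hs),
    fun s hs => le_trans (mul_le_mul_of_nonneg_right (by linarith) (sq_nonneg _)) (hdm s hs)⟩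
  rcases le_total (|s + 1|) ρ with h | h
  · exact le_trans (mul_le_mul_of_nonneg_right k1 (sq_nonneg _)) (lower s h)
  · refine le_trans ?_ (hm s hs h)
    rw [le_div_iff₀ hR1] at k2
    have : (s + 1) ^ 2 ≤ (R + 1) ^ 2 := by
      rw [← sq_abs]; exact pow_le_pow_left₀ (abs_nonneg _) (hab s hs) 2
    nlinarith

/-- A solution with uniform bounds on its range and its energy. -/
structure Tame (G : ℝ → ℝ) (I : Set ℝ) (K κ ρ E : ℝ) (u : ℝ → ℝ → ℝ) : Prop where
  well : WellBounds G I K κ ρ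
  smooth : IsSmoothSolution G (u 0) u
  mem : ∀ t ≥ 0, ∀ x, u t x ∈ I
  energy_nonneg : 0 ≤ E
  energy_le : ∀ t > 0, ∫⁻ x, ENNReal.ofReal (energyDensity G u t x) ≤ ENNReal.ofReal E
  energy_inequality : ∀ s > 0, ∀ t ≥ s, (∫⁻ x, ENNReal.ofReal (energyDensity G u t x)) +
    1 / 2 * ∫⁻ τ in Ioc s t, dissipation G u τ ≤ ∫⁻ x, ENNReal.ofReal (energyDensity G u s x)
  normSq_bounded : ∀ T : ℝ, ∃ B : ℝ≥0∞, B < ⊤ ∧ (∀ t ∈ Icc 0 T, normSq (fun x => u t x + 1) ≤ B) ∧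
      ∀ s > 0, ∀ t ≥ s, t ≤ T → ∫⁻ τ in Ioc s t,
        ∫⁻ x, ENNReal.ofReal (1 / 2 * (slope u τ x ^ 2 + curv u τ x ^ 2)) ≤ B

lemma Tame.regularFlow {I : Set ℝ} {K κ ρ E : ℝ} {u : ℝ → ℝ → ℝ} (h : Tame G I K κ ρ E u) :
    RegularFlow G u := h.smooth.regularFlow h.well.contDiff

lemma setLIntegral_Ioc_shift (f : ℝ → ℝ≥0∞) (σ s t : ℝ) :
    ∫⁻ τ in Ioc s t, f (σ + τ) = ∫⁻ τ in Ioc (σ + s) (σ + t), f τ := by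
  rw [← lintegral_indicator measurableSet_Ioc, ← lintegral_indicator measurableSet_Ioc,
    ← lintegral_add_left_eq_self ((Ioc (σ + s) (σ + t)).indicator f) σ]
  refine lintegral_congr fun r => ?_
  by_cases hr : r ∈ Ioc s t
  · rw [indicator_of_mem hr, indicator_of_mem]
    exact ⟨by linarith [hr.1], by linarith [hr.2]⟩
  · rw [indicator_of_notMem hr, indicator_of_notMem]
    exact fun hc => hr ⟨by linarith [hc.1], by linarith [hc.2]⟩

/-- The class is invariant under time translation with the same constants, so estimates starting at
time `0` may be restarted at any time. -/
lemma Tame.shift {I : Set ℝ} {K κ ρ E : ℝ} {u : ℝ → ℝ → ℝ} (h : Tame G I K κ ρ E u) {σ : ℝ}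
    (hσ : 0 ≤ σ) : Tame G I K κ ρ E (fun t => u (σ + t)) where
  well := h.well
  smooth := by
    have := h.smooth.shift hσ
    simpa using this
  mem t ht x := h.mem (σ + t) (add_nonneg hσ ht) x
  energy_nonneg := h.energy_nonneg
  energy_le t ht := h.energy_le (σ + t) (by linarith)
  energy_inequality s hs t hst := by
    have := h.energy_inequality (σ + s) (by linarith) (σ + t) (by linarith)
    rw [← setLIntegral_Ioc_shift] at this
    exact this
  normSq_bounded T := by
    obtain ⟨B, hB, h1, h2⟩ := h.normSq_bounded (σ + T)
    refine ⟨B, hB, fun t ht => h1 _ ⟨add_nonneg hσ ht.1, by linarith [ht.2]⟩,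
      fun s hs t hst htT => ?_⟩
    have := h2 (σ + s) (by linarith) (σ + t) (by linarith) (by linarith)
    rw [← setLIntegral_Ioc_shift] at this
    exact this

/-- Low-energy solutions are tame, with bounds depending only on the potential and the gap. -/
lemma exists_tame (hG : IsDoubleWell G)
    (hGinf : kinkEnergy G ≤ ∫⁻ s in Ioi (1 : ℝ), ENNReal.ofReal (Real.sqrt (2 * G s)))
    {ε : ℝ} (hε : 0 < ε) : ∃ (I : Set ℝ) (K κ ρ E : ℝ), WellBounds G I K κ ρ ∧ 0 ≤ E ∧
      ∀ (u₀ : ℝ → ℝ) (u : ℝ → ℝ → ℝ), IsSmoothSolution G u₀ u →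
        energy G u₀ + ENNReal.ofReal ε ≤ 2 * kinkEnergy G → excessMass u₀ < ⊤ →
        Tame G I K κ ρ E u ∧ ∀ t > 0, energy G (u t) ≤ energy G u₀ := by
  obtain ⟨R, c, hR, hc, hc2, hrange⟩ := exists_range hG hGinf hε
  obtain ⟨K, κ, ρ, hW⟩ := exists_wellBounds hG hR hc hc2
  have hkt : kinkEnergy G ≠ ⊤ := ne_top_of_le_ne_top ENNReal.ofReal_ne_top (kinkEnergy_le hG)
  have h2k : 2 * kinkEnergy G ≠ ⊤ := ENNReal.mul_ne_top (by simp) hkt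
  refine ⟨Icc (-R) (1 - c), K, κ, ρ, (2 * kinkEnergy G).toReal, hW, ENNReal.toReal_nonneg,
    fun u₀ u h hE hV => ?_⟩
  have hE0 : energy G u₀ ≤ 2 * kinkEnergy G := le_trans le_self_add hE
  have hac : LocallyAC u₀ := by
    by_contra hcon
    rw [energy, if_neg hcon, top_le_iff] at hE0
    exact h2k hE0
  have H := h.regularFlow hG.contDiff
  have hen : ∀ t > 0, energy G (u t) ≤ energy G u₀ := fun t ht =>
    le_trans le_self_add (h.energy_inequality_zero hG hac ht le_rfl)
  have hL2 := h.normSq_bounded hG hV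
  -- There is no continuation argument in time: finiteness of the `L²` norm and of the energy at
  -- each positive time gives the limits `-1` at infinity, and the Modica-Mortola bound applies at
  -- each time separately.
  have hmem0 : ∀ t > 0, ∀ x, u t x ∈ Icc (-R) (1 - c) := by
    intro t ht x
    have cux := continuous_slice H.cont_slope ht
    have cu := continuous_slice H.cont ht
    have hd : normSq (slope u t) < ⊤ := by
      have h1 : 1 / 2 * normSq (slope u t) ≤ 2 * kinkEnergy G := by
        rw [← lintegral_half_sq]
        refine le_trans (lintegral_mono fun x => ENNReal.ofReal_le_ofReal ?_)
          ((h.energy_eq ht).symm.le.trans ((hen t ht).trans hE0))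
        exact le_add_of_nonneg_right (hG.nonneg _)
      by_contra hcon
      rw [not_lt, top_le_iff] at hcon
      rw [hcon, ENNReal.mul_top (by simp), top_le_iff] at h1
      exact h2k h1
    obtain ⟨B, hB, hB1, -⟩ := hL2 t
    obtain ⟨l1, l2⟩ := tendsto_zero_of_normSq (f := fun x => u t x + 1)
      (fun x => (H.deriv_u t ht x).add_const 1) cux ((hB1 t ⟨ht.le, le_rfl⟩).trans_lt hB) hd
    have l1' : Tendsto (u t) atBot (𝓝 (-1)) := by simpa using l1.add_const (-1)
    have l2' : Tendsto (u t) atTop (𝓝 (-1)) := by simpa using l2.add_const (-1)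
    have hb := two_abs_primH_le hG (H.deriv_u t ht) cux l1' l2' x
    refine hrange _ (le_trans (add_le_add (hb.trans ?_) le_rfl) hE)
    exact (h.energy_eq ht).symm.le.trans (hen t ht)
  have e0 : u 0 = u₀ := funext h.initial
  refine ⟨⟨hW, by rw [e0]; exact h, fun t ht x => ?_, ENNReal.toReal_nonneg, fun t ht => ?_,
    fun s hs t hst => ?_, hL2⟩, hen⟩
  · rcases (show 0 ≤ t from ht).eq_or_lt with rfl | ht'
    · refine isClosed_Icc.mem_of_tendsto (h.tendsto_zero x) ?_
      filter_upwards [self_mem_nhdsWithin] with s hs using hmem0 s hs x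
    · exact hmem0 t ht' x
  · rw [ENNReal.ofReal_toReal h2k, ← h.energy_eq ht]
    exact (hen t ht).trans hE0
  · have := h.energy_inequality hG hs hst
    rwa [h.energy_eq hs, h.energy_eq (lt_of_lt_of_le hs hst)] at this

/-! ### Local masses -/

/-- A positive integrable majorant of `|f + 1|`. -/
def majorant (f : ℝ → ℝ) (z : ℝ) : ℝ := |f z + 1| + tail 1 0 z

/-- The mass of the majorant seen from `y` at scale `L`. -/
def localMass (f : ℝ → ℝ) (L y : ℝ) : ℝ := ∫ z, tail L y z * majorant f z

section localMass
variable {f : ℝ → ℝ}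

lemma majorant_pos (f : ℝ → ℝ) (z : ℝ) : 0 < majorant f z :=
  add_pos_of_nonneg_of_pos (abs_nonneg _) (tail_pos _ _ _)

lemma continuous_majorant (hf : Continuous f) : Continuous (majorant f) := by
  unfold majorant; fun_prop

lemma lintegral_majorant (hf : Continuous f) :
    ∫⁻ z, ENNReal.ofReal (majorant f z) = excessMass f + ENNReal.ofReal Real.pi := by
  have := lintegral_tail one_pos 0
  rw [mul_one] at this
  rw [excessMass, ← this, ← lintegral_add_left (by fun_prop)]
  exact lintegral_congr fun z => ENNReal.ofReal_add (abs_nonneg _) (tail_pos _ _ _).le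

lemma integrable_majorant (hf : Continuous f) (hV : excessMass f < ⊤) : Integrable (majorant f) := by
  refine ⟨(continuous_majorant hf).aestronglyMeasurable, ?_⟩
  rw [hasFiniteIntegral_iff_ofReal (ae_of_all _ fun x => (majorant_pos f x).le),
    lintegral_majorant hf]
  exact ENNReal.add_lt_top.2 ⟨hV, ENNReal.ofReal_lt_top⟩

lemma integrable_tail_mul_majorant (hf : Continuous f) (hV : excessMass f < ⊤) (L y : ℝ) :
    Integrable fun z => tail L y z * majorant f z := by
  refine (integrable_majorant hf hV).mono'
    ((continuous_tail L y).mul (continuous_majorant hf)).aestronglyMeasurable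
    (ae_of_all _ fun z => ?_)
  rw [Real.norm_of_nonneg (mul_nonneg (tail_pos _ _ _).le (majorant_pos f z).le)]
  exact mul_le_of_le_one_left (majorant_pos f z).le (tail_le_one _ _ _)

lemma localMass_nonneg (f : ℝ → ℝ) (L y : ℝ) : 0 ≤ localMass f L y :=
  integral_nonneg fun z => mul_nonneg (tail_pos _ _ _).le (majorant_pos f z).le

lemma localMass_pos (hf : Continuous f) (hV : excessMass f < ⊤) (L y : ℝ) :
    0 < localMass f L y := by
  refine (integral_pos_iff_support_of_nonneg (fun z => mul_nonneg (tail_pos _ _ _).le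
    (majorant_pos f z).le) (integrable_tail_mul_majorant hf hV L y)).2 ?_
  have : Function.support (fun z => tail L y z * majorant f z) = univ := by
    ext z; simpa using ⟨(tail_pos L y z).ne', (majorant_pos f z).ne'⟩
  rw [this]; simp

lemma tail_joint (L : ℝ) : Continuous fun z : ℝ × ℝ => tail L z.1 z.2 := by
  unfold tail
  have : ∀ z : ℝ × ℝ, 1 + ((z.2 - z.1) / L) ^ 2 ≠ 0 := fun x => by positivity
  fun_prop (disch := assumption)

/-- Tonelli and the symmetry of the kernel in its two points. Integration over centres converts
local masses back into the total mass. -/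
lemma lintegral_localMass (hf : Continuous f) (hV : excessMass f < ⊤) {L : ℝ} (hL : 0 < L) :
    ∫⁻ y, ENNReal.ofReal (localMass f L y) =
      ENNReal.ofReal (Real.pi * L) * (excessMass f + ENNReal.ofReal Real.pi) := by
  have e : ∀ y, ENNReal.ofReal (localMass f L y) =
      ∫⁻ z, ENNReal.ofReal (tail L y z * majorant f z) := fun y =>
    ofReal_integral_eq_lintegral_ofReal (integrable_tail_mul_majorant hf hV L y)
      (ae_of_all _ fun z => mul_nonneg (tail_pos _ _ _).le (majorant_pos f z).le)
  simp_rw [e]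
  have cm := continuous_majorant hf
  have cj := tail_joint L
  rw [lintegral_lintegral_swap]
  · rw [← lintegral_majorant hf, ← lintegral_const_mul' _ _ ENNReal.ofReal_ne_top]
    refine lintegral_congr fun z => ?_
    rw [← lintegral_tail hL z, ← lintegral_mul_const' _ _ ENNReal.ofReal_ne_top]
    refine lintegral_congr fun y => ?_
    rw [tail_symm, ENNReal.ofReal_mul (tail_pos _ _ _).le]
  · exact (Measurable.ennreal_ofReal (by fun_prop)).aemeasurable

/-- Between `y` and `x` the kernel is at least `(1 + ((x - y) / L)²)⁻¹`, its value at the endpoint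
`x`. -/
lemma abs_integral_le_localMass (hf : Continuous f) (hV : excessMass f < ⊤) {L : ℝ}
    (x y : ℝ) :
    |∫ z in y..x, (f z + 1)| ≤ (1 + ((x - y) / L) ^ 2) * localMass f L y := by
  have hi := integrable_tail_mul_majorant hf hV L y
  have hpos : 0 < 1 + ((x - y) / L) ^ 2 := by positivity
  have hpt : ∀ z ∈ uIoc y x, |f z + 1| ≤ (1 + ((x - y) / L) ^ 2) * (tail L y z * majorant f z) := by
    intro z hz
    have h1 : ((z - y) / L) ^ 2 ≤ ((x - y) / L) ^ 2 := by
      rw [div_pow, div_pow]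
      refine div_le_div_of_nonneg_right (sq_le_sq.2 ?_) (sq_nonneg _)
      rcases le_total y x with h | h
      · rw [uIoc_of_le h] at hz
        rw [abs_of_nonneg (by linarith [hz.1]), abs_of_nonneg (by linarith)]; linarith [hz.2]
      · rw [uIoc_of_ge h] at hz
        rw [abs_of_nonpos (by linarith [hz.2]), abs_of_nonpos (by linarith)]; linarith [hz.1]
    have h2 : 1 ≤ (1 + ((x - y) / L) ^ 2) * tail L y z := by
      unfold tail
      rw [← div_eq_mul_inv, one_le_div (by positivity)]; linarith
    have h3 : |f z + 1| ≤ majorant f z := le_add_of_nonneg_right (tail_pos _ _ _).le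
    have h4 := (majorant_pos f z).le
    calc |f z + 1| ≤ 1 * majorant f z := by linarith
      _ ≤ ((1 + ((x - y) / L) ^ 2) * tail L y z) * majorant f z := by gcongr
      _ = _ := by ring
  have hii : IntegrableOn (fun z => (1 + ((x - y) / L) ^ 2) * (tail L y z * majorant f z)) (uIoc y x) :=
    (hi.const_mul _).integrableOn
  calc |∫ z in y..x, (f z + 1)| ≤ ∫ z in uIoc y x, |f z + 1| :=
        intervalIntegral.norm_integral_le_integral_norm_uIoc (f := fun z => f z + 1)
    _ ≤ ∫ z in uIoc y x, (1 + ((x - y) / L) ^ 2) * (tail L y z * majorant f z) := by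
        refine setIntegral_mono_on ?_ hii measurableSet_uIoc hpt
        refine Integrable.mono' hii (by fun_prop) ?_
        refine (ae_restrict_iff' measurableSet_uIoc).2 (ae_of_all _ fun z hz => ?_)
        simpa using hpt z hz
    _ ≤ ∫ z, (1 + ((x - y) / L) ^ 2) * (tail L y z * majorant f z) :=
        setIntegral_le_integral (hi.const_mul _) (ae_of_all _ fun z =>
          mul_nonneg hpos.le (mul_nonneg (tail_pos _ _ _).le (majorant_pos f z).le))
    _ = _ := integral_const_mul _ _

lemma wint_sq_primitive_le (hf : Continuous f) (hV : excessMass f < ⊤) {L y : ℝ} (hL : 0 < L) :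
    wint L y (fun x => (∫ z in y..x, (f z + 1)) ^ 2) ≤
      ENNReal.ofReal (localMass f L y ^ 2 * (Real.pi * L)) := by
  refine wint_le_of_le hL (sq_nonneg _) fun x => ?_
  rw [← mul_pow, ← sq_abs]
  refine pow_le_pow_left₀ (abs_nonneg _) ?_ 2
  rw [mul_comm]
  exact abs_integral_le_localMass hf hV x y

/-- Global `L¹` bound from local `L²` bounds. -/
lemma lintegral_abs_le_of_wint (hf : Continuous f) (hV : excessMass f < ⊤) {g : ℝ → ℝ}
    (hg : Continuous g) {L a : ℝ} (hL : 0 < L) (ha : 0 ≤ a)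
    (h : ∀ y, wint L y (fun x => g x ^ 2) ≤ ENNReal.ofReal (a * L⁻¹ * localMass f L y ^ 2)) :
    ∫⁻ x, ENNReal.ofReal |g x| ≤
      ENNReal.ofReal (2 * Real.pi * (Real.pi + a)) * (excessMass f + ENNReal.ofReal Real.pi) := by
  have hπ := Real.pi_pos
  -- Young's inequality with parameter `m / L`, where `m` is the local mass at the centre `y`; this
  -- balances the two terms. The positivity of the majorant makes the division legitimate.
  have h1 : ∀ y, wint L y (fun x => |g x|) ≤
      ENNReal.ofReal ((Real.pi + a) / 2) * ENNReal.ofReal (localMass f L y) := by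
    intro y
    have hm := localMass_pos hf hV L y
    set m := localMass f L y with hmdef
    calc wint L y (fun x => |g x|) ≤ wint L y (fun x => m / (2 * L) + L / (2 * m) * g x ^ 2) := by
          refine wint_mono fun x => ?_
          have : (|g x| - m / L) ^ 2 * (L / (2 * m)) =
              m / (2 * L) + L / (2 * m) * g x ^ 2 - |g x| := by
            rw [sub_sq, sq_abs]; field_simp; ring
          have h2 : 0 ≤ (|g x| - m / L) ^ 2 * (L / (2 * m)) := by positivity
          linarith
      _ = wint L y (fun x => m / (2 * L)) + ENNReal.ofReal (L / (2 * m)) *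
            wint L y (fun x => g x ^ 2) := by
          rw [wint_add continuous_const (fun x => by positivity) (fun x => by positivity),
            wint_const_mul (by positivity)]
      _ ≤ ENNReal.ofReal (m / (2 * L) * (Real.pi * L)) + ENNReal.ofReal (L / (2 * m)) *
            ENNReal.ofReal (a * L⁻¹ * m ^ 2) := by
          gcongr
          · exact wint_le_of_le_const hL (by positivity) fun x => le_rfl
          · exact h y
      _ = _ := by
          rw [← ENNReal.ofReal_mul (by positivity), ← ENNReal.ofReal_mul (by positivity),
            ← ENNReal.ofReal_add (by positivity) (by positivity)]
          congr 1
          field_simp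
  have cw : Continuous fun z : ℝ × ℝ => weight L z.1 z.2 := (tail_joint L).pow 3
  -- Integration over centres: every `x` is seen with weight at least `1 / 8` from an interval of
  -- length `2L`.
  have h2 : ENNReal.ofReal (L / 4) * ∫⁻ x, ENNReal.ofReal |g x| ≤
      ∫⁻ y, wint L y (fun x => |g x|) := by
    unfold wint
    rw [lintegral_lintegral_swap (Measurable.ennreal_ofReal (by fun_prop)).aemeasurable,
      ← lintegral_const_mul' _ _ ENNReal.ofReal_ne_top]
    refine lintegral_mono fun x => ?_
    calc ENNReal.ofReal (L / 4) * ENNReal.ofReal |g x|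
        = ENNReal.ofReal (1 / 8 * |g x|) * ENNReal.ofReal ((x + L) - (x - L)) := by
          rw [← ENNReal.ofReal_mul (by positivity), ← ENNReal.ofReal_mul (by positivity)]
          congr 1; ring
      _ ≤ ∫⁻ y in Ioc (x - L) (x + L), ENNReal.ofReal (weight L y x * |g x|) := by
          refine le_setLIntegral_Ioc fun y h1 h2 => ENNReal.ofReal_le_ofReal ?_
          gcongr
          have h3 : ((x - y) / L) ^ 2 ≤ 1 := by
            rw [div_pow, div_le_one (by positivity), sq_le_sq, abs_of_pos hL, abs_le]
            constructor <;> linarith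
          have h4 : (1 / 2 : ℝ) ≤ tail L y x := by
            unfold tail
            rw [one_div]
            exact inv_anti₀ (by positivity) (by linarith)
          rw [weight_eq_tail_pow]
          calc (1 / 8 : ℝ) = (1 / 2) ^ 3 := by norm_num
            _ ≤ _ := by gcongr
      _ ≤ _ := setLIntegral_le_lintegral _ _
  have h3 := h2.trans (lintegral_mono h1)
  rw [lintegral_const_mul' _ _ ENNReal.ofReal_ne_top, lintegral_localMass hf hV hL] at h3
  have h4 : ENNReal.ofReal (4 / L) * (ENNReal.ofReal (L / 4) * ∫⁻ x, ENNReal.ofReal |g x|) ≤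
      ENNReal.ofReal (4 / L) * (ENNReal.ofReal ((Real.pi + a) / 2) *
        (ENNReal.ofReal (Real.pi * L) * (excessMass f + ENNReal.ofReal Real.pi))) := by
    gcongr
  have e1 : ENNReal.ofReal (4 / L) * ENNReal.ofReal (L / 4) = 1 := by
    rw [← ENNReal.ofReal_mul (by positivity)]
    rw [show 4 / L * (L / 4) = 1 by field_simp, ENNReal.ofReal_one]
  rw [← mul_assoc, e1, one_mul] at h4
  refine h4.trans (le_of_eq ?_)
  rw [← mul_assoc, ← mul_assoc, ← ENNReal.ofReal_mul (by positivity),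
    ← ENNReal.ofReal_mul (by positivity)]
  congr 2
  field_simp; ring

end localMass

/-! ### The mass potential -/

variable {G : ℝ → ℝ} {u : ℝ → ℝ → ℝ}

/-- A space primitive of `u + 1` whose time derivative is `p_x`. -/
def massPot (G : ℝ → ℝ) (u : ℝ → ℝ → ℝ) (s y τ x : ℝ) : ℝ :=
  (∫ z in y..x, (u τ z + 1)) + ∫ σ in s..τ, potX G u σ y

lemma hasDerivAt_intervalIntegral_param {F F' : ℝ → ℝ → ℝ} {a y x τ : ℝ}
    (hF : ContinuousOn (fun z : ℝ × ℝ => F z.1 z.2) (Ioi a ×ˢ univ))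
    (hF' : ContinuousOn (fun z : ℝ × ℝ => F' z.1 z.2) (Ioi a ×ˢ univ))
    (hd : ∀ τ > a, ∀ x, HasDerivAt (fun τ => F τ x) (F' τ x) τ) (hτ : a < τ) :
    HasDerivAt (fun τ => ∫ z in y..x, F τ z) (∫ z in y..x, F' τ z) τ := by
  obtain ⟨b, hab, hbτ⟩ := exists_between hτ
  have hK : IsCompact (Icc b (τ + 1) ×ˢ uIcc y x) := isCompact_Icc.prod isCompact_uIcc
  obtain ⟨M, hM⟩ := hK.exists_bound_of_continuousOn (hF'.mono fun z hz =>
    ⟨lt_of_lt_of_le hab hz.1.1, mem_univ _⟩)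
  have hs : Ioo b (τ + 1) ∈ 𝓝 τ := Ioo_mem_nhds hbτ (by linarith)
  refine (intervalIntegral.hasDerivAt_integral_of_dominated_loc_of_deriv_le
    (F := F) (F' := F') (bound := fun _ => M) hs ?_ ?_ ?_ ?_ ?_ ?_).2
  · filter_upwards [Ioi_mem_nhds hτ] with σ hσ
    exact (continuous_slice hF hσ).aestronglyMeasurable
  · exact (continuous_slice hF hτ).intervalIntegrable _ _
  · exact (continuous_slice hF' hτ).aestronglyMeasurable
  · exact ae_of_all _ fun z hz σ hσ =>
      hM (σ, z) ⟨⟨hσ.1.le, hσ.2.le⟩, uIoc_subset_uIcc hz⟩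
  · exact intervalIntegrable_const
  · exact ae_of_all _ fun z _ σ hσ => hd σ (hab.trans hσ.1) z

lemma hasDerivAt_primitive_Ioi {f : ℝ → ℝ} (hf : ContinuousOn f (Ioi 0)) {s τ : ℝ} (hs : 0 < s)
    (hτ : 0 < τ) : HasDerivAt (fun τ => ∫ σ in s..τ, f σ) (f τ) τ := by
  have hsub : uIcc s τ ⊆ Ioi 0 := fun z hz => lt_of_lt_of_le (lt_min hs hτ) hz.1
  exact intervalIntegral.integral_hasDerivAt_right (hf.mono hsub).intervalIntegrable
    (hf.stronglyMeasurableAtFilter isOpen_Ioi τ hτ) (hf.continuousAt (Ioi_mem_nhds hτ))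

/-- The integral of `u_t = p_xx` from `y` to `x` is `p_x(x) - p_x(y)`; the time integral in the
definition restores `p_x(y)`. Thus `w_t = p_x` with `p = G'(w_x - 1) - w_xxx`, an equation in
divergence form. -/
lemma RegularFlow.massPot_family (H : RegularFlow G u) {s : ℝ} (hs : 0 < s) (y : ℝ) :
    TimeFamily 0 (massPot G u s y) (fun t x => u t x + 1) (slope u) (potX G u) := by
  have T := H.timeFamily
  have cA := continuousOn_time_slice H.cont_potX y
  have dA := fun {τ : ℝ} (hτ : 0 < τ) => hasDerivAt_primitive_Ioi cA hs hτ
  have cA' : ContinuousOn (fun τ => ∫ σ in s..τ, potX G u σ y) (Ioi 0) := fun τ hτ =>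
    (dA hτ).continuousAt.continuousWithinAt
  refine ⟨(continuousOn_primitive (F := fun t x => u t x + 1) T.cont0 y).add
    (cA'.comp continuousOn_fst fun z hz => hz.1 :
      ContinuousOn (fun z : ℝ × ℝ => ∫ σ in s..z.1, potX G u σ y) _), T.cont0, T.cont1, H.cont_potX,
    fun τ hτ x => (hasDerivAt_primitive (f := fun x => u τ x + 1)
      (continuous_slice (F := fun t x => u t x + 1) T.cont0 hτ) y x).add_const _,
    T.deriv0, fun τ hτ x => ?_⟩
  refine ((hasDerivAt_intervalIntegral_param T.cont0 T.contt T.derivt hτ).add (dA hτ)).congr_deriv ?_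
  rw [intervalIntegral.integral_eq_sub_of_hasDerivAt (fun z _ => H.deriv_potX τ hτ z)
    ((continuous_slice H.cont_potXX hτ).intervalIntegrable _ _)]
  ring

/-- The mass potential grows at most linearly. -/
lemma RegularFlow.massPot_growth (H : RegularFlow G u) {K s t y L : ℝ} (hs : 0 < s) (hst : s ≤ t)
    (hL : 0 < L) (hK : ∀ τ ∈ Icc s t, ∀ x, |u τ x + 1| ≤ K) :
    ∃ C, 0 ≤ C ∧ ∀ τ ∈ Icc s t, ∀ x,
      |massPot G u s y τ x| ≤ C * (1 + ((x - y) / L) ^ 2) := by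
  have hK0 : 0 ≤ K := (abs_nonneg _).trans (hK s ⟨le_rfl, hst⟩ 0)
  have cA : ContinuousOn (fun τ => massPot G u s y τ y) (Icc s t) :=
    (continuousOn_time_slice (H.massPot_family hs y).cont0 y).mono fun τ hτ => lt_of_lt_of_le hs hτ.1
  obtain ⟨M, hM⟩ := isCompact_Icc.exists_bound_of_continuousOn cA
  have hM0 : 0 ≤ M := (norm_nonneg _).trans (hM s ⟨le_rfl, hst⟩)
  refine ⟨M + K * L, by positivity, fun τ hτ x => ?_⟩
  have e : massPot G u s y τ x = massPot G u s y τ y + ∫ z in y..x, (u τ z + 1) := by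
    simp only [massPot, intervalIntegral.integral_same]; ring
  have h1 := intervalIntegral.norm_integral_le_of_norm_le_const (a := y) (b := x)
    (f := fun z => u τ z + 1) fun z _ => hK τ hτ z
  have h2 := hM τ hτ
  rw [Real.norm_eq_abs] at h1 h2
  set Z := (x - y) / L with hZ
  have h3 : |x - y| = L * |Z| := by rw [hZ, abs_div, abs_of_pos hL]; field_simp
  have h4 : |Z| ≤ 1 + Z ^ 2 := by nlinarith [sq_nonneg (|Z| - 1), sq_abs Z]
  rw [e]
  calc _ ≤ M + K * (L * |Z|) := (abs_add_le _ _).trans (add_le_add h2 (by rwa [← h3]))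
    _ ≤ M * (1 + Z ^ 2) + K * (L * (1 + Z ^ 2)) := by
        gcongr
        nlinarith [sq_nonneg Z]
    _ = _ := by ring

lemma RegularFlow.wint_massPot_bounded (H : RegularFlow G u) {K s t y L : ℝ} (hs : 0 < s)
    (hst : s ≤ t) (hL : 0 < L) (hK : ∀ τ ∈ Icc s t, ∀ x, |u τ x + 1| ≤ K) :
    ∃ M : ℝ≥0∞, M ≠ ⊤ ∧ ∀ τ ∈ Icc s t, wint L y (fun x => massPot G u s y τ x ^ 2) ≤ M := by
  obtain ⟨C, hC, h⟩ := H.massPot_growth (y := y) hs hst hL hK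
  refine ⟨ENNReal.ofReal (C ^ 2 * (Real.pi * L)), ENNReal.ofReal_ne_top, fun τ hτ =>
    wint_le_of_le hL (sq_nonneg C) fun x => ?_⟩
  rw [← mul_pow, ← sq_abs]
  exact pow_le_pow_left₀ (abs_nonneg _) (h τ hτ x) 2

lemma massPot_initial (s y x : ℝ) : massPot G u s y s x = ∫ z in y..x, (u s z + 1) := by
  simp [massPot]

/-! ### The short-time bound for the excess mass -/

variable {I : Set ℝ} {K κ ρ E : ℝ}

lemma Tame.abs_le (h : Tame G I K κ ρ E u) {t : ℝ} (ht : 0 ≤ t) (x : ℝ) : |u t x + 1| ≤ K :=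
  h.well.abs_le _ (h.mem t ht x)

lemma Tame.sq_le (h : Tame G I K κ ρ E u) {t : ℝ} (ht : 0 ≤ t) (x : ℝ) :
    (u t x + 1) ^ 2 ≤ K ^ 2 := by
  rw [← sq_abs]; exact pow_le_pow_left₀ (abs_nonneg _) (h.abs_le ht x) 2

/-- Transfer of a bound with the potential at time `s` to time `0`. -/
lemma Tame.tendsto_wint_primitive (h : Tame G I K κ ρ E u) {L y : ℝ} (hL : 0 < L) :
    Tendsto (fun s => wint L y (fun x => (∫ z in y..x, (u s z + 1)) ^ 2)) (𝓝[>] 0)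
      (𝓝 (wint L y (fun x => (∫ z in y..x, (u 0 z + 1)) ^ 2))) := by
  have hK0 : 0 ≤ K := by linarith [h.well.one_le]
  have cc : ContinuousOn (fun z : ℝ × ℝ => u z.1 z.2 + 1) (Ici 0 ×ˢ univ) :=
    h.smooth.continuousOn.add continuousOn_const
  have cp := continuousOn_primitive (F := fun t x => u t x + 1) cc y
  refine tendsto_wint_zero (f := fun s x => (∫ z in y..x, (u s z + 1)) ^ 2) (C := (K * L) ^ 2) hL
    (sq_nonneg _) ?_ (fun x => Tendsto.pow ?_ 2) ?_
  · filter_upwards [self_mem_nhdsWithin] with s hs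
    exact (continuous_slice (F := fun s x => ∫ z in y..x, (u s z + 1)) cp
      (mem_Ici.2 (mem_Ioi.1 hs).le)).pow 2
  · exact ((continuousOn_time_slice (F := fun s x => ∫ z in y..x, (u s z + 1)) cp x) 0
      self_mem_Ici).mono_left (nhdsWithin_mono _ Ioi_subset_Ici_self)
  · filter_upwards [self_mem_nhdsWithin] with s hs x
    have h1 := intervalIntegral.norm_integral_le_of_norm_le_const (a := y) (b := x)
      (f := fun z => u s z + 1) fun z _ => h.abs_le (le_of_lt hs) z
    rw [Real.norm_eq_abs] at h1
    rw [← mul_pow, ← sq_abs]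
    refine pow_le_pow_left₀ (abs_nonneg _) (h1.trans ?_) 2
    set Z := (x - y) / L with hZ
    have h3 : |x - y| = L * |Z| := by rw [hZ, abs_div, abs_of_pos hL]; field_simp
    have h4 : |Z| ≤ 1 + Z ^ 2 := by nlinarith [sq_nonneg (|Z| - 1), sq_abs Z]
    rw [h3, mul_assoc]
    gcongr

/-- Smoothing from the mass potential to its derivative `u + 1`. The estimate for the potential
bounds the time integral of `l⁻² (u + 1)²`; since the weighted `L²` norm at most doubles over the
interval, the final time is bounded by the time average. -/
lemma Tame.wint_le_of_short (h : Tame G I K κ ρ E u) {l L y s t : ℝ} (hl : 0 < l) (hl1 : l ≤ 1)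
    (hlL : l ≤ L) (hs : 0 < s) (hst : s ≤ t) (hsm : shortConst K * l⁻¹ ^ 4 * (t - s) ≤ 1 / 2) :
    ENNReal.ofReal (t - s) * wint L y (fun x => (u t x + 1) ^ 2) ≤
      ENNReal.ofReal (8 * l ^ 2) * wint L y (fun x => (∫ z in y..x, (u s z + 1)) ^ 2) := by
  have H := h.regularFlow
  have hL : 0 < L := hl.trans_le hlL
  have hK1 := h.well.one_le
  have hK0 : 0 ≤ K := by linarith
  have hS := shortConst_pos hK0
  have hp : ∀ τ ∈ Icc s t, 0 < τ := fun τ hτ => lt_of_lt_of_le hs hτ.1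
  have hG : ∀ τ ∈ Icc s t, ∀ x, |deriv G (u τ x)| ≤ K * |u τ x + 1| := fun τ hτ x =>
    h.well.deriv_le _ (h.mem τ (hp τ hτ).le x)
  have hhalf : ∀ σ ∈ Icc s t, ENNReal.ofReal (shortConst K * l⁻¹ ^ 4) * ENNReal.ofReal (t - σ) ≤
      1 / 2 := fun σ hσ => ofReal_mul_ofReal_le_half (by positivity) (le_trans (by
        gcongr; exact hσ.1) hsm)
  obtain ⟨M, hM, hMb⟩ := H.wint_massPot_bounded (y := y) hs hst hL fun τ hτ x =>
    h.abs_le (hp τ hτ).le x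
  have F := H.massPot_family hs y
  have cG' := continuous_deriv_of_contDiff_two H.contG
  have hN := (absorb (N := fun τ => wint L y (fun x => massPot G u s y τ x ^ 2))
    (J := fun τ => ∫⁻ σ in Ioc s τ, wint L y (fun x => 1 / 2 * (l⁻¹ ^ 2 * (u σ x + 1) ^ 2)))
    hM hMb (fun τ hτ => by
      have := F.weighted_divergence (y := y) (P := pot G u) (g := fun τ x => deriv G (u τ x))
        hl hl1 hlL hs hτ.1 hK0
        (fun σ hσ x => by
          refine (H.deriv_slope σ (lt_of_lt_of_le hs hσ.1) x).congr_deriv ?_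
          simp [pot])
        (fun σ hσ x => H.deriv_pot σ (lt_of_lt_of_le hs hσ.1) x)
        (fun σ hσ => cG'.comp (continuous_slice H.cont (lt_of_lt_of_le hs hσ.1)))
        (fun σ hσ x => hG σ ⟨hσ.1, hσ.2.trans hτ.2⟩ x)
      refine le_trans (add_le_add le_rfl (setLIntegral_mono_Ioc fun σ _ _ => wint_mono fun x => ?_))
        (this.trans (add_le_add le_rfl (le_of_eq ?_)))
      · nlinarith [sq_nonneg (slope u σ x)]
      · rw [← lintegral_const_mul' _ _ ENNReal.ofReal_ne_top]
        refine lintegral_congr fun σ => ?_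
        rw [← wint_const_mul (by positivity)]
        congr 1; ext x; unfold shortConst; ring)
    (hhalf s ⟨le_rfl, hst⟩) ⟨hst, le_rfl⟩).2
  have hX : ∀ τ, s < τ → τ ≤ t → wint L y (fun x => (u t x + 1) ^ 2) ≤
      2 * wint L y (fun x => (u τ x + 1) ^ 2) := by
    intro τ h1 h2
    have hτ : 0 < τ := hs.trans h1
    have := (absorb (N := fun τ => wint L y (fun x => (u τ x + 1) ^ 2)) (J := 0) (s := τ) (t := t)
      (c := ENNReal.ofReal (shortConst K * l⁻¹ ^ 4))
      (M := ENNReal.ofReal (K ^ 2 * (Real.pi * L))) ENNReal.ofReal_ne_top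
      (fun σ hσ => wint_le_of_le_const hL (sq_nonneg _) (h.sq_le (hτ.le.trans hσ.1)))
      (fun σ hσ => by
        simp only [Pi.zero_apply, add_zero]
        exact le_trans le_self_add (H.weighted_mass hl hl1 hlL hτ hσ.1 hK0
          fun r hr x => hG r ⟨h1.le.trans hr.1, hr.2.trans hσ.2⟩ x))
      (hhalf τ ⟨h1.le, h2⟩) ⟨h2, le_rfl⟩).2
    simpa using this
  have e1 : ENNReal.ofReal (t - s) * wint L y (fun x => (u t x + 1) ^ 2) ≤
      ENNReal.ofReal (4 * l ^ 2) *
        ∫⁻ σ in Ioc s t, wint L y (fun x => 1 / 2 * (l⁻¹ ^ 2 * (u σ x + 1) ^ 2)) := by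
    rw [mul_comm, ← lintegral_const_mul' _ _ ENNReal.ofReal_ne_top]
    refine le_setLIntegral_Ioc fun τ h1 h2 => (hX τ h1 h2).trans (le_of_eq ?_)
    rw [← wint_const_mul (by positivity), show (2 : ℝ≥0∞) = ENNReal.ofReal 2 by simp,
      ← wint_const_mul (by norm_num)]
    congr 1; ext x; field_simp; ring
  refine e1.trans ?_
  have e2 := le_trans le_add_self hN
  simp only [massPot_initial] at e2
  calc _ ≤ ENNReal.ofReal (4 * l ^ 2) *
        (2 * wint L y (fun x => (∫ z in y..x, (u s z + 1)) ^ 2)) := by gcongr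
    _ = _ := by
      rw [← mul_assoc, show (2 : ℝ≥0∞) = ENNReal.ofReal 2 by simp,
        ← ENNReal.ofReal_mul (by positivity)]
      congr 2; ring

/-- Short-time propagation of integrability. -/
lemma Tame.excessMass_le_short (h : Tame G I K κ ρ E u) (hV : excessMass (u 0) < ⊤) {t : ℝ}
    (ht : 0 < t) (ht1 : 2 * shortConst K * t ≤ 1) :
    excessMass (u t) ≤ ENNReal.ofReal (2 * Real.pi * (Real.pi + 16 * Real.pi * shortConst K)) *
      (excessMass (u 0) + ENNReal.ofReal Real.pi) := by
  have hK1 := h.well.one_le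
  have hS := shortConst_pos (by linarith : 0 ≤ K)
  have hπ := Real.pi_pos
  have c0 := h.smooth.continuous_at_time le_rfl
  have ct := h.smooth.continuous_at_time ht.le
  -- Fourth-order scaling, `l⁴ = 2 shortConst K * t`: the smallness condition of the smoothing
  -- estimate becomes an equality as `s → 0`.
  set l := Real.sqrt (Real.sqrt (2 * shortConst K * t)) with hl
  have hl0 : 0 < l := by positivity
  have hl4 : l ^ 4 = 2 * shortConst K * t := by
    rw [hl, show (4 : ℕ) = 2 * 2 from rfl, pow_mul, Real.sq_sqrt (Real.sqrt_nonneg _),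
      Real.sq_sqrt (by positivity)]
  have hl1 : l ≤ 1 := by
    by_contra hcon
    have := one_lt_pow₀ (not_le.1 hcon) (show (4 : ℕ) ≠ 0 by norm_num)
    linarith
  refine lintegral_abs_le_of_wint c0 hV (g := fun x => u t x + 1) (by fun_prop) hl0
    (by positivity) fun y => ?_
  have key : ENNReal.ofReal t * wint l y (fun x => (u t x + 1) ^ 2) ≤
      ENNReal.ofReal (8 * l ^ 2) * wint l y (fun x => (∫ z in y..x, (u 0 z + 1)) ^ 2) := by
    have l1 : Tendsto (fun s : ℝ => ENNReal.ofReal (t - s) * wint l y (fun x => (u t x + 1) ^ 2))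
        (𝓝[>] 0) (𝓝 (ENNReal.ofReal t * wint l y (fun x => (u t x + 1) ^ 2))) := by
      refine ENNReal.Tendsto.mul_const ?_ (Or.inl (by simpa using ht))
      have : Tendsto (fun s : ℝ => t - s) (𝓝[>] 0) (𝓝 t) := by
        have hc : Continuous fun s : ℝ => t - s := by fun_prop
        simpa using (hc.tendsto 0).mono_left (nhdsWithin_le_nhds (s := Ioi 0))
      exact ENNReal.tendsto_ofReal this
    refine le_of_tendsto_of_tendsto l1
      (ENNReal.Tendsto.const_mul (h.tendsto_wint_primitive hl0) (Or.inr ENNReal.ofReal_ne_top)) ?_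
    filter_upwards [Ioc_mem_nhdsGT ht] with s hs
    refine h.wint_le_of_short hl0 hl1 le_rfl hs.1 hs.2 ?_
    have : shortConst K * l⁻¹ ^ 4 * t = 1 / 2 := by
      rw [inv_pow, hl4]; field_simp
    rw [← this]
    gcongr
    linarith [hs.1]
  have k2 := key.trans (mul_le_mul' le_rfl (wint_sq_primitive_le c0 hV hl0))
  have k3 : ENNReal.ofReal t⁻¹ * (ENNReal.ofReal t * wint l y (fun x => (u t x + 1) ^ 2)) ≤
      ENNReal.ofReal t⁻¹ * (ENNReal.ofReal (8 * l ^ 2) *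
        ENNReal.ofReal (localMass (u 0) l y ^ 2 * (Real.pi * l))) := by gcongr
  rw [← mul_assoc, ← ENNReal.ofReal_mul (by positivity), inv_mul_cancel₀ ht.ne',
    ENNReal.ofReal_one, one_mul, ← ENNReal.ofReal_mul (by positivity),
    ← ENNReal.ofReal_mul (by positivity)] at k3
  refine k3.trans (le_of_eq ?_)
  congr 1
  have : shortConst K = l ^ 4 / (2 * t) := by rw [hl4]; field_simp
  rw [this]
  field_simp
  ring

/-! ### Decay on time intervals on which the solution stays near the well -/

/-- The constant of the monotone estimates. -/
def monoConst (K κ : ℝ) : ℝ := 2 * cutoffConst * (9 + K ^ 2 / κ)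

lemma le_monoConst {K κ : ℝ} (hκ : 0 < κ) : 18 * cutoffConst ≤ monoConst K κ := by
  have := one_le_cutoffConst
  have h : 0 ≤ K ^ 2 / κ := by positivity
  unfold monoConst
  nlinarith

lemma monoConst_pos {K κ : ℝ} (hκ : 0 < κ) : 0 < monoConst K κ := by
  have := one_le_cutoffConst
  have := le_monoConst (K := K) hκ
  linarith

/-- For a monotone second-order part the localization error is `L⁻² q²`, so it can be absorbed over
times of order `L²`, however long. The result is a coercive bound with constants independent of the
time interval. -/
lemma TimeFamily.monotone_decay {a s t L y K κ : ℝ} {q q1 q2 qt : ℝ → ℝ → ℝ}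
    (H : TimeFamily a q q1 q2 qt) (hL : 1 ≤ L) (has : a < s) (hst : s ≤ t) (hK : 0 ≤ K)
    (hκ : 0 < κ) {P g : ℝ → ℝ → ℝ} {M : ℝ≥0∞} (hM : M ≠ ⊤)
    (hb : ∀ τ ∈ Icc s t, wint L y (fun x => q τ x ^ 2) ≤ M)
    (hq2 : ∀ τ ∈ Icc s t, ∀ x, HasDerivAt (q2 τ) (g τ x - P τ x) x)
    (hP : ∀ τ ∈ Icc s t, ∀ x, HasDerivAt (P τ) (qt τ x) x)
    (hg : ∀ τ ∈ Icc s t, Continuous (g τ))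
    (hgb : ∀ τ ∈ Icc s t, ∀ x, |g τ x| ≤ K * |q1 τ x|)
    (hgm : ∀ τ ∈ Icc s t, ∀ x, κ * q1 τ x ^ 2 ≤ q1 τ x * g τ x)
    (hsm : monoConst K κ * L⁻¹ ^ 2 * (t - s) ≤ 1 / 2) :
    wint L y (fun x => q t x ^ 2) + ∫⁻ τ in Ioc s t, wint L y (fun x => κ * q1 τ x ^ 2 + q2 τ x ^ 2) ≤
      2 * wint L y (fun x => q s x ^ 2) := by
  have hm := monoConst_pos (K := K) hκ
  have hL0 : 0 < L := by linarith
  refine (absorb (N := fun τ => wint L y (fun x => q τ x ^ 2))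
    (J := fun τ => ∫⁻ σ in Ioc s τ, wint L y (fun x => κ * q1 σ x ^ 2 + q2 σ x ^ 2))
    hM hb (fun τ hτ => ?_) (ofReal_mul_ofReal_le_half (by positivity) hsm) ⟨hst, le_rfl⟩).2
  have hsub : ∀ σ ∈ Icc s τ, σ ∈ Icc s t := fun σ hσ => ⟨hσ.1, hσ.2.trans hτ.2⟩
  have := H.weighted_monotone (y := y) hL has hτ.1 hK hκ (fun σ hσ => hq2 σ (hsub σ hσ))
    (fun σ hσ => hP σ (hsub σ hσ)) (fun σ hσ => hg σ (hsub σ hσ)) (fun σ hσ => hgb σ (hsub σ hσ))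
    (fun σ hσ => hgm σ (hsub σ hσ))
  refine le_trans (add_le_add le_rfl (le_of_eq (lintegral_congr fun σ => ?_)))
    (this.trans (add_le_add le_rfl (le_of_eq ?_)))
  · congr 1; ext x; ring
  · rw [← lintegral_const_mul' _ _ ENNReal.ofReal_ne_top]
    refine lintegral_congr fun σ => ?_
    rw [← wint_const_mul (by positivity)]
    congr 1; ext x; unfold monoConst; ring

/-- Passage to the weight in a stationary inequality. -/
lemma static_inequality {A R : ℝ → ℝ} {L y : ℝ} (hL : 0 < L) (hA : Continuous A) (hR : Continuous R)
    (hA0 : ∀ x, 0 ≤ A x) (hR0 : ∀ x, 0 ≤ R x)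
    (h : ∀ φ ψ, Cutoff cutoffConst L φ ψ → ∫ x, φ 0 x * A x ≤ ∫ x, ψ x * R x) :
    wint L y A ≤ wint L y R := by
  have := weighted_inequality (B := fun _ _ => 0) (A := fun _ => A) (R := fun _ => R) (L := L) (y := y)
    (a := 0) (s := 1) (t := 2) hL (by norm_num) (by norm_num) continuousOn_const
    (continuousOn_lift_space hA) (continuousOn_lift_space hR) (fun _ _ _ => le_rfl)
    (fun _ _ => hA0) (fun _ _ => hR0) fun φ ψ hC τ _ => ⟨0, by
      simpa using hasDerivAt_const τ (0 : ℝ), by linarith [h φ ψ hC]⟩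
  simp only [setLIntegral_const, Real.volume_Ioc] at this
  norm_num at this
  simpa [wint] using this

lemma wint_lt_top_of_normSq {f : ℝ → ℝ} (hf : normSq f < ⊤) (L y : ℝ) :
    wint L y (fun x => f x ^ 2) < ⊤ :=
  (wint_le_lintegral fun _ => sq_nonneg _).trans_lt hf

variable {G : ℝ → ℝ} {u : ℝ → ℝ → ℝ} {I : Set ℝ} {K κ ρ E : ℝ}

lemma Tame.normSq_slope_le (h : Tame G I K κ ρ E u) {t : ℝ} (ht : 0 < t) :
    normSq (slope u t) ≤ ENNReal.ofReal (2 * E) := by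
  have h1 := h.energy_le t ht
  calc normSq (slope u t) ≤ ∫⁻ x, ENNReal.ofReal 2 * ENNReal.ofReal (energyDensity G u t x) := by
        refine lintegral_mono fun x => ?_
        rw [← ENNReal.ofReal_mul (by norm_num)]
        refine ENNReal.ofReal_le_ofReal ?_
        have := h.well.nonneg (u t x)
        unfold energyDensity; linarith
    _ ≤ _ := by
        rw [lintegral_const_mul' _ _ ENNReal.ofReal_ne_top, ENNReal.ofReal_mul (by norm_num)]
        gcongr

/-- Elliptic estimate for the slope in terms of the dissipation. -/
lemma Tame.elliptic (h : Tame G I K κ ρ E u) {t L y : ℝ} (ht : 0 < t) (hL : 0 < L)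
    (hgood : ∀ x, |u t x + 1| ≤ ρ) (hsm : cutoffConst * L⁻¹ ^ 2 ≤ κ / 2) :
    wint L y (fun x => slope u t x ^ 2 + curv u t x ^ 2) ≤
      ENNReal.ofReal (2 / κ ^ 2) * wint L y (fun x => potX G u t x ^ 2) := by
  have H := h.regularFlow
  have hκ := h.well.κ_pos
  have hκ1 := h.well.κ_le
  have hB := one_le_cutoffConst
  have c2G := continuous_deriv_deriv_of_contDiff_two H.contG
  have cu := continuous_slice H.cont ht
  have cux := continuous_slice H.cont_slope ht
  have cuxx := continuous_slice H.cont_curv ht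
  have cpX := continuous_slice H.cont_potX ht
  -- The identity `u_xxx = G''(u) u_x - p_x` is tested with `φ u_x`; convexity near the well makes
  -- the zero-order term in `u_x` coercive.
  have key : wint L y (fun x => 1 / 2 * curv u t x ^ 2 + κ / 2 * slope u t x ^ 2) ≤
      wint L y (fun x => 1 / (2 * κ) * potX G u t x ^ 2 +
        κ / 4 * slope u t x ^ 2) := by
    refine static_inequality hL (by fun_prop) (by fun_prop) (fun x => by positivity)
      (fun x => by positivity) fun φ ψ hC => ?_
    obtain ⟨r, hr⟩ := hC.compact
    have c0 := hC.cont 0 (by norm_num)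
    have c1 := hC.cont 1 (by norm_num)
    have cψ := hC.contψ
    have z0 : ∀ x, r < |x| → φ 0 x = 0 := fun x hx => (hr x hx).2 0 (by norm_num)
    have z1 : ∀ x, r < |x| → φ 1 x = 0 := fun x hx => (hr x hx).2 1 (by norm_num)
    have zψ : ∀ x, r < |x| → ψ x = 0 := fun x hx => (hr x hx).1
    have c2 : Continuous fun x => deriv (deriv G) (u t x) := c2G.comp cu
    refine integral_le_of_flux (R := r) (F := fun x => φ 0 x * (slope u t x * curv u t x))
      (F' := fun x => φ 1 x * (slope u t x * curv u t x) + φ 0 x * (curv u t x * curv u t x +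
        slope u t x * (deriv (deriv G) (u t x) * slope u t x - potX G u t x)))
      (by fun_prop) (by fun_prop) ((c1.mul (cux.mul cuxx)).add (c0.mul ((cuxx.mul cuxx).add
        (cux.mul ((c2.mul cux).sub cpX)))))
      (fun x => (hC.deriv 0 (by norm_num) x).mul
        ((H.deriv_slope t ht x).mul (H.deriv_curv t ht x)))
      (fun x hx => by simp [z0 x hx]) (fun x hx => by simp [zψ x hx])
      (fun x hx => by simp [z0 x hx]) (fun x hx => by simp [z0 x hx, z1 x hx]) fun x => ?_
    obtain ⟨h0, h1, h2, -, -, -⟩ := hC.bounds hB hL x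
    have hψ := hC.psi_nonneg x
    have a1 := two_abs_mul_le (x := curv u t x) (y := slope u t x) (ε := 1) one_pos h0 hψ
      (show 0 ≤ cutoffConst * L⁻¹ ^ 2 by positivity) h2
    have a2 := neg_abs_le (φ 1 x * curv u t x * slope u t x)
    have a3 := h.well.convex _ (hgood x)
    have a4 : φ 0 x * (slope u t x * potX G u t x) ≤
        φ 0 x * (κ / 2 * slope u t x ^ 2 + 1 / (2 * κ) * potX G u t x ^ 2) := by
      refine mul_le_mul_of_nonneg_left ?_ h0
      have : 0 ≤ (κ * slope u t x - potX G u t x) ^ 2 * (1 / (2 * κ)) := by positivity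
      have e : (κ * slope u t x - potX G u t x) ^ 2 * (1 / (2 * κ)) =
        κ / 2 * slope u t x ^ 2 + 1 / (2 * κ) * potX G u t x ^ 2 - slope u t x * potX G u t x := by
        field_simp; ring
      linarith
    have a5 : φ 0 x * (κ * slope u t x ^ 2) ≤ φ 0 x * (deriv (deriv G) (u t x) * slope u t x ^ 2) := by
      gcongr
    have a6 : cutoffConst * L⁻¹ ^ 2 / 1 * (ψ x * slope u t x ^ 2) ≤ κ / 2 * (ψ x * slope u t x ^ 2) := by
      rw [div_one]; gcongr
    have a7 : φ 0 x * (1 / (2 * κ) * potX G u t x ^ 2) ≤ ψ x * (1 / (2 * κ) * potX G u t x ^ 2) := by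
      gcongr
    linarith
  -- Cancellation in `ℝ≥0∞` requires the absorbed term to be finite; the energy bound provides this.
  have fin : wint L y (fun x => κ / 4 * slope u t x ^ 2) ≠ ⊤ := by
    rw [wint_const_mul (by positivity)]
    exact ENNReal.mul_ne_top ENNReal.ofReal_ne_top
      (wint_lt_top_of_normSq ((h.normSq_slope_le ht).trans_lt ENNReal.ofReal_lt_top) L y).ne
  have key2 : wint L y (fun x => 1 / 2 * curv u t x ^ 2 + κ / 4 * slope u t x ^ 2) ≤
      wint L y (fun x => 1 / (2 * κ) * potX G u t x ^ 2) := by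
    refine (ENNReal.add_le_add_iff_right fin).1 ?_
    rw [← wint_add (by fun_prop) (fun x => by positivity) (fun x => by positivity),
      ← wint_add (by fun_prop) (fun x => by positivity) (fun x => by positivity)]
    refine le_trans (le_of_eq ?_) key
    congr 1; ext x; ring
  calc _ ≤ wint L y (fun x => 4 / κ * (1 / 2 * curv u t x ^ 2 + κ / 4 * slope u t x ^ 2)) := by
        refine wint_mono fun x => ?_
        have : 1 ≤ 2 / κ := by rw [le_div_iff₀ hκ]; linarith
        have e : 4 / κ * (1 / 2 * curv u t x ^ 2 + κ / 4 * slope u t x ^ 2) =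
          slope u t x ^ 2 + 2 / κ * curv u t x ^ 2 := by field_simp; ring
        rw [e]
        nlinarith [sq_nonneg (curv u t x)]
    _ = ENNReal.ofReal (4 / κ) * wint L y (fun x => 1 / 2 * curv u t x ^ 2 + κ / 4 * slope u t x ^ 2) :=
        wint_const_mul (by positivity) _
    _ ≤ ENNReal.ofReal (4 / κ) * wint L y (fun x => 1 / (2 * κ) * potX G u t x ^ 2) := by gcongr
    _ = _ := by
        rw [wint_const_mul (by positivity), ← mul_assoc, ← ENNReal.ofReal_mul (by positivity)]
        congr 2; field_simp; norm_num

/-- Local Sobolev inequality. -/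
lemma sq_le_wint {f f' : ℝ → ℝ} (hf : ∀ x, HasDerivAt f (f' x) x) (hf' : Continuous f') {L : ℝ}
    (hL : 1 ≤ L) (y : ℝ) :
    ENNReal.ofReal (f y ^ 2) ≤ ENNReal.ofReal 16 * wint L y (fun x => f x ^ 2 + f' x ^ 2) := by
  have cf : Continuous f := continuous_iff_continuousAt.2 fun x => (hf x).continuousAt
  have cs : Continuous fun x => f x ^ 2 + f' x ^ 2 := by fun_prop
  have cd : Continuous fun x => 2 * f x * f' x := by fun_prop
  set A := ∫ x in y..y + 1, (f x ^ 2 + f' x ^ 2) with hA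
  have h1 : ∀ z ∈ Icc y (y + 1), f y ^ 2 - A ≤ f z ^ 2 + f' z ^ 2 := by
    intro z hz
    have e : ∫ x in y..z, 2 * f x * f' x = f z ^ 2 - f y ^ 2 :=
      intervalIntegral.integral_eq_sub_of_hasDerivAt (f := fun x => f x ^ 2)
        (fun x _ => ((hf x).pow 2).congr_deriv (by simp)) (cd.intervalIntegrable _ _)
    have h2 : -(∫ x in y..z, (f x ^ 2 + f' x ^ 2)) ≤ ∫ x in y..z, 2 * f x * f' x := by
      rw [← intervalIntegral.integral_neg]
      refine intervalIntegral.integral_mono_on hz.1 (cs.neg.intervalIntegrable _ _)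
        (cd.intervalIntegrable _ _) fun x _ => ?_
      nlinarith [sq_nonneg (f x + f' x)]
    have h3 : ∫ x in y..z, (f x ^ 2 + f' x ^ 2) ≤ A := by
      rw [hA, ← intervalIntegral.integral_add_adjacent_intervals (cs.intervalIntegrable y z)
        (cs.intervalIntegrable z (y + 1))]
      exact le_add_of_nonneg_right (intervalIntegral.integral_nonneg hz.2 fun x _ => by positivity)
    nlinarith [sq_nonneg (f' z)]
  have h4 : f y ^ 2 - A ≤ A := by
    have := intervalIntegral.integral_mono_on (by linarith : y ≤ y + 1)
      (intervalIntegrable_const (μ := volume)) (cs.intervalIntegrable _ _) h1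
    rw [intervalIntegral.integral_const] at this
    simpa using this
  calc ENNReal.ofReal (f y ^ 2) ≤ ENNReal.ofReal (2 * A) := ENNReal.ofReal_le_ofReal (by linarith)
    _ = ENNReal.ofReal 2 * ∫⁻ x in Ioc y (y + 1), ENNReal.ofReal (f x ^ 2 + f' x ^ 2) := by
        rw [ENNReal.ofReal_mul (by norm_num), hA, intervalIntegral.integral_of_le (by linarith),
          ofReal_integral_eq_lintegral_ofReal cs.integrableOn_Ioc
            (ae_of_all _ fun x => by positivity)]
    _ ≤ ENNReal.ofReal 2 * ∫⁻ x in Ioc y (y + 1),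
          ENNReal.ofReal 8 * ENNReal.ofReal (weight L y x * (f x ^ 2 + f' x ^ 2)) := by
        gcongr ENNReal.ofReal 2 * ?_
        refine setLIntegral_mono_Ioc fun x h1 h2 => ?_
        rw [← ENNReal.ofReal_mul (by norm_num)]
        refine ENNReal.ofReal_le_ofReal ?_
        have h3 : ((x - y) / L) ^ 2 ≤ 1 := by
          rw [div_pow, div_le_one (by positivity)]
          exact pow_le_pow_left₀ (by linarith) (by linarith) 2
        have h4 : (1 / 2 : ℝ) ≤ tail L y x := by
          unfold tail
          rw [one_div]
          exact inv_anti₀ (by positivity) (by linarith)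
        have h5 : (1 / 8 : ℝ) ≤ weight L y x := by
          rw [weight_eq_tail_pow]
          calc (1 / 8 : ℝ) = (1 / 2) ^ 3 := by norm_num
            _ ≤ _ := by gcongr
        have h6 : 0 ≤ f x ^ 2 + f' x ^ 2 := by positivity
        nlinarith
    _ = ENNReal.ofReal 16 * ∫⁻ x in Ioc y (y + 1),
          ENNReal.ofReal (weight L y x * (f x ^ 2 + f' x ^ 2)) := by
        rw [lintegral_const_mul' _ _ ENNReal.ofReal_ne_top, ← mul_assoc,
          ← ENNReal.ofReal_mul (by norm_num)]
        norm_num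
    _ ≤ _ := by
        gcongr
        exact setLIntegral_le_lintegral _ _

variable {G : ℝ → ℝ} {u : ℝ → ℝ → ℝ} {I : Set ℝ} {K κ ρ E : ℝ}

/-- The square of a time integral, in the weighted space. -/
lemma wint_sq_time_integral_le {P : ℝ → ℝ → ℝ}
    (hP : ContinuousOn (fun z : ℝ × ℝ => P z.1 z.2) (Ioi 0 ×ˢ univ)) {a b L y : ℝ} (ha : 0 < a)
    (hab : a ≤ b) :
    wint L y (fun x => (∫ σ in a..b, P σ x) ^ 2) ≤
      ENNReal.ofReal (b - a) * ∫⁻ σ in Ioc a b, wint L y (fun x => P σ x ^ 2) := by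
  have hsub : uIcc a b ⊆ Ioi 0 := fun z hz => by
    rw [uIcc_of_le hab] at hz; exact lt_of_lt_of_le ha hz.1
  have hm : MeasurableSet (Ioi (0 : ℝ) ×ˢ (univ : Set ℝ)) := measurableSet_Ioi.prod .univ
  have h1 : Measurable ((Ioi (0 : ℝ) ×ˢ (univ : Set ℝ)).indicator
      fun z : ℝ × ℝ => weight L y z.2 * P z.1 z.2 ^ 2) := by
    classical
    rw [← piecewise_eq_indicator]
    exact ((continuousOn_lift_space (continuous_weight L y)).mul
      (hP.pow 2)).measurable_piecewise continuousOn_const hm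
  set Φ : ℝ → ℝ → ℝ≥0∞ := fun σ x => ENNReal.ofReal ((Ioi (0 : ℝ) ×ˢ (univ : Set ℝ)).indicator
      (fun z : ℝ × ℝ => weight L y z.2 * P z.1 z.2 ^ 2) (σ, x)) with hΦ
  have eΦ : ∀ σ, a < σ → ∀ x, Φ σ x = ENNReal.ofReal (weight L y x * P σ x ^ 2) := fun σ hσ x => by
    simp only [hΦ]
    rw [indicator_of_mem (show (σ, x) ∈ Ioi (0 : ℝ) ×ˢ (univ : Set ℝ) from
      ⟨ha.trans hσ, mem_univ _⟩)]
  calc wint L y (fun x => (∫ σ in a..b, P σ x) ^ 2)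
      ≤ ∫⁻ x, ENNReal.ofReal (b - a) * ∫⁻ σ in Ioc a b, Φ σ x := by
        refine lintegral_mono fun x => ?_
        have := ofReal_sq_intervalIntegral_le (f := fun σ => P σ x) hab
          ((continuousOn_time_slice hP x).mono hsub).intervalIntegrable
        rw [ENNReal.ofReal_mul (weight_pos _ _ _).le]
        refine (mul_le_mul' le_rfl this).trans (le_of_eq ?_)
        rw [mul_left_comm, ← lintegral_const_mul' _ _ ENNReal.ofReal_ne_top]
        congr 1
        refine setLIntegral_congr_fun measurableSet_Ioc fun σ hσ => ?_
        simp only [eΦ σ hσ.1]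
        rw [ENNReal.ofReal_mul (weight_pos _ _ _).le]
    _ = ENNReal.ofReal (b - a) * ∫⁻ σ in Ioc a b, ∫⁻ x, Φ σ x := by
        rw [lintegral_const_mul' _ _ ENNReal.ofReal_ne_top, lintegral_lintegral_swap]
        exact ((h1.ennreal_ofReal).comp measurable_swap).aemeasurable
    _ = _ := by
        congr 1
        refine setLIntegral_congr_fun measurableSet_Ioc fun σ hσ => ?_
        exact lintegral_congr fun x => eΦ σ hσ.1 x

lemma sum_setLIntegral_grid (F : ℝ → ℝ≥0∞) (a : ℝ) {h : ℝ} (hh : 0 ≤ h) (n : ℕ) :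
    ∑ k ∈ Finset.range n, ∫⁻ σ in Ioc (a + k * h) (a + (k + 1) * h), F σ =
      ∫⁻ σ in Ioc a (a + n * h), F σ := by
  induction n with
  | zero => simp
  | succ n ih =>
    rw [Finset.sum_range_succ, ih, ← lintegral_union measurableSet_Ioc, Ioc_union_Ioc_eq_Ioc]
    · push_cast; rfl
    · have : 0 ≤ (n : ℝ) * h := by positivity
      linarith
    · nlinarith
    · exact Ioc_disjoint_Ioc_of_le le_rfl

section good
variable {T L y : ℝ}

lemma Tame.deriv_mul_le (h : Tame G I K κ ρ E u) {τ : ℝ} (hτ : 0 < τ)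
    (x : ℝ) : |deriv (deriv G) (u τ x) * slope u τ x| ≤ K * |slope u τ x| := by
  rw [abs_mul]
  gcongr
  exact h.well.deriv2_le _ (h.mem τ hτ.le x)

/-- Decay of the local mass potential, near the well. -/
lemma Tame.potential_decay (h : Tame G I K κ ρ E u) (hT : 0 < T) (hL : 1 ≤ L)
    (hLT : L ^ 2 = 4 * monoConst K κ * T)
    (hgood : ∀ τ, 0 < τ → τ ≤ 2 * T → ∀ x, |u τ x + 1| ≤ ρ) {s : ℝ} (hs : 0 < s)
    (hsT : s ≤ 2 * T) :
    ∫⁻ τ in Ioc s (2 * T), wint L y (fun x => κ * (u τ x + 1) ^ 2 + slope u τ x ^ 2) ≤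
      2 * wint L y (fun x => (∫ z in y..x, (u s z + 1)) ^ 2) := by
  have H := h.regularFlow
  have hκ := h.well.κ_pos
  have hm := monoConst_pos (K := K) hκ
  have hp : ∀ τ ∈ Icc s (2 * T), 0 < τ := fun τ hτ => lt_of_lt_of_le hs hτ.1
  obtain ⟨M, hM, hMb⟩ := H.wint_massPot_bounded (L := L) (y := y) hs hsT (by linarith) fun τ hτ x =>
    h.abs_le (hp τ hτ).le x
  have := (H.massPot_family hs y).monotone_decay (L := L) (y := y) (K := K) (κ := κ) (P := pot G u)
    (g := fun τ x => deriv G (u τ x)) hL hs hsT (by linarith [h.well.one_le]) hκ hM hMb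
    (fun τ hτ x => (H.deriv_slope τ (hp τ hτ) x).congr_deriv (by simp [pot]))
    (fun τ hτ x => H.deriv_pot τ (hp τ hτ) x)
    (fun τ hτ => (continuous_deriv_of_contDiff_two H.contG).comp (continuous_slice H.cont (hp τ hτ)))
    (fun τ hτ x => h.well.deriv_le _ (h.mem τ (hp τ hτ).le x))
    (fun τ hτ x => h.well.deriv_mul _ (hgood τ (hp τ hτ) hτ.2 x))
    (by
      -- The relation `L² = 4 monoConst T` is chosen so that the absorption condition holds on the
      -- whole interval, of length at most `2T`.
      rw [inv_pow, hLT]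
      calc _ ≤ monoConst K κ * (4 * monoConst K κ * T)⁻¹ * (2 * T) := by gcongr; linarith
        _ = 1 / 2 := by field_simp; norm_num)
  simp only [massPot_initial] at this
  exact le_trans le_add_self this

/-- Decay of the local `L²` norm, near the well. -/
lemma Tame.mass_decay (h : Tame G I K κ ρ E u) (hT : 0 < T) (hL : 1 ≤ L)
    (hLT : L ^ 2 = 4 * monoConst K κ * T)
    (hgood : ∀ τ, 0 < τ → τ ≤ 2 * T → ∀ x, |u τ x + 1| ≤ ρ) {s : ℝ} (hs : 0 < s)
    (hsT : s ≤ 2 * T) :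
    ∫⁻ τ in Ioc s (2 * T), wint L y (fun x => κ * slope u τ x ^ 2 + curv u τ x ^ 2) ≤
      2 * wint L y (fun x => (u s x + 1) ^ 2) := by
  have H := h.regularFlow
  have hκ := h.well.κ_pos
  have hm := monoConst_pos (K := K) hκ
  have hp : ∀ τ ∈ Icc s (2 * T), 0 < τ := fun τ hτ => lt_of_lt_of_le hs hτ.1
  have c2G := continuous_deriv_deriv_of_contDiff_two H.contG
  have := H.timeFamily.monotone_decay (L := L) (y := y) (K := K) (κ := κ) (P := potX G u)
    (M := ENNReal.ofReal (K ^ 2 * (Real.pi * L)))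
    (g := fun τ x => deriv (deriv G) (u τ x) * slope u τ x) hL hs hsT
    (by linarith [h.well.one_le]) hκ ENNReal.ofReal_ne_top
    (fun τ hτ => wint_le_of_le_const (by linarith) (sq_nonneg _) (h.sq_le (hp τ hτ).le))
    (fun τ hτ x => H.deriv_curv τ (hp τ hτ) x)
    (fun τ hτ x => H.deriv_potX τ (hp τ hτ) x)
    (fun τ hτ => (c2G.comp (continuous_slice H.cont (hp τ hτ))).mul
      (continuous_slice H.cont_slope (hp τ hτ)))
    (fun τ hτ x => h.deriv_mul_le (hp τ hτ) x)
    (fun τ hτ x => by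
      have := h.well.convex _ (hgood τ (hp τ hτ) hτ.2 x)
      nlinarith [sq_nonneg (slope u τ x)])
    (by
      rw [inv_pow, hLT]
      calc _ ≤ monoConst K κ * (4 * monoConst K κ * T)⁻¹ * (2 * T) := by gcongr; linarith
        _ = 1 / 2 := by field_simp; norm_num)
  exact le_trans le_add_self this

/-- The constant in the bound of the time integral of the local dissipation. -/
def dissConst (K κ : ℝ) : ℝ := 16 * K / κ + 8 * K ^ 2 / κ + 256 / κ ^ 2

lemma inv_sq_scale_le (hκ : 0 < κ) (hT : 0 < T) (hLT : L ^ 2 = 4 * monoConst K κ * T) :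
    cutoffConst * L⁻¹ ^ 2 ≤ T⁻¹ / 2 := by
  have hB := one_le_cutoffConst
  have h1 := le_monoConst (K := K) hκ
  have hm := monoConst_pos (K := K) hκ
  rw [inv_pow, hLT]
  calc cutoffConst * (4 * monoConst K κ * T)⁻¹ = cutoffConst / (4 * monoConst K κ) * T⁻¹ := by
        field_simp
    _ ≤ 1 / 2 * T⁻¹ := by
        refine mul_le_mul_of_nonneg_right ?_ (by positivity)
        rw [div_le_iff₀ (by positivity)]; linarith
    _ = _ := by ring

/-- Time-integrated decay of the local dissipation, near the well. -/
lemma Tame.integral_dissipation_decay (h : Tame G I K κ ρ E u) (hT : 1 ≤ T) (hL : 1 ≤ L)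
    (hLT : L ^ 2 = 4 * monoConst K κ * T)
    (hgood : ∀ τ, 0 < τ → τ ≤ 2 * T → ∀ x, |u τ x + 1| ≤ ρ) {s : ℝ} (hs : 0 < s)
    (hsT : s ≤ T / 4) :
    ∫⁻ τ in Ioc (3 * T / 4) (2 * T), wint L y (fun x => potX G u τ x ^ 2) ≤
      ENNReal.ofReal (dissConst K κ * T⁻¹) * wint L y (fun x => (∫ z in y..x, (u s z + 1)) ^ 2) := by
  have H := h.regularFlow
  have hκ := h.well.κ_pos
  have hκ1 := h.well.κ_le
  have hK1 := h.well.one_le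
  have hT0 : 0 < T := by linarith
  have hL0 : 0 < L := by linarith
  have hB := one_le_cutoffConst
  have hBL := inv_sq_scale_le hκ hT0 hLT
  set N := wint L y (fun x => (∫ z in y..x, (u s z + 1)) ^ 2) with hN
  have hNt : N ≠ ⊤ := by
    obtain ⟨M, hM, hMb⟩ := H.wint_massPot_bounded (L := L) (y := y) hs le_rfl hL0
      fun τ hτ x => h.abs_le (hs.le.trans hτ.1) x
    have := hMb s ⟨le_rfl, le_rfl⟩
    simp only [massPot_initial] at this
    exact ne_top_of_le_ne_top hM this
  have hA := h.potential_decay (y := y) hT0 hL hLT hgood hs (by linarith)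
  rw [← hN] at hA
  -- a good initial time
  obtain ⟨τ, hτ, hτN⟩ : ∃ τ ∈ Ioc (T / 4) (T / 2),
      wint L y (fun x => κ * (u τ x + 1) ^ 2 + slope u τ x ^ 2) ≤ ENNReal.ofReal (8 * T⁻¹) * N := by
    have hfin : ∫⁻ τ in Ioc (T / 4) (T / 2), wint L y
        (fun x => κ * (u τ x + 1) ^ 2 + slope u τ x ^ 2) ≤ 2 * N :=
      (lintegral_mono_set (Ioc_subset_Ioc hsT (by linarith))).trans hA
    obtain ⟨τ, hτ, hle⟩ := exists_le_setLAverage (μ := volume) (s := Ioc (T / 4) (T / 2))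
      (f := fun τ => wint L y (fun x => κ * (u τ x + 1) ^ 2 + slope u τ x ^ 2))
      (by rw [Real.volume_Ioc]; simpa using by linarith) (by simp)
      (by
        have k1 := H.cont
        have k2 := H.cont_slope
        exact aemeasurable_wint (a := 0)
          (F := fun σ x => κ * (u σ x + 1) ^ 2 + slope u σ x ^ 2) (by fun_prop) (by linarith))
    refine ⟨τ, hτ, le_trans hle ?_⟩
    simp only [setLAverage_eq]
    rw [Real.volume_Ioc, div_eq_mul_inv]
    calc _ ≤ 2 * N * (ENNReal.ofReal (T / 2 - T / 4))⁻¹ := by gcongr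
      _ = _ := by
        rw [← ENNReal.ofReal_inv_of_pos (by linarith), mul_right_comm,
          show (2 : ℝ≥0∞) = ENNReal.ofReal 2 by simp, ← ENNReal.ofReal_mul (by norm_num)]
        congr 2
        rw [show T / 2 - T / 4 = T / 4 by ring]; field_simp; norm_num
  have hτ0 : 0 < τ := by linarith [hτ.1]
  have cu := continuous_slice H.cont hτ0
  have cux := continuous_slice H.cont_slope hτ0
  have hτ2 : τ ≤ 2 * T := by linarith [hτ.2]
  have hX : wint L y (fun x => (u τ x + 1) ^ 2) ≤ ENNReal.ofReal (8 / κ * T⁻¹) * N := by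
    calc _ ≤ wint L y (fun x => κ⁻¹ * (κ * (u τ x + 1) ^ 2 + slope u τ x ^ 2)) := by
          refine wint_mono fun x => ?_
          rw [mul_add, inv_mul_cancel_left₀ hκ.ne']
          have : 0 ≤ κ⁻¹ * slope u τ x ^ 2 := by positivity
          linarith
      _ ≤ ENNReal.ofReal κ⁻¹ * (ENNReal.ofReal (8 * T⁻¹) * N) := by
          rw [wint_const_mul (by positivity)]; gcongr
      _ = _ := by
          rw [← mul_assoc, ← ENNReal.ofReal_mul (by positivity)]; congr 2; field_simp
  have he : wint L y (energyDensity G u τ) ≤ ENNReal.ofReal (8 * K / κ * T⁻¹) * N := by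
    calc _ ≤ wint L y (fun x => K / κ * (κ * (u τ x + 1) ^ 2 + slope u τ x ^ 2)) := by
          refine wint_mono fun x => ?_
          have h1 := h.well.potential_le _ (h.mem τ hτ0.le x)
          have h2 : 1 ≤ K / κ := by rw [le_div_iff₀ hκ]; linarith
          have e : K / κ * (κ * (u τ x + 1) ^ 2 + slope u τ x ^ 2) =
            K * (u τ x + 1) ^ 2 + K / κ * slope u τ x ^ 2 := by field_simp
          rw [e]
          unfold energyDensity
          nlinarith [sq_nonneg (slope u τ x)]
      _ ≤ ENNReal.ofReal (K / κ) * (ENNReal.ofReal (8 * T⁻¹) * N) := by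
          rw [wint_const_mul (by positivity)]; gcongr
      _ = _ := by
          rw [← mul_assoc, ← ENNReal.ofReal_mul (by positivity)]; congr 2; field_simp
  -- The energy inequality is started at the good time `τ`, where the local energy is of order `N /
  -- T`. Its localization error carries `L⁻²`, of order `1 / T`, times space-time integrals already
  -- bounded by multiples of `N`.
  have hE := le_trans le_add_self (h.regularFlow.weighted_energy (y := y) h.well.nonneg hL0 hτ0 hτ2)
  have hR : ∫⁻ σ in Ioc τ (2 * T), wint L y (fun x => cutoffConst *
        (L⁻¹ ^ 2 * (pot G u σ x - curv u σ x) ^ 2 + L⁻¹ ^ 4 * slope u σ x ^ 2)) ≤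
      ENNReal.ofReal (K ^ 2 / κ * T⁻¹) * (2 * N) +
        ENNReal.ofReal (8 / κ * T⁻¹) * (2 * (ENNReal.ofReal (8 / κ * T⁻¹) * N)) := by
    have hpt : ∀ σ, τ < σ → σ ≤ 2 * T → wint L y (fun x => cutoffConst *
        (L⁻¹ ^ 2 * (pot G u σ x - curv u σ x) ^ 2 + L⁻¹ ^ 4 * slope u σ x ^ 2)) ≤
        ENNReal.ofReal (K ^ 2 / κ * T⁻¹) *
          wint L y (fun x => κ * (u σ x + 1) ^ 2 + slope u σ x ^ 2) +
        ENNReal.ofReal (8 / κ * T⁻¹) *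
          wint L y (fun x => κ * slope u σ x ^ 2 + curv u σ x ^ 2) := by
      intro σ h1 h2
      have hσ : 0 < σ := hτ0.trans h1
      have mu := continuous_slice H.cont hσ
      have mux := continuous_slice H.cont_slope hσ
      rw [← wint_const_mul (by positivity), ← wint_const_mul (by positivity),
        ← wint_add (by fun_prop) (fun x => by positivity) (fun x => by positivity)]
      refine wint_mono fun x => ?_
      have e : pot G u σ x - curv u σ x = deriv G (u σ x) - 2 * curv u σ x := by
        simp only [pot]; ring
      have b1 : (deriv G (u σ x)) ^ 2 ≤ K ^ 2 * (u σ x + 1) ^ 2 := by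
        rw [← sq_abs (deriv G (u σ x)), ← sq_abs (u σ x + 1), ← mul_pow]
        exact pow_le_pow_left₀ (abs_nonneg _) (h.well.deriv_le _ (h.mem σ hσ.le x)) 2
      have b2 : L⁻¹ ^ 4 ≤ L⁻¹ ^ 2 :=
        pow_le_pow_of_le_one (by positivity) (inv_le_one_of_one_le₀ hL) (by norm_num)
      have b3 : (deriv G (u σ x) - 2 * curv u σ x) ^ 2 ≤
          2 * (K ^ 2 * (u σ x + 1) ^ 2) + 8 * curv u σ x ^ 2 := by
        nlinarith [sq_nonneg (deriv G (u σ x) + 2 * curv u σ x)]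
      have e1 : K ^ 2 / κ * T⁻¹ * (κ * (u σ x + 1) ^ 2 + slope u σ x ^ 2) =
        T⁻¹ * (K ^ 2 * (u σ x + 1) ^ 2) + K ^ 2 / κ * T⁻¹ * slope u σ x ^ 2 := by field_simp
      have e2 : 8 / κ * T⁻¹ * (κ * slope u σ x ^ 2 + curv u σ x ^ 2) =
        8 * T⁻¹ * slope u σ x ^ 2 + 8 * T⁻¹ * (κ⁻¹ * curv u σ x ^ 2) := by field_simp
      have b4 : curv u σ x ^ 2 ≤ κ⁻¹ * curv u σ x ^ 2 :=
        le_mul_of_one_le_left (sq_nonneg _) ((one_le_inv₀ hκ).2 hκ1)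
      rw [e, e1, e2]
      calc _ ≤ cutoffConst * (L⁻¹ ^ 2 * (2 * (K ^ 2 * (u σ x + 1) ^ 2) + 8 * curv u σ x ^ 2) +
            L⁻¹ ^ 2 * slope u σ x ^ 2) := by gcongr
        _ = cutoffConst * L⁻¹ ^ 2 * (2 * (K ^ 2 * (u σ x + 1) ^ 2) + 8 * curv u σ x ^ 2 +
            slope u σ x ^ 2) := by ring
        _ ≤ T⁻¹ / 2 * (2 * (K ^ 2 * (u σ x + 1) ^ 2) + 8 * (κ⁻¹ * curv u σ x ^ 2) +
            slope u σ x ^ 2) := by gcongr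
        _ ≤ _ := by
          have p1 : 0 ≤ K ^ 2 / κ * T⁻¹ * slope u σ x ^ 2 := by positivity
          have p2 : 0 ≤ T⁻¹ * slope u σ x ^ 2 := by positivity
          have p3 : 0 ≤ T⁻¹ * (κ⁻¹ * curv u σ x ^ 2) := by positivity
          linarith
    refine (setLIntegral_mono_Ioc hpt).trans ?_
    rw [lintegral_add_left' ?_, lintegral_const_mul' _ _ ENNReal.ofReal_ne_top,
      lintegral_const_mul' _ _ ENNReal.ofReal_ne_top]
    · gcongr
      · exact (lintegral_mono_set (Ioc_subset_Ioc_left (by linarith [hτ.1]))).trans hA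
      · refine (h.mass_decay hT0 hL hLT hgood hτ0 hτ2).trans ?_
        gcongr
    · have k1 := H.cont
      have k2 := H.cont_slope
      refine AEMeasurable.const_mul (aemeasurable_wint (a := 0)
        (F := fun σ x => κ * (u σ x + 1) ^ 2 + slope u σ x ^ 2) (by fun_prop) hτ0.le) _
  have e3 : ∀ σ, wint L y (fun x => potX G u σ x ^ 2) =
      2 * wint L y (fun x => 1 / 2 * potX G u σ x ^ 2) := fun σ => by
    rw [show (2 : ℝ≥0∞) = ENNReal.ofReal 2 by simp, ← wint_const_mul (by norm_num)]
    congr 1; ext x; ring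
  have hTi : T⁻¹ ≤ 1 := inv_le_one_of_one_le₀ hT
  calc _ ≤ ∫⁻ σ in Ioc τ (2 * T), wint L y (fun x => potX G u σ x ^ 2) :=
        lintegral_mono_set (Ioc_subset_Ioc_left (by linarith [hτ.2]))
    _ = 2 * ∫⁻ σ in Ioc τ (2 * T), wint L y (fun x => 1 / 2 * potX G u σ x ^ 2) := by
        simp_rw [e3]; exact lintegral_const_mul' _ _ (by simp)
    _ ≤ 2 * (ENNReal.ofReal (8 * K / κ * T⁻¹) * N + (ENNReal.ofReal (K ^ 2 / κ * T⁻¹) * (2 * N) +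
        ENNReal.ofReal (8 / κ * T⁻¹) * (2 * (ENNReal.ofReal (8 / κ * T⁻¹) * N)))) := by
        gcongr
        exact hE.trans (add_le_add he hR)
    _ = ENNReal.ofReal (2 * (8 * K / κ * T⁻¹ + (2 * (K ^ 2 / κ * T⁻¹) +
          8 / κ * T⁻¹ * (2 * (8 / κ * T⁻¹))))) * N := by
        have p1 : 0 ≤ 8 * K / κ * T⁻¹ := by positivity
        have p2 : 0 ≤ K ^ 2 / κ * T⁻¹ := by positivity
        have p3 : 0 ≤ 8 / κ * T⁻¹ := by positivity
        generalize 8 * K / κ * T⁻¹ = a₁ at p1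
        generalize K ^ 2 / κ * T⁻¹ = a₂ at p2
        generalize 8 / κ * T⁻¹ = a₃ at p3
        rw [ENNReal.ofReal_mul (by norm_num), ENNReal.ofReal_add (by positivity) (by positivity),
          ENNReal.ofReal_add (by positivity) (by positivity),
          ENNReal.ofReal_mul (p := 2) (by norm_num), ENNReal.ofReal_mul (p := a₃) p3,
          ENNReal.ofReal_mul (p := 2) (by norm_num), ENNReal.ofReal_ofNat]
        ring
    _ ≤ _ := by
        refine mul_le_mul' (ENNReal.ofReal_le_ofReal ?_) le_rfl
        have p : 8 / κ * T⁻¹ * (2 * (8 / κ * T⁻¹)) ≤ 8 / κ * T⁻¹ * (2 * (8 / κ * 1)) := by gcongr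
        have e5 : dissConst K κ * T⁻¹ = 2 * (8 * K / κ * T⁻¹ + (2 * (2 * (K ^ 2 / κ * T⁻¹)) +
          8 / κ * T⁻¹ * (2 * (8 / κ * 1)))) := by unfold dissConst; field_simp; ring
        have p2 : 0 ≤ K ^ 2 / κ * T⁻¹ := by positivity
        rw [e5]; linarith

end good

/-! ### Pointwise decay of the dissipation and of the slope -/

variable {G : ℝ → ℝ} {u : ℝ → ℝ → ℝ} {I : Set ℝ} {K κ ρ E T L y : ℝ}

/-- Monotone decay of time differences of the mass potential, near the well. -/
lemma Tame.time_difference_decay (h : Tame G I K κ ρ E u) (hT : 0 < T) (hL : 1 ≤ L)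
    (hLT : L ^ 2 = 4 * monoConst K κ * T)
    (hgood : ∀ τ, 0 < τ → τ ≤ 2 * T → ∀ x, |u τ x + 1| ≤ ρ) {s δ τ t : ℝ} (hs : 0 < s)
    (hδ : 0 < δ) (hτ : s + δ ≤ τ) (hτt : τ ≤ t) (ht : t ≤ 2 * T) :
    wint L y (fun x => (massPot G u s y t x - massPot G u s y (t - δ) x) ^ 2) ≤
      2 * (ENNReal.ofReal δ * ∫⁻ σ in Ioc (τ - δ) τ, wint L y (fun x => potX G u σ x ^ 2)) := by
  have H := h.regularFlow
  have hκ := h.well.κ_pos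
  have hm := monoConst_pos (K := K) hκ
  have F := H.massPot_family hs y
  -- The difference of the potential and its time delay again solves an equation with monotone
  -- second-order part, because both profiles lie near the well. No time regularity of `p_x` is
  -- needed.
  have F1 := (F.mono (b := 0 + δ) (by linarith)).sub (F.delay δ)
  have hp : ∀ σ ∈ Icc τ t, 0 < σ := fun σ hσ => by linarith [hσ.1]
  have hp' : ∀ σ ∈ Icc τ t, 0 < σ - δ := fun σ hσ => by linarith [hσ.1]
  obtain ⟨M, hM, hMb⟩ := H.wint_massPot_bounded (L := L) (y := y) hs (by linarith : s ≤ t)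
    (by linarith) fun σ hσ x => h.abs_le (hs.le.trans hσ.1) x
  have cG' := continuous_deriv_of_contDiff_two H.contG
  have key := F1.monotone_decay (L := L) (y := y) (K := K) (κ := κ) (s := τ) (t := t)
    (P := fun σ x => pot G u σ x - pot G u (σ - δ) x) (M := 2 * M + 2 * M)
    (g := fun σ x => deriv G (u σ x) - deriv G (u (σ - δ) x)) hL (by linarith) hτt
    (by linarith [h.well.one_le]) hκ
    (ENNReal.add_ne_top.2 ⟨ENNReal.mul_ne_top (by simp) hM, ENNReal.mul_ne_top (by simp) hM⟩)
    (fun σ hσ => by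
      have c1 := continuous_slice F.cont0 (hp σ hσ)
      calc _ ≤ wint L y (fun x => 2 * massPot G u s y σ x ^ 2 + 2 * massPot G u s y (σ - δ) x ^ 2) :=
            wint_mono fun x => by
              nlinarith [sq_nonneg (massPot G u s y σ x + massPot G u s y (σ - δ) x)]
        _ ≤ _ := by
          rw [wint_add (by fun_prop) (fun x => by positivity) (fun x => by positivity),
            wint_const_mul (by norm_num), wint_const_mul (by norm_num), ENNReal.ofReal_ofNat]
          gcongr
          · exact hMb σ ⟨by linarith [hσ.1], hσ.2⟩
          · exact hMb (σ - δ) ⟨by linarith [hσ.1], by linarith [hσ.2]⟩)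
    (fun σ hσ x => ((H.deriv_slope σ (hp σ hσ) x).sub
      (H.deriv_slope (σ - δ) (hp' σ hσ) x)).congr_deriv (by simp only [pot]; ring))
    (fun σ hσ x => (H.deriv_pot σ (hp σ hσ) x).sub (H.deriv_pot (σ - δ) (hp' σ hσ) x))
    (fun σ hσ => (cG'.comp (continuous_slice H.cont (hp σ hσ))).sub
      (cG'.comp (continuous_slice H.cont (hp' σ hσ))))
    (fun σ hσ x => by
      have := h.well.lipschitz _ (h.mem σ (hp σ hσ).le x) _ (h.mem (σ - δ) (hp' σ hσ).le x)
      rwa [add_sub_add_right_eq_sub])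
    (fun σ hσ x => by
      have := h.well.monotone _ _ (hgood σ (hp σ hσ) (hσ.2.trans ht) x)
        (hgood (σ - δ) (hp' σ hσ) (by linarith [hσ.2]) x)
      rwa [add_sub_add_right_eq_sub])
    (by
      rw [inv_pow, hLT]
      calc _ ≤ monoConst K κ * (4 * monoConst K κ * T)⁻¹ * (2 * T) := by gcongr; linarith
        _ = 1 / 2 := by field_simp; norm_num)
  refine (le_trans le_self_add key).trans (mul_le_mul' le_rfl ?_)
  have e : ∀ x, massPot G u s y τ x - massPot G u s y (τ - δ) x = ∫ σ in (τ - δ)..τ, potX G u σ x := by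
    intro x
    have hsub : uIcc (τ - δ) τ ⊆ Ioi 0 := fun z hz => by
      rw [uIcc_of_le (by linarith)] at hz; exact lt_of_lt_of_le (by linarith : 0 < τ - δ) hz.1
    refine (intervalIntegral.integral_eq_sub_of_hasDerivAt (f := fun σ => massPot G u s y σ x)
      (fun σ hσ => F.derivt σ (hsub hσ) x) ?_).symm
    exact ((continuousOn_time_slice H.cont_potX x).mono hsub).intervalIntegrable
  simp only [e]
  have := wint_sq_time_integral_le (L := L) (y := y) H.cont_potX (a := τ - δ) (b := τ) (by linarith)
    (by linarith)
  rwa [sub_sub_cancel] at this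

/-- Pointwise-in-time bound of the local dissipation, near the well. -/
lemma Tame.dissipation_le_average (h : Tame G I K κ ρ E u) (hT : 0 < T) (hL : 1 ≤ L)
    (hLT : L ^ 2 = 4 * monoConst K κ * T)
    (hgood : ∀ τ, 0 < τ → τ ≤ 2 * T → ∀ x, |u τ x + 1| ≤ ρ) {t : ℝ} (hTt : T ≤ t)
    (ht : t ≤ 2 * T) :
    wint L y (fun x => potX G u t x ^ 2) ≤ ENNReal.ofReal (8 * T⁻¹) *
      ∫⁻ τ in Ioc (3 * T / 4) (2 * T), wint L y (fun x => potX G u τ x ^ 2) := by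
  have H := h.regularFlow
  have ht0 : 0 < t := by linarith
  set s := T / 4 with hs
  have hs0 : 0 < s := by positivity
  have F := H.massPot_family hs0 y
  set J := ∫⁻ τ in Ioc (3 * T / 4) (2 * T), wint L y (fun x => potX G u τ x ^ 2) with hJ
  set q : ℝ → ℝ → ℝ := fun δ x => massPot G u s y t x - massPot G u s y (t - δ) x with hq
  -- The interval `(3T/4, T]` is cut into `n + 1` cells of length `δ`. On each cell the difference
  -- at time `t` is bounded by the dissipation on that cell; adding the bounds gains a factor `n +
  -- 1`, and `(n + 1) δ = T / 4` turns the sum into a bound by the average dissipation, uniform in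
  -- `n`.
  have step : ∀ n : ℕ, wint L y (fun x => ((T / (4 * (n + 1)))⁻¹ * q (T / (4 * (n + 1))) x) ^ 2) ≤
      ENNReal.ofReal (8 * T⁻¹) * J := by
    intro n
    set δ := T / (4 * ((n : ℝ) + 1)) with hδ
    have hδ0 : 0 < δ := by positivity
    have hnδ : ((n : ℝ) + 1) * δ = T / 4 := by rw [hδ]; field_simp
    have hδT : δ ≤ T / 4 := by rw [← hnδ]; nlinarith [(Nat.cast_nonneg n : (0 : ℝ) ≤ n)]
    have hk : ∀ k ∈ Finset.range (n + 1), wint L y (fun x => q δ x ^ 2) ≤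
        ENNReal.ofReal (2 * δ) * ∫⁻ σ in Ioc (3 * T / 4 + k * δ) (3 * T / 4 + (k + 1) * δ),
          wint L y (fun x => potX G u σ x ^ 2) := by
      intro k hk
      have hkn : ((k : ℝ) + 1) * δ ≤ T / 4 := by
        rw [← hnδ]
        have : (k : ℝ) + 1 ≤ n + 1 := by exact_mod_cast Finset.mem_range.1 hk
        gcongr
      have hk0 : 0 ≤ (k : ℝ) * δ := by positivity
      have := h.time_difference_decay (y := y) hT hL hLT hgood hs0 hδ0
        (τ := 3 * T / 4 + (k + 1) * δ) (t := t) (by rw [hs]; linarith) (by linarith) ht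
      rw [show 3 * T / 4 + ((k : ℝ) + 1) * δ - δ = 3 * T / 4 + k * δ by ring] at this
      rwa [ENNReal.ofReal_mul (by norm_num), ENNReal.ofReal_ofNat, mul_assoc]
    have hsum := Finset.sum_le_sum hk
    rw [← Finset.mul_sum, sum_setLIntegral_grid _ _ hδ0.le, Finset.sum_const, Finset.card_range,
      nsmul_eq_mul] at hsum
    have hJ' : ∫⁻ σ in Ioc (3 * T / 4) (3 * T / 4 + ((n + 1 : ℕ) : ℝ) * δ),
        wint L y (fun x => potX G u σ x ^ 2) ≤ J :=
      lintegral_mono_set (Ioc_subset_Ioc_right (by push_cast; linarith))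
    have e : wint L y (fun x => (δ⁻¹ * q δ x) ^ 2) =
        ENNReal.ofReal (4 * T⁻¹ * δ⁻¹) * (((n + 1 : ℕ) : ℝ≥0∞) * wint L y (fun x => q δ x ^ 2)) := by
      simp only [mul_pow]
      rw [wint_const_mul (by positivity), ← mul_assoc, ← ENNReal.ofReal_natCast,
        ← ENNReal.ofReal_mul (by positivity)]
      congr 2
      push_cast
      rw [show T⁻¹ = (4 * (((n : ℝ) + 1) * δ))⁻¹ by rw [hnδ]; congr 1; ring]
      field_simp
    calc _ ≤ ENNReal.ofReal (4 * T⁻¹ * δ⁻¹) * (ENNReal.ofReal (2 * δ) * J) := by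
          rw [e]
          exact mul_le_mul' le_rfl (hsum.trans (mul_le_mul' le_rfl hJ'))
      _ = _ := by
          rw [← mul_assoc, ← ENNReal.ofReal_mul (by positivity)]
          congr 2; field_simp; norm_num
  -- As `δ → 0` the quotients tend to `w_t = p_x`, and Fatou's lemma yields the bound at the single
  -- time `t`.
  have hlim : ∀ x, Tendsto (fun n : ℕ => ENNReal.ofReal (weight L y x *
      ((T / (4 * (n + 1)))⁻¹ * q (T / (4 * (n + 1))) x) ^ 2)) atTop
      (𝓝 (ENNReal.ofReal (weight L y x * potX G u t x ^ 2))) := by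
    intro x
    refine (ENNReal.continuous_ofReal.tendsto _).comp (Tendsto.const_mul _ (Tendsto.pow ?_ 2))
    have hd := (hasDerivAt_iff_tendsto_slope_zero.1 (F.derivt t ht0 x))
    have hseq : Tendsto (fun n : ℕ => -(T / (4 * ((n : ℝ) + 1)))) atTop (𝓝[≠] 0) := by
      refine tendsto_nhdsWithin_iff.2 ⟨?_, Eventually.of_forall fun n => ?_⟩
      · have := (tendsto_one_div_add_atTop_nhds_zero_nat (𝕜 := ℝ)).const_mul (-(T / 4))
        rw [mul_zero] at this
        refine this.congr fun n => ?_
        field_simp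
      · exact neg_ne_zero.2 (by positivity)
    refine (hd.comp hseq).congr fun n => ?_
    simp only [Function.comp_apply, smul_eq_mul, hq, ← sub_eq_add_neg]
    rw [inv_neg]; ring
  calc wint L y (fun x => potX G u t x ^ 2)
      = ∫⁻ x, liminf (fun n : ℕ => ENNReal.ofReal (weight L y x *
        ((T / (4 * (n + 1)))⁻¹ * q (T / (4 * (n + 1))) x) ^ 2)) atTop :=
        lintegral_congr fun x => (hlim x).liminf_eq.symm
    _ ≤ liminf (fun n : ℕ => wint L y (fun x =>
        ((T / (4 * (n + 1)))⁻¹ * q (T / (4 * (n + 1))) x) ^ 2)) atTop := by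
        refine lintegral_liminf_le' fun n => ?_
        have hδ0 : 0 < T / (4 * ((n : ℝ) + 1)) := by positivity
        have hδT : T / (4 * ((n : ℝ) + 1)) ≤ T / 4 := by
          rw [← div_div]; exact div_le_self (by positivity) (by linarith [(Nat.cast_nonneg n : (0 : ℝ) ≤ n)])
        have c1 := continuous_slice F.cont0 ht0
        have c2 := continuous_slice F.cont0 (τ := t - T / (4 * ((n : ℝ) + 1)))
          (by simp only [mem_Ioi]; linarith)
        have := continuous_weight L y
        refine Measurable.aemeasurable ?_
        refine Measurable.ennreal_ofReal (Continuous.measurable ?_)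
        exact this.mul ((continuous_const.mul (c1.sub c2)).pow 2)
    _ ≤ liminf (fun _ : ℕ => ENNReal.ofReal (8 * T⁻¹) * J) atTop :=
        liminf_le_liminf (Eventually.of_forall step)
    _ = _ := by simp

/-- The constant in the pointwise decay of the slope. -/
def slopeConst (K κ : ℝ) : ℝ := 16 * (2 / κ ^ 2) * (8 * dissConst K κ) *
  (4 * monoConst K κ) ^ 2 * Real.pi

lemma dissConst_nonneg (hK : 0 ≤ K) (hκ : 0 < κ) : 0 ≤ dissConst K κ := by
  unfold dissConst; positivity

/-- Pointwise decay of the slope, near the well. -/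
lemma Tame.slope_sq_le (h : Tame G I K κ ρ E u) (hV : excessMass (u 0) < ⊤) (hT : κ⁻¹ ≤ T)
    (hL : 1 ≤ L) (hLT : L ^ 2 = 4 * monoConst K κ * T)
    (hgood : ∀ τ, 0 < τ → τ ≤ 2 * T → ∀ x, |u τ x + 1| ≤ ρ) {t : ℝ} (hTt : T ≤ t)
    (ht : t ≤ 2 * T) (y : ℝ) :
    slope u t y ^ 2 ≤ slopeConst K κ * L⁻¹ ^ 3 * localMass (u 0) L y ^ 2 := by
  have H := h.regularFlow
  have hκ := h.well.κ_pos
  have hκ1 := h.well.κ_le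
  have hK1 := h.well.one_le
  have hT1 : 1 ≤ T := ((one_le_inv₀ hκ).2 hκ1).trans hT
  have hT0 : 0 < T := by linarith
  have ht0 : 0 < t := by linarith
  have hL0 : 0 < L := by linarith
  have hm := monoConst_pos (K := K) hκ
  have hd0 := dissConst_nonneg (by linarith : 0 ≤ K) hκ
  have hTi : T⁻¹ ≤ κ := inv_le_of_inv_le₀ hκ hT
  have hBL := inv_sq_scale_le hκ hT0 hLT
  set N : ℝ → ℝ≥0∞ := fun s => wint L y (fun x => (∫ z in y..x, (u s z + 1)) ^ 2) with hN
  -- Averaging in time and the dissipation estimate each contribute `T⁻¹`. The squared primitive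
  -- contributes `L` times the squared local mass, so the total power is `L⁻⁴ L = L⁻³`.
  have h1 : ∀ s ∈ Ioc 0 (T / 4), wint L y (fun x => potX G u t x ^ 2) ≤
      ENNReal.ofReal (8 * T⁻¹) * (ENNReal.ofReal (dissConst K κ * T⁻¹) * N s) := fun s hs =>
    (h.dissipation_le_average hT0 hL hLT hgood hTt ht).trans
      (mul_le_mul' le_rfl (h.integral_dissipation_decay hT1 hL hLT hgood hs.1 hs.2))
  have h2 : wint L y (fun x => potX G u t x ^ 2) ≤
      ENNReal.ofReal (8 * T⁻¹) * (ENNReal.ofReal (dissConst K κ * T⁻¹) * N 0) := by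
    refine ge_of_tendsto (ENNReal.Tendsto.const_mul (ENNReal.Tendsto.const_mul
      (h.tendsto_wint_primitive hL0) (Or.inr ENNReal.ofReal_ne_top))
      (Or.inr ENNReal.ofReal_ne_top)) ?_
    filter_upwards [Ioc_mem_nhdsGT (show 0 < T / 4 by positivity)] with s hs using h1 s hs
  have cont0 : Continuous (u 0) := h.smooth.continuous_at_time le_rfl
  have h3 : N 0 ≤ ENNReal.ofReal (localMass (u 0) L y ^ 2 * (Real.pi * L)) :=
    wint_sq_primitive_le cont0 hV hL0
  have h4 := sq_le_wint (fun x => H.deriv_slope t ht0 x) (continuous_slice H.cont_curv ht0) hL y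
  have h5 := h.elliptic (y := y) ht0 hL0 (hgood t ht0 ht) (hBL.trans (by linarith))
  have h6 : ENNReal.ofReal (slope u t y ^ 2) ≤ ENNReal.ofReal (16 * (2 / κ ^ 2 *
      (8 * T⁻¹ * (dissConst K κ * T⁻¹ * (localMass (u 0) L y ^ 2 * (Real.pi * L)))))) := by
    rw [ENNReal.ofReal_mul (p := 16) (by norm_num), ENNReal.ofReal_mul (p := 2 / κ ^ 2) (by positivity),
      ENNReal.ofReal_mul (p := 8 * T⁻¹) (by positivity),
      ENNReal.ofReal_mul (p := dissConst K κ * T⁻¹) (by positivity)]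
    refine h4.trans (mul_le_mul' le_rfl (h5.trans (mul_le_mul' le_rfl (h2.trans ?_))))
    exact mul_le_mul' le_rfl (mul_le_mul' le_rfl h3)
  have h7 := (ENNReal.ofReal_le_ofReal_iff (by positivity)).1 h6
  refine h7.trans (le_of_eq ?_)
  have e : T⁻¹ = 4 * monoConst K κ * L⁻¹ ^ 2 := by rw [inv_pow, hLT]; field_simp
  rw [e]
  unfold slopeConst
  field_simp

/-! ### The entropy -/

/-- Entropy production in normalized variables: `γ`, `σ` are the cosine and sine of the angle of
`(c, m)`; `δ`, `η` are the first and second derivatives of `c` divided by `√(c² + m²)`; `θ₁`, `θ₂`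
are those of `m` divided by `m`. The squares `a δ²` and `η²` are favourable. Completing the square
in `η` leaves `X² / 4`, where `X` consists of `-3 γ δ²` and terms containing `θ`. Smallness of `δ`
makes the first harmless, as `X² ≤ κ δ² + 392 l²`; this is the origin of `κ / 18` and of `98 = 392 /
4`. -/
lemma entropy_algebra {a K κ γ σ δ η θ₁ θ₂ l e : ℝ} (hκ : 0 < κ) (ha : κ ≤ a) (haK : a ≤ K)
    (hγ : γ ^ 2 + σ ^ 2 = 1) (hδ : |δ| ≤ e) (he : e ^ 2 ≤ κ / 18) (he1 : e ≤ 1)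
    (h1 : |θ₁| ≤ l) (h2 : |θ₂| ≤ 8 * l ^ 2) (hl : l ≤ 1) :
    -((K + 98) * l ^ 2) ≤ a * δ ^ 2 - a * γ * θ₁ * δ + η ^ 2 +
      η * (θ₁ * δ - γ * θ₁ ^ 2 - γ * θ₂ - 3 * (δ - γ * θ₁) * (γ * δ + σ ^ 2 * θ₁)) := by
  have hl0 : 0 ≤ l := (abs_nonneg _).trans h1
  have he0 : 0 ≤ e := (abs_nonneg _).trans hδ
  set X := θ₁ * δ - γ * θ₁ ^ 2 - γ * θ₂ - 3 * (δ - γ * θ₁) * (γ * δ + σ ^ 2 * θ₁) with hX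
  have eX : X = -3 * γ * (δ * δ) + (4 - 6 * σ ^ 2) * (θ₁ * δ) + (3 * σ ^ 2 - 1) * γ * (θ₁ * θ₁)
      - γ * θ₂ := by
    have : γ ^ 2 = 1 - σ ^ 2 := by linarith
    rw [hX]
    linear_combination (3 * θ₁ * δ) * this
  have hγ1 : |γ| ≤ 1 := by rw [← sq_le_one_iff_abs_le_one]; nlinarith
  have hσ1 : σ ^ 2 ≤ 1 := by nlinarith
  have hσ0 := sq_nonneg σ
  have b1 : |(-3 * γ) * (δ * δ)| ≤ 3 * (e * |δ|) := by
    rw [abs_mul, abs_mul, abs_mul δ δ, abs_of_neg (by norm_num : (-3 : ℝ) < 0)]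
    calc _ ≤ - -3 * 1 * (e * |δ|) := by gcongr
      _ = _ := by ring
  have b2 : |(4 - 6 * σ ^ 2) * (θ₁ * δ)| ≤ 4 * (l * 1) := by
    rw [abs_mul, abs_mul θ₁]
    gcongr
    · rw [abs_le]; constructor <;> linarith
    · linarith
  have b3 : |(3 * σ ^ 2 - 1) * γ * (θ₁ * θ₁)| ≤ 2 * (1 * (l * 1)) := by
    rw [abs_mul, abs_mul, abs_mul θ₁, mul_assoc]
    gcongr
    · rw [abs_le]; constructor <;> linarith
    · linarith
  have b4 : |γ * θ₂| ≤ 1 * (8 * l ^ 2) := by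
    rw [abs_mul]; gcongr
  have b5 : l ^ 2 ≤ l := by nlinarith
  have hXb : |X| ≤ 3 * (e * |δ|) + 14 * l := by
    rw [eX]
    refine (abs_sub _ _).trans ?_
    have t1 := abs_add_le (-3 * γ * (δ * δ) + (4 - 6 * σ ^ 2) * (θ₁ * δ))
      ((3 * σ ^ 2 - 1) * γ * (θ₁ * θ₁))
    have t2 := abs_add_le (-3 * γ * (δ * δ)) ((4 - 6 * σ ^ 2) * (θ₁ * δ))
    linarith
  have hX2 : X ^ 2 ≤ κ * δ ^ 2 + 392 * l ^ 2 := by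
    have : X ^ 2 ≤ (3 * (e * |δ|) + 14 * l) ^ 2 := by
      rw [← sq_abs X]; exact pow_le_pow_left₀ (abs_nonneg _) hXb 2
    have t : e ^ 2 * δ ^ 2 ≤ κ / 18 * δ ^ 2 := by gcongr
    have t' : (e * |δ|) ^ 2 = e ^ 2 * δ ^ 2 := by rw [mul_pow, sq_abs]
    have t2 := sq_nonneg (3 * (e * |δ|) - 14 * l)
    linarith only [this, t, t', t2, show (3 * (e * |δ|) + 14 * l) ^ 2 = 18 * (e * |δ|) ^ 2 + 392 * l ^ 2 - (3 * (e * |δ|) - 14 * l) ^ 2 by ring]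
  have hY : a * γ * θ₁ * δ ≤ a * (δ ^ 2 / 2 + l ^ 2 / 2) := by
    have ha0 : 0 ≤ a := hκ.le.trans ha
    have : γ * θ₁ * δ ≤ |δ| * l := by
      calc γ * θ₁ * δ ≤ |γ * θ₁ * δ| := le_abs_self _
        _ = |γ| * |θ₁| * |δ| := by rw [abs_mul, abs_mul]
        _ ≤ 1 * l * |δ| := by gcongr
        _ = _ := by ring
    have t : |δ| * l ≤ δ ^ 2 / 2 + l ^ 2 / 2 := by
      have := sq_nonneg (|δ| - l)
      have := sq_abs δ
      nlinarith
    calc a * γ * θ₁ * δ = a * (γ * θ₁ * δ) := by ring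
      _ ≤ _ := mul_le_mul_of_nonneg_left (this.trans t) ha0
  have t1 : κ * δ ^ 2 ≤ a * δ ^ 2 := by gcongr
  have t2 : a * l ^ 2 ≤ K * l ^ 2 := by gcongr
  have t3 : 0 ≤ κ * δ ^ 2 := by positivity
  have t4 : 0 ≤ K * l ^ 2 := mul_nonneg (by linarith) (sq_nonneg l)
  have hη : -(X ^ 2 / 4) ≤ η ^ 2 + η * X := by
    linarith only [sq_nonneg (2 * η + X), show (2 * η + X) ^ 2 = 4 * (η ^ 2 + η * X) + X ^ 2 by ring]
  linarith only [hη, hY, hX2, t1, t2, t3, t4]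

/-- The derivative of `c / √(c² + μ²)`. -/
def angle1 (j c c1 m m1 : ℝ) : ℝ := (c1 * m ^ 2 - c * m * m1) / j ^ 3

/-- The second derivative of `c / √(c² + μ²)`. -/
def angle2 (j c c1 c2 m m1 m2 : ℝ) : ℝ :=
  (c2 * m ^ 2 + c1 * m * m1 - c * m1 ^ 2 - c * m * m2) / j ^ 3 -
    3 * (c1 * m ^ 2 - c * m * m1) * (c * c1 + m * m1) / j ^ 5

lemma abs_angle1_le {j c c1 m m1 l e : ℝ} (hj : 0 < j) (hj2 : j ^ 2 = c ^ 2 + m ^ 2) (hm : 0 < m)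
    (hc : |c1| ≤ e * m) (hm1 : |m1| ≤ l * m) : |angle1 j c c1 m m1| ≤ e + l := by
  have hmj : m ≤ j := by nlinarith [sq_nonneg c]
  have hcj : |c| ≤ j := abs_le_of_sq_le_sq (by nlinarith) hj.le
  have he : 0 ≤ e * m := (abs_nonneg _).trans hc
  have hl : 0 ≤ l * m := (abs_nonneg _).trans hm1
  have he' : 0 ≤ e := by by_contra h; nlinarith
  have hl' : 0 ≤ l := by by_contra h; nlinarith
  unfold angle1
  rw [abs_div, abs_of_pos (by positivity : 0 < j ^ 3), div_le_iff₀ (by positivity)]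
  calc |c1 * m ^ 2 - c * m * m1| ≤ |c1 * m ^ 2| + |c * m * m1| := abs_sub _ _
    _ = |c1| * m ^ 2 + |c| * m * |m1| := by
        rw [abs_mul, abs_mul, abs_mul, abs_of_pos hm, abs_of_pos (by positivity : 0 < m ^ 2)]
    _ ≤ (e * m) * m ^ 2 + j * m * (l * m) := by gcongr
    _ ≤ (e * j) * j ^ 2 + j * j * (l * j) := by gcongr
    _ = _ := by ring

/-- In normalized variables the left side is `-(m² / j)` times the expression of `entropy_algebra`,
and `m² / j ≤ m`. Here `c` stands for `u + 1`, `m` for the profile and `a` for `G''(u)`. -/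
lemma entropy_production_le {a K κ j c c1 c2 m m1 m2 l e : ℝ} (hκ : 0 < κ) (ha : κ ≤ a)
    (haK : a ≤ K) (hj : 0 < j) (hj2 : j ^ 2 = c ^ 2 + m ^ 2) (hm : 0 < m) (hc : |c1| ≤ e * m)
    (he : e ^ 2 ≤ κ / 18) (he1 : e ≤ 1) (hm1 : |m1| ≤ l * m) (hm2 : |m2| ≤ 8 * l ^ 2 * m)
    (hl : l ≤ 1) :
    -(angle1 j c c1 m m1 * (a * c1)) - angle2 j c c1 c2 m m1 m2 * c2 ≤ (K + 98) * l ^ 2 * m := by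
  have hmj : m ≤ j := by nlinarith [sq_nonneg c]
  have h := entropy_algebra (γ := c / j) (σ := m / j) (δ := c1 / j) (η := c2 / j) (θ₁ := m1 / m)
    (θ₂ := m2 / m) (l := l) (e := e) hκ ha haK (by rw [div_pow, div_pow]; field_simp; linarith)
    (by
      rw [abs_div, abs_of_pos hj, div_le_iff₀ hj]
      have : 0 ≤ e := by
        by_contra hn
        have := (abs_nonneg _).trans hc
        nlinarith
      exact hc.trans (by gcongr)) he he1
    (by rw [abs_div, abs_of_pos hm, div_le_iff₀ hm]; exact hm1)
    (by rw [abs_div, abs_of_pos hm, div_le_iff₀ hm]; exact hm2) hl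
  have e1 : -(angle1 j c c1 m m1 * (a * c1)) - angle2 j c c1 c2 m m1 m2 * c2 =
      -(m * (m / j)) * (a * (c1 / j) ^ 2 - a * (c / j) * (m1 / m) * (c1 / j) + (c2 / j) ^ 2 +
      c2 / j * (m1 / m * (c1 / j) - c / j * (m1 / m) ^ 2 - c / j * (m2 / m) -
        3 * (c1 / j - c / j * (m1 / m)) * (c / j * (c1 / j) + (m / j) ^ 2 * (m1 / m)))) := by
    unfold angle1 angle2
    field_simp
    ring
  have h3 : 0 ≤ m * (m / j) := by positivity
  have h4 : m * (m / j) ≤ m * 1 := by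
    gcongr; rwa [div_le_one hj]
  have h5 : 0 ≤ (K + 98) * l ^ 2 := by
    have : 0 ≤ K := by linarith
    positivity
  rw [e1]
  calc _ ≤ m * (m / j) * ((K + 98) * l ^ 2) := by
        rw [neg_mul, ← mul_neg]
        exact mul_le_mul_of_nonneg_left (by linarith only [h]) h3
    _ ≤ m * 1 * ((K + 98) * l ^ 2) := by gcongr
    _ = _ := by ring

/-! ### Slow profiles and the smoothed modulus -/

/-- Positive functions that vary slowly. -/
structure SlowProfile (l : ℝ) (m m1 m2 : ℝ → ℝ) : Prop where
  pos : ∀ x, 0 < m x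
  deriv0 : ∀ x, HasDerivAt m (m1 x) x
  deriv1 : ∀ x, HasDerivAt m1 (m2 x) x
  cont2 : Continuous m2
  bound1 : ∀ x, |m1 x| ≤ l * m x
  bound2 : ∀ x, |m2 x| ≤ 8 * l ^ 2 * m x

/-- Smooth approximation of `|c|`. -/
def softAbs (c m : ℝ) : ℝ := Real.sqrt (c ^ 2 + m ^ 2)

lemma softAbs_pos {c m : ℝ} (hm : 0 < m) : 0 < softAbs c m := Real.sqrt_pos.2 (by positivity)

lemma softAbs_sq (c m : ℝ) : softAbs c m ^ 2 = c ^ 2 + m ^ 2 := Real.sq_sqrt (by positivity)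

lemma abs_le_softAbs (c m : ℝ) : |c| ≤ softAbs c m :=
  Real.abs_le_sqrt (le_add_of_nonneg_right (sq_nonneg m))

lemma softAbs_le (c : ℝ) {m : ℝ} (hm : 0 < m) : softAbs c m ≤ |c| + m := by
  refine Real.sqrt_le_iff.2 ⟨by positivity, ?_⟩
  nlinarith [abs_nonneg c, sq_abs c]

lemma continuous_softAbs {c m : ℝ → ℝ} (hc : Continuous c) (hm : Continuous m) :
    Continuous fun x => softAbs (c x) (m x) := by unfold softAbs; fun_prop

lemma hasDerivAt_softAbs {c m : ℝ → ℝ} {c1 m1 x : ℝ} (hc : HasDerivAt c c1 x)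
    (hm : HasDerivAt m m1 x) (h0 : 0 < m x) :
    HasDerivAt (fun x => softAbs (c x) (m x)) ((c x * c1 + m x * m1) / softAbs (c x) (m x)) x := by
  have := ((hc.fun_pow 2).fun_add (hm.fun_pow 2)).sqrt (by positivity)
  refine this.congr_deriv ?_
  unfold softAbs
  field_simp
  push_cast
  ring

lemma hasDerivAt_angle {c m : ℝ → ℝ} {c1 m1 x : ℝ} (hc : HasDerivAt c c1 x)
    (hm : HasDerivAt m m1 x) (h0 : 0 < m x) :
    HasDerivAt (fun x => c x / softAbs (c x) (m x))
      (angle1 (softAbs (c x) (m x)) (c x) c1 (m x) m1) x := by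
  have hj := softAbs_pos (c := c x) h0
  have hj2 := softAbs_sq (c x) (m x)
  refine (hc.fun_div (hasDerivAt_softAbs hc hm h0) hj.ne').congr_deriv ?_
  unfold angle1
  generalize softAbs (c x) (m x) = j at *
  field_simp
  linear_combination c1 * hj2

lemma hasDerivAt_angle1 {c c1 m m1 : ℝ → ℝ} {c2 m2 x : ℝ} (hc : HasDerivAt c (c1 x) x)
    (hc1 : HasDerivAt c1 c2 x) (hm : HasDerivAt m (m1 x) x) (hm1 : HasDerivAt m1 m2 x)
    (h0 : 0 < m x) :
    HasDerivAt (fun x => angle1 (softAbs (c x) (m x)) (c x) (c1 x) (m x) (m1 x))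
      (angle2 (softAbs (c x) (m x)) (c x) (c1 x) c2 (m x) (m1 x) m2) x := by
  have hj := softAbs_pos (c := c x) h0
  have hN := (hc1.fun_mul (hm.fun_pow 2)).fun_sub ((hc.fun_mul hm).fun_mul hm1)
  refine (hN.fun_div ((hasDerivAt_softAbs hc hm h0).fun_pow 3) (pow_ne_zero 3 hj.ne')).congr_deriv ?_
  unfold angle2
  push_cast
  generalize softAbs (c x) (m x) = j at *
  field_simp
  ring

section profile
variable {f : ℝ → ℝ}

lemma norm_mul_majorant_le {k C z : ℝ} (hk : |k| ≤ C) : ‖k * majorant f z‖ ≤ C * majorant f z := by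
  rw [norm_mul, Real.norm_of_nonneg (majorant_pos f z).le, Real.norm_eq_abs]
  exact mul_le_mul_of_nonneg_right hk (majorant_pos f z).le

lemma hasDerivAt_integral_mul_majorant (hf : Continuous f) (hV : excessMass f < ⊤)
    {k k' : ℝ → ℝ → ℝ} {C : ℝ} (ck : ∀ y, Continuous (k y)) (ck' : ∀ y, Continuous (k' y))
    (hk : ∀ y z, |k y z| ≤ C) (hk' : ∀ y z, |k' y z| ≤ C)
    (hd : ∀ y z, HasDerivAt (fun y => k y z) (k' y z) y) (y : ℝ) :
    HasDerivAt (fun y => ∫ z, k y z * majorant f z) (∫ z, k' y z * majorant f z) y := by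
  have cm := continuous_majorant hf
  have im := integrable_majorant hf hV
  refine (hasDerivAt_integral_of_dominated_loc_of_deriv_le (F := fun y z => k y z * majorant f z)
    (F' := fun y z => k' y z * majorant f z) (bound := fun z => C * majorant f z)
    (s := univ) univ_mem ?_ ?_ ?_ ?_ ?_ ?_).2
  · exact Eventually.of_forall fun y => ((ck y).mul cm).aestronglyMeasurable
  · exact (im.const_mul C).mono' ((ck y).mul cm).aestronglyMeasurable
      (ae_of_all _ fun z => norm_mul_majorant_le (hk y z))
  · exact ((ck' y).mul cm).aestronglyMeasurable
  · exact ae_of_all _ fun z y _ => norm_mul_majorant_le (hk' y z)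
  · exact im.const_mul C
  · exact ae_of_all _ fun z y _ => (hd y z).mul_const _

lemma abs_integral_mul_majorant_le (hf : Continuous f) (hV : excessMass f < ⊤) {k : ℝ → ℝ} {C L y : ℝ}
    (h : ∀ z, |k z| ≤ C * tail L y z) : |∫ z, k z * majorant f z| ≤ C * localMass f L y := by
  rw [localMass, ← integral_const_mul, ← Real.norm_eq_abs]
  refine norm_integral_le_of_norm_le ((integrable_tail_mul_majorant hf hV L y).const_mul C)
    (ae_of_all _ fun z => ?_)
  rw [← mul_assoc]
  exact norm_mul_majorant_le (h z)

/-- The derivative of `tail L y z` with respect to `y`. -/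
def tailD (L y z : ℝ) : ℝ := 2 * L⁻¹ * ((z - y) / L) * tail L y z ^ 2

/-- The second derivative of `tail L y z` with respect to `y`. -/
def tailDD (L y z : ℝ) : ℝ :=
  -2 * L⁻¹ ^ 2 * tail L y z ^ 2 + 8 * L⁻¹ ^ 2 * ((z - y) / L) ^ 2 * tail L y z ^ 3

lemma hasDerivAt_tail (L y z : ℝ) : HasDerivAt (fun y => tail L y z) (tailD L y z) y := by
  have h1 : HasDerivAt (fun y : ℝ => (z - y) / L) (-1 / L) y :=
    ((hasDerivAt_id y).const_sub z).div_const L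
  have h2 := ((h1.fun_pow 2).const_add 1).fun_inv
    (by positivity : (1 + ((z - y) / L) ^ 2 : ℝ) ≠ 0)
  refine h2.congr_deriv ?_
  unfold tailD tail
  have : (1 + ((z - y) / L) ^ 2 : ℝ) ≠ 0 := by positivity
  rw [inv_pow, div_eq_mul_inv _ ((1 + ((z - y) / L) ^ 2) ^ 2)]
  push_cast
  ring

lemma hasDerivAt_tailD (L y z : ℝ) : HasDerivAt (fun y => tailD L y z) (tailDD L y z) y := by
  have h1 : HasDerivAt (fun y : ℝ => (z - y) / L) (-1 / L) y :=
    ((hasDerivAt_id y).const_sub z).div_const L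
  refine ((h1.const_mul (2 * L⁻¹)).fun_mul ((hasDerivAt_tail L y z).fun_pow 2)).congr_deriv ?_
  unfold tailDD tailD
  push_cast
  ring

lemma tail_mul (L y z : ℝ) : (1 + ((z - y) / L) ^ 2) * tail L y z = 1 :=
  mul_inv_cancel₀ (by positivity)

lemma abs_tailD_le {L : ℝ} (hL : 0 < L) (y z : ℝ) : |tailD L y z| ≤ L⁻¹ * tail L y z := by
  have h1 := tail_mul L y z
  have h2 := tail_pos L y z
  have h3 : 2 * |(z - y) / L| ≤ 1 + ((z - y) / L) ^ 2 := by
    nlinarith [sq_nonneg (|(z - y) / L| - 1), sq_abs ((z - y) / L)]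
  unfold tailD
  rw [abs_mul, abs_mul, abs_of_pos (by positivity : 0 < 2 * L⁻¹), abs_of_pos (by positivity : 0 < tail L y z ^ 2)]
  calc 2 * L⁻¹ * |(z - y) / L| * tail L y z ^ 2 = L⁻¹ * (2 * |(z - y) / L|) * tail L y z ^ 2 := by ring
    _ ≤ L⁻¹ * (1 + ((z - y) / L) ^ 2) * tail L y z ^ 2 := by gcongr
    _ = L⁻¹ * ((1 + ((z - y) / L) ^ 2) * tail L y z) * tail L y z := by ring
    _ = _ := by rw [h1]; ring

lemma abs_tailDD_le {L : ℝ} (y z : ℝ) : |tailDD L y z| ≤ 8 * L⁻¹ ^ 2 * tail L y z := by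
  have h1 := tail_mul L y z
  have h2 := tail_pos L y z
  have h3 := tail_le_one L y z
  have h4 : ((z - y) / L) ^ 2 * tail L y z = 1 - tail L y z := by linarith
  have e : tailDD L y z = L⁻¹ ^ 2 * ((6 - 8 * tail L y z) * tail L y z * tail L y z) := by
    unfold tailDD
    linear_combination (8 * L⁻¹ ^ 2 * tail L y z ^ 2) * h4
  rw [e, abs_mul, abs_of_nonneg (by positivity : 0 ≤ L⁻¹ ^ 2), abs_mul, abs_mul, abs_of_pos h2]
  have h5 : |6 - 8 * tail L y z| ≤ 8 := by rw [abs_le]; constructor <;> linarith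
  calc _ ≤ L⁻¹ ^ 2 * (8 * 1 * tail L y z) := by gcongr
    _ = _ := by ring

/-- The local mass is a slow profile. -/
lemma slowProfile_localMass (hf : Continuous f) (hV : excessMass f < ⊤) {L A : ℝ} (hL : 1 ≤ L)
    (hA : 0 < A) :
    SlowProfile L⁻¹ (fun y => A * localMass f L y) (fun y => A * ∫ z, tailD L y z * majorant f z)
      (fun y => A * ∫ z, tailDD L y z * majorant f z) := by
  have hL0 : 0 < L := by linarith
  have hLi : L⁻¹ ≤ 1 := inv_le_one_of_one_le₀ hL
  have hLi0 : 0 < L⁻¹ := by positivity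
  have ct := tail_joint L
  have b0 : ∀ y z, |tail L y z| ≤ 8 := fun y z => by
    rw [abs_of_pos (tail_pos _ _ _)]; linarith [tail_le_one L y z]
  have b1 : ∀ y z, |tailD L y z| ≤ 8 := fun y z => by
    have := abs_tailD_le hL0 y z
    have := mul_le_mul hLi (tail_le_one L y z) (tail_pos _ _ _).le zero_le_one
    linarith
  have b2 : ∀ y z, |tailDD L y z| ≤ 8 := fun y z => by
    have := abs_tailDD_le (L := L) y z
    have h1 : L⁻¹ ^ 2 ≤ 1 := pow_le_one₀ hLi0.le hLi
    have := mul_le_mul h1 (tail_le_one L y z) (tail_pos _ _ _).le zero_le_one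
    linarith
  have c0 : ∀ y, Continuous fun z => tail L y z := fun y => continuous_tail L y
  have c1 : ∀ y, Continuous fun z => tailD L y z := fun y => by unfold tailD; fun_prop
  have c2 : ∀ y, Continuous fun z => tailDD L y z := fun y => by unfold tailDD; fun_prop
  exact {
    pos := fun y => mul_pos hA (localMass_pos hf hV L y)
    deriv0 := fun y => (hasDerivAt_integral_mul_majorant hf hV c0 c1 b0 b1
      (fun y z => hasDerivAt_tail L y z) y).const_mul A
    deriv1 := fun y => (hasDerivAt_integral_mul_majorant hf hV c1 c2 b1 b2
      (fun y z => hasDerivAt_tailD L y z) y).const_mul A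
    cont2 := by
      refine continuous_const.mul (continuous_of_dominated (bound := fun z => 8 * majorant f z)
        (fun y => ((c2 y).mul (continuous_majorant hf)).aestronglyMeasurable)
        (fun y => ae_of_all _ fun z => norm_mul_majorant_le (b2 y z))
        ((integrable_majorant hf hV).const_mul 8) (ae_of_all _ fun z => ?_))
      have : Continuous fun y => tail L y z := ct.comp (by fun_prop : Continuous fun y : ℝ => (y, z))
      unfold tailDD
      fun_prop
    bound1 := fun y => by
      have := abs_integral_mul_majorant_le hf hV (fun z => abs_tailD_le hL0 y z)
      rw [abs_mul, abs_of_pos hA]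
      calc _ ≤ A * (L⁻¹ * localMass f L y) := by gcongr
        _ = _ := by ring
    bound2 := fun y => by
      have := abs_integral_mul_majorant_le hf hV (fun z => abs_tailDD_le (L := L) y z)
      rw [abs_mul, abs_of_pos hA]
      calc _ ≤ A * (8 * L⁻¹ ^ 2 * localMass f L y) := by gcongr
        _ = _ := by ring }

end profile

/-! ### Entropy inequalities for the flow -/

variable {G : ℝ → ℝ} {u : ℝ → ℝ → ℝ} {I : Set ℝ} {K κ ρ E : ℝ}

lemma SlowProfile.cont0 {l : ℝ} {m m1 m2 : ℝ → ℝ} (h : SlowProfile l m m1 m2) : Continuous m :=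
  continuous_iff_continuousAt.2 fun x => (h.deriv0 x).continuousAt

lemma SlowProfile.cont1 {l : ℝ} {m m1 m2 : ℝ → ℝ} (h : SlowProfile l m m1 m2) : Continuous m1 :=
  continuous_iff_continuousAt.2 fun x => (h.deriv1 x).continuousAt

lemma Cutoff.abs_deriv_le {B L : ℝ} {φ : ℕ → ℝ → ℝ} {ψ : ℝ → ℝ} (hC : Cutoff B L φ ψ) (hB : 1 ≤ B)
    (hL : 1 ≤ L) (x : ℝ) : |φ 1 x| ≤ B * L⁻¹ * ψ x ∧ |φ 2 x| ≤ B * L⁻¹ * ψ x := by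
  have hL0 : 0 < L := by linarith
  obtain ⟨h0, h1, h2, -, h3, -⟩ := hC.bounds hB hL0 x
  have hψ := hC.psi_nonneg x
  have hLi : L⁻¹ ≤ 1 := inv_le_one_of_one_le₀ hL
  constructor
  · refine abs_le_of_sq_le_sq (h2.trans ?_) (by positivity)
    calc B * L⁻¹ ^ 2 * (φ 0 x * ψ x) ≤ B * L⁻¹ ^ 2 * (ψ x * ψ x) := by gcongr
      _ ≤ B * (B * L⁻¹ ^ 2 * (ψ x * ψ x)) := le_mul_of_one_le_left (by positivity) hB
      _ = _ := by ring
  · refine h3.trans ?_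
    have : L⁻¹ ^ 2 ≤ L⁻¹ := by
      rw [sq]; exact mul_le_of_le_one_left (by positivity) hLi
    gcongr

/-- The weighted entropy inequality. -/
lemma RegularFlow.weighted_entropy (H : RegularFlow G u) {m m1 m2 : ℝ → ℝ} {l e s t L y : ℝ}
    (hm : SlowProfile l m m1 m2) (hl : l ≤ 1) (hL : 1 ≤ L) (hs : 0 < s) (hst : s ≤ t) (hκ : 0 < κ)
    (he : e ^ 2 ≤ κ / 18) (he1 : e ≤ 1)
    (h2 : ∀ τ ∈ Icc s t, ∀ x, κ ≤ deriv (deriv G) (u τ x) ∧ deriv (deriv G) (u τ x) ≤ K)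
    (h1 : ∀ τ ∈ Icc s t, ∀ x, |slope u τ x| ≤ e * m x) :
    wint L y (fun x => softAbs (u t x + 1) (m x)) ≤
      wint L y (fun x => softAbs (u s x + 1) (m x)) +
      ∫⁻ τ in Ioc s t, wint L y (fun x => (K + 98) * l ^ 2 * m x +
        cutoffConst * (K + 5) * (L⁻¹ * (|slope u τ x| + |curv u τ x|))) := by
  have hL0 : 0 < L := by linarith
  have hB := one_le_cutoffConst
  have hK0 : 0 ≤ K := by
    have := h2 s ⟨le_rfl, hst⟩ 0
    linarith [this.1, this.2]
  have cm := hm.cont0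
  have cm1 := hm.cont1
  have lift : ∀ {g : ℝ → ℝ}, Continuous g → ContinuousOn (fun z : ℝ × ℝ => g z.2)
      (Ioi (0 : ℝ) ×ˢ univ) := fun hg => continuousOn_lift_space hg
  have Hc : ContinuousOn (fun z : ℝ × ℝ => u z.1 z.2 + 1) (Ioi 0 ×ˢ univ) :=
    H.cont.add continuousOn_const
  have cj : ContinuousOn (fun z : ℝ × ℝ => softAbs (u z.1 z.2 + 1) (m z.2)) (Ioi 0 ×ˢ univ) :=
    ((Hc.pow 2).add ((lift cm).pow 2)).sqrt
  have := weighted_inequality (a := 0) (L := L) (y := y) (A := fun _ _ => 0)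
    (B := fun τ x => softAbs (u τ x + 1) (m x)) (R := fun τ x => (K + 98) * l ^ 2 * m x +
        cutoffConst * (K + 5) * (L⁻¹ * (|slope u τ x| + |curv u τ x|))) hL0 hs hst cj
    continuousOn_const ((continuousOn_const.mul (lift cm)).add
      (continuousOn_const.mul (continuousOn_const.mul (H.cont_slope.abs.add H.cont_curv.abs))))
    (fun τ _ x => (softAbs_pos (hm.pos x)).le) (fun _ _ _ => le_rfl)
    (fun τ _ x => by have := hm.pos x; positivity) ?_
  · simpa [wint] using this
  intro φ ψ hC τ hτ
  have hτ0 : 0 < τ := hs.trans_le hτ.1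
  obtain ⟨r, hr⟩ := hC.compact
  have c0 := hC.cont 0 (by norm_num)
  have c1 := hC.cont 1 (by norm_num)
  have c2 := hC.cont 2 (by norm_num)
  have cψ := hC.contψ
  have z0 : ∀ x, r < |x| → φ 0 x = 0 := fun x hx => (hr x hx).2 0 (by norm_num)
  have z1 : ∀ x, r < |x| → φ 1 x = 0 := fun x hx => (hr x hx).2 1 (by norm_num)
  have z2 : ∀ x, r < |x| → φ 2 x = 0 := fun x hx => (hr x hx).2 2 (by norm_num)
  have zψ : ∀ x, r < |x| → ψ x = 0 := fun x hx => (hr x hx).1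
  have pj : ∀ x, softAbs (u τ x + 1) (m x) ≠ 0 := fun x => (softAbs_pos (hm.pos x)).ne'
  refine ⟨∫ x, φ 0 x * ((u τ x + 1) / softAbs (u τ x + 1) (m x) * potXX G u τ x),
    hasDerivAt_integral_of_continuousOn (R := r)
    (F := fun τ x => φ 0 x * softAbs (u τ x + 1) (m x))
    (F' := fun τ x => φ 0 x * ((u τ x + 1) / softAbs (u τ x + 1) (m x) * potXX G u τ x))
    ((lift c0).mul cj) ((lift c0).mul ((Hc.div cj fun z _ => (softAbs_pos (hm.pos z.2)).ne').mul
      H.cont_potXX)) (fun σ hσ x => ?_) (fun σ _ x hx => by simp [z0 x hx])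
    (fun σ _ x hx => by simp [z0 x hx]) hτ0, ?_⟩
  · refine ((hasDerivAt_softAbs (m := fun _ => m x) ((H.timeFamily.derivt σ hσ x))
      (hasDerivAt_const σ (m x)) (hm.pos x)).const_mul (φ 0 x)).congr_deriv ?_
    rw [mul_zero, add_zero, div_mul_eq_mul_div]
  · simp only [mul_zero, integral_zero, neg_zero, zero_add]
    have cu : Continuous fun x => u τ x + 1 := (continuous_slice H.cont hτ0).add continuous_const
    have cux := continuous_slice H.cont_slope hτ0
    have cuxx := continuous_slice H.cont_curv hτ0
    have cpX := continuous_slice H.cont_potX hτ0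
    have cpXX := continuous_slice H.cont_potXX hτ0
    have cG2 : Continuous fun x => deriv (deriv G) (u τ x) :=
      (continuous_deriv_deriv_of_contDiff_two H.contG).comp (continuous_slice H.cont hτ0)
    have cjτ : Continuous fun x => softAbs (u τ x + 1) (m x) := continuous_softAbs cu cm
    set γ : ℝ → ℝ := fun x => (u τ x + 1) / softAbs (u τ x + 1) (m x) with hγ
    set γ₁ : ℝ → ℝ := fun x =>
      angle1 (softAbs (u τ x + 1) (m x)) (u τ x + 1) (slope u τ x) (m x) (m1 x) with hγ₁
    set γ₂ : ℝ → ℝ := fun x => angle2 (softAbs (u τ x + 1) (m x)) (u τ x + 1) (slope u τ x)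
      (curv u τ x) (m x) (m1 x) (m2 x) with hγ₂
    have cγ : Continuous γ := cu.div cjτ pj
    have cγ₁ : Continuous γ₁ := by
      simp only [hγ₁]; unfold angle1
      exact ((cux.mul (cm.pow 2)).sub ((cu.mul cm).mul cm1)).div (cjτ.pow 3)
        fun x => pow_ne_zero 3 (pj x)
    have cγ₂ : Continuous γ₂ := by
      have := hm.cont2
      simp only [hγ₂]; unfold angle2
      refine Continuous.sub (Continuous.div (by fun_prop) (cjτ.pow 3) fun x => pow_ne_zero 3 (pj x))
        (Continuous.div (by fun_prop) (cjτ.pow 5) fun x => pow_ne_zero 5 (pj x))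
    have dγ : ∀ x, HasDerivAt γ (γ₁ x) x := fun x => hasDerivAt_angle
      (H.timeFamily.deriv0 τ hτ0 x) (hm.deriv0 x) (hm.pos x)
    have dγ₁ : ∀ x, HasDerivAt γ₁ (γ₂ x) x := fun x => hasDerivAt_angle1
      (H.timeFamily.deriv0 τ hτ0 x) (H.deriv_slope τ hτ0 x) (hm.deriv0 x) (hm.deriv1 x) (hm.pos x)
    -- After two integrations by parts the term `(φ γ)_x p_x` cancels against the one in `u_xxx =
    -- G''(u) u_x - p_x`. What remains is the production `-γ₁ G'' u_x - γ₂ u_xx` under `φ` and terms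
    -- with derivatives of `φ`.
    refine integral_le_of_flux (R := r)
      (F := fun x => φ 0 x * γ x * potX G u τ x + (φ 1 x * γ x + φ 0 x * γ₁ x) * curv u τ x)
      (F' := fun x => ((φ 1 x * γ x + φ 0 x * γ₁ x) * potX G u τ x +
        φ 0 x * γ x * potXX G u τ x) + ((φ 2 x * γ x + φ 1 x * γ₁ x +
        (φ 1 x * γ₁ x + φ 0 x * γ₂ x)) * curv u τ x + (φ 1 x * γ x + φ 0 x * γ₁ x) *
        (deriv (deriv G) (u τ x) * slope u τ x - potX G u τ x)))
      (by fun_prop) (by fun_prop) (by fun_prop) (fun x => ?_) (fun x hx => by simp [z0 x hx])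
      (fun x hx => by simp [zψ x hx]) (fun x hx => by simp [z0 x hx, z1 x hx])
      (fun x hx => by simp [z0 x hx, z1 x hx, z2 x hx]) fun x => ?_
    · have d0 := hC.deriv 0 (by norm_num) x
      have d1 := hC.deriv 1 (by norm_num) x
      exact ((d0.fun_mul (dγ x)).fun_mul (H.deriv_potX τ hτ0 x)).fun_add
        (((d1.fun_mul (dγ x)).fun_add (d0.fun_mul (dγ₁ x))).fun_mul (H.deriv_curv τ hτ0 x))
    · have hφ0 := hC.nonneg x
      have hφψ := hC.le x
      have hψ := hC.psi_nonneg x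
      obtain ⟨b1, b2⟩ := hC.abs_deriv_le hB hL x
      have hj := softAbs_pos (c := u τ x + 1) (hm.pos x)
      have hprod := entropy_production_le (c2 := curv u τ x) hκ (h2 τ hτ x).1 (h2 τ hτ x).2 hj
        (softAbs_sq _ _) (hm.pos x) (h1 τ hτ x) he he1 (hm.bound1 x) (hm.bound2 x) hl
      have hγ1b : |γ x| ≤ 1 := by
        rw [hγ, abs_div, abs_of_pos hj, div_le_one hj]; exact abs_le_softAbs _ _
      have hγ2b : |γ₁ x| ≤ 2 := (abs_angle1_le hj (softAbs_sq _ _) (hm.pos x) (h1 τ hτ x)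
        (hm.bound1 x)).trans (by linarith)
      have ha : |deriv (deriv G) (u τ x)| ≤ K := by
        rw [abs_of_pos (hκ.trans_le (h2 τ hτ x).1)]; exact (h2 τ hτ x).2
      have hm0 := (hm.pos x).le
      have k1 : φ 0 x * (-(γ₁ x * (deriv (deriv G) (u τ x) * slope u τ x)) - γ₂ x * curv u τ x) ≤
          ψ x * ((K + 98) * l ^ 2 * m x) :=
        (mul_le_mul_of_nonneg_left hprod hφ0).trans (by gcongr)
      have k2 : |φ 1 x * γ x * deriv (deriv G) (u τ x) * slope u τ x| ≤
          cutoffConst * L⁻¹ * ψ x * 1 * K * |slope u τ x| := by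
        rw [abs_mul, abs_mul, abs_mul]; gcongr
      have k3 : |φ 1 x * γ₁ x * curv u τ x| ≤ cutoffConst * L⁻¹ * ψ x * 2 * |curv u τ x| := by
        rw [abs_mul, abs_mul]; gcongr
      have k4 : |φ 2 x * γ x * curv u τ x| ≤ cutoffConst * L⁻¹ * ψ x * 1 * |curv u τ x| := by
        rw [abs_mul, abs_mul]; gcongr
      have p1 : 0 ≤ cutoffConst * L⁻¹ * ψ x * |slope u τ x| := by positivity
      have p2 : 0 ≤ cutoffConst * L⁻¹ * ψ x * |curv u τ x| * K := by positivity
      change φ 0 x * (γ x * potXX G u τ x) ≤ _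
      have k2' := (abs_le.1 k2).1
      have k3' := (abs_le.1 k3).1
      have k4' := (abs_le.1 k4).1
      linarith only [k1, k2', k3', k4', p1, p2]

/-- The entropy inequality near the well. -/
lemma Tame.entropy_le (h : Tame G I K κ ρ E u) {m m1 m2 : ℝ → ℝ} {l e s t : ℝ}
    (hm : SlowProfile l m m1 m2) (hl : l ≤ 1) (hs : 0 < s) (hst : s ≤ t)
    (he : e ^ 2 ≤ κ / 18) (he1 : e ≤ 1)
    (hgood : ∀ τ ∈ Icc s t, ∀ x, |u τ x + 1| ≤ ρ)
    (h1 : ∀ τ ∈ Icc s t, ∀ x, |slope u τ x| ≤ e * m x) :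
    ∫⁻ x, ENNReal.ofReal (softAbs (u t x + 1) (m x)) ≤
      (∫⁻ x, ENNReal.ofReal (softAbs (u s x + 1) (m x))) +
        ENNReal.ofReal ((K + 98) * l ^ 2 * (t - s)) * ∫⁻ x, ENNReal.ofReal (m x) := by
  have H := h.regularFlow
  have hB := one_le_cutoffConst
  have hK1 := h.well.one_le
  have ht : 0 < t := hs.trans_le hst
  obtain ⟨B, hBt, -, hBi⟩ := h.normSq_bounded t
  have hBi := hBi s hs t hst le_rfl
  have cm := hm.cont0
  set c := cutoffConst * (K + 5) with hc
  have hc0 : 0 ≤ c := by positivity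
  set X := (∫⁻ x, ENNReal.ofReal (softAbs (u s x + 1) (m x))) +
        ENNReal.ofReal ((K + 98) * l ^ 2 * (t - s)) * ∫⁻ x, ENNReal.ofReal (m x) with hX
  have step : ∀ n : ℕ, wint (n + 1) 0 (fun x => softAbs (u t x + 1) (m x)) ≤
      X + (ENNReal.ofReal (Real.pi * c * (t - s) * Real.sqrt ((n : ℝ) + 1)⁻¹) +
        ENNReal.ofReal (c * Real.sqrt ((n : ℝ) + 1)⁻¹) * B) := by
    intro n
    have hn : 0 ≤ (n : ℝ) := n.cast_nonneg
    set L : ℝ := n + 1 with hL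
    have hL1 : 1 ≤ L := by linarith
    have hL0 : 0 < L := by linarith
    -- Young's inequality with parameter `b = L^{-1/2}` splits the error `L⁻¹ (|u_x| + |u_xx|)` into
    -- `b³`, of weighted integral of order `b³ L = b`, and `b` times squares whose space-time
    -- integral is finite. Both vanish as `L → ∞`.
    set b := Real.sqrt L⁻¹ with hb
    have hb0 : 0 < b := Real.sqrt_pos.2 (by positivity)
    have hb2 : b ^ 2 = L⁻¹ := Real.sq_sqrt (by positivity)
    refine (H.weighted_entropy (K := K) (κ := κ) (L := L) (y := 0) hm hl hL1 hs hst h.well.κ_pos he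
      he1 (fun τ hτ x => ⟨h.well.convex _ (hgood τ hτ x), (le_abs_self _).trans
        (h.well.deriv2_le _ (h.mem τ (hs.le.trans hτ.1) x))⟩) h1).trans ?_
    rw [hX, add_assoc]
    refine add_le_add (wint_le_lintegral fun x => (softAbs_pos (hm.pos x)).le) ?_
    have pt : ∀ τ, s < τ → τ ≤ t → wint L 0 (fun x => (K + 98) * l ^ 2 * m x +
        c * (L⁻¹ * (|slope u τ x| + |curv u τ x|))) ≤
        (ENNReal.ofReal ((K + 98) * l ^ 2) * (∫⁻ x, ENNReal.ofReal (m x)) +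
          ENNReal.ofReal (Real.pi * c * b)) +
        ENNReal.ofReal (c * b) *
          ∫⁻ x, ENNReal.ofReal (1 / 2 * (slope u τ x ^ 2 + curv u τ x ^ 2)) := by
      intro τ h1 h2
      have hτ : 0 < τ := hs.trans h1
      have cux := continuous_slice H.cont_slope hτ
      have cuxx := continuous_slice H.cont_curv hτ
      calc _ ≤ wint L 0 (fun x => ((K + 98) * l ^ 2 * m x + c * b ^ 3) +
            (c * b) * (1 / 2 * (slope u τ x ^ 2 + curv u τ x ^ 2))) := by
            refine wint_mono fun x => ?_
            have q1 : b * |slope u τ x| ≤ (slope u τ x ^ 2 + b ^ 2) / 2 := by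
              nlinarith only [sq_nonneg (|slope u τ x| - b), sq_abs (slope u τ x)]
            have q2 : b * |curv u τ x| ≤ (curv u τ x ^ 2 + b ^ 2) / 2 := by
              nlinarith only [sq_nonneg (|curv u τ x| - b), sq_abs (curv u τ x)]
            have q3 := mul_le_mul_of_nonneg_left (add_le_add q1 q2) (by positivity : 0 ≤ c * b)
            rw [← hb2]
            linarith only [q3]
        _ = wint L 0 (fun x => (K + 98) * l ^ 2 * m x) + wint L 0 (fun _ => c * b ^ 3) +
            wint L 0 (fun x => (c * b) * (1 / 2 * (slope u τ x ^ 2 + curv u τ x ^ 2))) := by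
            have hm0 := fun x => (hm.pos x).le
            rw [wint_add (by fun_prop) (fun x => by have := hm0 x; positivity)
                (fun x => by positivity),
              wint_add (by fun_prop) (fun x => by have := hm0 x; positivity)
                (fun x => by positivity)]
        _ ≤ _ := by
            rw [wint_const_mul (by positivity), wint_const_mul (c := c * b) (by positivity)]
            refine add_le_add (add_le_add (mul_le_mul' le_rfl
              (wint_le_lintegral fun x => (hm.pos x).le)) ?_) (mul_le_mul' le_rfl
              (wint_le_lintegral fun x => by positivity))
            refine (wint_le_of_le_const (C := c * b ^ 3) hL0 (by positivity) fun x => le_rfl).trans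
              (le_of_eq ?_)
            congr 1
            have : b ^ 2 * L = 1 := by rw [hb2, inv_mul_cancel₀ hL0.ne']
            linear_combination (c * b * Real.pi) * this
    refine (setLIntegral_mono_Ioc pt).trans ?_
    rw [lintegral_add_left measurable_const, setLIntegral_const,
      lintegral_const_mul' _ _ ENNReal.ofReal_ne_top, Real.volume_Ioc, add_mul, ← add_assoc]
    refine add_le_add (le_of_eq ?_) (mul_le_mul' le_rfl hBi)
    have hts : 0 ≤ t - s := by linarith
    rw [mul_right_comm, ← ENNReal.ofReal_mul (by positivity), ← ENNReal.ofReal_mul (by positivity)]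
    congr 2
    ring
  have hlim : Tendsto (fun n : ℕ => Real.sqrt ((n : ℝ) + 1)⁻¹) atTop (𝓝 0) := by
    have := (Real.continuous_sqrt.tendsto 0).comp
      (tendsto_one_div_add_atTop_nhds_zero_nat (𝕜 := ℝ))
    simpa [Function.comp_def] using this
  have hlim' : ∀ C : ℝ, Tendsto (fun n : ℕ => ENNReal.ofReal (C * Real.sqrt ((n : ℝ) + 1)⁻¹)) atTop
      (𝓝 0) := fun C => by
    simpa using ENNReal.tendsto_ofReal (hlim.const_mul C)
  have cj : Continuous fun x => softAbs (u t x + 1) (m x) := by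
    have cu := continuous_slice H.cont ht
    exact continuous_softAbs (by fun_prop) cm
  have := le_of_tendsto_of_tendsto' (tendsto_wint_atTop 0 cj fun x => (softAbs_pos (hm.pos x)).le)
    ((((hlim' (Real.pi * c * (t - s))).add (ENNReal.Tendsto.mul_const (hlim' c)
      (Or.inr hBt.ne))).const_add X)) step
  simpa using this

/-! ### The excess mass on short time intervals and near the well -/

/-- The excess mass, augmented by a fixed constant. -/
def augMass (f : ℝ → ℝ) : ℝ≥0∞ := excessMass f + ENNReal.ofReal Real.pi

lemma augMass_lt_top {f : ℝ → ℝ} (h : excessMass f < ⊤) : augMass f < ⊤ :=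
  ENNReal.add_lt_top.2 ⟨h, ENNReal.ofReal_lt_top⟩

lemma excessMass_lt_top {f : ℝ → ℝ} (h : augMass f < ⊤) : excessMass f < ⊤ :=
  lt_of_le_of_lt le_self_add h

lemma le_ofReal_mul {B : ℝ} (hB : 1 ≤ B) (a : ℝ≥0∞) : a ≤ ENNReal.ofReal B * a := by
  calc a = ENNReal.ofReal 1 * a := by simp
    _ ≤ _ := by gcongr

/-- The short-time bound holds on steps of length `δ` depending only on `K`; restarting the flow
after each step gives a power of the one-step factor. The constant added in `augMass` makes the
one-step bound multiplicative. -/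
lemma exists_augMass_le_short (K T : ℝ) (hK : 1 ≤ K) : ∃ B, 1 ≤ B ∧
    ∀ (G : ℝ → ℝ) (I : Set ℝ) (κ ρ E : ℝ) (u : ℝ → ℝ → ℝ), Tame G I K κ ρ E u →
      augMass (u 0) < ⊤ → ∀ t, 0 ≤ t → t ≤ T →
        augMass (u t) ≤ ENNReal.ofReal B * augMass (u 0) := by
  have hS := shortConst_pos (by linarith : 0 ≤ K)
  have hπ := Real.pi_pos
  set δ := (2 * shortConst K)⁻¹ with hδ
  have hδ0 : 0 < δ := by positivity
  set β := 2 * Real.pi * (Real.pi + 16 * Real.pi * shortConst K) + 1 with hβ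
  have hβ1 : 1 ≤ β := le_add_of_nonneg_left (by positivity)
  have step : ∀ (G : ℝ → ℝ) (I : Set ℝ) (κ ρ E : ℝ) (u : ℝ → ℝ → ℝ), Tame G I K κ ρ E u →
      augMass (u 0) < ⊤ → ∀ t, 0 ≤ t → t ≤ δ → augMass (u t) ≤ ENNReal.ofReal β * augMass (u 0) := by
    intro G I κ ρ E u h hV t ht htδ
    rcases ht.eq_or_lt with rfl | ht0
    · exact le_ofReal_mul hβ1 _
    · have := h.excessMass_le_short (excessMass_lt_top hV) ht0 (by
        calc 2 * shortConst K * t ≤ 2 * shortConst K * δ := by gcongr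
          _ = 1 := by rw [hδ]; field_simp)
      rw [hβ, ENNReal.ofReal_add (by positivity) zero_le_one, add_mul, ENNReal.ofReal_one, one_mul]
      exact add_le_add this le_add_self
  have iter : ∀ n : ℕ, ∀ (G : ℝ → ℝ) (I : Set ℝ) (κ ρ E : ℝ) (u : ℝ → ℝ → ℝ), Tame G I K κ ρ E u →
      augMass (u 0) < ⊤ → ∀ t, 0 ≤ t → t ≤ n * δ →
        augMass (u t) ≤ ENNReal.ofReal (β ^ n) * augMass (u 0) := by
    intro n
    induction n with
    | zero =>
      intro G I κ ρ E u h hV t ht ht'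
      simp only [Nat.cast_zero, zero_mul] at ht'
      rw [le_antisymm ht' ht]; simp
    | succ n ih =>
      intro G I κ ρ E u h hV t ht ht'
      rcases le_total t δ with htδ | htδ
      · refine (step G I κ ρ E u h hV t ht htδ).trans ?_
        gcongr
        exact le_self_pow₀ hβ1 (by simp)
      · have h1 := step G I κ ρ E u h hV δ hδ0.le le_rfl
        have h2 := h.shift hδ0.le
        have h3 := ih G I κ ρ E _ h2 (by
          simp only [add_zero]
          exact h1.trans_lt (ENNReal.mul_lt_top ENNReal.ofReal_lt_top hV)) (t - δ) (by linarith)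
          (by push_cast at ht'; linarith)
        simp only [add_zero, add_sub_cancel] at h3
        refine h3.trans ((mul_le_mul' le_rfl h1).trans (le_of_eq ?_))
        rw [← mul_assoc, ← ENNReal.ofReal_mul (by positivity), pow_succ]
  obtain ⟨n, hn⟩ := exists_nat_ge (T / δ)
  refine ⟨β ^ n, one_le_pow₀ hβ1, fun G I κ ρ E u h hV t ht htT => iter n G I κ ρ E u h hV t ht ?_⟩
  rw [div_le_iff₀ hδ0] at hn
  linarith

variable {G : ℝ → ℝ} {u : ℝ → ℝ → ℝ} {I : Set ℝ} {K κ ρ E : ℝ}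

lemma slopeConst_nonneg (hK : 0 ≤ K) (hκ : 0 < κ) : 0 ≤ slopeConst K κ := by
  have := dissConst_nonneg hK hκ
  have := monoConst_pos (K := K) hκ
  unfold slopeConst
  positivity

/-- The constant in the increment of the mass over a dyadic time interval. -/
def dyadicConst (K κ : ℝ) : ℝ := (K + 99) * Real.pi * Real.sqrt (18 / κ * slopeConst K κ)

/-- Increment of the mass over a dyadic time interval, near the well. -/
lemma Tame.excessMass_le_half (h : Tame G I K κ ρ E u) (hV : excessMass (u 0) < ⊤) {T : ℝ}
    (hT : κ⁻¹ ≤ T) (hgood : ∀ τ, 0 < τ → τ ≤ 2 * T → ∀ x, |u τ x + 1| ≤ ρ) :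
    excessMass (u (2 * T)) ≤ excessMass (u T) +
      ENNReal.ofReal (dyadicConst K κ * Real.sqrt (Real.sqrt T⁻¹)) * augMass (u 0) := by
  have hκ := h.well.κ_pos
  have hκ1 := h.well.κ_le
  have hK1 := h.well.one_le
  have hB := one_le_cutoffConst
  have hT1 : 1 ≤ T := ((one_le_inv₀ hκ).2 hκ1).trans hT
  have hT0 : 0 < T := by linarith
  have hm18 := le_monoConst (K := K) hκ
  have hm : 1 ≤ monoConst K κ := by linarith
  have hS := slopeConst_nonneg (by linarith : 0 ≤ K) hκ
  set L := Real.sqrt (4 * monoConst K κ * T) with hL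
  have hLT : L ^ 2 = 4 * monoConst K κ * T := Real.sq_sqrt (by positivity)
  have hTL : T ≤ L ^ 2 := by rw [hLT]; nlinarith
  have hL1 : 1 ≤ L := Real.one_le_sqrt.2 (by nlinarith)
  clear_value L
  have hL0 : 0 < L := by linarith
  -- The largest ratio of slope to profile that the entropy estimate tolerates.
  set e := Real.sqrt (κ / 18) with he
  have he2 : e ^ 2 = κ / 18 := Real.sq_sqrt (by positivity)
  have he0 : 0 < e := Real.sqrt_pos.2 (by positivity)
  have he1 : e ≤ 1 := by nlinarith
  have hf := h.smooth.continuous_at_time (le_refl (0 : ℝ))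
  -- the profile
  obtain ⟨A, hA0, hA2, hAL⟩ : ∃ A, 0 < A ∧ slopeConst K κ * L⁻¹ ^ 3 ≤ (e * A) ^ 2 ∧
      A * L ≤ Real.sqrt (18 / κ * slopeConst K κ) * Real.sqrt (Real.sqrt T⁻¹) := by
    have hSp : 0 < slopeConst K κ := by
      have hd : 0 < dissConst K κ := by
        have : 0 < K := by linarith
        unfold dissConst; positivity
      have hπ := Real.pi_pos
      unfold slopeConst
      positivity
    -- The amplitude is the least one for which the slope bound reads `|u_x| ≤ e A m`. It is of
    -- order `L^{-3/2}`, so the integral of the profile is of order `A L`, that is `L^{-1/2}`, times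
    -- the mass; as `T ≤ L²` this is at most of order `T^{-1/4}`.
    refine ⟨Real.sqrt (18 / κ * slopeConst K κ * L⁻¹ ^ 3), Real.sqrt_pos.2 (by positivity), ?_, ?_⟩
    · rw [mul_pow, he2, Real.sq_sqrt (by positivity)]
      refine le_of_eq ?_
      field_simp
    · rw [← Real.sqrt_mul (by positivity)]
      refine Real.le_sqrt_of_sq_le ?_
      rw [mul_pow, Real.sq_sqrt (by positivity)]
      have e1 : 18 / κ * slopeConst K κ * L⁻¹ ^ 3 * L ^ 2 = 18 / κ * slopeConst K κ * L⁻¹ := by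
        field_simp
      rw [e1]
      gcongr
      refine Real.le_sqrt_of_sq_le ?_
      rw [inv_pow]
      exact inv_anti₀ hT0 hTL
  have hm := slowProfile_localMass hf hV hL1 hA0
  have hsl : ∀ τ ∈ Icc T (2 * T), ∀ x, |slope u τ x| ≤ e * (A * localMass (u 0) L x) := by
    intro τ hτ x
    have h0 := localMass_nonneg (u 0) L x
    refine abs_le_of_sq_le_sq ?_ (by positivity)
    calc slope u τ x ^ 2 ≤ slopeConst K κ * L⁻¹ ^ 3 * localMass (u 0) L x ^ 2 :=
          h.slope_sq_le hV hT hL1 hLT hgood hτ.1 hτ.2 x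
      _ ≤ (e * A) ^ 2 * localMass (u 0) L x ^ 2 := by gcongr
      _ = _ := by ring
  have key := h.entropy_le hm (inv_le_one_of_one_le₀ hL1) hT0 (by linarith : T ≤ 2 * T) he2.le he1
    (fun τ hτ => hgood τ (hT0.trans_le hτ.1) hτ.2) hsl
  have hμ : ∫⁻ x, ENNReal.ofReal (A * localMass (u 0) L x) =
      ENNReal.ofReal (Real.pi * (A * L)) * augMass (u 0) := by
    simp_rw [ENNReal.ofReal_mul hA0.le]
    rw [lintegral_const_mul' _ _ ENNReal.ofReal_ne_top, lintegral_localMass hf hV hL0, ← mul_assoc,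
      ← ENNReal.ofReal_mul hA0.le, augMass]
    congr 2; ring
  have cm := hm.cont0
  calc excessMass (u (2 * T))
      ≤ ∫⁻ x, ENNReal.ofReal (softAbs (u (2 * T) x + 1) (A * localMass (u 0) L x)) :=
        lintegral_mono fun x => ENNReal.ofReal_le_ofReal (abs_le_softAbs _ _)
    _ ≤ _ := key
    _ ≤ (excessMass (u T) + ∫⁻ x, ENNReal.ofReal (A * localMass (u 0) L x)) +
          ENNReal.ofReal (K + 98) * ∫⁻ x, ENNReal.ofReal (A * localMass (u 0) L x) := by
        refine add_le_add ?_ (mul_le_mul' (ENNReal.ofReal_le_ofReal ?_) le_rfl)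
        · rw [excessMass, ← lintegral_add_right _ cm.measurable.ennreal_ofReal]
          refine lintegral_mono fun x => ?_
          rw [← ENNReal.ofReal_add (abs_nonneg _) (hm.pos x).le]
          exact ENNReal.ofReal_le_ofReal (softAbs_le _ (hm.pos x))
        · have : L⁻¹ ^ 2 * (2 * T - T) ≤ 1 := by
            rw [inv_pow, inv_mul_le_iff₀ (by positivity)]; linarith
          calc (K + 98) * L⁻¹ ^ 2 * (2 * T - T) = (K + 98) * (L⁻¹ ^ 2 * (2 * T - T)) := by ring
            _ ≤ (K + 98) * 1 := by gcongr
            _ = _ := mul_one _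
    _ = excessMass (u T) + ENNReal.ofReal ((K + 99) * Real.pi * (A * L)) * augMass (u 0) := by
        rw [hμ, add_assoc]
        congr 1
        rw [← mul_assoc (ENNReal.ofReal (K + 98)), ← ENNReal.ofReal_mul (by linarith), ← add_mul,
          ← ENNReal.ofReal_add (by positivity) (by positivity)]
        congr 2; ring
    _ ≤ _ := by
        have hπ := Real.pi_pos
        refine add_le_add le_rfl (mul_le_mul' (ENNReal.ofReal_le_ofReal ?_) le_rfl)
        unfold dyadicConst
        calc _ ≤ (K + 99) * Real.pi * (Real.sqrt (18 / κ * slopeConst K κ) *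
            Real.sqrt (Real.sqrt T⁻¹)) := by gcongr
          _ = _ := by ring

/-- The mass stays bounded as long as the solution stays near the well. -/
lemma exists_augMass_le_good (K κ : ℝ) (hK : 1 ≤ K) (hκ : 0 < κ) : ∃ B, 1 ≤ B ∧
    ∀ (G : ℝ → ℝ) (I : Set ℝ) (ρ E : ℝ) (u : ℝ → ℝ → ℝ), Tame G I K κ ρ E u →
      augMass (u 0) < ⊤ → ∀ t, 0 ≤ t → (∀ τ, 0 < τ → τ ≤ t → ∀ x, |u τ x + 1| ≤ ρ) →
        augMass (u t) ≤ ENNReal.ofReal B * augMass (u 0) := by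
  obtain ⟨B₀, hB₀, hs⟩ := exists_augMass_le_short K (2 * κ⁻¹) hK
  set q := Real.sqrt (Real.sqrt 2) with hq
  have hq1 : 1 < q := by
    have : 1 < Real.sqrt 2 := by rw [Real.lt_sqrt (by norm_num)]; norm_num
    rw [hq, Real.lt_sqrt (by norm_num)]; simpa using this
  have hD : 0 ≤ dyadicConst K κ := by
    have := Real.pi_pos
    unfold dyadicConst; positivity
  -- With `r t = t^{-1/4}` and `q = 2^{1/4}`, the increment `dyadicConst * r (t / 2)` equals `M (r
  -- (t / 2) - r t)`, so the dyadic increments telescope.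
  set M := dyadicConst K κ * q / (q - 1) with hM
  have hM0 : 0 ≤ M := div_nonneg (by positivity) (by linarith)
  set r : ℝ → ℝ := fun t => Real.sqrt (Real.sqrt t⁻¹) with hr
  have hr0 : ∀ t, 0 ≤ r t := fun t => Real.sqrt_nonneg _
  have hr2 : ∀ t, r t = q * r (2 * t) := fun t => by
    rw [hr, hq]
    simp only
    rw [← Real.sqrt_mul (by positivity), ← Real.sqrt_mul (by positivity)]
    congr 2
    rw [mul_inv]; ring
  have main : ∀ n : ℕ, ∀ (G : ℝ → ℝ) (I : Set ℝ) (ρ E : ℝ) (u : ℝ → ℝ → ℝ), Tame G I K κ ρ E u →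
      augMass (u 0) < ⊤ → ∀ t, 0 ≤ t → t ≤ 2 ^ n * (2 * κ⁻¹) →
      (∀ τ, 0 < τ → τ ≤ t → ∀ x, |u τ x + 1| ≤ ρ) →
        augMass (u t) ≤ ENNReal.ofReal (B₀ + M * (r κ⁻¹ - min (r κ⁻¹) (r t))) * augMass (u 0) := by
    have base : ∀ (G : ℝ → ℝ) (I : Set ℝ) (ρ E : ℝ) (u : ℝ → ℝ → ℝ), Tame G I K κ ρ E u →
      augMass (u 0) < ⊤ → ∀ t, 0 ≤ t → t ≤ 2 * κ⁻¹ →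
        augMass (u t) ≤ ENNReal.ofReal (B₀ + M * (r κ⁻¹ - min (r κ⁻¹) (r t))) * augMass (u 0) := by
      intro G I ρ E u h hV t ht ht'
      refine (hs G I κ ρ E u h hV t ht ht').trans ?_
      gcongr
      have : 0 ≤ r κ⁻¹ - min (r κ⁻¹) (r t) := sub_nonneg.2 (min_le_left _ _)
      have : 0 ≤ M * (r κ⁻¹ - min (r κ⁻¹) (r t)) := by positivity
      linarith
    intro n
    induction n with
    | zero =>
      intro G I ρ E u h hV t ht ht' hg
      exact base G I ρ E u h hV t ht (by linarith)
    | succ n ih =>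
      intro G I ρ E u h hV t ht ht' hg
      rcases le_total t (2 * κ⁻¹) with h1 | h1
      · exact base G I ρ E u h hV t ht h1
      have ht0 : 0 < t := lt_of_lt_of_le (by positivity) h1
      have hκt : κ⁻¹ ≤ t / 2 := by linarith
      have h2 := ih G I ρ E u h hV (t / 2) (by linarith) (by rw [pow_succ] at ht'; linarith)
        fun τ h1 h2 => hg τ h1 (by linarith)
      have h3 := h.excessMass_le_half (excessMass_lt_top hV) hκt
        (fun τ h1 h2 => hg τ h1 (by linarith))
      rw [mul_div_cancel₀ t two_ne_zero] at h3
      have hrm : ∀ s, κ⁻¹ ≤ s → r s ≤ r κ⁻¹ := fun s hs => by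
        have : 0 < κ⁻¹ := by positivity
        exact Real.sqrt_le_sqrt (Real.sqrt_le_sqrt (inv_anti₀ this hs))
      rw [min_eq_right (hrm _ hκt)] at h2
      rw [min_eq_right (hrm t (by linarith))]
      have hrt := hr2 (t / 2)
      rw [mul_div_cancel₀ t two_ne_zero] at hrt
      calc augMass (u t) ≤ augMass (u (t / 2)) +
            ENNReal.ofReal (dyadicConst K κ * r (t / 2)) * augMass (u 0) := by
            unfold augMass at h3 ⊢
            rw [add_right_comm]
            exact add_le_add h3 le_rfl
        _ ≤ ENNReal.ofReal (B₀ + M * (r κ⁻¹ - r (t / 2))) * augMass (u 0) +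
            ENNReal.ofReal (dyadicConst K κ * r (t / 2)) * augMass (u 0) := add_le_add h2 le_rfl
        _ = ENNReal.ofReal (B₀ + M * (r κ⁻¹ - r (t / 2)) + dyadicConst K κ * r (t / 2)) *
            augMass (u 0) := by
            have := hrm _ hκt
            have := hr0 (t / 2)
            rw [← add_mul, ← ENNReal.ofReal_add (add_nonneg (by linarith)
              (mul_nonneg hM0 (by linarith))) (by positivity)]
        _ = _ := by
            congr 2
            rw [hrt, hM]
            have : q - 1 ≠ 0 := by linarith
            field_simp
            ring
  refine ⟨B₀ + M * r κ⁻¹, by have := hr0 κ⁻¹; have : 0 ≤ M * r κ⁻¹ := by positivity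
                             linarith, fun G I ρ E u h hV t ht hg => ?_⟩
  obtain ⟨n, hn⟩ := pow_unbounded_of_one_lt (t / (2 * κ⁻¹)) (one_lt_two : (1 : ℝ) < 2)
  rw [div_lt_iff₀ (by positivity)] at hn
  refine (main n G I ρ E u h hV t ht hn.le hg).trans ?_
  gcongr
  have : 0 ≤ min (r κ⁻¹) (r t) := le_min (hr0 _) (hr0 _)
  linarith

/-! ### Estimates at fixed times, and persistence -/

lemma intervalIntegral_le_of_lintegral {f : ℝ → ℝ} (cf : Continuous f) (h0 : ∀ x, 0 ≤ f x) {e : ℝ}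
    (he : 0 ≤ e) (h : ∫⁻ x, ENNReal.ofReal (f x) ≤ ENNReal.ofReal e) {a b : ℝ} (hab : a ≤ b) :
    ∫ x in a..b, f x ≤ e := by
  refine (ENNReal.ofReal_le_ofReal_iff he).1 (le_trans ?_ h)
  rw [intervalIntegral.integral_of_le hab,
    ofReal_integral_eq_lintegral_ofReal cf.integrableOn_Ioc (ae_of_all _ h0)]
  exact setLIntegral_le_lintegral _ _

lemma exists_le_of_lintegral {f : ℝ → ℝ} (cf : Continuous f) (h0 : ∀ x, 0 ≤ f x) {e l : ℝ}
    (he : 0 ≤ e) (h : ∫⁻ x, ENNReal.ofReal (f x) ≤ ENNReal.ofReal e) (hl : 0 < l) (a : ℝ) :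
    ∃ z ∈ Icc a (a + l), f z ≤ e / l := by
  have hal : a ≤ a + l := by linarith
  obtain ⟨z, hz, hmin⟩ := isCompact_Icc.exists_isMinOn (nonempty_Icc.2 hal) cf.continuousOn
  refine ⟨z, hz, ?_⟩
  have h1 := intervalIntegral.integral_mono_on hal (intervalIntegrable_const (μ := volume))
    (cf.intervalIntegrable _ _) fun x hx => hmin hx
  have h2 := intervalIntegral_le_of_lintegral cf h0 he h hal
  rw [intervalIntegral.integral_const, add_sub_cancel_left, smul_eq_mul] at h1
  rw [le_div_iff₀ hl]; linarith

lemma sq_intervalIntegral_le_of_normSq {f : ℝ → ℝ} (cf : Continuous f) {d : ℝ} (hd : 0 ≤ d)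
    (h : normSq f ≤ ENNReal.ofReal d) {a b : ℝ} (hab : a ≤ b) :
    (∫ x in a..b, f x) ^ 2 ≤ (b - a) * d :=
  (sq_intervalIntegral_le hab (cf.intervalIntegrable _ _) ((cf.pow 2).intervalIntegrable _ _)).trans
    (mul_le_mul_of_nonneg_left (intervalIntegral_le_of_lintegral (cf.pow 2)
      (fun _ => sq_nonneg _) hd h hab) (by linarith))

/-- Hölder continuity with exponent `1/2`. -/
lemma abs_sub_le_sqrt {f f' : ℝ → ℝ} (hf : ∀ x, HasDerivAt f (f' x) x) (cf' : Continuous f') {d : ℝ}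
    (hd : 0 ≤ d) (h : normSq f' ≤ ENNReal.ofReal d) {x y r : ℝ} (hr : |y - x| ≤ r) :
    |f y - f x| ≤ Real.sqrt (r * d) := by
  wlog hxy : x ≤ y generalizing x y
  · rw [abs_sub_comm]; exact this (by rwa [abs_sub_comm]) (by linarith)
  refine Real.abs_le_sqrt ?_
  have := sq_intervalIntegral_le_of_normSq cf' hd h hxy
  rw [intervalIntegral.integral_eq_sub_of_hasDerivAt (fun x _ => hf x)
    (cf'.intervalIntegrable _ _)] at this
  rw [abs_of_nonneg (by linarith)] at hr
  exact this.trans (by gcongr)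

variable {G : ℝ → ℝ} {u : ℝ → ℝ → ℝ} {I : Set ℝ} {K κ ρ E : ℝ}

lemma Tame.continuous_energyDensity (h : Tame G I K κ ρ E u) {t : ℝ} (ht : 0 < t) :
    Continuous (energyDensity G u t) := by
  have cG := h.well.contDiff.continuous
  have c1 := continuous_slice h.regularFlow.cont ht
  have c2 := continuous_slice h.regularFlow.cont_slope ht
  unfold energyDensity
  fun_prop

lemma Tame.energyDensity_nonneg (h : Tame G I K κ ρ E u) (t x : ℝ) : 0 ≤ energyDensity G u t x :=
  add_nonneg (by positivity) (h.well.nonneg _)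

/-- The total dissipation is controlled by the energy. -/
lemma Tame.integral_dissipation_le (h : Tame G I K κ ρ E u) {s t : ℝ} (hs : 0 < s) (hst : s ≤ t) :
    ∫⁻ τ in Ioc s t, dissipation G u τ ≤ 2 * ∫⁻ x, ENNReal.ofReal (energyDensity G u s x) := by
  calc _ = 2 * (1 / 2 * ∫⁻ τ in Ioc s t, dissipation G u τ) := by
        rw [← mul_assoc, one_div, ENNReal.mul_inv_cancel (by simp) (by simp), one_mul]
    _ ≤ _ := mul_le_mul' le_rfl (le_trans le_add_self (h.energy_inequality s hs t hst))

/-- Bound of the chemical potential by energy, mass and dissipation. -/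
lemma Tame.abs_pot_le (h : Tame G I K κ ρ E u) {t e d l S x : ℝ} (ht : 0 < t) (he : 0 ≤ e)
    (hd : 0 ≤ d) (hl : 0 < l)
    (hE : ∫⁻ x, ENNReal.ofReal (energyDensity G u t x) ≤ ENNReal.ofReal e)
    (hD : dissipation G u t ≤ ENNReal.ofReal d) (hS : ∫ z in x..x + 3 * l, |u t z + 1| ≤ S)
    {w : ℝ} (hw : w ∈ Icc x (x + 3 * l)) :
    |pot G u t w| ≤ Real.sqrt (3 * l * d) + (K * S + 2 * Real.sqrt (2 * e / l)) / l := by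
  have H := h.regularFlow
  have hK := h.well.one_le
  have cu := continuous_slice H.cont ht
  have cG' : Continuous fun z => deriv G (u t z) := (continuous_deriv_of_contDiff_two H.contG).comp cu
  have ced := h.continuous_energyDensity ht
  -- Points of small energy density, hence small slope, are picked in the first and in the last
  -- third of the interval.
  obtain ⟨a, ha, hae⟩ := exists_le_of_lintegral ced (h.energyDensity_nonneg t) he hE hl x
  obtain ⟨b, hb, hbe⟩ := exists_le_of_lintegral ced (h.energyDensity_nonneg t) he hE hl (x + 2 * l)
  have hab : a + l ≤ b := by linarith [ha.2, hb.1]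
  have hux : ∀ z, energyDensity G u t z ≤ e / l → |slope u t z| ≤ Real.sqrt (2 * e / l) := by
    intro z hz
    refine Real.abs_le_sqrt ?_
    have := h.well.nonneg (u t z)
    unfold energyDensity at hz
    rw [mul_div_assoc]; linarith
  -- The mean of `p = G'(u) - u_xx` over `[a, b]` involves only the mass and the slopes at the
  -- endpoints, and `p` attains its mean. Hölder continuity of `p`, from the dissipation, transfers
  -- the bound to every point.
  obtain ⟨ξ, hξ, hp⟩ := exists_hasDerivAt_eq_slope
    (fun z => (∫ y in a..z, deriv G (u t y)) - slope u t z) (pot G u t) (by linarith : a < b)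
    (fun z _ => ((hasDerivAt_primitive cG' a z).sub
      (H.deriv_slope t ht z)).continuousAt.continuousWithinAt)
    (fun z _ => (hasDerivAt_primitive cG' a z).sub (H.deriv_slope t ht z))
  have hint : |∫ y in a..b, deriv G (u t y)| ≤ K * S := by
    have c1 : Continuous fun z => |u t z + 1| := by fun_prop
    have h0 : ∀ p q, p ≤ q → 0 ≤ ∫ z in p..q, |u t z + 1| := fun p q hpq =>
      intervalIntegral.integral_nonneg hpq fun _ _ => abs_nonneg _
    calc |∫ y in a..b, deriv G (u t y)| ≤ ∫ y in a..b, |deriv G (u t y)| :=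
          intervalIntegral.abs_integral_le_integral_abs (by linarith)
      _ ≤ ∫ y in a..b, K * |u t y + 1| :=
          intervalIntegral.integral_mono_on (by linarith) (cG'.abs.intervalIntegrable _ _)
            ((continuous_const.mul c1).intervalIntegrable _ _)
            fun z _ => h.well.deriv_le _ (h.mem t ht.le z)
      _ = K * ∫ y in a..b, |u t y + 1| := intervalIntegral.integral_const_mul _ _
      _ ≤ K * S := by
          refine mul_le_mul_of_nonneg_left (le_trans ?_ hS) (by linarith)
          rw [← intervalIntegral.integral_add_adjacent_intervals (c1.intervalIntegrable x a)
            (c1.intervalIntegrable a (x + 3 * l)), ← intervalIntegral.integral_add_adjacent_intervals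
            (c1.intervalIntegrable a b) (c1.intervalIntegrable b (x + 3 * l))]
          have := h0 x a ha.1
          have := h0 b (x + 3 * l) (by linarith [hb.2])
          linarith
  have hpξ : |pot G u t ξ| ≤ (K * S + 2 * Real.sqrt (2 * e / l)) / l := by
    rw [hp, abs_div, abs_of_pos (by linarith : 0 < b - a)]
    have h1 := hux a hae
    have h2 := hux b hbe
    have h3 : |(∫ y in a..b, deriv G (u t y)) - slope u t b -
        ((∫ y in a..a, deriv G (u t y)) - slope u t a)| ≤ K * S + 2 * Real.sqrt (2 * e / l) := by
      rw [intervalIntegral.integral_same, _root_.abs_le]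
      rw [_root_.abs_le] at h1 h2 hint
      constructor <;> linarith
    exact div_le_div₀ ((abs_nonneg _).trans h3) h3 hl (by linarith)
  have hpw := abs_sub_le_sqrt (H.deriv_pot t ht) (continuous_slice H.cont_potX ht) hd hD
    (x := ξ) (y := w) (r := 3 * l) (by
      rw [_root_.abs_le]; constructor <;> linarith [hξ.1, hξ.2, ha.1, hb.2, hw.1, hw.2])
  have := abs_sub_abs_le_abs_sub (pot G u t w) (pot G u t ξ)
  linarith

/-- The energy controls the local mass. -/
lemma Tame.local_mass_le (h : Tame G I K κ ρ E u) {t : ℝ} (ht : 0 < t) {l : ℝ} (hl : 0 ≤ l) (x : ℝ) :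
    ∫ z in x..x + l, |u t z + 1| ≤ Real.sqrt (l * (E / κ)) := by
  have hκ := h.well.κ_pos
  have cu := continuous_slice h.regularFlow.cont ht
  refine Real.le_sqrt_of_sq_le ?_
  have := sq_intervalIntegral_le_of_normSq (f := fun z => |u t z + 1|) (d := E / κ) (by fun_prop)
    (div_nonneg h.energy_nonneg hκ.le) ?_ (by linarith : x ≤ x + l)
  · rwa [add_sub_cancel_left] at this
  · calc normSq (fun z => |u t z + 1|)
        ≤ ∫⁻ z, ENNReal.ofReal κ⁻¹ * ENNReal.ofReal (energyDensity G u t z) := by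
          refine lintegral_mono fun z => ?_
          rw [← ENNReal.ofReal_mul (by positivity)]
          refine ENNReal.ofReal_le_ofReal ?_
          rw [sq_abs, inv_mul_eq_div, le_div_iff₀ hκ, mul_comm]
          exact (h.well.le_potential _ (h.mem t ht.le z)).trans
            (le_add_of_nonneg_left (by positivity))
      _ ≤ _ := by
          rw [lintegral_const_mul' _ _ ENNReal.ofReal_ne_top, div_eq_inv_mul,
            ENNReal.ofReal_mul (by positivity)]
          exact mul_le_mul' le_rfl (h.energy_le t ht)

/-- At a critical point, the potential energy is small if the dissipation is. -/
lemma Tame.potential_le_of_critical (h : Tame G I K κ ρ E u) {t d r x : ℝ} (ht : 0 < t) (hd : 0 ≤ d)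
    (hr : 1 ≤ r) (hD : dissipation G u t ≤ ENNReal.ofReal (d ^ 2)) (hx : slope u t x = 0) :
    G (u t x) ≤ (E + 2 * K * (2 * K * Real.sqrt (E / κ) + 2 * Real.sqrt (2 * E))) / r +
      5 * K * (r * d) := by
  have H := h.regularFlow
  have hK := h.well.one_le
  have hE := h.energy_nonneg
  have hr0 : 0 < r := by linarith
  have cu := continuous_slice H.cont ht
  have cpX := continuous_slice H.cont_potX ht
  obtain ⟨z, hz, hze⟩ := exists_le_of_lintegral (h.continuous_energyDensity ht)
    (h.energyDensity_nonneg t) hE (h.energy_le t ht) (show 0 < r ^ 2 by positivity) x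
  have hd4 : ∀ a, 0 ≤ a → Real.sqrt (a * r ^ 2 * d ^ 2) = Real.sqrt a * (r * d) := fun a ha => by
    rw [mul_assoc, ← mul_pow, Real.sqrt_mul ha, Real.sqrt_sq (by positivity)]
  have s3 : Real.sqrt 3 ≤ 2 := Real.sqrt_le_iff.2 ⟨by norm_num, by norm_num⟩
  have hpb : ∀ w ∈ Icc x (x + 3 * r ^ 2), |pot G u t w| ≤
      2 * (r * d) + (2 * K * Real.sqrt (E / κ) + 2 * Real.sqrt (2 * E)) / r := by
    intro w hw
    refine (h.abs_pot_le ht hE (sq_nonneg d) (show 0 < r ^ 2 by positivity) (h.energy_le t ht) hD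
      (h.local_mass_le ht (by positivity) x) hw).trans (add_le_add ?_ ?_)
    · rw [hd4 3 (by norm_num)]
      gcongr
    · have e1 : Real.sqrt (3 * r ^ 2 * (E / κ)) = Real.sqrt 3 * (r * Real.sqrt (E / κ)) := by
        rw [mul_assoc, Real.sqrt_mul (by norm_num), Real.sqrt_mul (by positivity),
          Real.sqrt_sq hr0.le]
      have e2 : Real.sqrt (2 * E / r ^ 2) ≤ r * Real.sqrt (2 * E) := by
        rw [Real.sqrt_div' _ (by positivity), Real.sqrt_sq hr0.le]
        exact (div_le_self (Real.sqrt_nonneg _) hr).trans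
          (le_mul_of_one_le_left (Real.sqrt_nonneg _) hr)
      rw [e1]
      calc _ ≤ (K * (2 * (r * Real.sqrt (E / κ))) + 2 * (r * Real.sqrt (2 * E))) / r ^ 2 := by
            gcongr
        _ = _ := by field_simp
  set P := 2 * (r * d) + (2 * K * Real.sqrt (E / κ) + 2 * Real.sqrt (2 * E)) / r with hP
  have cpc : Continuous fun y => potX G u t y * (u t y + 1) := by fun_prop
  have hint : |∫ y in x..z, potX G u t y * (u t y + 1)| ≤ K * (r * d) := by
    refine abs_le_of_sq_le_sq ?_ (by positivity)
    calc _ ≤ (z - x) * (K * d) ^ 2 := by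
          refine sq_intervalIntegral_le_of_normSq cpc (by positivity) ?_ hz.1
          calc _ ≤ ∫⁻ y, ENNReal.ofReal (K ^ 2) * ENNReal.ofReal (potX G u t y ^ 2) := by
                refine lintegral_mono fun y => ?_
                rw [← ENNReal.ofReal_mul (by positivity), mul_pow, mul_comm]
                exact ENNReal.ofReal_le_ofReal
                  (mul_le_mul_of_nonneg_right (h.sq_le ht.le y) (sq_nonneg _))
            _ ≤ _ := by
                rw [lintegral_const_mul' _ _ ENNReal.ofReal_ne_top, mul_pow,
                  ENNReal.ofReal_mul (by positivity)]
                exact mul_le_mul' le_rfl hD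
      _ ≤ r ^ 2 * (K * d) ^ 2 := by gcongr; linarith [hz.2]
      _ = _ := by ring
  -- The quantity `½ u_x² - G(u) + p (u + 1)` is conserved when `p` is constant; in general its
  -- derivative is `p_x (u + 1)`. It compares the critical point `x` with a point `z` of small
  -- energy density.
  have hFTC : ∫ y in x..z, potX G u t y * (u t y + 1) =
      (1 / 2 * slope u t z ^ 2 - G (u t z) + pot G u t z * (u t z + 1)) -
      (1 / 2 * slope u t x ^ 2 - G (u t x) + pot G u t x * (u t x + 1)) := by
    refine intervalIntegral.integral_eq_sub_of_hasDerivAt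
      (f := fun y => 1 / 2 * slope u t y ^ 2 - G (u t y) + pot G u t y * (u t y + 1))
      (fun y _ => ?_) (cpc.intervalIntegrable _ _)
    have dG : HasDerivAt G (deriv G (u t y)) (u t y) :=
      (h.well.contDiff.differentiable (by norm_num) _).hasDerivAt
    refine (((((H.deriv_slope t ht y).fun_pow 2).const_mul (1 / 2)).fun_sub
      (dG.comp y (H.deriv_u t ht y))).fun_add
      ((H.deriv_pot t ht y).fun_mul ((H.deriv_u t ht y).add_const 1))).congr_deriv ?_
    unfold pot
    push_cast
    ring
  have hpc : ∀ w ∈ Icc x (x + 3 * r ^ 2), |pot G u t w * (u t w + 1)| ≤ P * K := fun w hw => by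
    rw [abs_mul]
    exact mul_le_mul (hpb w hw) (h.abs_le ht.le w) (abs_nonneg _) ((abs_nonneg _).trans (hpb w hw))
  have b1 := _root_.abs_le.1 (hpc x ⟨le_rfl, by nlinarith⟩)
  have b2 := _root_.abs_le.1 (hpc z ⟨hz.1, by nlinarith [hz.2]⟩)
  have b3 := _root_.abs_le.1 hint
  have b4 := h.well.nonneg (u t z)
  have b5 : E / r ^ 2 ≤ E / r := div_le_div_of_nonneg_left hE hr0 (by nlinarith)
  have b6 := sq_nonneg (slope u t z)
  have eP : P * K = 2 * K * (r * d) + (K * (2 * K * Real.sqrt (E / κ) + 2 * Real.sqrt (2 * E))) / r := by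
    rw [hP]; field_simp
  have eR : (E + 2 * K * (2 * K * Real.sqrt (E / κ) + 2 * Real.sqrt (2 * E))) / r =
    E / r + 2 * ((K * (2 * K * Real.sqrt (E / κ) + 2 * Real.sqrt (2 * E))) / r) := by
    field_simp
  rw [hx] at hFTC
  unfold energyDensity at hze
  rw [eR]
  linarith

/-- Small dissipation forces the solution to be near the well. -/
lemma exists_small_dissipation (K κ ρ E : ℝ) (hK : 1 ≤ K) (hκ : 0 < κ) (hρ : 0 < ρ) (hE : 0 ≤ E) :
    ∃ d > 0, ∀ (G : ℝ → ℝ) (I : Set ℝ) (u : ℝ → ℝ → ℝ), Tame G I K κ ρ E u → ∀ t > 0,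
      dissipation G u t ≤ ENNReal.ofReal d → ∀ x, |u t x + 1| ≤ ρ / 2 := by
  set W := E + 2 * K * (2 * K * Real.sqrt (E / κ) + 2 * Real.sqrt (2 * E)) with hW
  have hW0 : 0 ≤ W := by positivity
  set η := κ * ρ ^ 2 / 8 with hη
  have hη0 : 0 < η := by positivity
  -- The choices of `r` and `d` make both terms of the critical-point bound at most `η`, and `2η = κ
  -- (ρ / 2)²`.
  set r := W / η + 1 with hr
  have hr1 : 1 ≤ r := le_add_of_nonneg_left (by positivity)
  set d := η / (5 * K * r) with hd
  have hd0 : 0 < d := by positivity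
  refine ⟨d ^ 2, by positivity, fun G I u h t ht hD => ?_⟩
  have H := h.regularFlow
  have cu := continuous_slice H.cont ht
  have crit : ∀ x, slope u t x = 0 → (u t x + 1) ^ 2 ≤ (ρ / 2) ^ 2 := by
    intro x hx
    have h1 := h.potential_le_of_critical ht hd0.le hr1 hD hx
    have h2 := h.well.le_potential _ (h.mem t ht.le x)
    have h3 : W / r ≤ η := by
      rw [div_le_iff₀ (by linarith), hr, mul_add, mul_div_cancel₀ _ hη0.ne']; linarith
    have h4 : 5 * K * (r * d) = η := by rw [hd]; field_simp
    rw [← hW, h4] at h1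
    refine le_of_mul_le_mul_left ?_ hκ
    have : κ * (ρ / 2) ^ 2 = 2 * η := by rw [hη]; ring
    linarith
  by_contra! hc
  obtain ⟨x₀, hx₀⟩ := hc
  have hpos : 0 < |u t x₀ + 1| := lt_trans (by positivity) hx₀
  obtain ⟨B, hB, hB', -⟩ := h.normSq_bounded t
  have hlim := tendsto_zero_of_normSq (fun x => (H.timeFamily.deriv0 t ht x))
    (continuous_slice H.cont_slope ht) ((hB' t ⟨ht.le, le_rfl⟩).trans_lt hB)
    ((h.normSq_slope_le ht).trans_lt ENNReal.ofReal_lt_top)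
  have hlim' : Tendsto (fun x => (u t x + 1) ^ 2) (cocompact ℝ) (𝓝 0) := by
    rw [cocompact_eq_atBot_atTop, tendsto_sup]
    have := hlim.1.pow 2
    have := hlim.2.pow 2
    simp only [ne_eq, OfNat.ofNat_ne_zero, not_false_eq_true, zero_pow] at *
    constructor <;> assumption
  have c2 : Continuous fun x => (u t x + 1) ^ 2 := by fun_prop
  have hsq : 0 < (u t x₀ + 1) ^ 2 := by rw [← sq_abs]; positivity
  -- As `u + 1` vanishes at infinity, `(u + 1)²` attains its maximum; since the maximum is positive,
  -- the slope vanishes there.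
  obtain ⟨x, hx⟩ := c2.exists_forall_ge' x₀ ((hlim'.eventually (gt_mem_nhds hsq)).mono fun y hy => hy.le)
  have hmax : IsLocalMax (fun x => (u t x + 1) ^ 2) x := Eventually.of_forall hx
  have hder := hmax.hasDerivAt_eq_zero ((H.timeFamily.deriv0 t ht x).fun_pow 2)
  have hne : u t x + 1 ≠ 0 := by
    intro h0
    have := hx x₀
    rw [h0] at this
    simp only [ne_eq, OfNat.ofNat_ne_zero, not_false_eq_true, zero_pow] at this
    linarith
  have hsl : slope u t x = 0 := by simpa [hne] using hder
  have h1 := (hx x₀).trans (crit x hsl)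
  rw [← sq_abs] at h1
  have := abs_le_of_sq_le_sq h1 (by positivity)
  rw [abs_abs] at this
  linarith

/-- A solution that is away from the well stays so for a while. -/
lemma exists_persistence (K κ ρ E : ℝ) (hρ : 0 < ρ) (hE : 0 ≤ E) :
    ∃ τ > 0, ∀ (G : ℝ → ℝ) (I : Set ℝ) (u : ℝ → ℝ → ℝ), Tame G I K κ ρ E u → ∀ t > 0, ∀ x,
      ρ < |u t x + 1| → ∀ σ ∈ Icc t (t + τ), ∃ y, ρ / 2 < |u σ y + 1| := by
  set l := ρ ^ 2 / (256 * (E + 1)) with hl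
  have hl0 : 0 < l := by positivity
  set τ := (ρ * l ^ 2 / 8) ^ 2 / (8 * l * (E + 1)) with hτ
  have hτ0 : 0 < τ := by positivity
  refine ⟨τ, hτ0, fun G I u h t ht x hx σ hσ => ?_⟩
  by_contra! hc
  have H := h.regularFlow
  have F := H.timeFamily
  -- Averaging twice in space removes both derivatives from `u_t = p_xx`: the time derivative of `N`
  -- is a second difference of `p`, whose square is at most `4 l` times the dissipation.
  set m : ℝ → ℝ → ℝ := fun s y => ∫ z in y..y + l, (u s z + 1) with hm
  set N : ℝ → ℝ := fun s => ∫ y in x..x + l, m s y with hN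
  have hinner : ∀ s > 0, ∀ y, ∫ z in y..y + l, potXX G u s z = potX G u s (y + l) - potX G u s y :=
    fun s hs y => intervalIntegral.integral_eq_sub_of_hasDerivAt (fun z _ => H.deriv_potX s hs z)
      ((continuous_slice H.cont_potXX hs).intervalIntegrable _ _)
  have dm : ∀ s > 0, ∀ y, HasDerivAt (fun s => m s y) (potX G u s (y + l) - potX G u s y) s :=
    fun s hs y => (hasDerivAt_intervalIntegral_param F.cont0 F.contt F.derivt hs).congr_deriv
      (hinner s hs y)
  have hshift : ∀ {Z : ℝ → ℝ → ℝ}, ContinuousOn (fun z : ℝ × ℝ => Z z.1 z.2) (Ioi 0 ×ˢ univ) →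
      ContinuousOn (fun z : ℝ × ℝ => Z z.1 (z.2 + l)) (Ioi 0 ×ˢ univ) := fun hZ =>
    hZ.comp (f := fun z : ℝ × ℝ => (z.1, z.2 + l)) (by fun_prop) fun z hz => ⟨hz.1, mem_univ _⟩
  have cP := continuousOn_primitive (F := fun s z => u s z + 1) F.cont0 x
  have cm : ContinuousOn (fun z : ℝ × ℝ => m z.1 z.2) (Ioi 0 ×ˢ univ) := by
    refine ((hshift (Z := fun s y => ∫ z in x..y, (u s z + 1)) cP).sub cP).congr fun z hz => ?_
    have c1 := continuous_slice (F := fun s z => u s z + 1) F.cont0 hz.1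
    exact (intervalIntegral.integral_interval_sub_left (c1.intervalIntegrable _ _)
      (c1.intervalIntegrable _ _)).symm
  set g : ℝ → ℝ := fun s => (pot G u s (x + l + l) - pot G u s (x + l)) -
    (pot G u s (x + l) - pot G u s x) with hg
  have dN : ∀ s > 0, HasDerivAt N (g s) s := by
    intro s hs
    refine (hasDerivAt_intervalIntegral_param cm ((hshift H.cont_potX).sub H.cont_potX) dm
      hs).congr_deriv ?_
    refine intervalIntegral.integral_eq_sub_of_hasDerivAt
      (f := fun y => pot G u s (y + l) - pot G u s y) (fun y _ => ?_) ?_ |>.trans (by simp only [hg])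
    · exact ((H.deriv_pot s hs (y + l)).comp_add_const y l).sub (H.deriv_pot s hs y)
    · have c1 := continuous_slice H.cont_potX hs
      exact Continuous.intervalIntegrable (by fun_prop) _ _
  have hsub : uIcc t σ ⊆ Ioi 0 := fun z hz => by
    rw [uIcc_of_le hσ.1] at hz; exact ht.trans_le hz.1
  have cg : ContinuousOn g (Ioi 0) :=
    ((continuousOn_time_slice H.cont_pot _).sub (continuousOn_time_slice H.cont_pot _)).sub
      ((continuousOn_time_slice H.cont_pot _).sub (continuousOn_time_slice H.cont_pot _))
  have ig : IntervalIntegrable g volume t σ := (cg.mono hsub).intervalIntegrable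
  have hgD : ∀ s, t < s → s ≤ σ → ENNReal.ofReal (g s ^ 2) ≤
      ENNReal.ofReal (4 * l) * dissipation G u s := by
    intro s h1 h2
    have hs : 0 < s := ht.trans h1
    have cX := continuous_slice H.cont_potX hs
    have part : ∀ y, ENNReal.ofReal ((pot G u s (y + l) - pot G u s y) ^ 2) ≤
        ENNReal.ofReal l * dissipation G u s := by
      intro y
      have := ofReal_sq_intervalIntegral_le (f := potX G u s) (by linarith : y ≤ y + l)
        (cX.intervalIntegrable _ _)
      rw [intervalIntegral.integral_eq_sub_of_hasDerivAt (fun z _ => H.deriv_pot s hs z)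
        (cX.intervalIntegrable _ _), add_sub_cancel_left] at this
      exact this.trans (mul_le_mul' le_rfl (setLIntegral_le_lintegral _ _))
    calc _ ≤ ENNReal.ofReal (2 * (pot G u s (x + l + l) - pot G u s (x + l)) ^ 2 +
          2 * (pot G u s (x + l) - pot G u s x) ^ 2) := by
          refine ENNReal.ofReal_le_ofReal ?_
          simp only [hg]
          linarith [sq_nonneg ((pot G u s (x + l + l) - pot G u s (x + l)) +
            (pot G u s (x + l) - pot G u s x))]
      _ ≤ 2 * (ENNReal.ofReal l * dissipation G u s) + 2 * (ENNReal.ofReal l * dissipation G u s) := by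
          rw [ENNReal.ofReal_add (by positivity) (by positivity), ENNReal.ofReal_mul (by norm_num),
            ENNReal.ofReal_mul (by norm_num), ENNReal.ofReal_ofNat]
          exact add_le_add (mul_le_mul' le_rfl (part _)) (mul_le_mul' le_rfl (part _))
      _ = _ := by rw [ENNReal.ofReal_mul (by norm_num), ENNReal.ofReal_ofNat]; ring
  have hdiss : ∫⁻ s in Ioc t σ, dissipation G u s ≤ ENNReal.ofReal (2 * E) := by
    rw [ENNReal.ofReal_mul (by norm_num), ENNReal.ofReal_ofNat]
    exact (h.integral_dissipation_le ht hσ.1).trans (mul_le_mul' le_rfl (h.energy_le t ht))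
  have hNdiff : |N σ - N t| ≤ ρ * l ^ 2 / 8 := by
    refine abs_le_of_sq_le_sq ?_ (by positivity)
    rw [← intervalIntegral.integral_eq_sub_of_hasDerivAt (fun s hs => dN s (hsub hs)) ig]
    refine (ENNReal.ofReal_le_ofReal_iff (by positivity)).1 ?_
    refine (ofReal_sq_intervalIntegral_le hσ.1 ig).trans ?_
    calc _ ≤ ENNReal.ofReal τ * (ENNReal.ofReal (4 * l) * ENNReal.ofReal (2 * E)) := by
          refine mul_le_mul' (ENNReal.ofReal_le_ofReal (by linarith [hσ.2]))
            ((setLIntegral_mono_Ioc hgD).trans ?_)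
          rw [lintegral_const_mul' _ _ ENNReal.ofReal_ne_top]
          exact mul_le_mul' le_rfl hdiss
      _ ≤ _ := by
          rw [← ENNReal.ofReal_mul (by positivity), ← ENNReal.ofReal_mul hτ0.le]
          refine ENNReal.ofReal_le_ofReal ?_
          calc τ * (4 * l * (2 * E)) ≤ τ * (8 * l * (E + 1)) := mul_le_mul_of_nonneg_left (by nlinarith) hτ0.le
            _ = _ := by rw [hτ]; field_simp
  have hbd : ∀ s > 0, ∀ a C : ℝ, (∀ z ∈ Icc x (x + 2 * l), |u s z + 1 - a| ≤ C) →
      |N s - a * l ^ 2| ≤ C * l ^ 2 := by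
    intro s hs a C hC
    have cs := continuous_slice (F := fun s z => u s z + 1) F.cont0 hs
    have cms : Continuous (m s) := continuous_slice cm hs
    have h1 : ∀ y ∈ Icc x (x + l), |m s y - a * l| ≤ C * l := by
      intro y hy
      have e : m s y - a * l = ∫ z in y..y + l, (u s z + 1 - a) := by
        rw [intervalIntegral.integral_sub (cs.intervalIntegrable _ _) intervalIntegrable_const,
          intervalIntegral.integral_const, add_sub_cancel_left, smul_eq_mul, mul_comm l]
      rw [e]
      have := intervalIntegral.norm_integral_le_of_norm_le_const (f := fun z => u s z + 1 - a)
        (a := y) (b := y + l) (C := C) fun z hz => by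
          rw [uIoc_of_le (by linarith)] at hz
          exact hC z ⟨by linarith [hy.1, hz.1], by linarith [hy.2, hz.2]⟩
      rwa [add_sub_cancel_left, abs_of_pos hl0] at this
    have e : N s - a * l ^ 2 = ∫ y in x..x + l, (m s y - a * l) := by
      rw [intervalIntegral.integral_sub (cms.intervalIntegrable _ _) intervalIntegrable_const,
        intervalIntegral.integral_const, add_sub_cancel_left, smul_eq_mul]
      simp only [hN]; ring
    rw [e]
    have := intervalIntegral.norm_integral_le_of_norm_le_const (f := fun y => m s y - a * l)
      (a := x) (b := x + l) (C := C * l) fun z hz => by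
        rw [uIoc_of_le (by linarith)] at hz
        exact h1 z ⟨hz.1.le, hz.2⟩
    rwa [add_sub_cancel_left, abs_of_pos hl0, mul_assoc, ← sq] at this
  have h1 := hbd t ht (u t x + 1) (ρ / 8) fun z hz => by
    refine (abs_sub_le_sqrt (F.deriv0 t ht) (continuous_slice H.cont_slope ht)
      (by positivity : 0 ≤ 2 * E) (h.normSq_slope_le ht) (r := 2 * l) ?_).trans ?_
    · rw [abs_of_nonneg (by linarith [hz.1])]; linarith [hz.2]
    · refine Real.sqrt_le_iff.2 ⟨by positivity, ?_⟩
      calc 2 * l * (2 * E) ≤ 4 * l * (E + 1) := by nlinarith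
        _ = _ := by rw [hl]; field_simp; norm_num
  have h2 := hbd σ (ht.trans_le hσ.1) 0 (ρ / 2) fun z _ => by rw [sub_zero]; exact hc z
  rw [zero_mul, sub_zero] at h2
  have hl2 : 0 < l ^ 2 := by positivity
  have h3 : |u t x + 1| * l ^ 2 ≤ |N t| + ρ / 8 * l ^ 2 := by
    calc |u t x + 1| * l ^ 2 = |(u t x + 1) * l ^ 2| := by rw [abs_mul, abs_of_pos hl2]
      _ ≤ |N t| + |N t - (u t x + 1) * l ^ 2| := by
          rw [← abs_neg (N t - _)]
          refine le_trans (le_of_eq ?_) (abs_add_le _ _)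
          congr 1; ring
      _ ≤ _ := by linarith
  have h4 : |N t| ≤ |N σ| + |N σ - N t| := by
    rw [← abs_neg (N σ - _)]
    refine le_trans (le_of_eq ?_) (abs_add_le _ _)
    congr 1; ring
  nlinarith [mul_lt_mul_of_pos_right hx hl2]

/-- The excess mass stays bounded. -/
lemma exists_augMass_le (K κ ρ E : ℝ) (hK : 1 ≤ K) (hκ : 0 < κ) (hρ : 0 < ρ) (hE : 0 ≤ E) :
    ∃ B, 1 ≤ B ∧ ∀ (G : ℝ → ℝ) (I : Set ℝ) (u : ℝ → ℝ → ℝ), Tame G I K κ ρ E u →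
      augMass (u 0) < ⊤ → ∀ t ≥ 0, augMass (u t) ≤ ENNReal.ofReal B * augMass (u 0) := by
  obtain ⟨d, hd, hsmall⟩ := exists_small_dissipation K κ ρ E hK hκ hρ hE
  obtain ⟨δ, hδ, hpers⟩ := exists_persistence K κ ρ E hρ hE
  obtain ⟨B₁, hB₁, hgood⟩ := exists_augMass_le_good K κ hK hκ
  obtain ⟨B₂, hB₂, hshort⟩ := exists_augMass_le_short K (3 * δ) hK
  set B := B₂ * B₁ with hB
  have hB1 : 1 ≤ B := one_le_mul_of_one_le_of_one_le hB₂ hB₁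
  set Q := ENNReal.ofReal (d * δ) with hQ
  have hQ0 : Q ≠ 0 := by simpa [hQ] using by positivity
  -- A departure from the well persists for a time `δ` at amplitude above `ρ / 2`, so the
  -- dissipation exceeds `d` throughout; the cost is at least `Q`.
  have hbad : ∀ (G : ℝ → ℝ) (I : Set ℝ) (u : ℝ → ℝ → ℝ), Tame G I K κ ρ E u → ∀ t > 0, ∀ x,
      ρ < |u t x + 1| → Q ≤ ∫⁻ τ in Ioc t (t + δ), dissipation G u τ := by
    intro G I u h t ht x hx
    calc Q = ∫⁻ τ in Ioc t (t + δ), ENNReal.ofReal d := by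
          rw [setLIntegral_const, Real.volume_Ioc, add_sub_cancel_left, hQ, ENNReal.ofReal_mul hd.le]
      _ ≤ _ := setLIntegral_mono_Ioc fun τ h1 h2 => by
          by_contra! hc
          obtain ⟨y, hy⟩ := hpers G I u h t ht x hx τ ⟨h1.le, h2⟩
          exact absurd (hsmall G I u h τ (ht.trans h1) hc.le y) (not_le.2 hy)
  -- Induction on the dissipation budget `n Q`. With budget zero there is no departure; otherwise
  -- the first window of departures spends at least `Q`, and the flow restarts with budget reduced
  -- by one.
  have iter : ∀ n : ℕ, ∀ (G : ℝ → ℝ) (I : Set ℝ) (u : ℝ → ℝ → ℝ), Tame G I K κ ρ E u →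
      augMass (u 0) < ⊤ →
      (∀ s > 0, ∀ t ≥ s, ∫⁻ τ in Ioc s t, dissipation G u τ ≤ n * Q) → ∀ t ≥ 0,
        augMass (u t) ≤ ENNReal.ofReal (B ^ (n + 1)) * augMass (u 0) := by
    intro n
    induction n with
    | zero =>
      intro G I u h hV hn t ht
      have hg : ∀ τ, 0 < τ → τ ≤ t → ∀ x, |u τ x + 1| ≤ ρ := by
        intro τ hτ _ x
        by_contra! hc
        have := (hbad G I u h τ hτ x hc).trans (hn τ hτ (τ + δ) (by linarith))
        simp only [CharP.cast_eq_zero, zero_mul, nonpos_iff_eq_zero] at this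
        exact hQ0 this
      refine (hgood G I ρ E u h hV t ht hg).trans ?_
      rw [zero_add, pow_one]
      gcongr
      exact le_mul_of_one_le_left (by linarith) hB₂
    | succ n ih =>
      intro G I u h hV hn t ht
      have hBn : B ≤ B ^ (n + 1 + 1) := le_self_pow₀ hB1 (by simp)
      set S := {τ : ℝ | 0 < τ ∧ ∃ x, ρ < |u τ x + 1|} with hS
      by_cases hg : ∀ τ, 0 < τ → τ ≤ t → ∀ x, |u τ x + 1| ≤ ρ
      · refine (hgood G I ρ E u h hV t ht hg).trans ?_
        gcongr
        exact (le_mul_of_one_le_left (by linarith) hB₂).trans hBn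
      push Not at hg
      obtain ⟨τ₁, hτ₁, hτ₁t, x₁, hx₁⟩ := hg
      have hbdd : BddBelow S := ⟨0, fun τ hτ => hτ.1.le⟩
      have hmem : τ₁ ∈ S := ⟨hτ₁, x₁, hx₁⟩
      have hi0 : 0 ≤ sInf S := le_csInf ⟨_, hmem⟩ fun τ hτ => hτ.1.le
      have hit : sInf S ≤ t := (csInf_le hbdd hmem).trans hτ₁t
      -- The infimum of the departure times need not be a departure time, so an actual one within
      -- `δ` of it is taken.
      obtain ⟨t₁, ⟨ht₁, x, hx⟩, ht₁i⟩ := exists_lt_of_csInf_lt ⟨_, hmem⟩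
        (show sInf S < sInf S + δ by linarith)
      -- Retreating by `δ` guarantees that no departure occurs up to `s`. The window from `s` to `t₁
      -- + δ` then has length below `3δ`, as the short-time bound requires.
      set s := max 0 (sInf S - δ) with hs
      have hs0 : 0 ≤ s := le_max_left _ _
      have hsi : s ≤ sInf S := max_le hi0 (by linarith)
      have hsδ : sInf S - δ ≤ s := le_max_right _ _
      have h1 : augMass (u s) ≤ ENNReal.ofReal B₁ * augMass (u 0) := by
        refine hgood G I ρ E u h hV s hs0 fun τ hτ hτs y => ?_
        by_contra! hc
        have h2 := csInf_le hbdd (show τ ∈ S from ⟨hτ, y, hc⟩)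
        rcases max_choice 0 (sInf S - δ) with h3 | h3 <;> rw [← hs] at h3 <;> linarith
      have hVs : augMass (u s) < ⊤ := h1.trans_lt (ENNReal.mul_lt_top ENNReal.ofReal_lt_top hV)
      have h2 : ∀ r, s ≤ r → r ≤ t₁ + δ → augMass (u r) ≤ ENNReal.ofReal B * augMass (u 0) := by
        intro r hr1 hr2
        have := hshort G I κ ρ E _ (h.shift hs0) (by simpa using hVs) (r - s) (by linarith)
          (by linarith)
        simp only [add_zero, add_sub_cancel] at this
        refine this.trans ((mul_le_mul' le_rfl h1).trans (le_of_eq ?_))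
        rw [← mul_assoc, ← ENNReal.ofReal_mul (by linarith)]
      rcases le_total t (t₁ + δ) with htt | htt
      · refine (h2 t (hsi.trans hit) htt).trans ?_
        gcongr
      have h3 := h2 (t₁ + δ) (by linarith [csInf_le hbdd (show t₁ ∈ S from ⟨ht₁, x, hx⟩)]) le_rfl
      have h4 := ih G I _ (h.shift (by linarith : 0 ≤ t₁ + δ)) (by
        simp only [add_zero]
        exact h3.trans_lt (ENNReal.mul_lt_top ENNReal.ofReal_lt_top hV)) (fun p hp r hr => ?_)
        (t - (t₁ + δ)) (by linarith)
      · simp only [add_zero, add_sub_cancel] at h4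
        refine h4.trans ((mul_le_mul' le_rfl h3).trans (le_of_eq ?_))
        rw [← mul_assoc, ← ENNReal.ofReal_mul (by positivity), ← pow_succ]
      · have e : ∫⁻ τ in Ioc p r, dissipation G (fun t => u (t₁ + δ + t)) τ =
            ∫⁻ τ in Ioc (t₁ + δ + p) (t₁ + δ + r), dissipation G u τ :=
          setLIntegral_Ioc_shift (dissipation G u) (t₁ + δ) p r
        rw [e]
        have h5 := hn t₁ ht₁ (t₁ + δ + r) (by linarith)
        have h6 : Q + ∫⁻ τ in Ioc (t₁ + δ + p) (t₁ + δ + r), dissipation G u τ ≤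
            ∫⁻ τ in Ioc t₁ (t₁ + δ + r), dissipation G u τ := by
          refine (add_le_add (hbad G I u h t₁ ht₁ x hx) le_rfl).trans ?_
          rw [← lintegral_union measurableSet_Ioc]
          · refine lintegral_mono_set (union_subset (Ioc_subset_Ioc_right (by linarith))
              (Ioc_subset_Ioc_left (by linarith)))
          · exact Ioc_disjoint_Ioc_of_le (by linarith)
        have h7 := h6.trans h5
        push_cast at h7
        rw [add_mul, one_mul, add_comm _ Q] at h7
        exact (ENNReal.add_le_add_iff_left ENNReal.ofReal_ne_top).1 h7
  obtain ⟨N, hN⟩ := exists_nat_ge (2 * E / (d * δ))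
  rw [div_le_iff₀ (by positivity)] at hN
  refine ⟨B ^ (N + 1), one_le_pow₀ hB1, fun G I u h hV t ht => iter N G I u h hV ?_ t ht⟩
  intro s hs t hst
  calc ∫⁻ τ in Ioc s t, dissipation G u τ ≤ 2 * ENNReal.ofReal E :=
        (h.integral_dissipation_le hs hst).trans (mul_le_mul' le_rfl (h.energy_le s hs))
    _ = ENNReal.ofReal (2 * E) := by rw [ENNReal.ofReal_mul (by norm_num), ENNReal.ofReal_ofNat]
    _ ≤ ENNReal.ofReal (N * (d * δ)) := ENNReal.ofReal_le_ofReal hN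
    _ = _ := by rw [ENNReal.ofReal_mul (by positivity), ENNReal.ofReal_natCast]

/-! ### Decay of the energy -/

lemma integrable_of_lintegral_lt_top {f : ℝ → ℝ} (cf : Continuous f) (h0 : ∀ x, 0 ≤ f x)
    (h : ∫⁻ x, ENNReal.ofReal (f x) < ⊤) : Integrable f :=
  ⟨cf.aestronglyMeasurable, by rwa [hasFiniteIntegral_iff_ofReal (ae_of_all _ h0)]⟩

variable {G : ℝ → ℝ} {u : ℝ → ℝ → ℝ} {I : Set ℝ} {K κ ρ E : ℝ}

/-- The energy is controlled by the chemical potential and the mass, near the well. -/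
lemma Tame.energy_le_mul (h : Tame G I K κ ρ E u) {t P a : ℝ} (ht : 0 < t)
    (hgood : ∀ x, |u t x + 1| ≤ ρ) (hP : ∀ x, |pot G u t x| ≤ P) (ha : 0 ≤ a)
    (hV : excessMass (u t) ≤ ENNReal.ofReal a) :
    ∫⁻ x, ENNReal.ofReal (energyDensity G u t x) ≤ ENNReal.ofReal (K / κ * (P * a)) := by
  have H := h.regularFlow
  have hκ := h.well.κ_pos
  have hκ1 := h.well.κ_le
  have hK := h.well.one_le
  have hP0 : 0 ≤ P := (abs_nonneg _).trans (hP 0)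
  have cu : Continuous fun x => u t x + 1 := (continuous_slice H.cont ht).add continuous_const
  have cux := continuous_slice H.cont_slope ht
  have cuxx := continuous_slice H.cont_curv ht
  have cp := continuous_slice H.cont_pot ht
  have cG' : Continuous fun x => deriv G (u t x) :=
    (continuous_deriv_of_contDiff_two H.contG).comp (continuous_slice H.cont ht)
  obtain ⟨B, hB, hB', -⟩ := h.normSq_bounded t
  have i1 : Integrable fun x => |u t x + 1| :=
    integrable_of_lintegral_lt_top cu.abs (fun _ => abs_nonneg _)
      (hV.trans_lt ENNReal.ofReal_lt_top)
  have i2 : Integrable fun x => (u t x + 1) ^ 2 :=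
    integrable_of_lintegral_lt_top (cu.pow 2) (fun _ => sq_nonneg _)
      ((hB' t ⟨ht.le, le_rfl⟩).trans_lt hB)
  have i3 : Integrable fun x => slope u t x ^ 2 :=
    integrable_of_lintegral_lt_top (cux.pow 2) (fun _ => sq_nonneg _)
      ((h.normSq_slope_le ht).trans_lt ENNReal.ofReal_lt_top)
  have i4 : Integrable fun x => (u t x + 1) * slope u t x :=
    (i2.add i3).mono' (cu.mul cux).aestronglyMeasurable (ae_of_all _ fun x => by
      simp only [Real.norm_eq_abs, Pi.add_apply, abs_mul]
      nlinarith only [sq_nonneg (|u t x + 1| - |slope u t x|), sq_abs (u t x + 1),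
        sq_abs (slope u t x)])
  have i5 : Integrable fun x => slope u t x * slope u t x + (u t x + 1) * curv u t x := by
    refine ((i3.add (i2.const_mul K)).add (i1.const_mul P)).mono'
      ((cux.mul cux).add (cu.mul cuxx)).aestronglyMeasurable (ae_of_all _ fun x => ?_)
    have e : curv u t x = deriv G (u t x) - pot G u t x := by simp only [pot]; ring
    simp only [Real.norm_eq_abs, Pi.add_apply]
    have b1 : |(u t x + 1) * deriv G (u t x)| ≤ K * (u t x + 1) ^ 2 := by
      rw [abs_mul, ← sq_abs (u t x + 1), sq, mul_left_comm]
      exact mul_le_mul_of_nonneg_left (h.well.deriv_le _ (h.mem t ht.le x)) (abs_nonneg _)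
    have b2 : |(u t x + 1) * pot G u t x| ≤ |u t x + 1| * P := by
      rw [abs_mul]; exact mul_le_mul_of_nonneg_left (hP x) (abs_nonneg _)
    have b4 := sq_nonneg (slope u t x)
    rw [_root_.abs_le] at b1 b2
    rw [e, _root_.abs_le]
    constructor <;> linarith only [b1.1, b1.2, b2.1, b2.2, b4]
  -- The identity `p = G'(u) - u_xx` is tested with `u + 1`: near the well `(u + 1) G'(u)` is
  -- coercive, and the right side is at most `sup |p|` times the mass.
  have hint : ∫ x, (κ * (u t x + 1) ^ 2 + slope u t x ^ 2) ≤ P * ∫ x, |u t x + 1| := by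
    have h0 := integral_eq_zero_of_hasDerivAt_of_integrable
      (fun x => (H.timeFamily.deriv0 t ht x).mul (H.deriv_slope t ht x)) i5 i4
    calc _ ≤ ∫ x, (P * |u t x + 1| + (slope u t x * slope u t x + (u t x + 1) * curv u t x)) := by
          refine integral_mono ((i2.const_mul κ).add i3) ((i1.const_mul P).add i5) fun x => ?_
          have e : curv u t x = deriv G (u t x) - pot G u t x := by simp only [pot]; ring
          have b1 := h.well.deriv_mul _ (hgood x)
          have b2 : (u t x + 1) * pot G u t x ≤ |u t x + 1| * P := by
            refine (le_abs_self _).trans ?_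
            rw [abs_mul]; exact mul_le_mul_of_nonneg_left (hP x) (abs_nonneg _)
          simp only [e]
          nlinarith only [b1, b2]
      _ = _ := by rw [integral_add (i1.const_mul P) i5, h0, add_zero, integral_const_mul]
  have hVa : ∫ x, |u t x + 1| ≤ a := by
    refine (ENNReal.ofReal_le_ofReal_iff ha).1 ?_
    rwa [ofReal_integral_eq_lintegral_ofReal i1 (ae_of_all _ fun _ => abs_nonneg _)]
  calc _ ≤ ∫⁻ x, ENNReal.ofReal (K / κ * (κ * (u t x + 1) ^ 2 + slope u t x ^ 2)) := by
        refine lintegral_mono fun x => ENNReal.ofReal_le_ofReal ?_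
        have h1 := h.well.potential_le _ (h.mem t ht.le x)
        have h2 : 1 ≤ K / κ := by rw [le_div_iff₀ hκ]; linarith
        have e : K / κ * (κ * (u t x + 1) ^ 2 + slope u t x ^ 2) =
          K * (u t x + 1) ^ 2 + K / κ * slope u t x ^ 2 := by field_simp
        rw [e]
        unfold energyDensity
        nlinarith only [sq_nonneg (slope u t x), h1, h2]
    _ = ENNReal.ofReal (K / κ * ∫ x, (κ * (u t x + 1) ^ 2 + slope u t x ^ 2)) := by
        rw [← integral_const_mul]
        exact (ofReal_integral_eq_lintegral_ofReal (((i2.const_mul κ).add i3).const_mul _)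
          (ae_of_all _ fun x => by simp only [Pi.add_apply, Pi.zero_apply]; positivity)).symm
    _ ≤ _ := by
        refine ENNReal.ofReal_le_ofReal (mul_le_mul_of_nonneg_left (hint.trans ?_) (by positivity))
        exact mul_le_mul_of_nonneg_left hVa hP0

/-- Interpolation of the energy between mass and dissipation. -/
lemma exists_energy_interpolation (K κ ρ E : ℝ) (hK : 1 ≤ K) (hκ : 0 < κ) (hρ : 0 < ρ) (hE : 0 ≤ E) :
    ∃ C > 0, ∀ (G : ℝ → ℝ) (I : Set ℝ) (u : ℝ → ℝ → ℝ), Tame G I K κ ρ E u → ∀ t > 0, ∀ a ≥ 1,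
      excessMass (u t) ≤ ENNReal.ofReal a → (∫⁻ x, ENNReal.ofReal (energyDensity G u t x)) ^ 3 ≤
        ENNReal.ofReal (C * a ^ 4) * dissipation G u t := by
  obtain ⟨d₀, hd₀, hsmall⟩ := exists_small_dissipation K κ ρ E hK hκ hρ hE
  set C₀ := K / κ * (2 + K + 2 * Real.sqrt (2 * E)) + E with hC₀
  have hC₀0 : 0 < C₀ := by positivity
  refine ⟨8 * C₀ ^ 3 + E ^ 3 / d₀, by positivity, fun G I u h t ht a ha hV => ?_⟩
  have ha0 : 0 < a := by linarith
  have hele := h.energy_le t ht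
  set eN := ∫⁻ x, ENNReal.ofReal (energyDensity G u t x) with heN
  have heT : eN ≠ ⊤ := ne_top_of_le_ne_top ENNReal.ofReal_ne_top hele
  set e := eN.toReal with he
  have hee : eN = ENNReal.ofReal e := (ENNReal.ofReal_toReal heT).symm
  have he0 : 0 ≤ e := ENNReal.toReal_nonneg
  have heE : e ≤ E := by rw [hee] at hele; exact (ENNReal.ofReal_le_ofReal_iff hE).1 hele
  rcases eq_or_ne (dissipation G u t) ⊤ with hD | hD
  · rw [hD, ENNReal.mul_top (by simpa using by positivity)]; exact le_top
  set d := (dissipation G u t).toReal with hd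
  have hdd : dissipation G u t = ENNReal.ofReal d := (ENNReal.ofReal_toReal hD).symm
  have hd0 : 0 ≤ d := ENNReal.toReal_nonneg
  rw [hee, hdd, ← ENNReal.ofReal_pow he0, ← ENNReal.ofReal_mul (by positivity)]
  refine ENNReal.ofReal_le_ofReal ?_
  have ha4 : 1 ≤ a ^ 4 := one_le_pow₀ ha
  have r1 : 0 ≤ 8 * C₀ ^ 3 * a ^ 4 * d := by positivity
  have r2 : 0 ≤ E ^ 3 / d₀ * (a ^ 4 * d) := by positivity
  -- Large dissipation needs only the trivial bound `e ≤ E`; otherwise the solution is near the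
  -- well.
  rcases le_total d₀ d with hdd0 | hdd0
  · have : e ^ 3 ≤ E ^ 3 / d₀ * (a ^ 4 * d) := by
      calc e ^ 3 ≤ E ^ 3 := by gcongr
        _ = E ^ 3 / d₀ * (1 * d₀) := by field_simp
        _ ≤ _ := by gcongr
    linarith
  have hgood : ∀ x, |u t x + 1| ≤ ρ := fun x =>
    (hsmall G I u h t ht (hdd.le.trans (ENNReal.ofReal_le_ofReal hdd0)) x).trans (by linarith)
  rcases he0.eq_or_lt with h0 | hepos
  · rw [← h0]; nlinarith
  have cu : Continuous fun x => |u t x + 1| := by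
    have := continuous_slice h.regularFlow.cont ht
    fun_prop
  have key : ∀ l, 1 ≤ l → e ≤ C₀ * (a * Real.sqrt (l * d) + a ^ 2 / l) := by
    intro l hl
    have hl0 : 0 < l := by linarith
    have hp : ∀ x, |pot G u t x| ≤ 2 * Real.sqrt (l * d) + (K + 2 * Real.sqrt (2 * E)) * a / l := by
      intro x
      refine (h.abs_pot_le ht he0 hd0 hl0 hee.le hdd.le (intervalIntegral_le_of_lintegral cu
        (fun _ => abs_nonneg _) ha0.le hV (by linarith)) ⟨le_rfl, by linarith⟩).trans
        (add_le_add ?_ ?_)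
      · rw [mul_assoc, Real.sqrt_mul (by norm_num)]
        gcongr
        exact Real.sqrt_le_iff.2 ⟨by norm_num, by norm_num⟩
      · rw [add_mul]
        refine div_le_div_of_nonneg_right ?_ hl0.le
        have s1 : Real.sqrt (2 * e / l) ≤ Real.sqrt (2 * E) := by
          refine Real.sqrt_le_sqrt ((div_le_self (by positivity) hl).trans (by gcongr))
        have s2 : Real.sqrt (2 * E) ≤ Real.sqrt (2 * E) * a :=
          le_mul_of_one_le_right (Real.sqrt_nonneg _) ha
        linarith
    have := h.energy_le_mul ht hgood hp ha0.le hV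
    rw [← heN, hee, ENNReal.ofReal_le_ofReal_iff (by positivity)] at this
    have hs := Real.sqrt_nonneg (2 * E)
    have p1 : 0 ≤ a * Real.sqrt (l * d) := by positivity
    have p2 : 0 ≤ a ^ 2 / l := by positivity
    have e1 : K / κ * ((2 * Real.sqrt (l * d) + (K + 2 * Real.sqrt (2 * E)) * a / l) * a) =
        K / κ * (2 * (a * Real.sqrt (l * d)) + (K + 2 * Real.sqrt (2 * E)) * (a ^ 2 / l)) := by
      field_simp
    rw [e1] at this
    refine this.trans ?_
    have hq : 0 ≤ K / κ := by positivity
    calc _ ≤ K / κ * ((2 + K + 2 * Real.sqrt (2 * E)) *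
          (a * Real.sqrt (l * d) + a ^ 2 / l)) := by
          refine mul_le_mul_of_nonneg_left ?_ hq
          nlinarith only [p1, p2, hs, hK, mul_nonneg hs p1, mul_nonneg (by linarith : 0 ≤ K) p1]
      _ ≤ _ := by
          rw [← mul_assoc]
          exact mul_le_mul_of_nonneg_right (by rw [hC₀]; linarith) (by positivity)
  have hCE : E ≤ C₀ := le_add_of_nonneg_left (by positivity)
  have ha2 : 1 ≤ a ^ 2 := one_le_pow₀ ha
  -- This length makes the second term of `key` equal to `e / 2`, which is absorbed. The condition
  -- `l ≥ 1` holds because `e ≤ E ≤ C₀` and `a ≥ 1`.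
  set l := 2 * C₀ * a ^ 2 / e with hl
  have hl1 : 1 ≤ l := by rw [hl, le_div_iff₀ hepos]; nlinarith
  have h1 := key l hl1
  have h2 : C₀ * (a ^ 2 / l) = e / 2 := by rw [hl]; field_simp
  have h3 : e ≤ 2 * C₀ * a * Real.sqrt (l * d) := by linarith
  have h4 : e ^ 2 ≤ (2 * C₀ * a) ^ 2 * (l * d) := by
    calc e ^ 2 ≤ (2 * C₀ * a * Real.sqrt (l * d)) ^ 2 := pow_le_pow_left₀ he0 h3 2
      _ = _ := by rw [mul_pow _ (Real.sqrt _), Real.sq_sqrt (by positivity)]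
  have h5 : e ^ 3 ≤ 8 * C₀ ^ 3 * a ^ 4 * d := by
    calc e ^ 3 = e * e ^ 2 := by ring
      _ ≤ e * ((2 * C₀ * a) ^ 2 * (l * d)) := by gcongr
      _ = _ := by rw [hl]; field_simp; ring
  linarith

/-- Decay of the energy, given a bound of the mass. -/
lemma exists_energy_decay (K κ ρ E : ℝ) (hK : 1 ≤ K) (hκ : 0 < κ) (hρ : 0 < ρ) (hE : 0 ≤ E) :
    ∃ M > 0, ∀ (G : ℝ → ℝ) (I : Set ℝ) (u : ℝ → ℝ → ℝ), Tame G I K κ ρ E u → ∀ a ≥ 1,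
      (∀ t > 0, excessMass (u t) ≤ ENNReal.ofReal a) → ∀ t > 0,
        ∫⁻ x, ENNReal.ofReal (energyDensity G u t x) ≤ ENNReal.ofReal (M * a ^ 2 / Real.sqrt t) := by
  obtain ⟨C, hC, hinter⟩ := exists_energy_interpolation K κ ρ E hK hκ hρ hE
  -- Large enough for times up to `1`, and with `8 C ≤ M²`, so that the dyadic induction below
  -- reproduces the same constant.
  set M := E + 8 * C + 1 with hM
  have hM0 : 0 < M := by positivity
  refine ⟨M, hM0, fun G I u h a ha hV => ?_⟩
  have ha0 : 0 < a := by linarith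
  set e : ℝ → ℝ := fun t => (∫⁻ x, ENNReal.ofReal (energyDensity G u t x)).toReal with he
  have hT : ∀ t > 0, ∫⁻ x, ENNReal.ofReal (energyDensity G u t x) = ENNReal.ofReal (e t) :=
    fun t ht => (ENNReal.ofReal_toReal
      (ne_top_of_le_ne_top ENNReal.ofReal_ne_top (h.energy_le t ht))).symm
  have he0 : ∀ t, 0 ≤ e t := fun t => ENNReal.toReal_nonneg
  have heE : ∀ t > 0, e t ≤ E := fun t ht => by
    have := h.energy_le t ht
    rwa [hT t ht, ENNReal.ofReal_le_ofReal_iff hE] at this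
  have hmono : ∀ s > 0, ∀ t ≥ s, e t ≤ e s := fun s hs t hst => by
    have := le_trans le_self_add (h.energy_inequality s hs t hst)
    rwa [hT s hs, hT t (hs.trans_le hst), ENNReal.ofReal_le_ofReal_iff (he0 s)] at this
  -- On `[t / 2, t]` the energy is at least `e t`, so the interpolation bounds the dissipation from
  -- below, while its time integral is at most twice the energy at `t / 2`.
  have hstep : ∀ t > 0, e t ^ 3 * t ≤ 4 * C * a ^ 4 * e (t / 2) := by
    intro t ht
    have ht2 : 0 < t / 2 := by linarith
    have h1 : ENNReal.ofReal (e t ^ 3 * (t / 2)) ≤ ENNReal.ofReal (C * a ^ 4 * (2 * e (t / 2))) := by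
      calc _ = ∫⁻ _ in Ioc (t / 2) t, ENNReal.ofReal (e t ^ 3) := by
            rw [setLIntegral_const, Real.volume_Ioc, ENNReal.ofReal_mul (by have := he0 t; positivity)]
            congr 2; ring
        _ ≤ ∫⁻ τ in Ioc (t / 2) t, ENNReal.ofReal (C * a ^ 4) * dissipation G u τ := by
            refine setLIntegral_mono_Ioc fun τ h1 h2 => ?_
            have hτ := ht2.trans h1
            refine le_trans ?_ (hinter G I u h τ hτ a ha (hV τ hτ))
            rw [hT τ hτ, ← ENNReal.ofReal_pow (he0 τ)]
            exact ENNReal.ofReal_le_ofReal (pow_le_pow_left₀ (he0 t) (hmono τ hτ t h2) 3)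
        _ ≤ _ := by
            rw [lintegral_const_mul' _ _ ENNReal.ofReal_ne_top, ENNReal.ofReal_mul (p := C * a ^ 4) (by positivity),
              ENNReal.ofReal_mul (p := 2) (by norm_num), ENNReal.ofReal_ofNat, ← hT _ ht2]
            exact mul_le_mul' le_rfl (h.integral_dissipation_le ht2 (by linarith))
    have h2 := (ENNReal.ofReal_le_ofReal_iff (by have := he0 (t / 2); positivity)).1 h1
    linarith
  have main : ∀ n : ℕ, ∀ t > 0, t ≤ 2 ^ n → e t * Real.sqrt t ≤ M * a ^ 2 := by
    have base : ∀ t > 0, t ≤ 1 → e t * Real.sqrt t ≤ M * a ^ 2 := fun t ht ht1 => by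
      calc e t * Real.sqrt t ≤ E * 1 :=
            mul_le_mul (heE t ht) (Real.sqrt_le_one.2 ht1) (Real.sqrt_nonneg _) hE
        _ ≤ M * 1 := by rw [mul_one, mul_one, hM]; linarith
        _ ≤ _ := mul_le_mul_of_nonneg_left (one_le_pow₀ ha) hM0.le
    intro n
    induction n with
    | zero => intro t ht ht1; exact base t ht (by simpa using ht1)
    | succ n ih =>
      intro t ht htn
      rcases le_total t 1 with ht1 | ht1
      · exact base t ht ht1
      have h1 := ih (t / 2) (by linarith) (by rw [pow_succ] at htn; linarith)
      have h2 := hstep t ht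
      have s0 : 0 < Real.sqrt t := Real.sqrt_pos.2 ht
      have s1 : Real.sqrt t ≤ 2 * Real.sqrt (t / 2) := by
        refine Real.sqrt_le_iff.2 ⟨by positivity, ?_⟩
        rw [mul_pow, Real.sq_sqrt (by positivity)]; linarith
      refine le_of_pow_le_pow_left₀ three_ne_zero (by positivity) ?_
      have hst := Real.sq_sqrt ht.le
      have h3 := he0 (t / 2)
      calc (e t * Real.sqrt t) ^ 3 = e t ^ 3 * Real.sqrt t ^ 2 * Real.sqrt t := by ring
        _ = e t ^ 3 * t * Real.sqrt t := by rw [hst]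
        _ ≤ 4 * C * a ^ 4 * e (t / 2) * Real.sqrt t := by gcongr
        _ ≤ 4 * C * a ^ 4 * e (t / 2) * (2 * Real.sqrt (t / 2)) := by gcongr
        _ = 8 * C * a ^ 4 * (e (t / 2) * Real.sqrt (t / 2)) := by ring
        _ ≤ 8 * C * a ^ 4 * (M * a ^ 2) := by gcongr
        _ = 8 * C * (M * a ^ 6) := by ring
        _ ≤ M ^ 2 * (M * a ^ 6) := by
            refine mul_le_mul_of_nonneg_right ?_ (by positivity)
            have : 8 * C ≤ M := by rw [hM]; linarith
            have : 1 ≤ M := by rw [hM]; linarith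
            nlinarith
        _ = _ := by ring
  intro t ht
  obtain ⟨n, hn⟩ := pow_unbounded_of_one_lt t (one_lt_two : (1 : ℝ) < 2)
  rw [hT t ht]
  refine ENNReal.ofReal_le_ofReal ?_
  rw [le_div_iff₀ (Real.sqrt_pos.2 ht)]
  exact main n t ht hn.le

lemma Tame.h1NormSq_le (h : Tame G I K κ ρ E u) {t : ℝ} (ht : 0 < t) :
    h1NormSq (fun x => u t x + 1) ≤ ENNReal.ofReal (2 / κ) *
      ∫⁻ x, ENNReal.ofReal (energyDensity G u t x) := by
  have hκ := h.well.κ_pos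
  have hac : LocallyAC fun x => u t x + 1 :=
    locallyAC_of_contDiff ((h.smooth.contDiff_space t ht).add contDiff_const)
  rw [h1NormSq, if_pos hac, ← lintegral_const_mul' _ _ ENNReal.ofReal_ne_top]
  refine lintegral_mono fun x => ?_
  rw [← ENNReal.ofReal_mul (by positivity)]
  refine ENNReal.ofReal_le_ofReal ?_
  rw [(h.regularFlow.timeFamily.deriv0 t ht x).deriv, div_mul_eq_mul_div, le_div_iff₀ hκ]
  have h1 := h.well.le_potential _ (h.mem t ht.le x)
  have h2 := mul_le_mul_of_nonneg_right h.well.κ_le (sq_nonneg (slope u t x))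
  have h3 := h.well.nonneg (u t x)
  unfold energyDensity
  linarith

end CahnHilliard

end

/-! ### Conclusion -/

theorem theorem1p3 (G : ℝ → ℝ) (hG : CahnHilliard.IsDoubleWell G)
    (hGinf : CahnHilliard.kinkEnergy G ≤
      ∫⁻ s in Ioi (1 : ℝ), ENNReal.ofReal (Real.sqrt (2 * G s)))
    (ε : ℝ) (hε : 0 < ε) :
    ∃ C : ℝ≥0, 0 < C ∧
      ∀ (u₀ : ℝ → ℝ) (u : ℝ → ℝ → ℝ), CahnHilliard.IsSmoothSolution G u₀ u →
        CahnHilliard.energy G u₀ + ENNReal.ofReal ε ≤ 2 * CahnHilliard.kinkEnergy G →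
        CahnHilliard.excessMass u₀ < ⊤ →
        Tendsto (fun t : ℝ => CahnHilliard.h1NormSq (fun x => u t x + 1)) atTop (𝓝 0) ∧
        ∀ t : ℝ, 0 ≤ t →
          CahnHilliard.excessMass (u t) ≤ C * (CahnHilliard.excessMass u₀ + 1) ∧
          CahnHilliard.energy G (u t) ≤
            C * min (CahnHilliard.energy G u₀)
              ((CahnHilliard.excessMass u₀ ^ 2 + 1) / ENNReal.ofReal (Real.sqrt t)) := by
  open CahnHilliard in
  obtain ⟨I, K, κ, ρ, E, hW, hE, htame⟩ := exists_tame hG hGinf hε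
  obtain ⟨B, hB, hmass⟩ := exists_augMass_le K κ ρ E hW.one_le hW.κ_pos hW.ρ_pos hE
  obtain ⟨M, hM, hdecay⟩ := exists_energy_decay K κ ρ E hW.one_le hW.κ_pos hW.ρ_pos hE
  have hπ : 1 ≤ Real.pi := by linarith [Real.pi_gt_three]
  -- The first term serves the mass bound, the second the decay; `π ≥ 1` turns the constant in
  -- `augMass` into a multiple of `v + 1`, and the factor `2` comes from `(v + 1)² ≤ 2 (v² + 1)`.
  set C := B * Real.pi + M * (2 * (B * Real.pi) ^ 2) with hC
  have hC1 : 1 ≤ C := by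
    have : 1 ≤ B * Real.pi := one_le_mul_of_one_le_of_one_le hB hπ
    have : 0 ≤ M * (2 * (B * Real.pi) ^ 2) := by positivity
    linarith
  refine ⟨C.toNNReal, Real.toNNReal_pos.2 (by linarith), fun u₀ u h hE₀ hV₀ => ?_⟩
  obtain ⟨hT, hle⟩ := htame u₀ u h hE₀ hV₀
  obtain rfl : u 0 = u₀ := funext h.initial
  change _ ∧ ∀ t : ℝ, 0 ≤ t → excessMass (u t) ≤ ENNReal.ofReal C * _ ∧
    energy G (u t) ≤ ENNReal.ofReal C * _
  -- the mass in real terms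
  set v := (excessMass (u 0)).toReal with hv
  have hv0 : 0 ≤ v := ENNReal.toReal_nonneg
  have hvV : excessMass (u 0) = ENNReal.ofReal v := (ENNReal.ofReal_toReal hV₀.ne).symm
  set a := B * Real.pi * (v + 1) with ha
  have ha1 : 1 ≤ a := one_le_mul_of_one_le_of_one_le (one_le_mul_of_one_le_of_one_le hB hπ)
    (by linarith)
  have hVa : ∀ t ≥ 0, excessMass (u t) ≤ ENNReal.ofReal a := fun t ht => by
    refine (le_trans le_self_add (hmass G I u hT (augMass_lt_top hV₀) t ht)).trans ?_
    rw [augMass, hvV, ← ENNReal.ofReal_add hv0 (by linarith), ← ENNReal.ofReal_mul (by linarith)]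
    refine ENNReal.ofReal_le_ofReal ?_
    rw [ha, mul_assoc]
    refine mul_le_mul_of_nonneg_left ?_ (by linarith)
    nlinarith
  have hdec : ∀ t > 0, ∫⁻ x, ENNReal.ofReal (energyDensity G u t x) ≤
      ENNReal.ofReal (M * a ^ 2 / Real.sqrt t) := hdecay G I u hT a ha1 fun t ht => hVa t ht.le
  refine ⟨?_, fun t ht => ⟨?_, ?_⟩⟩
  · have hlim : Tendsto (fun t => ENNReal.ofReal (2 / κ) *
        ENNReal.ofReal (M * a ^ 2 / Real.sqrt t)) atTop (𝓝 (ENNReal.ofReal (2 / κ) * ENNReal.ofReal 0)) :=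
      ENNReal.Tendsto.const_mul (ENNReal.tendsto_ofReal
        (tendsto_const_nhds.div_atTop Real.tendsto_sqrt_atTop)) (Or.inr ENNReal.ofReal_ne_top)
    rw [ENNReal.ofReal_zero, mul_zero] at hlim
    refine tendsto_of_tendsto_of_tendsto_of_le_of_le' tendsto_const_nhds hlim
      (Eventually.of_forall fun _ => zero_le) ?_
    filter_upwards [eventually_gt_atTop 0] with t ht
    exact (hT.h1NormSq_le ht).trans (mul_le_mul' le_rfl (hdec t ht))
  · refine (hVa t ht).trans ?_
    rw [hvV, ← ENNReal.ofReal_one, ← ENNReal.ofReal_add hv0 zero_le_one,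
      ← ENNReal.ofReal_mul (by linarith)]
    refine ENNReal.ofReal_le_ofReal (mul_le_mul_of_nonneg_right ?_ (by linarith))
    exact le_add_of_nonneg_right (by positivity)
  · rw [mul_min]
    refine le_min ?_ ?_
    · rcases ht.eq_or_lt with rfl | ht0
      · exact le_ofReal_mul hC1 _
      · exact (hle t ht0).trans (le_ofReal_mul hC1 _)
    · rcases ht.eq_or_lt with rfl | ht0
      · rw [Real.sqrt_zero, ENNReal.ofReal_zero, ENNReal.div_zero (by simp),
          ENNReal.mul_top (by simpa using by linarith)]
        exact le_top
      · rw [h.energy_eq ht0]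
        refine (hdec t ht0).trans ?_
        have hs := Real.sqrt_pos.2 ht0
        rw [hvV, ← ENNReal.ofReal_one, ← ENNReal.ofReal_pow hv0,
          ← ENNReal.ofReal_add (by positivity) zero_le_one, ← ENNReal.ofReal_div_of_pos hs,
          ← ENNReal.ofReal_mul (by linarith)]
        refine ENNReal.ofReal_le_ofReal ?_
        rw [← mul_div_assoc]
        refine div_le_div_of_nonneg_right ?_ hs.le
        calc M * a ^ 2 = M * (B * Real.pi) ^ 2 * (v + 1) ^ 2 := by rw [ha]; ring
          _ ≤ M * (B * Real.pi) ^ 2 * (2 * (v ^ 2 + 1)) := by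
              gcongr; linarith [sq_nonneg (v - 1), show (v - 1) ^ 2 = v ^ 2 - 2 * v + 1 by ring,
                show (v + 1) ^ 2 = v ^ 2 + 2 * v + 1 by ring]
          _ = M * (2 * (B * Real.pi) ^ 2) * (v ^ 2 + 1) := by ring
          _ ≤ C * (v ^ 2 + 1) := by
              gcongr; rw [hC]; exact le_add_of_nonneg_left (by positivity)
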